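/- **Setting.** Let $n,l\ge 1$ be integers, $d:=\frac{2l}{l+1}$, $\Omega:=[1,2]^n$. For $\sigma\in\mathbb R$ let $\mathcal H^\sigma$ be the space of complex sequences $(\psi_j)_{j\ge1}$ with $\|\psi\|_{\mathcal H^\sigma}^2=\sum_{j\ge1}j^{2\sigma}|\psi_j|^2<\infty$; $L^2=\mathcal H^0$ and $\mathrm{diag}(\lambda_j)$ is the diagonal operator on sequences. Fix $s>0$ and $\kappa>1$. Put $|k|=\sum_m|k_m|$ for $k\in\mathbb Z^n$, $|\omega|=\max_m|\omega_m|$ for $\omega\in\mathbb R^n$, $\langle x\rangle=\max\{1,|x|\}$, $\Delta f=f(\omega')-f(\omega)$, $\Delta\omega=\omega'-\omega$; $|S|$ is the Lebesgue measure of a set $S$. Let $\mathbb T^n_r$ be the set of angles in the complexified torus with $|\mathrm{Im}\,\phi_m|<r$ for all $m$. For $F(\phi,\omega)\in B(\mathcal H^{s-\kappa};\mathcal H^s)$, $\phi\in\mathbb T^n_r$, $\omega\in S\subset\Omega$, put $$\|F\|_r=\sup_{\omega\in S}\sup_{\phi\in\mathbb T^n_r}\|F(\phi,\omega)\|_{B(\mathcal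 H^{s-\kappa};\mathcal H^s)},\qquad \|F\|^{\mathcal L}_r=\sup_{\omega\ne\omega'\in S}\ \sup_{\phi\in\mathbb T^n_r}\frac{\|F(\phi,\omega)-F(\phi,\omega')\|_{B(\mathcal H^{s-\kappa};\mathcal H^s)}}{|\omega-\omega'|};$$ $F$ is *Lipschitz analytic* on $\mathbb T^n_r\times S$ if it is analytic in $\phi$ and both quantities are finite. **Theorem.** Fix positive numbers $\mathcal K_0,\mathcal K_1,\Gamma,\tau,\vartheta$ with $$\tau>\frac{n+1-\kappa^{-1}}{1-\kappa^{-1}},\qquad 0<\vartheta<1,\qquad \mathcal K_0>8\mathcal K_1,$$ and put $b:=2n+2\tau+1$. Then there are positive constants $\varsigma_*,C_\Gamma,C_0,C_\Omega,C_U,d_2,d_3$, depending only on $n,l,s,\kappa,\mathcal K_0,\mathcal K_1,\Gamma,\tau,\vartheta$, such that the following holds for all $0<r\le1$ and $0<\varsigma<\varsigma_*$. Let $\Omega^{(0)}\subset\Omega$ be measurable with $|\Omega\setminus\Omega^{(0)}|\le\Upsilon^{(0)}$, $\Upsilon^{(0)}>0$. Let $A^{(0)}=\mathrm{diag}(\lambda^{(0)}_j(\omega))$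 with real $\lambda_j^{(0)}(\omega)$, $\omega\in\Omega^{(0)}$, and let $P^{(0)}(\phi,\omega)\in B(\mathcal H^{s-\kappa};\mathcal H^s)$ be Lipschitz analytic on $\mathbb T^n_r\times\Omega^{(0)}$, selfadjoint for real $\phi$ (that is, its matrix $P^{(0)}_{ij}$ is Hermitian), with $$\|P^{(0)}\|_r\le\varsigma r^b,\qquad r^{\tau+1}\|P^{(0)}\|^{\mathcal L}_r\le\varsigma r^b .$$ Assume that for all $i,j\ge 1$, $k\in\mathbb Z^n$ and $\omega\ne\omega'$ in $\Omega^{(0)}$ $$|\lambda^{(0)}_i-\lambda^{(0)}_j|\ge\mathcal K^{(0)}_{0\lambda}|i^d-j^d|,\qquad \left|\frac{\Delta(\lambda^{(0)}_i-\lambda^{(0)}_j)}{\Delta\omega}\right|\le\mathcal K^{(0)}_{1\lambda}|i^d-j^d|,$$ $$|\lambda^{(0)}_i-\lambda^{(0)}_j+\omega\cdot k|\ge\frac{\gamma^{(0)}}{1+|k|^\tau}\langle i^d-j^d\rangle\quad\text{if }|i-j|+|k|\ne0,$$ with real constants such that, writing $$\mathcal K^{(\infty)}_{0\lambda}:=\mathcal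 K^{(0)}_{0\lambda}-C_0r^b\varsigma,\qquad \mathcal K^{(\infty)}_{1\lambda}:=\mathcal K^{(0)}_{1\lambda}+C_0r^{b-\tau-1}\varsigma,\qquad \gamma^{(\infty)}:=\gamma^{(0)}-C_\Gamma(r^b\varsigma)^{d_2},$$ one has $\mathcal K^{(\infty)}_{0\lambda}>\mathcal K_0$, $\mathcal K^{(\infty)}_{1\lambda}<\mathcal K_1$ and $\gamma^{(\infty)}\ge\Gamma$. Then there are a measurable set $\Omega^{(\infty)}\subset\Omega^{(0)}$, real functions $\lambda^{(\infty)}_j(\omega)$ on it, and operators $U(\phi,\omega)$, $\omega\in\Omega^{(\infty)}$, unitary in $L^2$ for real $\phi$, such that $\mathbf 1-U$ extends to a Lipschitz analytic map from $\mathbb T^n_{\vartheta r}\times\Omega^{(\infty)}$ to $B(\mathcal H^{s-\kappa};\mathcal H^s)$, and such that for every $\omega\in\Omega^{(\infty)}$ the transformation $\psi=U(\omega t,\omega)\psi'$ transforms $\mathrm i\dot\psi=(A^{(0)}+P^{(0)}(\omega t,\omega))\psi$ into $$\mathrm i\dot\psi'=A^{(\infty)}\psi',\qquad A^{(\infty)}=\mathrm{diag}(\lambda^{(\infty)}_j),$$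 i.e. $\psi'$ solves the latter equation if and only if $\psi$ solves the former. (Solutions are continuous curves in $L^2$ which satisfy the equation componentwise for all $t\in\mathbb R$.) Moreover, on $\Omega^{(\infty)}$, $$|\lambda^{(\infty)}_i-\lambda^{(\infty)}_j|\ge\mathcal K^{(\infty)}_{0\lambda}|i^d-j^d|,\qquad \left|\frac{\Delta(\lambda^{(\infty)}_i-\lambda^{(\infty)}_j)}{\Delta\omega}\right|\le\mathcal K^{(\infty)}_{1\lambda}|i^d-j^d|,$$ $$|\lambda^{(\infty)}_i-\lambda^{(\infty)}_j+\omega\cdot k|\ge\frac{\gamma^{(\infty)}}{1+|k|^\tau}\langle i^d-j^d\rangle\quad\text{if }|i-j|+|k|\ne0,$$ $$|\Omega^{(0)}\setminus\Omega^{(\infty)}|\le C_\Omega\gamma^{(0)}(\varsigma r^b)^{d_3},\qquad |\Omega\setminus\Omega^{(\infty)}|\le\Upsilon^{(0)}+C_\Omega\gamma^{(0)}(\varsigma r^b)^{d_3},$$ $$\|\mathbf 1-U\|_{\vartheta r}\le C_U\varsigma r^{b-(n+\tau)},\qquad r^{\tau+1}\|\mathbf 1-U\|^{\mathcal L}_{\vartheta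 r}\le C_U\varsigma r^{b-(n+\tau)}.$$ -/

import Mathlib

open MeasureTheory

noncomputable section

/-- `L²`, identified with `ℓ²` through the basis of eigenvectors, labelled by `j = 1, 2, …`. -/
abbrev EllTwo : Type := lp (fun _ : ℕ+ => ℂ) 2

/-- The complex sequences `ψ` with `∑ j ^ (2 σ) * |ψ_j| ^ 2 < ∞`. -/
def sobolevSubmodule (σ : ℝ) : Submodule ℂ (ℕ+ → ℂ) where
  carrier := {ψ | Memℓp (fun j : ℕ+ => (((j : ℝ) ^ σ : ℝ) : ℂ) * ψ j) 2}
  zero_mem' := by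
    have h : Memℓp (0 : ℕ+ → ℂ) 2 := zero_memℓp
    simpa [Pi.zero_def] using h
  add_mem' := by
    intro a b ha hb
    have h := Memℓp.add ha hb
    simpa [mul_add, Pi.add_def] using h
  smul_mem' := by
    intro c a ha
    have h := Memℓp.const_smul ha c
    simpa [mul_left_comm, Pi.smul_def] using h

/-- The space `ℋ^σ = ℓ²_σ`, for every real `σ`. -/
def Sobolev (σ : ℝ) : Type := ↥(sobolevSubmodule σ)

instance (σ : ℝ) : AddCommGroup (Sobolev σ) :=
  inferInstanceAs (AddCommGroup ↥(sobolevSubmodule σ))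

instance (σ : ℝ) : Module ℂ (Sobolev σ) :=
  inferInstanceAs (Module ℂ ↥(sobolevSubmodule σ))

/-- The `j`-th component of an element of `ℋ^σ`. -/
def Sobolev.coord {σ : ℝ} (ψ : Sobolev σ) (j : ℕ+) : ℂ := ψ.1 j

/-- The linear map `(ψ_j) ↦ (j ^ σ * ψ_j)` from `ℋ^σ` to `ℓ²`. -/
def Sobolev.toEllTwo (σ : ℝ) : Sobolev σ →ₗ[ℂ] EllTwo where
  toFun ψ := ⟨fun j : ℕ+ => (((j : ℝ) ^ σ : ℝ) : ℂ) * ψ.1 j, ψ.2⟩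
  map_add' := by
    intro a b
    apply Subtype.ext
    funext j
    exact mul_add _ _ _
  map_smul' := by
    intro c a
    apply Subtype.ext
    funext j
    exact mul_left_comm _ _ _

theorem Sobolev.toEllTwo_injective (σ : ℝ) : Function.Injective (Sobolev.toEllTwo σ) := by
  intro a b hab
  apply Subtype.ext
  funext j
  have h : (((j : ℝ) ^ σ : ℝ) : ℂ) * a.1 j = (((j : ℝ) ^ σ : ℝ) : ℂ) * b.1 j :=
    congrFun (congrArg Subtype.val hab) j
  have hj : (0 : ℝ) < (j : ℝ) ^ σ := Real.rpow_pos_of_pos (by exact_mod_cast j.pos) σ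
  exact mul_left_cancel₀ (by exact_mod_cast hj.ne') h

/-- The norm of `ℋ^σ`: `‖ψ‖² = ∑ j ^ (2 σ) * |ψ_j| ^ 2`. -/
instance (σ : ℝ) : NormedAddCommGroup (Sobolev σ) :=
  NormedAddCommGroup.induced (Sobolev σ) EllTwo (Sobolev.toEllTwo σ)
    (Sobolev.toEllTwo_injective σ)

instance (σ : ℝ) : NormedSpace ℂ (Sobolev σ) :=
  NormedSpace.induced ℂ (Sobolev σ) EllTwo (Sobolev.toEllTwo σ)

/-- The `j`-th basis vector, as an element of `ℋ^σ`. -/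
def Sobolev.basisVec (σ : ℝ) (j : ℕ+) : Sobolev σ :=
  ⟨Pi.single j 1, by
    have h := (lp.single (E := fun _ : ℕ+ => ℂ) 2 j (((j : ℝ) ^ σ : ℝ) : ℂ)).2
    have e : (fun i : ℕ+ => (((i : ℝ) ^ σ : ℝ) : ℂ) * (Pi.single j (1 : ℂ) : ℕ+ → ℂ) i)
        = ⇑(lp.single (E := fun _ : ℕ+ => ℂ) 2 j (((j : ℝ) ^ σ : ℝ) : ℂ)) := by
      funext i
      by_cases hij : i = j
      · subst hij
        simp
      · simp [hij]
    change Memℓp (fun i : ℕ+ => (((i : ℝ) ^ σ : ℝ) : ℂ) * (Pi.single j (1 : ℂ) : ℕ+ → ℂ) i) 2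
    rw [e]
    exact h⟩

/-- The matrix element `T_{ij}` of a bounded operator `T : ℋ^a → ℋ^b`. -/
def matrixElem {a b : ℝ} (T : Sobolev a →L[ℂ] Sobolev b) (i j : ℕ+) : ℂ :=
  (T (Sobolev.basisVec a j)).coord i

/-- The matrix element `T_{ij}` of a unitary operator of `ℓ²`. -/
def unitaryElem (T : EllTwo ≃ₗᵢ[ℂ] EllTwo) (i j : ℕ+) : ℂ :=
  (T (lp.single 2 j (1 : ℂ))) i

/-- The set `Ω = [1,2]^n` of frequencies. Vectors of frequencies carry the sup norm. -/
def frequencySet (n : ℕ) : Set (Fin n → ℝ) := Set.Icc (fun _ => 1) (fun _ => 2)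

/-- The strip `|Im φ_m| < r`, `m = 1, …, n`; functions on the complexified torus `𝕋^n_r`
are the functions on the strip that are `2π`-periodic in each variable. -/
def strip (n : ℕ) (r : ℝ) : Set (Fin n → ℂ) := {φ | ∀ m, |(φ m).im| < r}

/-- A real angle as a point of the strip. -/
def realAngle {n : ℕ} (φ : Fin n → ℝ) : Fin n → ℂ := fun m => (φ m : ℂ)

/-- `sup_{ω ∈ S} sup_{φ ∈ 𝕋^n_r} ‖F(φ,ω)‖ ≤ C`. -/
def SupNormLE {n : ℕ} {E : Type*} [NormedAddCommGroup E] (r : ℝ) (S : Set (Fin n → ℝ))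
    (F : (Fin n → ℂ) → (Fin n → ℝ) → E) (C : ℝ) : Prop :=
  ∀ ω ∈ S, ∀ φ ∈ strip n r, ‖F φ ω‖ ≤ C

/-- `sup_{ω ≠ ω' ∈ S} sup_{φ ∈ 𝕋^n_r} ‖F(φ,ω) - F(φ,ω')‖ / |ω - ω'| ≤ C`. -/
def LipNormLE {n : ℕ} {E : Type*} [NormedAddCommGroup E] (r : ℝ) (S : Set (Fin n → ℝ))
    (F : (Fin n → ℂ) → (Fin n → ℝ) → E) (C : ℝ) : Prop :=
  ∀ ω ∈ S, ∀ ω' ∈ S, ω ≠ ω' → ∀ φ ∈ strip n r, ‖F φ ω - F φ ω'‖ ≤ C * ‖ω - ω'‖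

/-- Lipschitz analytic maps: analytic in `φ ∈ 𝕋^n_r` and Lipschitz in `ω ∈ S`. -/
structure IsLipschitzAnalytic {n : ℕ} {E : Type*} [NormedAddCommGroup E] [NormedSpace ℂ E]
    (r : ℝ) (S : Set (Fin n → ℝ)) (F : (Fin n → ℂ) → (Fin n → ℝ) → E) : Prop where
  periodic : ∀ ω ∈ S, ∀ φ ∈ strip n r, ∀ m : Fin n,
    F (φ + Pi.single m ((2 * Real.pi : ℝ) : ℂ)) ω = F φ ω
  analytic : ∀ ω ∈ S, DifferentiableOn ℂ (fun φ => F φ ω) (strip n r)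
  bounded : ∃ C, SupNormLE r S F C
  lipschitz : ∃ L, LipNormLE r S F L

/-- The exponent `d = 2l / (l + 1)`. -/
def growthExp (l : ℕ) : ℝ := 2 * (l : ℝ) / ((l : ℝ) + 1)

/-- `|i^d - j^d|`. -/
def powGap (d : ℝ) (i j : ℕ+) : ℝ := |(i : ℝ) ^ d - (j : ℝ) ^ d|

/-- `⟨m⟩ = max {1, |m|}`. -/
def bracket (m : ℝ) : ℝ := max 1 |m|

/-- `|k| = |k_1| + … + |k_n|`. -/
def intNorm {n : ℕ} (k : Fin n → ℤ) : ℝ := ∑ m, |(k m : ℝ)|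

/-- `|λ_i - λ_j| ≥ K |i^d - j^d|` on `S`. -/
def GapBound {n : ℕ} (d : ℝ) (S : Set (Fin n → ℝ)) (lam : ℕ+ → (Fin n → ℝ) → ℝ) (K : ℝ) :
    Prop :=
  ∀ ω ∈ S, ∀ i j : ℕ+, K * powGap d i j ≤ |lam i ω - lam j ω|

/-- `|Δ(λ_i - λ_j) / Δω| ≤ K |i^d - j^d|` on `S`. -/
def LipGapBound {n : ℕ} (d : ℝ) (S : Set (Fin n → ℝ)) (lam : ℕ+ → (Fin n → ℝ) → ℝ) (K : ℝ) :
    Prop :=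
  ∀ ω ∈ S, ∀ ω' ∈ S, ω ≠ ω' → ∀ i j : ℕ+,
    |(lam i ω' - lam j ω') - (lam i ω - lam j ω)| ≤ K * powGap d i j * ‖ω' - ω‖

/-- `|λ_i - λ_j + ω·k| ≥ γ ⟨i^d - j^d⟩ / (1 + |k|^τ)` on `S`, whenever `|i - j| + |k| ≠ 0`. -/
def MelnikovBound {n : ℕ} (d τ : ℝ) (S : Set (Fin n → ℝ)) (lam : ℕ+ → (Fin n → ℝ) → ℝ)
    (γ : ℝ) : Prop :=
  ∀ ω ∈ S, ∀ (i j : ℕ+) (k : Fin n → ℤ), (i ≠ j ∨ k ≠ 0) →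
    γ / (1 + intNorm k ^ τ) * bracket ((i : ℝ) ^ d - (j : ℝ) ^ d)
      ≤ |lam i ω - lam j ω + ∑ m, ω m * (k m : ℝ)|

/-- The matrix of `diag(λ_j)`. -/
def diagMatrix (lam : ℕ+ → ℝ) (i j : ℕ+) : ℂ := if i = j then (lam i : ℂ) else 0

/-- `ψ` solves `i ψ' = H(t) ψ`, where `H(t)` is given by its matrix: `ψ` is a continuous curve in
`L²` and the equation holds in the weak sense, that is, componentwise in the eigenvector basis. -/
def IsSolution (H : ℝ → ℕ+ → ℕ+ → ℂ) (ψ : ℝ → EllTwo) : Prop :=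
  Continuous ψ ∧ ∀ (t : ℝ) (i : ℕ+), ∃ v : ℂ,
    HasSum (fun j => H t i j * ψ t j) (Complex.I * v) ∧ HasDerivAt (fun u => ψ u i) v t

end

/-! Along `φ = ωt` one looks for a unitary `U` with `i dU/dt = (A + P) U - U (A + F)`, where `F` is
diagonal up to an error smaller than `P`. To first order this is the homological equation `[A, Y] -
i ω·∂Y = (Q - P) / 2`, with `Q` the diagonal of the average of `P`; it is solved by dividing Fourier
coefficients by `λ_i - λ_j + ω·k`. The transformation is the Cayley transform `U = (1 + Y)(1 -
Y)⁻¹`: it is unitary for skew `Y`, and the new perturbation has a closed form in which every term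
contains `Y` together with `P` or `Q` (`cayley_identity`).

Dividing by the divisors is bounded on operators: `d ≥ 1` gives `|i^d - j^d| ≥ |i - j|`, and matrix
multipliers of size `1 / |i - j|` are bounded by Cauchy–Schwarz and Schur's test
(`exists_schur_multiplier`). With the exponential decay of Fourier coefficients on a strip this
yields `exists_homSol_bound`, at the cost of some width.

Operators from `ℋ^(s-κ)` to `ℋ^s` are written on `ℓ²` with weights (`transfer`), where composition
becomes `a * powOp κ * a'`. Unitarity concerns the unweighted matrix. `OpRel` links the two
pictures: Krein's lemma (`krein_bound`) bounds the unweighted operator by the weighted norm when the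
matrix is Hermitian or skew, and expressions with inverses pass from one picture to the other as
fixed points of contractions.

The gain `κ > 1` makes the `j`-th eigenvalue move by at most `e j^(-κ)`. For given `k ≠ 0`, all but
finitely many pairs of indices therefore inherit their Melnikov condition with a slightly smaller
constant. Each remaining condition fails on a set of small measure, since `8 K₁ < K₀` keeps the
eigenvalues from following `ω·k` (`resonantSet_estimate`), and the hypothesis on `τ` makes the sum
over `k` converge (`exists_excision`).

The iteration converges geometrically. At step `m` the strip loses a width proportional to `2^(-m)`
and the small divisors cost a multiple of `q^m`, `q = 2^(n+2τ+1)`; the perturbation decays like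
`q^(-2m)`, so `Y` decays at least like `2^(-m)` (`exists_iterStep`). The Melnikov constant gives up
`√ε 2^(-m)` at step `m`, with `ε = ς r^b`, which is the origin of the exponents `d₂ = 1/2` and `d₃ =
1/(2κ)`.

In the limit (`exists_normalForm`) the matrix elements of `U` satisfy the operator equation. As `A`
is unbounded and solutions are componentwise, the flows are compared through scalar products in
which the diagonal terms cancel (`hasDerivAt_inner_of_diag`). -/

noncomputable section

/-! ### Bounded operators of `ℓ²` and their matrices -/

/-- Bounded operators of `ℓ²`. -/
abbrev EllOp : Type := EllTwo →L[ℂ] EllTwo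

/-- The `j`-th basis vector of `ℓ²`. -/
def ellBasis (j : ℕ+) : EllTwo := lp.single 2 j (1 : ℂ)

/-- The matrix element of a bounded operator of `ℓ²`. -/
def entry (a : EllOp) (i j : ℕ+) : ℂ := a (ellBasis j) i

theorem norm_ellBasis (j : ℕ+) : ‖ellBasis j‖ = 1 := by
  simp [ellBasis, lp.norm_single]

theorem ellBasis_apply (i j : ℕ+) : ellBasis j i = if i = j then 1 else 0 := by
  by_cases h : i = j
  · subst h; simp [ellBasis]
  · simp [ellBasis, h]

instance : Nontrivial EllTwo :=
  ⟨⟨ellBasis 1, 0, fun h => by simpa [h] using norm_ellBasis 1⟩⟩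

theorem norm_coord_le (x : EllTwo) (i : ℕ+) : ‖x i‖ ≤ ‖x‖ :=
  lp.norm_apply_le_norm (by norm_num) x i

/-- The `i`-th coordinate as a functional on `ℓ²`. -/
def coordCLM (i : ℕ+) : EllTwo →L[ℂ] ℂ :=
  LinearMap.mkContinuous
    { toFun := fun x => x i, map_add' := fun _ _ => rfl, map_smul' := fun _ _ => rfl } 1
    (fun x => by rw [one_mul]; exact norm_coord_le x i)

@[simp] theorem coordCLM_apply (i : ℕ+) (x : EllTwo) : coordCLM i x = x i := rfl

/-- A matrix element as a functional on operators. -/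
def entryCLM (i j : ℕ+) : EllOp →L[ℂ] ℂ :=
  (coordCLM i).comp (ContinuousLinearMap.apply ℂ EllTwo (ellBasis j))

@[simp] theorem entryCLM_apply (i j : ℕ+) (a : EllOp) : entryCLM i j a = entry a i j := rfl

theorem continuous_entry (i j : ℕ+) : Continuous (fun a : EllOp => entry a i j) :=
  (entryCLM i j).continuous

theorem norm_entry_le (a : EllOp) (i j : ℕ+) : ‖entry a i j‖ ≤ ‖a‖ := by
  refine (norm_coord_le _ _).trans ?_
  simpa [norm_ellBasis] using a.le_opNorm (ellBasis j)

theorem entry_add (a b : EllOp) (i j : ℕ+) : entry (a + b) i j = entry a i j + entry b i j := rfl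
theorem entry_sub (a b : EllOp) (i j : ℕ+) : entry (a - b) i j = entry a i j - entry b i j := rfl
theorem entry_neg (a : EllOp) (i j : ℕ+) : entry (-a) i j = -entry a i j := rfl
theorem entry_smul (c : ℂ) (a : EllOp) (i j : ℕ+) : entry (c • a) i j = c * entry a i j := rfl
theorem entry_zero (i j : ℕ+) : entry 0 i j = 0 := rfl
theorem entry_one (i j : ℕ+) : entry 1 i j = if i = j then 1 else 0 := ellBasis_apply i j

theorem hasSum_coord_smul_basis (x : EllTwo) : HasSum (fun j => x j • ellBasis j) x := by
  have h := lp.hasSum_single (p := 2) (by norm_num) x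
  convert h using 2 with j
  rw [ellBasis, ← lp.single_smul]
  simp

theorem hasSum_entry_mul (a : EllOp) (x : EllTwo) (i : ℕ+) :
    HasSum (fun j => entry a i j * x j) (a x i) := by
  have h := ((coordCLM i).comp a).hasSum (hasSum_coord_smul_basis x)
  convert h using 2 with j
  · simp [entry, mul_comm]
  · rfl

theorem hasSum_entry_mul_entry (a b : EllOp) (i j : ℕ+) :
    HasSum (fun l => entry a i l * entry b l j) (entry (a * b) i j) :=
  hasSum_entry_mul a (b (ellBasis j)) i

theorem ellOp_ext {a b : EllOp} (h : ∀ i j, entry a i j = entry b i j) : a = b := by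
  ext x i
  have h1 := hasSum_entry_mul a x i
  simp only [h] at h1
  exact h1.unique (hasSum_entry_mul b x i)

theorem inner_ellBasis_left (i : ℕ+) (x : EllTwo) : inner ℂ (ellBasis i) x = x i := by
  rw [ellBasis, lp.inner_single_left]; simp

theorem entry_star (a : EllOp) (i j : ℕ+) :
    entry (star a) i j = (starRingEnd ℂ) (entry a j i) := by
  rw [entry, ← inner_ellBasis_left, ContinuousLinearMap.star_eq_adjoint,
    ContinuousLinearMap.adjoint_inner_right, ← inner_conj_symm, inner_ellBasis_left]
  rfl

theorem ellTwo_hasSum_sq (x : EllTwo) : HasSum (fun i => ‖x i‖ ^ 2) (‖x‖ ^ 2) := by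
  have h := lp.hasSum_norm (p := 2) (by norm_num) x
  simpa using h

theorem hasSum_col_sq (a : EllOp) (j : ℕ+) :
    Summable (fun i => ‖entry a i j‖ ^ 2) ∧ ∑' i, ‖entry a i j‖ ^ 2 ≤ ‖a‖ ^ 2 := by
  have h := ellTwo_hasSum_sq (a (ellBasis j))
  refine ⟨h.summable, h.tsum_eq.trans_le ?_⟩
  have := a.le_opNorm (ellBasis j)
  rw [norm_ellBasis, mul_one] at this
  gcongr

theorem hasSum_row_sq (a : EllOp) (i : ℕ+) :
    Summable (fun j => ‖entry a i j‖ ^ 2) ∧ ∑' j, ‖entry a i j‖ ^ 2 ≤ ‖a‖ ^ 2 := by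
  have h := hasSum_col_sq (star a) i
  have e : ‖star a‖ = ‖a‖ := by
    rw [ContinuousLinearMap.star_eq_adjoint, LinearIsometryEquiv.norm_map]
  simpa only [entry_star, RCLike.norm_conj, e] using h

/-! ### Schur's test and Schur multipliers. -/

/-- **Schur's test.** -/
theorem exists_op_of_schur (K : ℕ+ → ℕ+ → ℂ) (R : ℝ) (hR : 0 ≤ R)
    (hrow : ∀ i, Summable (fun j => ‖K i j‖) ∧ ∑' j, ‖K i j‖ ≤ R)
    (hcol : ∀ j (s : Finset ℕ+), ∑ i ∈ s, ‖K i j‖ ≤ R) :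
    ∃ b : EllOp, (∀ i j, entry b i j = K i j) ∧ ‖b‖ ≤ R := by
  have hKR : ∀ i j, ‖K i j‖ ≤ R := fun i j => by simpa using hcol j {i}
  have hs1 : ∀ (x : EllTwo) i, Summable (fun j => ‖K i j‖ * ‖x j‖) := fun x i =>
    Summable.of_nonneg_of_le (fun j => by positivity)
      (fun j => mul_le_mul_of_nonneg_left (norm_coord_le x j) (norm_nonneg _))
      ((hrow i).1.mul_right ‖x‖)
  have hs2 : ∀ (x : EllTwo) i, Summable (fun j => ‖K i j‖ * ‖x j‖ ^ 2) := fun x i =>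
    Summable.of_nonneg_of_le (fun j => by positivity)
      (fun j => mul_le_mul_of_nonneg_right (hKR i j) (by positivity))
      ((ellTwo_hasSum_sq x).summable.mul_left R)
  have hs0 : ∀ (x : EllTwo) i, Summable (fun j => K i j * x j) := fun x i =>
    Summable.of_norm (by simpa using hs1 x i)
  -- Cauchy–Schwarz with the kernel split as `|K|^(1/2) · |K|^(1/2) |x|`. Only row sums enter here;
  -- the column sums are used in `hfin`.
  have hpt : ∀ (x : EllTwo) i, ‖∑' j, K i j * x j‖ ^ 2 ≤ R * ∑' j, ‖K i j‖ * ‖x j‖ ^ 2 := by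
    intro x i
    have h1 : ‖∑' j, K i j * x j‖ ≤ ∑' j, ‖K i j‖ * ‖x j‖ := by
      have := norm_tsum_le_tsum_norm (f := fun j => K i j * x j) (by simpa using hs1 x i)
      simpa using this
    have h2 : (∑' j, ‖K i j‖ * ‖x j‖) ^ 2 ≤ R * ∑' j, ‖K i j‖ * ‖x j‖ ^ 2 := by
      refine le_of_tendsto ((hs1 x i).hasSum.pow 2) (Filter.Eventually.of_forall fun s => ?_)
      have := Finset.sum_sq_le_sum_mul_sum_of_sq_le_mul s (r := fun j => ‖K i j‖ * ‖x j‖)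
        (f := fun j => ‖K i j‖) (g := fun j => ‖K i j‖ * ‖x j‖ ^ 2)
        (fun j _ => by positivity) (fun j _ => by positivity) (fun j _ => by rw [mul_pow]; exact le_of_eq (by ring))
      refine this.trans ?_
      gcongr
      · exact ((hrow i).1.sum_le_tsum s (fun j _ => by positivity)).trans (hrow i).2
      · exact (hs2 x i).sum_le_tsum s (fun j _ => by positivity)
    exact (pow_le_pow_left₀ (norm_nonneg _) h1 2).trans h2
  have hfin : ∀ (x : EllTwo) (s : Finset ℕ+),
      ∑ i ∈ s, ‖∑' j, K i j * x j‖ ^ 2 ≤ (R * ‖x‖) ^ 2 := by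
    intro x s
    calc ∑ i ∈ s, ‖∑' j, K i j * x j‖ ^ 2 ≤ ∑ i ∈ s, R * ∑' j, ‖K i j‖ * ‖x j‖ ^ 2 :=
          Finset.sum_le_sum fun i _ => hpt x i
      _ = R * ∑' j, ∑ i ∈ s, ‖K i j‖ * ‖x j‖ ^ 2 := by
          rw [← Finset.mul_sum, Summable.tsum_finsetSum fun i _ => hs2 x i]
      _ ≤ R * ∑' j, R * ‖x j‖ ^ 2 := by
          refine mul_le_mul_of_nonneg_left ?_ hR
          refine Summable.tsum_le_tsum (fun j => ?_) (summable_sum fun i _ => hs2 x i)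
            ((ellTwo_hasSum_sq x).summable.mul_left R)
          rw [← Finset.sum_mul]
          exact mul_le_mul_of_nonneg_right (hcol j s) (by positivity)
      _ = (R * ‖x‖) ^ 2 := by
          rw [tsum_mul_left, (ellTwo_hasSum_sq x).tsum_eq]; ring
  have hmem : ∀ x : EllTwo, Memℓp (fun i => ∑' j, K i j * x j) 2 := by
    intro x
    refine memℓp_gen' (C := (R * ‖x‖) ^ 2) (fun s => ?_)
    simpa using hfin x s
  let L : EllTwo →ₗ[ℂ] EllTwo :=
    { toFun := fun x => ⟨fun i => ∑' j, K i j * x j, hmem x⟩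
      map_add' := by
        intro x y
        ext i
        change ∑' j, K i j * (x j + y j) = ∑' j, K i j * x j + ∑' j, K i j * y j
        simp only [mul_add]
        exact (hs0 x i).tsum_add (hs0 y i)
      map_smul' := by
        intro c x
        ext i
        change ∑' j, K i j * (c * x j) = c * ∑' j, K i j * x j
        rw [← tsum_mul_left]
        exact tsum_congr fun j => by ring }
  refine ⟨L.mkContinuous R (fun x => ?_), fun i j => ?_, L.mkContinuous_norm_le hR _⟩
  · refine lp.norm_le_of_forall_sum_le (by norm_num) (by positivity) (fun s => ?_)
    have := hfin x s
    simp only [ENNReal.toReal_ofNat, Real.rpow_ofNat]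
    exact this
  · change ∑' l, K i l * ellBasis j l = K i j
    rw [tsum_eq_single j]
    · simp [ellBasis_apply]
    · intro l hl; simp [ellBasis_apply, hl]

/-- The constant in the bound on Schur multipliers decaying away from the diagonal. -/
def schurConst : ℝ := Real.sqrt (∑' p : ℤ, (1 / max 1 |(p : ℝ)|) ^ 2)

theorem summable_one_div_max_sq : Summable (fun p : ℤ => (1 / max 1 |(p : ℝ)|) ^ 2) := by
  have h := Real.summable_one_div_int_pow (p := 2) |>.2 (by norm_num)
  have h2 : Summable (fun p : ℤ => 1 / (p : ℝ) ^ 2 + if p = 0 then (1 : ℝ) else 0) :=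
    h.add (summable_of_ne_finset_zero (s := {0}) (by simp +contextual))
  refine Summable.of_nonneg_of_le (fun p => by positivity) (fun p => ?_) h2
  by_cases hp : p = 0
  · simp [hp]
  · have : (1 : ℝ) ≤ |(p : ℝ)| := by exact_mod_cast Int.one_le_abs hp
    simp [hp, max_eq_right this]

theorem schur_weight_bound (f : ℕ+ → ℤ) (hf : Function.Injective f) (s : Finset ℕ+) :
    ∑ j ∈ s, (1 / max 1 |((f j : ℤ) : ℝ)|) ^ 2 ≤ schurConst ^ 2 := by
  have h0 : 0 ≤ ∑' p : ℤ, (1 / max 1 |(p : ℝ)|) ^ 2 := tsum_nonneg fun p => by positivity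
  rw [schurConst, Real.sq_sqrt h0]
  rw [← Finset.sum_image (f := fun p : ℤ => (1 / max 1 |(p : ℝ)|) ^ 2) (s := s) (g := f)
    (fun x _ y _ h => hf h)]
  exact summable_one_div_max_sq.sum_le_tsum _ (fun p _ => by positivity)

theorem schurConst_nonneg : 0 ≤ schurConst := Real.sqrt_nonneg _

/-- Cauchy–Schwarz between the multiplier and a row or column of an operator, both square summable.
The map `f` will be `i - j` with one index frozen. -/
theorem schur_finite_bound (m v : ℕ+ → ℂ) (c A : ℝ) (hc : 0 ≤ c) (hA : 0 ≤ A) (f : ℕ+ → ℤ)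
    (hf : Function.Injective f) (hm : ∀ j, ‖m j‖ ≤ c / max 1 |((f j : ℤ) : ℝ)|)
    (s : Finset ℕ+) (hv : ∑ j ∈ s, ‖v j‖ ^ 2 ≤ A ^ 2) :
    ∑ j ∈ s, ‖m j * v j‖ ≤ schurConst * c * A := by
  have h1 : ∑ j ∈ s, ‖m j‖ ^ 2 ≤ (c * schurConst) ^ 2 := by
    calc ∑ j ∈ s, ‖m j‖ ^ 2 ≤ ∑ j ∈ s, c ^ 2 * (1 / max 1 |((f j : ℤ) : ℝ)|) ^ 2 := by
          refine Finset.sum_le_sum fun j _ => ?_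
          rw [← mul_pow, mul_one_div]
          exact pow_le_pow_left₀ (norm_nonneg _) (hm j) 2
      _ ≤ _ := by
          rw [← Finset.mul_sum, mul_pow]
          exact mul_le_mul_of_nonneg_left (schur_weight_bound f hf s) (by positivity)
  have h2 := Finset.sum_mul_sq_le_sq_mul_sq s (fun j => ‖m j‖) (fun j => ‖v j‖)
  have h3 : (∑ j ∈ s, ‖m j‖ * ‖v j‖) ^ 2 ≤ (schurConst * c * A) ^ 2 := by
    refine h2.trans ?_
    calc _ ≤ (c * schurConst) ^ 2 * A ^ 2 := by gcongr
      _ = _ := by ring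
  simp only [norm_mul]
  have := schurConst_nonneg
  exact le_of_sq_le_sq h3 (by positivity)

/-- Multipliers decaying like `1 / |i - j|` act boundedly on operators. -/
theorem exists_schur_multiplier (m : ℕ+ → ℕ+ → ℂ) (c : ℝ) (hc : 0 ≤ c)
    (hm : ∀ i j : ℕ+, ‖m i j‖ ≤ c / max 1 |(i : ℝ) - (j : ℝ)|) (a : EllOp) :
    ∃ b : EllOp, (∀ i j, entry b i j = m i j * entry a i j) ∧ ‖b‖ ≤ schurConst * c * ‖a‖ := by
  have h0 := schurConst_nonneg
  refine exists_op_of_schur _ _ (by positivity) (fun i => ?_) (fun j s => ?_)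
  · have hb : ∀ s : Finset ℕ+, ∑ j ∈ s, ‖m i j * entry a i j‖ ≤ schurConst * c * ‖a‖ := by
      intro s
      refine schur_finite_bound _ _ c _ hc (norm_nonneg _) (fun j => (i : ℤ) - (j : ℤ)) ?_ ?_ s ?_
      · intro x y h
        simpa using h
      · intro j; simpa using hm i j
      · exact ((hasSum_row_sq a i).1.sum_le_tsum s (fun _ _ => by positivity)).trans
          (hasSum_row_sq a i).2
    exact ⟨summable_of_sum_le (fun _ => norm_nonneg _) hb,
      Real.tsum_le_of_sum_le (fun _ => norm_nonneg _) hb⟩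
  · refine schur_finite_bound _ _ c _ hc (norm_nonneg _) (fun i => (i : ℤ) - (j : ℤ)) ?_ ?_ s ?_
    · intro x y h
      simpa using h
    · intro i; simpa using hm i j
    · exact ((hasSum_col_sq a j).1.sum_le_tsum s (fun _ _ => by positivity)).trans
        (hasSum_col_sq a j).2

theorem exists_diagOp (w : ℕ+ → ℝ) (hw : ∀ j, |w j| ≤ 1) :
    ∃ b : EllOp, (∀ i j, entry b i j = if i = j then (w j : ℂ) else 0) ∧ ‖b‖ ≤ 1 := by
  have hn : ∀ i j : ℕ+, ‖(if i = j then (w j : ℂ) else 0)‖ = if i = j then |w j| else 0 := by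
    intro i j; split_ifs <;> simp
  refine exists_op_of_schur _ 1 (by norm_num) (fun i => ?_) (fun j s => ?_)
  · simp only [hn]
    have : HasSum (fun j => if i = j then |w j| else 0) |w i| := by
      have := hasSum_single (f := fun j => if i = j then |w j| else 0) i
        (fun j hj => by simp [Ne.symm hj])
      simpa using this
    exact ⟨this.summable, this.tsum_eq.trans_le (hw i)⟩
  · simp only [hn]
    rw [Finset.sum_ite_eq']
    split_ifs
    · exact hw j
    · norm_num

/-! ### The weights `j ^ (-σ)` as operators. -/

theorem exists_powOp (σ : ℝ) (h : 0 ≤ σ) : ∃ b : EllOp,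
    (∀ i j, entry b i j = if i = j then (((j : ℝ) ^ (-σ) : ℝ) : ℂ) else 0) ∧ ‖b‖ ≤ 1 := by
  obtain ⟨b, hb, hb1⟩ := exists_diagOp (fun j => (j : ℝ) ^ (-σ)) (fun j => by
    rw [abs_of_nonneg (by positivity)]
    exact Real.rpow_le_one_of_one_le_of_nonpos (by exact_mod_cast j.pos) (by linarith))
  refine ⟨b, fun i j => ?_, hb1⟩
  rw [hb]

/-- The operator `diag (j ^ (-σ))`. -/
def powOp (σ : ℝ) : EllOp := if h : 0 ≤ σ then (exists_powOp σ h).choose else 0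

theorem entry_powOp {σ : ℝ} (h : 0 ≤ σ) (i j : ℕ+) :
    entry (powOp σ) i j = if i = j then (((j : ℝ) ^ (-σ) : ℝ) : ℂ) else 0 := by
  rw [powOp, dif_pos h]
  exact (exists_powOp σ h).choose_spec.1 i j

theorem norm_powOp_le (σ : ℝ) : ‖powOp σ‖ ≤ 1 := by
  unfold powOp
  split_ifs with h
  · exact (exists_powOp σ h).choose_spec.2
  · simp

theorem powOp_apply {σ : ℝ} (h : 0 ≤ σ) (x : EllTwo) (i : ℕ+) :
    powOp σ x i = (((i : ℝ) ^ (-σ) : ℝ) : ℂ) * x i := by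
  have h1 := hasSum_entry_mul (powOp σ) x i
  refine h1.unique ?_
  simp only [entry_powOp h]
  have := hasSum_single (f := fun j => (if i = j then (((j : ℝ) ^ (-σ) : ℝ) : ℂ) else 0) * x j) i
    (fun j hj => by simp [Ne.symm hj])
  simpa using this

theorem entry_powOp_mul {σ : ℝ} (h : 0 ≤ σ) (a : EllOp) (i j : ℕ+) :
    entry (powOp σ * a) i j = (((i : ℝ) ^ (-σ) : ℝ) : ℂ) * entry a i j :=
  powOp_apply h _ i

theorem entry_mul_powOp {σ : ℝ} (h : 0 ≤ σ) (a : EllOp) (i j : ℕ+) :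
    entry (a * powOp σ) i j = entry a i j * (((j : ℝ) ^ (-σ) : ℝ) : ℂ) := by
  refine (hasSum_entry_mul_entry a (powOp σ) i j).unique ?_
  simp only [entry_powOp h]
  have := hasSum_single (f := fun l => entry a i l *
    (if l = j then (((j : ℝ) ^ (-σ) : ℝ) : ℂ) else 0)) j (fun l hl => by simp [hl])
  simpa using this

theorem star_powOp {σ : ℝ} (h : 0 ≤ σ) : star (powOp σ) = powOp σ := by
  refine ellOp_ext fun i j => ?_
  rw [entry_star, entry_powOp h, entry_powOp h]
  by_cases hij : i = j
  · subst hij; simp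
  · simp [hij, Ne.symm hij]

/-! ### Symmetrisable operators -/

/-- Log-convexity makes the ratios `q (n + 1) / q n` nondecreasing. If the first one exceeded `M`,
the sequence would grow at least like `ρ ^ n` with `ρ > M`, against `h2`. -/
theorem ratio_bound_of_log_convex (q : ℕ → ℝ) (C M : ℝ) (hM : 0 ≤ M) (hq : ∀ n, 0 ≤ q n)
    (h1 : ∀ n, q (n + 1) ^ 2 ≤ q n * q (n + 2)) (h2 : ∀ n, q n ≤ C * M ^ n) :
    q 1 ≤ M * q 0 := by
  rcases (hq 0).eq_or_lt with h0 | h0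
  · have := h1 0
    rw [← h0] at this
    have : q 1 = 0 := by nlinarith [hq 1]
    rw [this, ← h0]; simp
  by_contra! hcon
  set ρ := q 1 / q 0 with hρ
  have hρM : M < ρ := by rw [hρ, lt_div_iff₀ h0]; exact hcon
  have hρ0 : 0 < ρ := hM.trans_lt hρM
  have hstep : ∀ n, 0 < q n ∧ ρ * q n ≤ q (n + 1) := by
    intro n
    induction n with
    | zero => exact ⟨h0, by rw [hρ]; field_simp; exact le_rfl⟩
    | succ n ih =>
      have hp : 0 < q (n + 1) := lt_of_lt_of_le (by nlinarith [ih.1]) ih.2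
      refine ⟨hp, ?_⟩
      have := h1 n
      have h3 : ρ * q n * q (n + 1) ≤ q n * q (n + 2) := by nlinarith [ih.2]
      have h4 : q n * (ρ * q (n + 1)) ≤ q n * q (n + 2) := by linarith [h3]
      exact le_of_mul_le_mul_left h4 ih.1
  have hpow : ∀ n, ρ ^ n * q 0 ≤ q n := by
    intro n
    induction n with
    | zero => simp
    | succ n ih =>
      calc ρ ^ (n + 1) * q 0 = ρ * (ρ ^ n * q 0) := by ring
        _ ≤ ρ * q n := by gcongr
        _ ≤ _ := (hstep n).2
  rcases hM.eq_or_lt with hM0 | hM0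
  · have := h2 1
    rw [← hM0] at this hcon
    simp at this hcon
    linarith
  · have hr : 1 < ρ / M := by rw [one_lt_div hM0]; exact hρM
    obtain ⟨n, hn⟩ := pow_unbounded_of_one_lt (C / q 0) hr
    have h5 : ρ ^ n * q 0 ≤ C * M ^ n := (hpow n).trans (h2 n)
    rw [div_pow, div_lt_div_iff₀ h0 (by positivity)] at hn
    linarith

/-- **Krein's lemma**: an operator that is symmetric for a weaker scalar product is bounded for
the weaker norm. -/
theorem krein_bound (W t : EllOp) (hW : IsSelfAdjoint W) (ht : IsSelfAdjoint (W * W * t))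
    (u : EllTwo) : ‖W (t u)‖ ≤ ‖t‖ * ‖W u‖ := by
  -- `t` is symmetric for the form `⟨W x, W y⟩`, so the numbers `‖W tⁿ u‖` are log-convex; they grow
  -- at most like `‖t‖ⁿ`.
  have hsym : ∀ x y : EllTwo, inner ℂ (W (t x)) (W y) = inner ℂ (W x) (W (t y)) := by
    intro x y
    have hWs : (W : EllTwo →ₗ[ℂ] EllTwo).IsSymmetric :=
      ContinuousLinearMap.isSelfAdjoint_iff_isSymmetric.1 hW
    have hts : ((W * W * t : EllOp) : EllTwo →ₗ[ℂ] EllTwo).IsSymmetric :=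
      ContinuousLinearMap.isSelfAdjoint_iff_isSymmetric.1 ht
    have e1 := hWs (W (t x)) y
    have e2 := hWs x (W (t y))
    have e3 := hts x y
    simp only [ContinuousLinearMap.coe_coe, mul_assoc, mul_apply_eq_comp] at e1 e2 e3
    rw [← e1, e3, ← e2]
  have key := ratio_bound_of_log_convex (fun n => ‖W ((t ^ n) u)‖) (‖W‖ * ‖u‖) ‖t‖
    (norm_nonneg _) (fun n => norm_nonneg _) (fun n => ?_) (fun n => ?_)
  · simpa using key
  · have h1 : inner ℂ (W ((t ^ (n + 1)) u)) (W ((t ^ (n + 1)) u))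
        = inner ℂ (W ((t ^ n) u)) (W ((t ^ (n + 2)) u)) := by
      have := hsym ((t ^ n) u) ((t ^ (n + 1)) u)
      rw [pow_succ' t (n + 1), pow_succ' t n] at *
      exact this
    have h2 : (‖W ((t ^ (n + 1)) u)‖ ^ 2 : ℝ) = ‖inner ℂ (W ((t ^ n) u)) (W ((t ^ (n + 2)) u))‖ := by
      rw [← h1, inner_self_eq_norm_sq_to_K]; simp
    change ‖W ((t ^ (n + 1)) u)‖ ^ 2 ≤ _
    rw [h2]
    exact norm_inner_le_norm _ _
  · calc ‖W ((t ^ n) u)‖ ≤ ‖W‖ * ‖(t ^ n) u‖ := W.le_opNorm _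
      _ ≤ ‖W‖ * (‖t ^ n‖ * ‖u‖) := by gcongr; exact (t ^ n).le_opNorm u
      _ ≤ ‖W‖ * (‖t‖ ^ n * ‖u‖) := by gcongr; exact norm_pow_le t n
      _ = _ := by ring

/-- Needed to extend the map `W u ↦ W t u` by continuity in `exists_rel_selfAdjoint`. -/
theorem denseRange_powOp {σ : ℝ} (h : 0 ≤ σ) : DenseRange (powOp σ) := by
  have hb : ∀ j, ellBasis j ∈ LinearMap.range (powOp σ : EllTwo →ₗ[ℂ] EllTwo) := by
    intro j
    have hj : (0 : ℝ) < (j : ℝ) ^ (-σ) := Real.rpow_pos_of_pos (by exact_mod_cast j.pos) _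
    refine ⟨((((j : ℝ) ^ (-σ) : ℝ) : ℂ)⁻¹) • ellBasis j, ?_⟩
    ext i
    change powOp σ _ i = _
    rw [powOp_apply h]
    by_cases hij : i = j
    · subst hij
      have : (((i : ℝ) ^ (-σ) : ℝ) : ℂ) ≠ 0 := by exact_mod_cast hj.ne'
      simp only [lp.coeFn_smul, Pi.smul_apply, smul_eq_mul]
      field_simp
    · simp [ellBasis_apply, hij]
  intro x
  refine mem_closure_of_tendsto (hasSum_coord_smul_basis x) (Filter.Eventually.of_forall fun s => ?_)
  exact (LinearMap.range (powOp σ : EllTwo →ₗ[ℂ] EllTwo)).sum_mem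
    (fun j _ => Submodule.smul_mem _ _ (hb j))

/-! ### Weighted and unweighted forms of the same operator. -/

/-- `b` is the operator of `ℓ²` with the matrix `i ^ (-s) * a_ij * j ^ (s - κ)`. -/
def OpRel (s κ : ℝ) (a b : EllOp) : Prop :=
  ∀ i j : ℕ+, entry b i j =
    (((i : ℝ) ^ (-s) : ℝ) : ℂ) * entry a i j * (((j : ℝ) ^ (s - κ) : ℝ) : ℂ)

theorem cast_rpow_mul (j : ℕ+) (x y : ℝ) :
    (((j : ℝ) ^ x : ℝ) : ℂ) * (((j : ℝ) ^ y : ℝ) : ℂ) = (((j : ℝ) ^ (x + y) : ℝ) : ℂ) := by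
  rw [← Complex.ofReal_mul, ← Real.rpow_add (by exact_mod_cast j.pos)]

theorem cast_rpow_ne_zero (j : ℕ+) (x : ℝ) : (((j : ℝ) ^ x : ℝ) : ℂ) ≠ 0 := by
  have : (0 : ℝ) < (j : ℝ) ^ x := Real.rpow_pos_of_pos (by exact_mod_cast j.pos) _
  exact_mod_cast this.ne'

section OpRel

variable {s κ : ℝ} {a b a' b' : EllOp}

theorem OpRel.add (h : OpRel s κ a b) (h' : OpRel s κ a' b') : OpRel s κ (a + a') (b + b') :=
  fun i j => by rw [entry_add, entry_add, h, h']; ring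

theorem OpRel.sub (h : OpRel s κ a b) (h' : OpRel s κ a' b') : OpRel s κ (a - a') (b - b') :=
  fun i j => by rw [entry_sub, entry_sub, h, h']; ring

theorem OpRel.smul (c : ℂ) (h : OpRel s κ a b) : OpRel s κ (c • a) (c • b) :=
  fun i j => by rw [entry_smul, entry_smul, h]; ring

theorem OpRel.zero : OpRel s κ 0 0 := fun i j => by simp [entry_zero]

/-- In weighted coordinates composition passes through the embedding of `ℋ^s` in `ℋ^(s-κ)`, which is
`powOp κ`: the weights at the intermediate index `l` multiply to `l^(s-κ) l^(-s) = l^(-κ)`. -/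
theorem OpRel.mul (hκ : 0 ≤ κ) (h : OpRel s κ a b) (h' : OpRel s κ a' b') :
    OpRel s κ (a * powOp κ * a') (b * b') := by
  intro i j
  have h1 := hasSum_entry_mul_entry b b' i j
  have h2 := ((hasSum_entry_mul_entry (a * powOp κ) a' i j).mul_left
    (((i : ℝ) ^ (-s) : ℝ) : ℂ)).mul_right (((j : ℝ) ^ (s - κ) : ℝ) : ℂ)
  refine h1.unique (h2.congr_fun fun l => ?_)
  rw [h, h', entry_mul_powOp hκ]
  have : (((l : ℝ) ^ (s - κ) : ℝ) : ℂ) * (((l : ℝ) ^ (-s) : ℝ) : ℂ) = (((l : ℝ) ^ (-κ) : ℝ) : ℂ) := by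
    rw [cast_rpow_mul]; congr 3; ring
  rw [← this]; ring

theorem OpRel.unique_right (h : OpRel s κ a b) (h' : OpRel s κ a b') : b = b' :=
  ellOp_ext fun i j => by rw [h, h']

theorem OpRel.of_tendsto {A B : ℕ → EllOp} (h : ∀ N, OpRel s κ (A N) (B N))
    (hA : Filter.Tendsto A Filter.atTop (nhds a)) (hB : Filter.Tendsto B Filter.atTop (nhds b)) :
    OpRel s κ a b := by
  intro i j
  have h1 := ((continuous_entry i j).tendsto b).comp hB
  have h2 := ((((continuous_entry i j).tendsto a).comp hA).const_mul
    (((i : ℝ) ^ (-s) : ℝ) : ℂ)).mul_const (((j : ℝ) ^ (s - κ) : ℝ) : ℂ)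
  refine tendsto_nhds_unique h1 (h2.congr fun N => ?_)
  exact (h N i j).symm

/-- The symmetric operator `powOp s * powOp s * (a * powOp κ)` attached to a Hermitian matrix. -/
theorem isSelfAdjoint_weighted (hs : 0 ≤ s) (hκ : 0 ≤ κ)
    (h : ∀ i j : ℕ+, (((i : ℝ) ^ (-s) : ℝ) : ℂ) * entry a i j * (((j : ℝ) ^ (s - κ) : ℝ) : ℂ) =
      (starRingEnd ℂ) ((((j : ℝ) ^ (-s) : ℝ) : ℂ) * entry a j i * (((i : ℝ) ^ (s - κ) : ℝ) : ℂ))) :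
    IsSelfAdjoint (powOp s * powOp s * (a * powOp κ)) := by
  refine ellOp_ext fun i j => ?_
  rw [entry_star, mul_assoc, entry_powOp_mul hs, entry_powOp_mul hs, entry_mul_powOp hκ,
    entry_powOp_mul hs, entry_powOp_mul hs, entry_mul_powOp hκ]
  have h1 := congrArg (fun z => (((i : ℝ) ^ (-s) : ℝ) : ℂ) * (((j : ℝ) ^ (-s) : ℝ) : ℂ) * z) (h i j)
  have e1 : ∀ k : ℕ+, (((k : ℝ) ^ (-κ) : ℝ) : ℂ) =
      (((k : ℝ) ^ (-s) : ℝ) : ℂ) * (((k : ℝ) ^ (s - κ) : ℝ) : ℂ) := by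
    intro k; rw [cast_rpow_mul]; congr 3; ring
  simp only [map_mul, Complex.conj_ofReal] at h1 ⊢
  rw [e1 i, e1 j]
  linear_combination -h1

/-- The operator wanted is `W t W⁻¹` with `W = powOp s` and `t = a * powOp κ`. It is defined on the
dense range of `W`. The hypothesis makes `W² t` selfadjoint, so Krein's lemma bounds it by `‖t‖ ≤
‖a‖`. -/
theorem exists_rel_selfAdjoint (hs : 0 ≤ s) (hκ : 0 ≤ κ)
    (h : ∀ i j : ℕ+, (((i : ℝ) ^ (-s) : ℝ) : ℂ) * entry a i j * (((j : ℝ) ^ (s - κ) : ℝ) : ℂ) =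
      (starRingEnd ℂ) ((((j : ℝ) ^ (-s) : ℝ) : ℂ) * entry a j i * (((i : ℝ) ^ (s - κ) : ℝ) : ℂ))) :
    ∃ b : EllOp, OpRel s κ a b ∧ IsSelfAdjoint b ∧ ‖b‖ ≤ ‖a‖ := by
  set W := powOp s
  set t : EllOp := a * powOp κ with ht
  have hkr := krein_bound W t (star_powOp hs) (isSelfAdjoint_weighted hs hκ h)
  have htn : ‖t‖ ≤ ‖a‖ := by
    refine (norm_mul_le _ _).trans ?_
    exact mul_le_of_le_one_right (norm_nonneg _) (norm_powOp_le κ)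
  let f : EllTwo →ₗ[ℂ] EllTwo := ((W * t : EllOp) : EllTwo →ₗ[ℂ] EllTwo)
  let e : EllTwo →ₗ[ℂ] EllTwo := (W : EllTwo →ₗ[ℂ] EllTwo)
  have hd : DenseRange e := denseRange_powOp hs
  have hfe : ∀ x, ‖f x‖ ≤ ‖t‖ * ‖e x‖ := hkr
  let b : EllOp := f.extendOfNorm e
  have hbe : ∀ x, b (W x) = W (t x) := LinearMap.extendOfNorm_eq hd ⟨_, hfe⟩
  have hrel : OpRel s κ a b := by
    intro i j
    have h1 : b * W = W * t := by ext1 x; exact hbe x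
    have h2 := congrArg (fun z => entry z i j) h1
    simp only [W, t] at h2
    rw [entry_mul_powOp hs, entry_powOp_mul hs, entry_mul_powOp hκ] at h2
    have h3 : (((j : ℝ) ^ (-s) : ℝ) : ℂ) * (((j : ℝ) ^ (s - κ) : ℝ) : ℂ) = (((j : ℝ) ^ (-κ) : ℝ) : ℂ) := by
      rw [cast_rpow_mul]; congr 3; ring
    rw [← h3] at h2
    apply mul_right_cancel₀ (cast_rpow_ne_zero j (-s))
    rw [h2]; ring
  refine ⟨b, hrel, ellOp_ext fun i j => ?_, ?_⟩
  · rw [entry_star, hrel, hrel, ← h]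
  · exact (ContinuousLinearMap.opNorm_le_bound _ (norm_nonneg _)
      (LinearMap.norm_extendOfNorm_apply_le hd _ hfe)).trans htn

/-- The operator of `exists_rel_selfAdjoint` is the only one with this matrix. Applied to
differences, the bound turns continuity in the weighted norm into continuity in the plain operator
norm. -/
theorem OpRel.norm_le_of_selfAdjoint (hs : 0 ≤ s) (hκ : 0 ≤ κ) (h : OpRel s κ a b)
    (hb : IsSelfAdjoint b) : ‖b‖ ≤ ‖a‖ := by
  obtain ⟨b', h', -, hn⟩ := exists_rel_selfAdjoint (a := a) hs hκ (fun i j => by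
    rw [← h, ← h, ← entry_star, hb.star_eq])
  rwa [h.unique_right h']

theorem exists_rel_skewAdjoint (hs : 0 ≤ s) (hκ : 0 ≤ κ)
    (h : ∀ i j : ℕ+, (((i : ℝ) ^ (-s) : ℝ) : ℂ) * entry a i j * (((j : ℝ) ^ (s - κ) : ℝ) : ℂ) =
      -(starRingEnd ℂ) ((((j : ℝ) ^ (-s) : ℝ) : ℂ) * entry a j i * (((i : ℝ) ^ (s - κ) : ℝ) : ℂ))) :
    ∃ b : EllOp, OpRel s κ a b ∧ star b = -b ∧ ‖b‖ ≤ ‖a‖ := by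
  obtain ⟨b, h1, h2, h3⟩ := exists_rel_selfAdjoint (a := Complex.I • a) hs hκ (fun i j => by
    have := congrArg (fun z => Complex.I * z) (h i j)
    simp only [entry_smul, map_mul, Complex.conj_I] at this ⊢
    linear_combination this)
  refine ⟨(-Complex.I) • b, fun i j => ?_, ?_, ?_⟩
  · have := h1 i j
    rw [entry_smul] at this
    rw [entry_smul, this]
    linear_combination (-(((i : ℝ) ^ (-s) : ℝ) : ℂ) * entry a i j * (((j : ℝ) ^ (s - κ) : ℝ) : ℂ)) * Complex.I_mul_I
  · rw [star_smul, h2.star_eq]; simp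
  · simpa [norm_smul] using h3

theorem OpRel.norm_le_of_skewAdjoint (hs : 0 ≤ s) (hκ : 0 ≤ κ) (h : OpRel s κ a b)
    (hb : star b = -b) : ‖b‖ ≤ ‖a‖ := by
  have h1 : IsSelfAdjoint (Complex.I • b) := by
    rw [IsSelfAdjoint, star_smul, hb]; simp
  simpa [norm_smul] using (h.smul Complex.I).norm_le_of_selfAdjoint hs hκ h1

end OpRel

/-! ### Sums over the lattice -/

theorem intNorm_nonneg {n : ℕ} (k : Fin n → ℤ) : 0 ≤ intNorm k :=
  Finset.sum_nonneg fun _ _ => abs_nonneg _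

theorem one_le_intNorm {n : ℕ} {k : Fin n → ℤ} (hk : k ≠ 0) : 1 ≤ intNorm k := by
  obtain ⟨m, hm⟩ := Function.ne_iff.1 hk
  refine le_trans ?_ (Finset.single_le_sum (f := fun m => |(k m : ℝ)|)
    (fun _ _ => abs_nonneg _) (Finset.mem_univ m))
  exact_mod_cast Int.one_le_abs hm

theorem sum_prod_le_pow {n : ℕ} (f : ℤ → ℝ) (hf : ∀ p, 0 ≤ f p) (A : ℝ)
    (hA : ∀ s : Finset ℤ, ∑ p ∈ s, f p ≤ A) (S : Finset (Fin n → ℤ)) :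
    ∑ k ∈ S, ∏ m, f (k m) ≤ A ^ n := by
  have hsub : S ⊆ Fintype.piFinset (fun m => S.image (fun k => k m)) := by
    intro k hk
    rw [Fintype.mem_piFinset]
    exact fun m => Finset.mem_image_of_mem _ hk
  calc ∑ k ∈ S, ∏ m, f (k m)
      ≤ ∑ k ∈ Fintype.piFinset (fun m => S.image (fun k => k m)), ∏ m, f (k m) :=
        Finset.sum_le_sum_of_subset_of_nonneg hsub
          (fun _ _ _ => Finset.prod_nonneg fun _ _ => hf _)
    _ = ∏ m, ∑ p ∈ S.image (fun k => k m), f p := (Finset.prod_univ_sum _ _).symm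
    _ ≤ ∏ _m : Fin n, A := Finset.prod_le_prod (fun _ _ => Finset.sum_nonneg fun _ _ => hf _)
        (fun m _ => hA _)
    _ = A ^ n := by simp

/-- Two geometric series of ratio `exp (-δ) ≤ 1 - δ / 2`, the latter because `δ ≤ 1`. -/
theorem sum_int_exp_le {δ : ℝ} (h0 : 0 < δ) (h1 : δ ≤ 1) (s : Finset ℤ) :
    ∑ p ∈ s, Real.exp (-δ * |(p : ℝ)|) ≤ 4 / δ := by
  set q := Real.exp (-δ) with hq
  have hq0 : 0 ≤ q := (Real.exp_pos _).le
  have hq1 : q ≤ 1 - δ / 2 := by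
    have h2 := Real.add_one_le_exp δ
    have h3 : q * Real.exp δ = 1 := by rw [hq, ← Real.exp_add]; simp
    have : q * (1 + δ) ≤ 1 := by nlinarith [Real.exp_pos (-δ)]
    by_contra! hcon
    nlinarith
  have hql : q < 1 := by linarith
  have hf : ∀ p : ℤ, Real.exp (-δ * |(p : ℝ)|) = q ^ p.natAbs := by
    intro p
    rw [hq, ← Real.exp_nat_mul]
    congr 1
    rw [Nat.cast_natAbs]
    push_cast
    ring
  have hg := summable_geometric_of_lt_one hq0 hql
  have hS : Summable (fun p : ℤ => q ^ p.natAbs) :=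
    Summable.of_nat_of_neg (by simpa using hg) (by simpa using hg)
  have hT : ∑' p : ℤ, q ^ p.natAbs ≤ 2 * (1 - q)⁻¹ := by
    have e := tsum_of_nat_of_neg_add_one (f := fun p : ℤ => q ^ p.natAbs)
      (by simpa using hg) (by
        have : ∀ m : ℕ, (-((m : ℤ) + 1)).natAbs = m + 1 := fun m => by omega
        simp only [this]
        exact (summable_nat_add_iff 1).2 hg)
    rw [e]
    have : ∀ m : ℕ, (-((m : ℤ) + 1)).natAbs = m + 1 := fun m => by omega
    simp only [this, Int.natAbs_natCast, pow_succ]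
    rw [tsum_mul_right, tsum_geometric_of_lt_one hq0 hql]
    have : 0 ≤ (1 - q)⁻¹ := inv_nonneg.2 (by linarith)
    nlinarith
  simp only [hf]
  refine (hS.sum_le_tsum s (fun _ _ => by positivity)).trans (hT.trans ?_)
  have h6 : (1 - q)⁻¹ ≤ (δ / 2)⁻¹ := inv_anti₀ (by positivity) (by linarith)
  calc 2 * (1 - q)⁻¹ ≤ 2 * (δ / 2)⁻¹ := by linarith
    _ = 4 / δ := by field_simp; norm_num

theorem sum_exp_intNorm_le {n : ℕ} {δ : ℝ} (h0 : 0 < δ) (h1 : δ ≤ 1) (S : Finset (Fin n → ℤ)) :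
    ∑ k ∈ S, Real.exp (-δ * intNorm k) ≤ (4 / δ) ^ n := by
  have h := sum_prod_le_pow (n := n) (fun p => Real.exp (-δ * |(p : ℝ)|))
    (fun _ => (Real.exp_pos _).le) (4 / δ) (sum_int_exp_le h0 h1) S
  refine le_trans (le_of_eq ?_) h
  refine Finset.sum_congr rfl fun k _ => ?_
  rw [← Real.exp_sum, intNorm, Finset.mul_sum]

theorem summable_exp_intNorm {n : ℕ} {δ : ℝ} (h0 : 0 < δ) :
    Summable (fun k : Fin n → ℤ => Real.exp (-δ * intNorm k)) := by
  have h : Summable (fun k : Fin n → ℤ => Real.exp (-(min δ 1) * intNorm k)) :=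
    summable_of_sum_le (fun _ => (Real.exp_pos _).le)
      (sum_exp_intNorm_le (lt_min h0 one_pos) (min_le_right _ _))
  refine Summable.of_nonneg_of_le (fun _ => (Real.exp_pos _).le) (fun k => ?_) h
  apply Real.exp_le_exp.2
  nlinarith [min_le_left δ 1, intNorm_nonneg k]

theorem rpow_le_const_mul_exp {a u : ℝ} (ha : 0 < a) (hu : 0 ≤ u) : u ^ a ≤ a ^ a * Real.exp u := by
  have h1 : u ≤ a * Real.exp (u / a) := by
    have := Real.add_one_le_exp (u / a)
    have h2 : u / a ≤ Real.exp (u / a) := by linarith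
    rwa [div_le_iff₀ ha, mul_comm] at h2
  calc u ^ a ≤ (a * Real.exp (u / a)) ^ a := Real.rpow_le_rpow hu h1 ha.le
    _ = a ^ a * Real.exp u := by
      rw [Real.mul_rpow ha.le (Real.exp_pos _).le, ← Real.exp_mul]
      congr 2
      field_simp

/-- Half of the exponential absorbs the power at the cost of `δ ^ (-a)`; the other half is summed
over the lattice at the cost of `δ ^ (-n)`. -/
theorem exists_sum_rpow_exp_le (n : ℕ) {a : ℝ} (ha : 0 < a) :
    ∃ C : ℝ, 0 < C ∧ ∀ δ : ℝ, 0 < δ → δ ≤ 1 → ∀ S : Finset (Fin n → ℤ),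
      ∑ k ∈ S, (1 + intNorm k) ^ a * Real.exp (-δ * intNorm k) ≤ C / δ ^ ((n : ℝ) + a) := by
  refine ⟨8 ^ n * (2 ^ a * a ^ a * Real.exp 1), by positivity, fun δ h0 h1 S => ?_⟩
  have hk : ∀ k : Fin n → ℤ, (1 + intNorm k) ^ a * Real.exp (-δ * intNorm k) ≤
      (2 ^ a * a ^ a * Real.exp 1) / δ ^ a * Real.exp (-(δ / 2) * intNorm k) := by
    intro k
    have hx := intNorm_nonneg k
    set x := intNorm k
    have h2 := rpow_le_const_mul_exp (u := δ * (1 + x) / 2) ha (by positivity)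
    have e1 : (1 + x) ^ a = 2 ^ a / δ ^ a * (δ * (1 + x) / 2) ^ a := by
      rw [← Real.div_rpow (by norm_num) h0.le, ← Real.mul_rpow (by positivity) (by positivity)]
      congr 1
      field_simp
    have e2 : Real.exp (δ * (1 + x) / 2) * Real.exp (-δ * x) =
        Real.exp (δ / 2) * Real.exp (-(δ / 2) * x) := by
      rw [← Real.exp_add, ← Real.exp_add]; congr 1; ring
    have e3 : Real.exp (δ / 2) ≤ Real.exp 1 := Real.exp_le_exp.2 (by linarith)
    calc (1 + x) ^ a * Real.exp (-δ * x)
        ≤ 2 ^ a / δ ^ a * (a ^ a * Real.exp (δ * (1 + x) / 2)) * Real.exp (-δ * x) := by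
          rw [e1]; gcongr
      _ = 2 ^ a / δ ^ a * a ^ a * (Real.exp (δ * (1 + x) / 2) * Real.exp (-δ * x)) := by ring
      _ = 2 ^ a / δ ^ a * a ^ a * (Real.exp (δ / 2) * Real.exp (-(δ / 2) * x)) := by rw [e2]
      _ ≤ 2 ^ a / δ ^ a * a ^ a * (Real.exp 1 * Real.exp (-(δ / 2) * x)) := by gcongr
      _ = _ := by ring
  calc _ ≤ ∑ k ∈ S, (2 ^ a * a ^ a * Real.exp 1) / δ ^ a * Real.exp (-(δ / 2) * intNorm k) :=
        Finset.sum_le_sum fun k _ => hk k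
    _ ≤ (2 ^ a * a ^ a * Real.exp 1) / δ ^ a * (4 / (δ / 2)) ^ n := by
        rw [← Finset.mul_sum]
        gcongr
        exact sum_exp_intNorm_le (by positivity) (by linarith) S
    _ = _ := by
        rw [Real.rpow_add h0, Real.rpow_natCast]
        have : (4 / (δ / 2)) ^ n = 8 ^ n / δ ^ n := by
          rw [← div_pow]; congr 1; field_simp; norm_num
        rw [this]
        field_simp

/-- Since `1 + |k| ≥ 1 + |k_m|` for every `m`, each term is at most a product over `m` of powers
with exponent `a / n > 1`, and the sum factorises. -/
theorem exists_sum_rpow_neg_le {n : ℕ} (hn : 1 ≤ n) {a : ℝ} (ha : (n : ℝ) < a) :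
    ∃ C : ℝ, 0 < C ∧ ∀ S : Finset (Fin n → ℤ), ∑ k ∈ S, (1 + intNorm k) ^ (-a) ≤ C := by
  have hn0 : (0 : ℝ) < n := by exact_mod_cast hn
  set c := a / n with hc
  have hc1 : 1 < c := by rw [hc, one_lt_div hn0]; exact ha
  have hs : Summable (fun p : ℤ => |(p : ℝ)| ^ (-c) + if p = 0 then (1 : ℝ) else 0) :=
    (Real.summable_abs_int_rpow hc1).add (summable_of_ne_finset_zero (s := {0}) (by simp +contextual))
  have hs2 : Summable (fun p : ℤ => (1 + |(p : ℝ)|) ^ (-c)) := by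
    refine Summable.of_nonneg_of_le (fun p => by positivity) (fun p => ?_) hs
    by_cases hp : p = 0
    · subst hp
      simp
      positivity
    · have : (0 : ℝ) < |(p : ℝ)| := by positivity
      simp only [hp, if_false, add_zero]
      exact Real.rpow_le_rpow_of_nonpos this (by linarith) (by linarith)
  set A := ∑' p : ℤ, (1 + |(p : ℝ)|) ^ (-c)
  have hA : ∀ s : Finset ℤ, ∑ p ∈ s, (1 + |(p : ℝ)|) ^ (-c) ≤ A :=
    fun s => hs2.sum_le_tsum s (fun _ _ => by positivity)
  have hA0 : 0 < A := lt_of_lt_of_le (by simp) (hA {0})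
  refine ⟨A ^ n, by positivity, fun S => ?_⟩
  refine le_trans (Finset.sum_le_sum fun k _ => ?_)
    (sum_prod_le_pow (n := n) _ (fun p => by positivity) A hA S)
  have hx := intNorm_nonneg k
  have e : (1 + intNorm k) ^ (-a) = ∏ _m : Fin n, (1 + intNorm k) ^ (-c) := by
    rw [Finset.prod_const, Finset.card_univ, Fintype.card_fin, ← Real.rpow_natCast,
      ← Real.rpow_mul (by positivity)]
    congr 1
    rw [hc]; field_simp
  rw [e]
  refine Finset.prod_le_prod (fun _ _ => by positivity) (fun m _ => ?_)
  refine Real.rpow_le_rpow_of_nonpos (by positivity) ?_ (by linarith)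
  have := Finset.single_le_sum (f := fun m => |(k m : ℝ)|)
    (fun _ _ => abs_nonneg _) (Finset.mem_univ m)
  simp only [intNorm]
  linarith

/-! ### Fourier series of analytic functions on a strip -/

section Fourier

variable {n : ℕ}

theorem isOpen_strip (n : ℕ) (r : ℝ) : IsOpen (strip n r) := by
  have : strip n r = ⋂ m : Fin n, {φ : Fin n → ℂ | |(φ m).im| < r} := by
    ext φ; simp [strip]
  rw [this]
  refine isOpen_iInter_of_finite fun m => ?_
  exact isOpen_lt (by fun_prop) continuous_const

theorem strip_mono {r r' : ℝ} (h : r ≤ r') : strip n r ⊆ strip n r' :=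
  fun _ hφ m => (hφ m).trans_le h

theorem realAngle_mem_strip {r : ℝ} (hr : 0 < r) (x : Fin n → ℝ) : realAngle x ∈ strip n r :=
  fun m => by simpa [realAngle] using hr

theorem add_realAngle_mem_strip {r : ℝ} {w : Fin n → ℂ} (hw : w ∈ strip n r) (x : Fin n → ℝ) :
    realAngle x + w ∈ strip n r := fun m => by simpa [realAngle] using hw m

variable {E : Type*}

/-- Functions that are `2π`-periodic in each variable on a strip. -/
def StripPeriodic (r : ℝ) (F : (Fin n → ℂ) → E) : Prop :=
  ∀ φ ∈ strip n r, ∀ m : Fin n, F (φ + Pi.single m ((2 * Real.pi : ℝ) : ℂ)) = F φ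

theorem StripPeriodic.int_single {r : ℝ} {F : (Fin n → ℂ) → E} (h : StripPeriodic r F)
    {φ : Fin n → ℂ} (hφ : φ ∈ strip n r) (m : Fin n) (p : ℤ) :
    F (φ + Pi.single m ((2 * Real.pi * p : ℝ) : ℂ)) = F φ := by
  have hmem : ∀ x : ℝ, φ + Pi.single m (x : ℂ) ∈ strip n r := by
    intro x m'
    by_cases hm : m' = m
    · subst hm; simpa using hφ m'
    · simpa [hm] using hφ m'
  induction p using Int.induction_on with
  | zero => simp
  | succ p ih =>
    rw [← ih, ← h _ (hmem (2 * Real.pi * (p : ℤ))) m]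
    congr 1
    rw [add_assoc, ← Pi.single_add]
    congr 2
    push_cast; ring
  | pred p ih =>
    rw [← ih, ← h _ (hmem _) m]
    congr 1
    rw [add_assoc, ← Pi.single_add]
    congr 2
    push_cast; ring

theorem StripPeriodic.int {r : ℝ} {F : (Fin n → ℂ) → E} (h : StripPeriodic r F)
    {φ : Fin n → ℂ} (hφ : φ ∈ strip n r) (k : Fin n → ℤ) :
    F (realAngle (fun m => 2 * Real.pi * (k m : ℝ)) + φ) = F φ := by
  have key : ∀ s : Finset (Fin n),
      F (φ + ∑ m ∈ s, Pi.single m ((2 * Real.pi * (k m : ℝ) : ℝ) : ℂ)) = F φ := by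
    intro s
    induction s using Finset.induction_on with
    | empty => simp
    | insert m s hm ih =>
      rw [Finset.sum_insert hm, add_comm (Pi.single m _), ← add_assoc,
        h.int_single _ m (k m), ih]
      intro m'
      have : (φ + ∑ m ∈ s, Pi.single m ((2 * Real.pi * (k m : ℝ) : ℝ) : ℂ)) m' =
          φ m' + ((if m' ∈ s then (2 * Real.pi * (k m' : ℝ)) else 0 : ℝ) : ℂ) := by
        simp only [Pi.add_apply, Finset.sum_apply, Finset.sum_pi_single]
        split_ifs <;> simp
      rw [this]
      simpa using hφ m'
  have := key Finset.univ
  rw [Finset.univ_sum_single, add_comm] at this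
  exact this

/-- A representative of a point of the torus, scaled to angles modulo `2π`. -/
def torusRep (q : UnitAddTorus (Fin n)) : Fin n → ℝ :=
  fun m => 2 * Real.pi * ((AddCircle.equivIco 1 0 (q m) : ℝ))

/-- The point of the torus with the given angles. -/
def toTorus (x : Fin n → ℝ) : UnitAddTorus (Fin n) :=
  fun m => ((x m / (2 * Real.pi) : ℝ) : UnitAddCircle)

theorem torusRep_toTorus (x : Fin n → ℝ) :
    ∃ k : Fin n → ℤ, x = torusRep (toTorus x) + fun m => 2 * Real.pi * (k m : ℝ) := by
  refine ⟨fun m => toIcoDiv (zero_lt_one' ℝ) 0 (x m / (2 * Real.pi)), ?_⟩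
  funext m
  have h := self_sub_toIcoDiv_zsmul (zero_lt_one' ℝ) 0 (x m / (2 * Real.pi))
  have h1 : ((AddCircle.equivIco 1 0 (toTorus x m) : ℝ)) =
      toIcoMod (zero_lt_one' ℝ) 0 (x m / (2 * Real.pi)) := by
    simp [toTorus, AddCircle.equivIco, QuotientAddGroup.equivIcoMod_coe]
  simp only [Pi.add_apply, torusRep, h1, ← h]
  field_simp
  simp

theorem toTorus_torusRep (q : UnitAddTorus (Fin n)) : toTorus (torusRep q) = q := by
  funext m
  have : torusRep q m / (2 * Real.pi) = (AddCircle.equivIco 1 0 (q m) : ℝ) := by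
    simp only [torusRep]; field_simp
  simp only [toTorus, this]
  exact AddCircle.coe_equivIco

theorem realAngle_add (x y : Fin n → ℝ) : realAngle (x + y) = realAngle x + realAngle y := by
  funext m; simp [realAngle]

/-- The representative of a point of the torus is not a continuous function of it, but it differs
from the given angle by multiples of `2π`, which a periodic function does not see. -/
theorem StripPeriodic.rep {r : ℝ} {F : (Fin n → ℂ) → E} (h : StripPeriodic r F)
    {w : Fin n → ℂ} (hw : w ∈ strip n r) (x : Fin n → ℝ) :
    F (realAngle (torusRep (toTorus x)) + w) = F (realAngle x + w) := by
  obtain ⟨k, hk⟩ := torusRep_toTorus x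
  conv_rhs => rw [hk, add_comm (torusRep _), realAngle_add, add_assoc]
  exact (h.int (add_realAngle_mem_strip hw _) k).symm

/-- Continuity is tested after composition with the open quotient map from `ℝ^n` to the torus. -/
theorem continuous_torus [TopologicalSpace E] {r : ℝ} {F : (Fin n → ℂ) → E} (h : StripPeriodic r F)
    (hF : ContinuousOn F (strip n r)) {w : Fin n → ℂ} (hw : w ∈ strip n r) :
    Continuous (fun q : UnitAddTorus (Fin n) => F (realAngle (torusRep q) + w)) := by
  have hq : IsOpenQuotientMap (Pi.map (fun (_ : Fin n) (x : ℝ) => (x : UnitAddCircle))) :=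
    IsOpenQuotientMap.piMap (fun _ => QuotientAddGroup.isOpenQuotientMap_mk)
  rw [hq.isQuotientMap.continuous_iff]
  have e : (fun q : UnitAddTorus (Fin n) => F (realAngle (torusRep q) + w)) ∘
      (Pi.map (fun (_ : Fin n) (x : ℝ) => (x : UnitAddCircle))) =
      fun x => F (realAngle (fun m => 2 * Real.pi * x m) + w) := by
    funext x
    rw [← h.rep hw]
    have : toTorus (fun m => 2 * Real.pi * x m) =
        Pi.map (fun (_ : Fin n) (x : ℝ) => (x : UnitAddCircle)) x := by
      funext m
      simp only [toTorus, Pi.map_apply]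
      congr 1
      field_simp
    rw [this]; rfl
  rw [e]
  refine hF.comp_continuous ?_ (fun x => add_realAngle_mem_strip hw _)
  unfold realAngle
  fun_prop

/-- The normalised Haar measure of the torus. -/
def torusMeasure (n : ℕ) : Measure (UnitAddTorus (Fin n)) :=
  Measure.pi (fun _ => AddCircle.haarAddCircle)

instance : IsProbabilityMeasure (torusMeasure n) := by
  unfold torusMeasure; infer_instance

instance : (torusMeasure n).IsAddRightInvariant := by
  unfold torusMeasure; infer_instance

end Fourier

/-! ### Shifts of the contour and the decay of Fourier coefficients. -/

section Fourier

open Filter Topology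

variable {n : ℕ}

theorem convex_strip (n : ℕ) (r : ℝ) : Convex ℝ (strip n r) := by
  intro x hx y hy a b ha hb hab m
  have h1 : (((a • x + b • y) m).im) = a * (x m).im + b * (y m).im := by simp
  rw [h1]
  have h2 := abs_lt.1 (hx m)
  have h3 := abs_lt.1 (hy m)
  rw [abs_lt]
  rcases ha.eq_or_lt with h0 | h0
  · subst h0
    have : b = 1 := by linarith
    subst this
    constructor <;> linarith
  · constructor <;> nlinarith

/-- A real sequence accumulating at `0`, for difference quotients and as the set of coincidence in
the identity theorem. -/
theorem tendsto_one_div_punctured :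
    Tendsto (fun N : ℕ => ((1 / ((N : ℝ) + 1) : ℝ) : ℂ)) atTop (𝓝[≠] 0) := by
  rw [tendsto_nhdsWithin_iff]
  constructor
  · exact (Complex.continuous_ofReal.tendsto 0).comp
      (tendsto_one_div_add_atTop_nhds_zero_nat (𝕜 := ℝ))
  · refine Eventually.of_forall fun N => ?_
    have : (1 / ((N : ℝ) + 1) : ℝ) ≠ 0 := by positivity
    exact Complex.ofReal_ne_zero.2 this

variable {E : Type*} [NormedAddCommGroup E]

theorem integrable_torus {r : ℝ} {F : (Fin n → ℂ) → E} (h : StripPeriodic r F)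
    (hF : ContinuousOn F (strip n r)) {w : Fin n → ℂ} (hw : w ∈ strip n r) :
    Integrable (fun q => F (realAngle (torusRep q) + w)) (torusMeasure n) :=
  (continuous_torus h hF hw).integrable_of_hasCompactSupport
    (HasCompactSupport.of_compactSpace _)

variable [NormedSpace ℂ E]

theorem integral_torus_add_real {r : ℝ} {F : (Fin n → ℂ) → E} (h : StripPeriodic r F)
    {w : Fin n → ℂ} (hw : w ∈ strip n r) (a : Fin n → ℝ) :
    ∫ q, F (realAngle (torusRep q) + (realAngle a + w)) ∂torusMeasure n =
      ∫ q, F (realAngle (torusRep q) + w) ∂torusMeasure n := by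
  rw [← integral_add_right_eq_self (fun q => F (realAngle (torusRep q) + w)) (toTorus a)]
  congr 1
  funext q
  have e : q + toTorus a = toTorus (torusRep q + a) := by
    conv_lhs => rw [← toTorus_torusRep q]
    funext m
    simp [toTorus, add_div]
  rw [e, h.rep hw, realAngle_add, add_assoc]

theorem differentiableOn_integral_torus {r C : ℝ} {F : (Fin n → ℂ) → E} (h : StripPeriodic r F)
    (hF : DifferentiableOn ℂ F (strip n r)) (hC : ∀ φ ∈ strip n r, ‖F φ‖ ≤ C) (y : Fin n → ℂ) :
    DifferentiableOn ℂ (fun ζ : ℂ => ∫ q, F (realAngle (torusRep q) + ζ • y) ∂torusMeasure n)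
      {ζ | ζ • y ∈ strip n r} := by
  have hU : IsOpen {ζ : ℂ | ζ • y ∈ strip n r} :=
    (isOpen_strip n r).preimage (by fun_prop : Continuous fun ζ : ℂ => ζ • y)
  intro ζ₀ hζ₀
  obtain ⟨R, hR0, hR⟩ := Metric.isOpen_iff.1 hU ζ₀ hζ₀
  have hdq : ∀ q : UnitAddTorus (Fin n),
      DifferentiableOn ℂ (fun ζ : ℂ => F (realAngle (torusRep q) + ζ • y)) {ζ | ζ • y ∈ strip n r} :=
    fun q => hF.comp (by fun_prop) (fun ζ hζ => add_realAngle_mem_strip hζ _)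
  have hda : ∀ (q : UnitAddTorus (Fin n)), ∀ ζ ∈ {ζ : ℂ | ζ • y ∈ strip n r},
      HasDerivAt (fun ζ : ℂ => F (realAngle (torusRep q) + ζ • y))
        (deriv (fun ζ : ℂ => F (realAngle (torusRep q) + ζ • y)) ζ) ζ :=
    fun q ζ hζ => ((hdq q).differentiableAt (hU.mem_nhds hζ)).hasDerivAt
  have hmeas : ∀ ζ ∈ {ζ : ℂ | ζ • y ∈ strip n r},
      AEStronglyMeasurable (fun q => F (realAngle (torusRep q) + ζ • y)) (torusMeasure n) :=
    fun ζ hζ => (integrable_torus h hF.continuousOn hζ).aestronglyMeasurable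
  have hR2 : 0 < R / 2 := by positivity
  refine (hasDerivAt_integral_of_dominated_loc_of_deriv_le
    (F := fun ζ q => F (realAngle (torusRep q) + ζ • y))
    (F' := fun ζ q => deriv (fun ζ : ℂ => F (realAngle (torusRep q) + ζ • y)) ζ)
    (bound := fun _ => C / (R / 4)) (s := Metric.ball ζ₀ (R / 2))
    (Metric.ball_mem_nhds _ hR2) ?_ (integrable_torus h hF.continuousOn hζ₀) ?_ ?_
    (integrable_const _) ?_).2.differentiableAt.differentiableWithinAt
  · filter_upwards [hU.mem_nhds hζ₀] with ζ hζ using hmeas ζ hζ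
  -- The derivative is measurable in `q` as a pointwise limit of difference quotients; the index is
  -- shifted by `N₀` so that the increments stay in the domain.
  · have hseq := tendsto_one_div_punctured
    have hev : ∀ᶠ N : ℕ in atTop, ζ₀ + ((1 / ((N : ℝ) + 1) : ℝ) : ℂ) ∈ {ζ : ℂ | ζ • y ∈ strip n r} := by
      have h1 : Tendsto (fun N : ℕ => ζ₀ + ((1 / ((N : ℝ) + 1) : ℝ) : ℂ)) atTop (𝓝 ζ₀) := by
        simpa using (hseq.mono_right nhdsWithin_le_nhds).const_add ζ₀
      exact h1 (hU.mem_nhds hζ₀)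
    obtain ⟨N₀, hN₀⟩ := eventually_atTop.1 hev
    refine aestronglyMeasurable_of_tendsto_ae (u := atTop)
      (f := fun (N : ℕ) q => ((1 / (((N + N₀ : ℕ) : ℝ) + 1) : ℝ) : ℂ)⁻¹ •
        (F (realAngle (torusRep q) + (ζ₀ + ((1 / (((N + N₀ : ℕ) : ℝ) + 1) : ℝ) : ℂ)) • y) -
          F (realAngle (torusRep q) + ζ₀ • y))) (fun N => ?_) (ae_of_all _ fun q => ?_)
    · exact ((hmeas _ (hN₀ _ (by omega))).sub (hmeas _ hζ₀)).const_smul _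
    · have := (hasDerivAt_iff_tendsto_slope_zero.1 (hda q ζ₀ hζ₀)).comp
        (hseq.comp (tendsto_add_atTop_nat N₀))
      exact this
  · refine ae_of_all _ fun q ζ hζ => ?_
    -- Circles of radius `R / 4` around points of the ball of radius `R / 2` stay in the domain, so
    -- Cauchy's estimate provides the dominating constant.
    have hsub : Metric.closedBall ζ (R / 4) ⊆ {ζ : ℂ | ζ • y ∈ strip n r} := by
      refine Set.Subset.trans ?_ hR
      intro z hz
      rw [Metric.mem_closedBall] at hz
      rw [Metric.mem_ball] at hζ ⊢
      linarith [dist_triangle z ζ ζ₀]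
    refine Complex.norm_deriv_le_of_forall_mem_sphere_norm_le (by positivity) ?_ ?_
    · exact DifferentiableOn.diffContOnCl_ball (U := {ζ : ℂ | ζ • y ∈ strip n r}) (hdq q) hsub
    · intro z hz
      exact hC _ (add_realAngle_mem_strip (hsub (Metric.sphere_subset_closedBall hz)) _)
  · refine ae_of_all _ fun q ζ hζ => hda q ζ (hR ?_)
    exact Metric.ball_subset_ball (by linarith) hζ

/-- The average over the torus does not change when the contour is shifted. -/
theorem integral_torus_shift [CompleteSpace E] {r C : ℝ} (hr : 0 < r) {F : (Fin n → ℂ) → E} (h : StripPeriodic r F)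
    (hF : DifferentiableOn ℂ F (strip n r)) (hC : ∀ φ ∈ strip n r, ‖F φ‖ ≤ C) (y : Fin n → ℝ)
    (hy : Complex.I • realAngle y ∈ strip n r) :
    ∫ q, F (realAngle (torusRep q) + Complex.I • realAngle y) ∂torusMeasure n =
      ∫ q, F (realAngle (torusRep q)) ∂torusMeasure n := by
  set U : Set ℂ := {ζ | ζ • realAngle y ∈ strip n r} with hUdef
  have hU : IsOpen U :=
    (isOpen_strip n r).preimage (by fun_prop : Continuous fun ζ : ℂ => ζ • realAngle y)
  have hUc : IsPreconnected U := by
    refine Convex.isPreconnected (fun a ha b hb s t hs ht hst => ?_)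
    have := convex_strip n r ha hb hs ht hst
    change (s • a + t • b) • realAngle y ∈ strip n r
    convert this using 1
    rw [add_smul, smul_assoc, smul_assoc]
  have h0 : (0 : ℂ) ∈ U := by
    intro m; simpa using hr
  set g : ℂ → E := fun ζ => ∫ q, F (realAngle (torusRep q) + ζ • realAngle y) ∂torusMeasure n
  have hg : AnalyticOnNhd ℂ g U := (differentiableOn_integral_torus h hF hC (realAngle y)).analyticOnNhd hU
  -- For real `ζ` the shift is a translation of the torus, so `g` is constant on the real axis; the
  -- identity theorem carries this to `ζ = i`.
  have hreal : ∀ t : ℝ, g (t : ℂ) = g 0 := by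
    intro t
    have := integral_torus_add_real h (w := 0) (fun m => by simpa using hr) (t • y)
    simp only [g, zero_smul]
    rw [← this]
    congr 1
    funext q
    congr 2
    funext m
    simp [realAngle]
  have heq := hg.eqOn_of_preconnected_of_frequently_eq (g := fun _ => g 0)
    analyticOnNhd_const hUc h0 (by
      exact tendsto_one_div_punctured.frequently (Frequently.of_forall fun N => hreal _))
  have := heq (x := Complex.I) hy
  simpa [g] using this

/-- The exponential `exp (i k·φ)`. -/
def expk (k : Fin n → ℤ) (φ : Fin n → ℂ) : ℂ := Complex.exp (Complex.I * ∑ m, (k m : ℂ) * φ m)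

theorem norm_expk (k : Fin n → ℤ) (φ : Fin n → ℂ) :
    ‖expk k φ‖ = Real.exp (-∑ m, (k m : ℝ) * (φ m).im) := by
  rw [expk, Complex.norm_exp]
  congr 1
  simp

theorem norm_expk_le {r : ℝ} (k : Fin n → ℤ) {φ : Fin n → ℂ} (hφ : φ ∈ strip n r) :
    ‖expk k φ‖ ≤ Real.exp (r * intNorm k) := by
  rw [norm_expk]
  apply Real.exp_le_exp.2
  rw [intNorm, Finset.mul_sum, ← Finset.sum_neg_distrib]
  refine Finset.sum_le_sum fun m _ => ?_
  have h1 : |(k m : ℝ) * (φ m).im| ≤ r * |(k m : ℝ)| := by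
    rw [abs_mul, mul_comm]
    exact mul_le_mul_of_nonneg_right (hφ m).le (abs_nonneg _)
  linarith [neg_abs_le ((k m : ℝ) * (φ m).im)]

theorem expk_add (k : Fin n → ℤ) (φ ψ : Fin n → ℂ) : expk k (φ + ψ) = expk k φ * expk k ψ := by
  rw [expk, expk, expk, ← Complex.exp_add, ← mul_add, ← Finset.sum_add_distrib]
  simp [mul_add]

theorem expk_neg_mul (k : Fin n → ℤ) (φ : Fin n → ℂ) : expk (-k) φ * expk k φ = 1 := by
  rw [expk, expk, ← Complex.exp_add]
  simp

theorem differentiable_expk (k : Fin n → ℤ) : Differentiable ℂ (expk k) := by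
  unfold expk; fun_prop

theorem mFourier_eq_expk (k : Fin n → ℤ) (x : Fin n → ℝ) :
    UnitAddTorus.mFourier k (toTorus x) = expk k (realAngle x) := by
  simp only [UnitAddTorus.mFourier, ContinuousMap.coe_mk, toTorus, fourier_coe_apply, expk,
    ← Complex.exp_sum, realAngle]
  congr 1
  rw [Finset.mul_sum]
  refine Finset.sum_congr rfl fun m _ => ?_
  have : (Real.pi : ℂ) ≠ 0 := by exact_mod_cast Real.pi_ne_zero
  push_cast
  field_simp

theorem stripPeriodic_expk (k : Fin n → ℤ) (r : ℝ) : StripPeriodic r (expk k) := by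
  intro φ _ m
  rw [expk_add]
  have : expk k (Pi.single m ((2 * Real.pi : ℝ) : ℂ)) = 1 := by
    rw [expk]
    have e : (Complex.I * ∑ m', (k m' : ℂ) * (Pi.single m ((2 * Real.pi : ℝ) : ℂ) : Fin n → ℂ) m') =
        (k m) * (2 * Real.pi * Complex.I) := by
      rw [Finset.sum_eq_single m (fun b _ hb => by simp [hb]) (by simp)]
      simp; ring
    rw [e]
    exact Complex.exp_int_mul_two_pi_mul_I (k m)
  rw [this, mul_one]

/-- The Fourier coefficients of a periodic function on a strip. -/
def fcoef (F : (Fin n → ℂ) → E) (k : Fin n → ℤ) : E :=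
  ∫ q, expk (-k) (realAngle (torusRep q)) • F (realAngle (torusRep q)) ∂torusMeasure n

theorem fcoef_shift [CompleteSpace E] {r C : ℝ} (hr : 0 < r) {F : (Fin n → ℂ) → E} (h : StripPeriodic r F)
    (hF : DifferentiableOn ℂ F (strip n r)) (hC : ∀ φ ∈ strip n r, ‖F φ‖ ≤ C) (y : Fin n → ℝ)
    (hy : Complex.I • realAngle y ∈ strip n r) (k : Fin n → ℤ) :
    ∫ q, expk (-k) (realAngle (torusRep q)) • F (realAngle (torusRep q) + Complex.I • realAngle y)
      ∂torusMeasure n = expk k (Complex.I • realAngle y) • fcoef F k := by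
  have h1 := integral_torus_shift (C := Real.exp (r * intNorm (-k)) * C) hr
    (F := fun φ => expk (-k) φ • F φ) (fun φ hφ m => by
      simp only [stripPeriodic_expk (-k) r φ hφ m, h φ hφ m])
    ((differentiable_expk _).differentiableOn.smul hF)
    (fun φ hφ => by
      rw [norm_smul]
      exact mul_le_mul (norm_expk_le _ hφ) (hC φ hφ) (norm_nonneg _) (Real.exp_pos _).le) y hy
  rw [fcoef, ← h1, ← integral_smul]
  congr 1
  funext q
  rw [expk_add, smul_smul]
  congr 1
  have := expk_neg_mul k (Complex.I • realAngle y)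
  linear_combination -(expk (-k) (realAngle (torusRep q))) * this

theorem norm_fcoef_le [CompleteSpace E] {r C : ℝ} (hr : 0 < r) {F : (Fin n → ℂ) → E} (h : StripPeriodic r F)
    (hF : DifferentiableOn ℂ F (strip n r)) (hC : ∀ φ ∈ strip n r, ‖F φ‖ ≤ C) (k : Fin n → ℤ) :
    ‖fcoef F k‖ ≤ C * Real.exp (-r * intNorm k) := by
  have key : ∀ r' : ℝ, 0 < r' → r' < r → ‖fcoef F k‖ ≤ C * Real.exp (-r' * intNorm k) := by
    intro r' hr' hrr
    -- The shift against the signs of `k` produces the factor `exp (r' |k|)`. Taking `r' < r` keeps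
    -- the contour in the open strip; at the end `r' → r`.
    set y : Fin n → ℝ := fun m => -r' * (SignType.sign (k m : ℝ) : ℝ) with hy
    have habs : ∀ m, |y m| ≤ r' := by
      intro m
      rw [hy]
      simp only [abs_mul, abs_neg, abs_of_pos hr']
      have : |((SignType.sign (k m : ℝ) : SignType) : ℝ)| ≤ 1 := by
        rcases lt_trichotomy (k m : ℝ) 0 with h | h | h
        · simp [sign_neg h]
        · simp [h]
        · simp [sign_pos h]
      nlinarith
    have hymem : Complex.I • realAngle y ∈ strip n r := by
      intro m
      have : ((Complex.I • realAngle y) m).im = y m := by simp [realAngle]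
      rw [this]; exact (habs m).trans_lt hrr
    have h1 := fcoef_shift hr h hF hC y hymem k
    have h2 : ‖expk k (Complex.I • realAngle y)‖ = Real.exp (r' * intNorm k) := by
      rw [norm_expk]
      congr 1
      rw [intNorm, Finset.mul_sum, ← Finset.sum_neg_distrib]
      refine Finset.sum_congr rfl fun m _ => ?_
      have : ((Complex.I • realAngle y) m).im = y m := by simp [realAngle]
      rw [this, hy]
      have := self_mul_sign (k m : ℝ)
      linear_combination r' * this
    have h3 : ‖∫ q, expk (-k) (realAngle (torusRep q)) •
        F (realAngle (torusRep q) + Complex.I • realAngle y) ∂torusMeasure n‖ ≤ C := by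
      have := norm_integral_le_of_norm_le_const (μ := torusMeasure n) (C := C)
        (f := fun q => expk (-k) (realAngle (torusRep q)) •
          F (realAngle (torusRep q) + Complex.I • realAngle y)) (ae_of_all _ fun q => by
            rw [norm_smul, norm_expk]
            simp only [realAngle, Complex.ofReal_im, mul_zero, Finset.sum_const_zero, neg_zero,
              Real.exp_zero, one_mul]
            exact hC _ (add_realAngle_mem_strip hymem _))
      simpa using this
    rw [h1, norm_smul, h2] at h3
    have h4 : Real.exp (-r' * intNorm k) * Real.exp (r' * intNorm k) = 1 := by
      rw [← Real.exp_add]; simp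
    have h5 := mul_le_mul_of_nonneg_left h3 (Real.exp_pos (-r' * intNorm k)).le
    rw [← mul_assoc, h4, one_mul, mul_comm] at h5
    exact h5
  have hcont : Tendsto (fun r' : ℝ => C * Real.exp (-r' * intNorm k)) (𝓝[<] r)
      (𝓝 (C * Real.exp (-r * intNorm k))) :=
    (Continuous.tendsto (by fun_prop) r).mono_left nhdsWithin_le_nhds
  refine ge_of_tendsto hcont ?_
  filter_upwards [Ioo_mem_nhdsLT hr] with r' hr' using key r' hr'.1 hr'.2

theorem fcoef_sub {r : ℝ} (hr : 0 < r) {F G : (Fin n → ℂ) → E} (hF : StripPeriodic r F)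
    (hG : StripPeriodic r G) (hF' : ContinuousOn F (strip n r)) (hG' : ContinuousOn G (strip n r))
    (k : Fin n → ℤ) : fcoef (fun φ => F φ - G φ) k = fcoef F k - fcoef G k := by
  have h0 : (0 : Fin n → ℂ) ∈ strip n r := fun m => by simpa using hr
  have key : ∀ {H : (Fin n → ℂ) → E}, StripPeriodic r H → ContinuousOn H (strip n r) →
      Integrable (fun q => expk (-k) (realAngle (torusRep q)) • H (realAngle (torusRep q)))
        (torusMeasure n) := by
    intro H h1 h2
    have := integrable_torus (r := r) (F := fun φ => expk (-k) φ • H φ) (fun φ hφ m => by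
      simp only [stripPeriodic_expk (-k) r φ hφ m, h1 φ hφ m])
      ((differentiable_expk _).continuous.continuousOn.smul h2) h0
    simpa using this
  rw [fcoef, fcoef, fcoef, ← integral_sub (key hF hF') (key hG hG')]
  simp only [smul_sub]

theorem fcoef_clm [CompleteSpace E] {E' : Type*} [NormedAddCommGroup E'] [NormedSpace ℂ E'] [CompleteSpace E']
    {r : ℝ} (hr : 0 < r) {F : (Fin n → ℂ) → E} (hF : StripPeriodic r F)
    (hF' : ContinuousOn F (strip n r)) (L : E →L[ℂ] E') (k : Fin n → ℤ) :
    L (fcoef F k) = fcoef (fun φ => L (F φ)) k := by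
  have h0 : (0 : Fin n → ℂ) ∈ strip n r := fun m => by simpa using hr
  have := integrable_torus (r := r) (F := fun φ => expk (-k) φ • F φ) (fun φ hφ m => by
      simp only [stripPeriodic_expk (-k) r φ hφ m, hF φ hφ m])
      ((differentiable_expk _).continuous.continuousOn.smul hF') h0
  rw [fcoef, fcoef, ← L.integral_comp_comm (by simpa using this)]
  simp

/-- This is the Fourier series of the restriction of `F` to the contour through `φ`, whose
coefficients are summable because the imaginary part of `φ` has sup norm below `r`. The scalar case
is enough, since it is applied to matrix elements. -/
theorem hasSum_fcoef_scalar {r C : ℝ} (hr : 0 < r) {F : (Fin n → ℂ) → ℂ} (h : StripPeriodic r F)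
    (hF : DifferentiableOn ℂ F (strip n r)) (hC : ∀ φ ∈ strip n r, ‖F φ‖ ≤ C) {φ : Fin n → ℂ}
    (hφ : φ ∈ strip n r) : HasSum (fun k => expk k φ * fcoef F k) (F φ) := by
  set x : Fin n → ℝ := fun m => (φ m).re with hx
  set y : Fin n → ℝ := fun m => (φ m).im with hy
  have hdec : φ = realAngle x + Complex.I • realAngle y := by
    funext m
    simp only [realAngle, hx, hy, Pi.add_apply, Pi.smul_apply, smul_eq_mul]
    rw [mul_comm]
    exact (Complex.re_add_im _).symm
  have hymem : Complex.I • realAngle y ∈ strip n r := by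
    intro m
    have : ((Complex.I • realAngle y) m).im = y m := by simp [realAngle]
    rw [this]; exact hφ m
  let f : C(UnitAddTorus (Fin n), ℂ) :=
    ⟨fun q => F (realAngle (torusRep q) + Complex.I • realAngle y),
      continuous_torus h hF.continuousOn hymem⟩
  have hcoef : ∀ k, UnitAddTorus.mFourierCoeff f k =
      expk k (Complex.I • realAngle y) * fcoef F k := by
    intro k
    have e := fcoef_shift hr h hF hC y hymem k
    rw [smul_eq_mul] at e
    rw [← e]
    change ∫ q, UnitAddTorus.mFourier (-k) q • f q ∂torusMeasure n = _
    congr 1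
    funext q
    have : UnitAddTorus.mFourier (-k) q = expk (-k) (realAngle (torusRep q)) := by
      rw [← mFourier_eq_expk, toTorus_torusRep]
    rw [this]; rfl
  have hyn : ‖y‖ < r := (pi_norm_lt_iff hr).2 fun m => hφ m
  have hsum : Summable (UnitAddTorus.mFourierCoeff f) := by
    refine Summable.of_norm_bounded
      (g := fun k => C * Real.exp (-(r - ‖y‖) * intNorm k)) ((summable_exp_intNorm (by linarith)).mul_left C) ?_
    intro k
    rw [hcoef, norm_mul]
    have h1 := norm_fcoef_le hr h hF hC k
    have h2 : ‖expk k (Complex.I • realAngle y)‖ ≤ Real.exp (‖y‖ * intNorm k) := by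
      rw [norm_expk]
      apply Real.exp_le_exp.2
      rw [intNorm, Finset.mul_sum, ← Finset.sum_neg_distrib]
      refine Finset.sum_le_sum fun m _ => ?_
      have e : ((Complex.I • realAngle y) m).im = y m := by simp [realAngle]
      rw [e]
      have h1 : |(k m : ℝ) * y m| ≤ ‖y‖ * |(k m : ℝ)| := by
        rw [abs_mul, mul_comm]
        exact mul_le_mul_of_nonneg_right (norm_le_pi_norm y m) (abs_nonneg _)
      linarith [neg_abs_le ((k m : ℝ) * y m)]
    calc _ ≤ Real.exp (‖y‖ * intNorm k) * (C * Real.exp (-r * intNorm k)) := by gcongr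
      _ = C * (Real.exp (‖y‖ * intNorm k) * Real.exp (-r * intNorm k)) := by ring
      _ = _ := by rw [← Real.exp_add]; congr 2; ring
  have hs := UnitAddTorus.hasSum_mFourier_series_apply_of_summable hsum (toTorus x)
  have hfx : f (toTorus x) = F φ := by
    change F (realAngle (torusRep (toTorus x)) + Complex.I • realAngle y) = F φ
    rw [h.rep hymem, ← hdec]
  rw [hfx] at hs
  convert hs using 2 with k
  rw [hcoef, mFourier_eq_expk, smul_eq_mul]
  conv_lhs => rw [hdec, expk_add]
  ring

end Fourier

/-! ### Measure estimates -/

theorem abs_sign_le_one (x : ℝ) : |((SignType.sign x : SignType) : ℝ)| ≤ 1 := by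
  rcases lt_trichotomy x 0 with h | h | h
  · simp [sign_neg h]
  · simp [h]
  · simp [sign_pos h]

/-- The translates of `A` by `0, h v, …, N h v`, with `N h ≤ 1 ≤ (N + 1) h`, are disjoint and lie in
a cube of side `3`. Comparing volumes takes the place of Fubini's theorem in the direction `v`. -/
theorem volume_le_of_no_long_translate {n : ℕ} {A : Set (Fin n → ℝ)} (hA : MeasurableSet A)
    (hAs : A ⊆ frequencySet n) {h : ℝ} (hh : 0 < h) {v : Fin n → ℝ} (hv : ∀ m, |v m| ≤ 1)
    (hno : ∀ x ∈ A, ∀ t : ℝ, h ≤ t → x + t • v ∉ A) :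
    volume A ≤ ENNReal.ofReal (3 ^ n * h) := by
  set N := ⌊1 / h⌋₊ with hN
  have hN1 : (N : ℝ) * h ≤ 1 := by
    have := Nat.floor_le (a := 1 / h) (by positivity)
    rw [← hN, le_div_iff₀ hh] at this
    exact this
  have hN2 : 1 ≤ ((N : ℝ) + 1) * h := by
    have := (Nat.lt_floor_add_one (1 / h)).le
    rwa [← hN, div_le_iff₀ hh] at this
  let T : ℕ → Set (Fin n → ℝ) := fun j => (fun x => x + (-((j : ℝ) * h)) • v) ⁻¹' A
  have hTm : ∀ j, MeasurableSet (T j) := fun j => hA.preimage (by fun_prop)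
  have hTv : ∀ j, volume (T j) = volume A := fun j => measure_preimage_add_right _ _ _
  have hlt : ∀ i j : ℕ, i < j → Disjoint (T i) (T j) := by
    intro i j hij
    rw [Set.disjoint_left]
    intro x hi hj
    have hij' : (1 : ℝ) ≤ (j : ℝ) - i := by
      have : (i : ℝ) + 1 ≤ j := by exact_mod_cast hij
      linarith
    refine hno _ hj (((j : ℝ) - i) * h) (by nlinarith) ?_
    have e : x + (-((j : ℝ) * h)) • v + (((j : ℝ) - i) * h) • v = x + (-((i : ℝ) * h)) • v := by
      rw [add_assoc, ← add_smul]; congr 2; ring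
    rw [e]
    exact hi
  have hdisj : (Finset.range (N + 1) : Set ℕ).PairwiseDisjoint T := by
    intro i _ j _ hij
    rcases lt_or_gt_of_ne hij with h1 | h1
    · exact hlt i j h1
    · exact (hlt j i h1).symm
  have hsub : (⋃ j ∈ Finset.range (N + 1), T j) ⊆ Set.Icc (fun _ => (0 : ℝ)) (fun _ => 3) := by
    intro x hx
    simp only [Set.mem_iUnion, Finset.mem_range] at hx
    obtain ⟨j, hj, hx⟩ := hx
    have hx2 := hAs hx
    have hjN : (j : ℝ) * h ≤ 1 := by
      have : (j : ℝ) ≤ N := by exact_mod_cast Nat.lt_succ_iff.1 hj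
      nlinarith
    have hj0 : 0 ≤ (j : ℝ) * h := by positivity
    have hb : ∀ m, |(j : ℝ) * h * v m| ≤ 1 := by
      intro m
      rw [abs_mul, abs_of_nonneg hj0]
      nlinarith [hv m, abs_nonneg (v m)]
    constructor
    · intro m
      have h1 := hx2.1 m
      have h2 := abs_le.1 (hb m)
      simp only [Pi.add_apply, Pi.smul_apply, smul_eq_mul] at h1
      simp only
      linarith
    · intro m
      have h1 := hx2.2 m
      have h2 := abs_le.1 (hb m)
      simp only [Pi.add_apply, Pi.smul_apply, smul_eq_mul] at h1
      simp only
      linarith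
  have hvol := measure_mono (μ := volume) hsub
  rw [measure_biUnion_finset hdisj (fun j _ => hTm j)] at hvol
  simp only [hTv, Finset.sum_const, Finset.card_range, nsmul_eq_mul] at hvol
  rw [Real.volume_Icc_pi] at hvol
  simp only [sub_zero, Finset.prod_const, Finset.card_univ, Fintype.card_fin] at hvol
  rw [← ENNReal.ofReal_pow (by norm_num)] at hvol
  have hfin : volume A ≠ ⊤ := by
    intro htop
    rw [htop, ENNReal.mul_top (by positivity)] at hvol
    exact absurd hvol (by simp)
  rw [← ENNReal.ofReal_toReal hfin, ← ENNReal.ofReal_natCast, ← ENNReal.ofReal_mul (by positivity),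
    ENNReal.ofReal_le_ofReal_iff (by positivity)] at hvol
  rw [← ENNReal.ofReal_toReal hfin]
  apply ENNReal.ofReal_le_ofReal
  push_cast at hvol
  have h0 : 0 ≤ (volume A).toReal := ENNReal.toReal_nonneg
  nlinarith

theorem one_le_growthExp {l : ℕ} (hl : 1 ≤ l) : 1 ≤ growthExp l := by
  have : (1 : ℝ) ≤ l := by exact_mod_cast hl
  rw [growthExp, le_div_iff₀ (by positivity)]
  linarith

theorem sub_le_rpow_sub {d x y : ℝ} (hd : 1 ≤ d) (hy : 1 ≤ y) (hxy : y ≤ x) :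
    x - y ≤ x ^ d - y ^ d := by
  have hy0 : 0 < y := by linarith
  have hx0 : 0 < x := by linarith
  have e : ∀ z : ℝ, 0 < z → z ^ d = z * z ^ (d - 1) := by
    intro z hz
    rw [mul_comm, ← Real.rpow_add_one hz.ne']; congr 1; ring
  rw [e x hx0, e y hy0]
  have h1 : y ^ (d - 1) ≤ x ^ (d - 1) := Real.rpow_le_rpow hy0.le hxy (by linarith)
  have h2 : 1 ≤ y ^ (d - 1) := Real.one_le_rpow hy (by linarith)
  nlinarith

/-- This is where `d ≥ 1` enters: it makes the small divisors grow at least linearly away from the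
diagonal. -/
theorem abs_sub_le_powGap {d : ℝ} (hd : 1 ≤ d) (i j : ℕ+) : |(i : ℝ) - (j : ℝ)| ≤ powGap d i j := by
  have hi : (1 : ℝ) ≤ (i : ℝ) := by exact_mod_cast i.pos
  have hj : (1 : ℝ) ≤ (j : ℝ) := by exact_mod_cast j.pos
  unfold powGap
  rcases le_total (j : ℝ) (i : ℝ) with h | h
  · have := sub_le_rpow_sub hd hj h
    rw [abs_of_nonneg (by linarith), abs_of_nonneg (by linarith)]
    exact this
  · have := sub_le_rpow_sub hd hi h
    rw [abs_of_nonpos (by linarith), abs_of_nonpos (by linarith)]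
    linarith

theorem one_le_abs_sub {i j : ℕ+} (h : i ≠ j) : 1 ≤ |(i : ℝ) - (j : ℝ)| := by
  have h1 : ((i : ℕ) : ℤ) - ((j : ℕ) : ℤ) ≠ 0 := by
    intro h0
    apply h
    exact PNat.eq (by omega)
  have := Int.one_le_abs h1
  exact_mod_cast this

theorem one_le_powGap {d : ℝ} (hd : 1 ≤ d) {i j : ℕ+} (h : i ≠ j) : 1 ≤ powGap d i j :=
  (one_le_abs_sub h).trans (abs_sub_le_powGap hd i j)

theorem powGap_nonneg (d : ℝ) (i j : ℕ+) : 0 ≤ powGap d i j := abs_nonneg _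

theorem bracket_eq_powGap {d : ℝ} (hd : 1 ≤ d) {i j : ℕ+} (h : i ≠ j) :
    bracket ((i : ℝ) ^ d - (j : ℝ) ^ d) = powGap d i j :=
  max_eq_right (one_le_powGap hd h)

theorem one_le_bracket (x : ℝ) : 1 ≤ bracket x := le_max_left _ _

theorem max_abs_sub_le_bracket {d : ℝ} (hd : 1 ≤ d) (i j : ℕ+) :
    max 1 |(i : ℝ) - (j : ℝ)| ≤ bracket ((i : ℝ) ^ d - (j : ℝ) ^ d) :=
  max_le_max le_rfl (abs_sub_le_powGap hd i j)

theorem abs_sum_mul_le {n : ℕ} (x : Fin n → ℝ) (k : Fin n → ℤ) {c : ℝ} (hx : ∀ m, |x m| ≤ c) :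
    |∑ m, x m * (k m : ℝ)| ≤ c * intNorm k := by
  rw [intNorm, Finset.mul_sum]
  refine (Finset.abs_sum_le_sum_abs _ _).trans (Finset.sum_le_sum fun m _ => ?_)
  rw [abs_mul]
  exact mul_le_mul_of_nonneg_right (hx m) (abs_nonneg _)

theorem abs_le_two_of_mem_frequencySet {n : ℕ} {ω : Fin n → ℝ} (h : ω ∈ frequencySet n)
    (m : Fin n) : |ω m| ≤ 2 := by
  have h1 := h.1 m
  have h2 := h.2 m
  rw [abs_le]; constructor <;> linarith

/-! ### The resonant set of a single Melnikov condition. -/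

section Resonance

variable {n : ℕ} {d τ : ℝ} {S : Set (Fin n → ℝ)} {lam : ℕ+ → (Fin n → ℝ) → ℝ}

/-- The frequencies at which the `(i, j, k)` Melnikov condition fails. -/
def resonantSet (d τ : ℝ) (S : Set (Fin n → ℝ)) (lam : ℕ+ → (Fin n → ℝ) → ℝ) (γ : ℝ)
    (i j : ℕ+) (k : Fin n → ℤ) : Set (Fin n → ℝ) :=
  {ω ∈ S | |lam i ω - lam j ω + ∑ m, ω m * (k m : ℝ)| <
    γ / (1 + intNorm k ^ τ) * bracket ((i : ℝ) ^ d - (j : ℝ) ^ d)}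

theorem LipGapBound.continuousOn {K : ℝ} (h : LipGapBound d S lam K) (i j : ℕ+) :
    ContinuousOn (fun ω => lam i ω - lam j ω) S := by
  have hL : LipschitzOnWith (Real.toNNReal (K * powGap d i j)) (fun ω => lam i ω - lam j ω) S := by
    refine LipschitzOnWith.of_dist_le_mul fun x hx y hy => ?_
    rw [Real.dist_eq, dist_eq_norm]
    by_cases hxy : x = y
    · subst hxy; simp
    · refine (h y hy x hx (Ne.symm hxy) i j).trans ?_
      exact mul_le_mul_of_nonneg_right (Real.le_coe_toNNReal _) (norm_nonneg _)
  exact hL.continuousOn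

/-- The set is relatively open in `S`, because `LipGapBound` makes the differences of eigenvalues
continuous. -/
theorem measurableSet_resonantSet (hS : MeasurableSet S) {K : ℝ} (h : LipGapBound d S lam K)
    (γ : ℝ) (i j : ℕ+) (k : Fin n → ℤ) : MeasurableSet (resonantSet d τ S lam γ i j k) := by
  have hc : ContinuousOn (fun ω => |lam i ω - lam j ω + ∑ m, ω m * (k m : ℝ)|) S :=
    ((h.continuousOn i j).add (by fun_prop)).abs
  obtain ⟨U, hU, he⟩ := continuousOn_iff'.1 hc _ (isOpen_Iio
    (a := γ / (1 + intNorm k ^ τ) * bracket ((i : ℝ) ^ d - (j : ℝ) ^ d)))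
  have : resonantSet d τ S lam γ i j k = U ∩ S := by
    rw [← he]; ext ω; simp [resonantSet, and_comm]
  rw [this]
  exact hU.measurableSet.inter hS

/-- By `hlow` the difference of eigenvalues is at least twice the threshold, so at a resonance `ω·k`
has to compensate it; hence `K₀ |i^d - j^d| ≤ 4 |k|`. Now move `ω` in the direction of the signs of
`k`: `ω·k` grows with speed `|k|`, while the difference of eigenvalues changes with speed at most
`K₁ |i^d - j^d| ≤ |k| / 2`, because `8 K₁ < K₀`. No second resonance occurs after a time `16 γ / (K₀
(1 + |k|^τ))`. -/
theorem resonantSet_estimate (hS : MeasurableSet S) (hSs : S ⊆ frequencySet n) (hd : 1 ≤ d)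
    (hτ : 0 < τ) {K₀ K₁ K₀' K₁' γ : ℝ} (hK₁ : 0 < K₁) (hK : 8 * K₁ < K₀) (hK₀' : K₀ ≤ K₀')
    (hK₁' : K₁' ≤ K₁) (hγ : 0 < γ) (hgap : GapBound d S lam K₀') (hlip : LipGapBound d S lam K₁')
    {i j : ℕ+} (hij : i ≠ j)
    (hlow : ∀ ω ∈ S, γ * powGap d i j ≤ |lam i ω - lam j ω|) {k : Fin n → ℤ} (hk : k ≠ 0) :
    ((resonantSet d τ S lam γ i j k).Nonempty → powGap d i j ≤ 4 * intNorm k / K₀) ∧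
    volume (resonantSet d τ S lam γ i j k) ≤
      ENNReal.ofReal (3 ^ n * (16 * γ / (K₀ * (1 + intNorm k ^ τ)))) := by
  have hk1 := one_le_intNorm hk
  have hK₀ : 0 < K₀ := by linarith
  set g := powGap d i j with hg
  have hg1 : 1 ≤ g := one_le_powGap hd hij
  set q := intNorm k ^ τ with hq
  have hq1 : 1 ≤ q := Real.one_le_rpow hk1 hτ.le
  have hne : (resonantSet d τ S lam γ i j k).Nonempty → g ≤ 4 * intNorm k / K₀ := by
    rintro ⟨ω, hωS, hω⟩
    rw [bracket_eq_powGap hd hij, ← hg, ← hq] at hω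
    have h1 := hlow ω hωS
    have h2 := hgap ω hωS i j
    rw [← hg] at h2
    have h3 := abs_sum_mul_le ω k (abs_le_two_of_mem_frequencySet (hSs hωS))
    have h4 : γ / (1 + q) * g ≤ γ * g / 2 := by
      rw [div_mul_eq_mul_div]
      exact div_le_div_of_nonneg_left (by positivity) (by norm_num) (by linarith)
    have h5 : |lam i ω - lam j ω| ≤ |lam i ω - lam j ω + ∑ m, ω m * (k m : ℝ)| +
        |∑ m, ω m * (k m : ℝ)| := by
      have := abs_sub (lam i ω - lam j ω + ∑ m, ω m * (k m : ℝ)) (∑ m, ω m * (k m : ℝ))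
      simpa using this
    rw [le_div_iff₀ hK₀]
    nlinarith
  refine ⟨hne, ?_⟩
  rcases Set.eq_empty_or_nonempty (resonantSet d τ S lam γ i j k) with h0 | h0
  · rw [h0]; simp
  have hgk := hne h0
  have hgk' : K₀ * g ≤ 4 * intNorm k := by
    rw [le_div_iff₀ hK₀] at hgk; linarith
  set v : Fin n → ℝ := fun m => (SignType.sign (k m : ℝ) : ℝ) with hv
  have hv1 : ∀ m, |v m| ≤ 1 := fun m => abs_sign_le_one _
  have hvk : ∑ m, v m * (k m : ℝ) = intNorm k := by
    rw [intNorm]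
    exact Finset.sum_congr rfl fun m _ => sign_mul_self _
  have hvn : ‖v‖ ≤ 1 := (pi_norm_le_iff_of_nonneg zero_le_one).2 hv1
  refine volume_le_of_no_long_translate (measurableSet_resonantSet hS hlip γ i j k)
    (fun ω hω => hSs hω.1) (by positivity) hv1 ?_
  rintro x ⟨hxS, hx⟩ t ht ⟨hyS, hy⟩
  rw [bracket_eq_powGap hd hij, ← hg, ← hq] at hx hy
  have ht0 : 0 < t := lt_of_lt_of_le (by positivity) ht
  have hxy : x ≠ x + t • v := by
    intro h
    have h1 : t • v = 0 := by simpa using h.symm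
    have h2 : v = 0 := (smul_eq_zero.1 h1).resolve_left ht0.ne'
    rw [h2] at hvk
    simp at hvk
    linarith
  have h1 := hlip x hxS _ hyS hxy i j
  have h2 : ‖x + t • v - x‖ ≤ t := by
    rw [add_sub_cancel_left, norm_smul, Real.norm_eq_abs, abs_of_pos ht0]
    exact mul_le_of_le_one_right ht0.le hvn
  have h3 : ∑ m, (x + t • v) m * (k m : ℝ) = ∑ m, x m * (k m : ℝ) + t * intNorm k := by
    rw [← hvk, Finset.mul_sum, ← Finset.sum_add_distrib]
    exact Finset.sum_congr rfl fun m _ => by simp; ring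
  rw [h3] at hy
  rw [← hg] at h1
  have h4 : |lam i (x + t • v) - lam j (x + t • v) - (lam i x - lam j x)| ≤ K₁ * g * t := by
    refine h1.trans ?_
    calc K₁' * g * ‖x + t • v - x‖ ≤ K₁ * g * ‖x + t • v - x‖ := by gcongr
      _ ≤ _ := by gcongr
  have hx' := abs_lt.1 hx
  have hy' := abs_lt.1 hy
  have h4' := abs_le.1 h4
  have h5 : K₁ * g ≤ intNorm k / 2 := by nlinarith
  have h6 : t * intNorm k / 2 < 2 * (γ / (1 + q) * g) := by
    have : K₁ * g * t ≤ intNorm k / 2 * t := by gcongr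
    linarith
  have h7 : γ / (1 + q) * g ≤ γ / (1 + q) * (4 * intNorm k / K₀) := by gcongr
  have h8 : t * intNorm k < 16 * γ / (K₀ * (1 + q)) * intNorm k := by
    have e : 16 * γ / (K₀ * (1 + q)) * intNorm k = 4 * (γ / (1 + q) * (4 * intNorm k / K₀)) := by
      field_simp; norm_num
    rw [e]; linarith
  have h9 : t < 16 * γ / (K₀ * (1 + q)) := lt_of_mul_lt_mul_right h8 (by linarith)
  linarith

/-- Comparison with an integral, done by induction: Bernoulli's inequality for the exponent `1 - x`
bounds each increment. -/
theorem sum_rpow_neg_le {x : ℝ} (hx0 : 0 < x) (hx1 : x < 1) (N : ℕ) :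
    ∑ p ∈ Finset.Icc 1 N, (p : ℝ) ^ (-x) ≤ (N : ℝ) ^ (1 - x) / (1 - x) := by
  have h1x : 0 < 1 - x := by linarith
  induction N with
  | zero => simp [Real.zero_rpow h1x.ne']
  | succ N ih =>
    rw [Finset.sum_Icc_succ_top (by omega)]
    have hN : (0 : ℝ) < (N : ℝ) + 1 := by positivity
    have hb := rpow_one_add_le_one_add_mul_self (s := -1 / ((N : ℝ) + 1)) (p := 1 - x) (by
      rw [le_div_iff₀ hN]; nlinarith [Nat.cast_nonneg (α := ℝ) N]) h1x.le (by linarith)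
    have e1 : (N : ℝ) = ((N : ℝ) + 1) * (1 + -1 / ((N : ℝ) + 1)) := by field_simp; ring
    have hpos : 0 ≤ 1 + -1 / ((N : ℝ) + 1) := by
      rw [neg_div, ← sub_eq_add_neg, sub_nonneg, div_le_one hN]; linarith [Nat.cast_nonneg (α := ℝ) N]
    have e2 : (N : ℝ) ^ (1 - x) = ((N : ℝ) + 1) ^ (1 - x) * (1 + -1 / ((N : ℝ) + 1)) ^ (1 - x) := by
      rw [← Real.mul_rpow hN.le hpos, ← e1]
    have e3 : ((N : ℝ) + 1) ^ (-x) = ((N : ℝ) + 1) ^ (1 - x) / ((N : ℝ) + 1) := by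
      rw [← Real.rpow_sub_one hN.ne']; congr 1; ring
    have hA : 0 ≤ ((N : ℝ) + 1) ^ (1 - x) := by positivity
    have h2 : (N : ℝ) ^ (1 - x) ≤ ((N : ℝ) + 1) ^ (1 - x) * (1 + (1 - x) * (-1 / ((N : ℝ) + 1))) := by
      rw [e2]; gcongr
    push_cast
    rw [le_div_iff₀ h1x] at ih ⊢
    rw [add_mul, e3]
    have e4 : ((N : ℝ) + 1) ^ (1 - x) * (1 + (1 - x) * (-1 / ((N : ℝ) + 1))) =
      ((N : ℝ) + 1) ^ (1 - x) - ((N : ℝ) + 1) ^ (1 - x) / ((N : ℝ) + 1) * (1 - x) := by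
      field_simp; ring
    linarith

end Resonance

/-! ### Cutting out the resonant frequencies. -/

section Excision

variable {n : ℕ} {d τ κ : ℝ}

theorem intNorm_neg (k : Fin n → ℤ) : intNorm (-k) = intNorm k := by
  simp [intNorm]

/-- For fixed `k`, the dangerous pairs `(j + p, j)` have `p ≤ 4 |k| / K₀` and `j ≤ (u (1 + |k|^τ) /
p)^(1/κ)`. The sum of `p^(-1/κ)` gives `|k|^(1 - 1/κ)`, and the powers of `|k|` combine to `-(τ -
1)(1 - 1/κ)`. -/
theorem resonance_count_bound (hκ : 1 < κ) (hτ : 1 < τ) {K₀ u γ : ℝ} (hK₀ : 0 < K₀) (hu : 0 ≤ u)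
    (hγ : 0 < γ) {k : Fin n → ℤ} (hk : k ≠ 0) :
    ∑ p ∈ Finset.Icc 1 ⌊4 * intNorm k / K₀⌋₊,
      (u * (1 + intNorm k ^ τ) / (p : ℝ)) ^ κ⁻¹ * (3 ^ n * (16 * γ / (K₀ * (1 + intNorm k ^ τ)))) ≤
    (3 ^ n * 16 / K₀ * ((4 / K₀) ^ (1 - κ⁻¹) / (1 - κ⁻¹)) * 2 ^ ((τ - 1) * (1 - κ⁻¹))) * γ * u ^ κ⁻¹ *
      (1 + intNorm k) ^ (-((τ - 1) * (1 - κ⁻¹))) := by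
  have hκi : 0 < κ⁻¹ := by positivity
  have hκi1 : κ⁻¹ < 1 := inv_lt_one_of_one_lt₀ hκ
  have hx := one_le_intNorm hk
  set x := intNorm k
  set q := 1 - κ⁻¹ with hq
  have hq0 : 0 < q := by linarith
  set Q := 1 + x ^ τ with hQ
  have hx0 : 0 < x := by linarith
  have hQ0 : 0 < Q := by positivity
  set N := ⌊4 * x / K₀⌋₊
  have hterm : ∀ p ∈ Finset.Icc 1 N, (u * Q / (p : ℝ)) ^ κ⁻¹ * (3 ^ n * (16 * γ / (K₀ * Q))) =
      (u ^ κ⁻¹ * Q ^ κ⁻¹ * (3 ^ n * (16 * γ / (K₀ * Q)))) * (p : ℝ) ^ (-κ⁻¹) := by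
    intro p _
    rw [Real.div_rpow (by positivity) (by positivity), Real.mul_rpow hu hQ0.le,
      Real.rpow_neg (by positivity)]
    ring
  rw [Finset.sum_congr rfl hterm, ← Finset.mul_sum]
  have hN : ∑ p ∈ Finset.Icc 1 N, (p : ℝ) ^ (-κ⁻¹) ≤ (4 / K₀) ^ q * x ^ q / q := by
    refine (sum_rpow_neg_le hκi hκi1 N).trans ?_
    rw [← hq, ← Real.mul_rpow (by positivity) hx0.le]
    gcongr
    refine (Nat.floor_le (by positivity)).trans (le_of_eq (by ring))
  have hQ1 : Q ^ κ⁻¹ * (1 / Q) ≤ x ^ (-(τ * q)) := by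
    have e : Q ^ κ⁻¹ * (1 / Q) = Q ^ (-q) := by
      rw [mul_one_div, ← Real.rpow_sub_one hQ0.ne']; congr 1; rw [hq]; ring
    rw [e, ← mul_neg, Real.rpow_mul hx0.le]
    exact Real.rpow_le_rpow_of_nonpos (by positivity) (by rw [hQ]; linarith) (by linarith)
  have hx2 : x ^ (-(τ * q)) * x ^ q ≤ 2 ^ ((τ - 1) * q) * (1 + x) ^ (-((τ - 1) * q)) := by
    have e : x ^ (-(τ * q)) * x ^ q = x ^ (-((τ - 1) * q)) := by
      rw [← Real.rpow_add hx0]; congr 1; ring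
    have e2 : 2 ^ ((τ - 1) * q) * (1 + x) ^ (-((τ - 1) * q)) = ((1 + x) / 2) ^ (-((τ - 1) * q)) := by
      rw [Real.div_rpow (by positivity) (by norm_num), Real.rpow_neg (by norm_num : (0 : ℝ) ≤ 2)]
      field_simp
    rw [e, e2]
    refine Real.rpow_le_rpow_of_nonpos (by positivity) (by linarith) ?_
    have : 0 ≤ (τ - 1) * q := mul_nonneg (by linarith) hq0.le
    linarith
  calc u ^ κ⁻¹ * Q ^ κ⁻¹ * (3 ^ n * (16 * γ / (K₀ * Q))) * ∑ p ∈ Finset.Icc 1 N, (p : ℝ) ^ (-κ⁻¹)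
      ≤ u ^ κ⁻¹ * Q ^ κ⁻¹ * (3 ^ n * (16 * γ / (K₀ * Q))) * ((4 / K₀) ^ q * x ^ q / q) := by gcongr
    _ = (3 ^ n * 16 / K₀ * ((4 / K₀) ^ q / q)) * γ * u ^ κ⁻¹ * (Q ^ κ⁻¹ * (1 / Q) * x ^ q) := by
        field_simp
    _ ≤ (3 ^ n * 16 / K₀ * ((4 / K₀) ^ q / q)) * γ * u ^ κ⁻¹ * (x ^ (-(τ * q)) * x ^ q) := by gcongr
    _ ≤ (3 ^ n * 16 / K₀ * ((4 / K₀) ^ q / q)) * γ * u ^ κ⁻¹ *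
          (2 ^ ((τ - 1) * q) * (1 + x) ^ (-((τ - 1) * q))) := by gcongr
    _ = _ := by ring

/-- The pair `(j + p, j)` moves by at most `2 e j^(-κ)`, so it keeps its Melnikov condition, with
the constant lowered by `δγ`, unless `p j^κ < 2 e (1 + |k|^τ) / δγ`. For each `k` only finitely many
pairs are left to be cut out, and `hτ` says that `n < (τ - 1)(1 - 1/κ)`, which makes the sum over
`k` finite. -/
theorem exists_excision (hn : 1 ≤ n) (hκ : 1 < κ)
    (hτ : ((n : ℝ) + 1 - κ⁻¹) / (1 - κ⁻¹) < τ) {K₀ K₁ : ℝ} (hK₁ : 0 < K₁) (hK : 8 * K₁ < K₀)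
    (hd : 1 ≤ d) :
    ∃ C : ℝ, 0 < C ∧ ∀ (S : Set (Fin n → ℝ)) (lam lam' : ℕ+ → (Fin n → ℝ) → ℝ)
      (γ δγ e K₀' K₁' : ℝ), MeasurableSet S → S ⊆ frequencySet n → 0 < e → 2 * e ≤ δγ →
      0 < γ - δγ → MelnikovBound d τ S lam γ → GapBound d S lam' K₀' → LipGapBound d S lam' K₁' →
      K₀ ≤ K₀' → K₁' ≤ K₁ → (∀ ω ∈ S, ∀ i, |lam' i ω - lam i ω| ≤ e * (i : ℝ) ^ (-κ)) →
      ∃ S' : Set (Fin n → ℝ), S' ⊆ S ∧ MeasurableSet S' ∧ MelnikovBound d τ S' lam' (γ - δγ) ∧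
        volume (S \ S') ≤ ENNReal.ofReal (C * (γ - δγ) * (e / δγ) ^ κ⁻¹) := by
  have hκi : 0 < κ⁻¹ := by positivity
  have hκi1 : κ⁻¹ < 1 := inv_lt_one_of_one_lt₀ hκ
  have hq : 0 < 1 - κ⁻¹ := by linarith
  have hn' : (1 : ℝ) ≤ n := by exact_mod_cast hn
  have ha : (n : ℝ) < (τ - 1) * (1 - κ⁻¹) := by
    rw [div_lt_iff₀ hq] at hτ; linarith
  have hτ1 : 1 < τ := by nlinarith
  have hτ0 : 0 < τ := by linarith
  have hK₀ : 0 < K₀ := by linarith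
  obtain ⟨B, hB0, hB⟩ := exists_sum_rpow_neg_le hn ha
  set A := 3 ^ n * 16 / K₀ * ((4 / K₀) ^ (1 - κ⁻¹) / (1 - κ⁻¹)) * 2 ^ ((τ - 1) * (1 - κ⁻¹)) with hA
  have hA0 : 0 < A := by positivity
  refine ⟨A * 2 ^ κ⁻¹ * B, by positivity, ?_⟩
  intro S lam lam' γ δγ e K₀' K₁' hS hSs he heδ hγ' hmel hgap hlip hK₀' hK₁' hch
  have hδγ : 0 < δγ := by linarith
  set γ' := γ - δγ with hγ'def
  set u := 2 * e / δγ with hu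
  have hu0 : 0 ≤ u := by positivity
  -- the condition is inherited when the change of the eigenvalues is small
  have auto : ∀ ω ∈ S, ∀ (j p : ℕ+) (k : Fin n → ℤ),
      u * (1 + intNorm k ^ τ) ≤ (p : ℝ) * (j : ℝ) ^ κ →
      γ' / (1 + intNorm k ^ τ) * bracket (((j + p : ℕ+) : ℝ) ^ d - (j : ℝ) ^ d) ≤
        |lam' (j + p) ω - lam' j ω + ∑ m, ω m * (k m : ℝ)| := by
    intro ω hω j p k hX
    have hne : j + p ≠ j := by
      intro h
      have := congrArg PNat.val h
      have hp := p.pos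
      simp at this
    have h1 := hmel ω hω (j + p) j k (Or.inl hne)
    have hgp : (p : ℝ) ≤ bracket (((j + p : ℕ+) : ℝ) ^ d - (j : ℝ) ^ d) := by
      refine le_trans ?_ (max_abs_sub_le_bracket hd _ _)
      refine le_trans (le_of_eq ?_) (le_max_right _ _)
      push_cast
      rw [add_sub_cancel_left, abs_of_nonneg (by positivity)]
    set g := bracket (((j + p : ℕ+) : ℝ) ^ d - (j : ℝ) ^ d)
    have hQ : 0 < 1 + intNorm k ^ τ := by
      have := Real.rpow_nonneg (intNorm_nonneg k) τ
      linarith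
    set Q := 1 + intNorm k ^ τ
    have hj0 : (0 : ℝ) < (j : ℝ) := by exact_mod_cast j.pos
    have hjκ : (0 : ℝ) < (j : ℝ) ^ κ := by positivity
    have h2 := hch ω hω (j + p)
    have h3 := hch ω hω j
    have h4 : ((j + p : ℕ+) : ℝ) ^ (-κ) ≤ (j : ℝ) ^ (-κ) := by
      refine Real.rpow_le_rpow_of_nonpos hj0 ?_ (by linarith)
      push_cast
      have : (0 : ℝ) ≤ (p : ℝ) := by positivity
      linarith
    have h5 : 2 * e * (j : ℝ) ^ (-κ) ≤ δγ / Q * g := by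
      rw [Real.rpow_neg hj0.le, ← div_eq_mul_inv, div_mul_eq_mul_div, div_le_div_iff₀ hjκ hQ]
      have h6 : u * Q * δγ = 2 * e * Q := by rw [hu]; field_simp
      calc 2 * e * Q = u * Q * δγ := h6.symm
        _ ≤ (p : ℝ) * (j : ℝ) ^ κ * δγ := by gcongr
        _ ≤ g * (j : ℝ) ^ κ * δγ := by gcongr
        _ = _ := by ring
    have h6 : γ' / Q * g = γ / Q * g - δγ / Q * g := by rw [hγ'def]; ring
    have h7 : |lam (j + p) ω - lam j ω + ∑ m, ω m * (k m : ℝ)| ≤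
        |lam' (j + p) ω - lam' j ω + ∑ m, ω m * (k m : ℝ)| +
        (|lam' (j + p) ω - lam (j + p) ω| + |lam' j ω - lam j ω|) := by
      have e1 : lam (j + p) ω - lam j ω + ∑ m, ω m * (k m : ℝ) =
        (lam' (j + p) ω - lam' j ω + ∑ m, ω m * (k m : ℝ)) -
          ((lam' (j + p) ω - lam (j + p) ω) - (lam' j ω - lam j ω)) := by ring
      rw [e1]
      refine (abs_sub _ _).trans ?_
      gcongr
      exact abs_sub _ _
    have h8 : e * ((j + p : ℕ+) : ℝ) ^ (-κ) ≤ e * (j : ℝ) ^ (-κ) := by gcongr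
    rw [h6]
    linarith
  -- With `u ≤ 1` every pair is safe for `k = 0`. Hence nothing is cut out there, and `hlow` holds
  -- on all of `S`.
  have hu1 : u ≤ 1 := by rw [hu, div_le_one hδγ]; exact heδ
  have hpj : ∀ p j : ℕ+, (1 : ℝ) ≤ (p : ℝ) * (j : ℝ) ^ κ := by
    intro p j
    have h1 : (1 : ℝ) ≤ (p : ℝ) := by exact_mod_cast p.pos
    have h2 : (1 : ℝ) ≤ (j : ℝ) ^ κ := Real.one_le_rpow (by exact_mod_cast j.pos) (by linarith)
    nlinarith
  have hlow : ∀ (j p : ℕ+), ∀ ω ∈ S, γ' * powGap d (j + p) j ≤ |lam' (j + p) ω - lam' j ω| := by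
    intro j p ω hω
    have h0 : intNorm (0 : Fin n → ℤ) = 0 := by simp [intNorm]
    have h1 := auto ω hω j p 0 (by
      rw [h0, Real.zero_rpow hτ0.ne', add_zero, mul_one]
      exact hu1.trans (hpj p j))
    rw [h0, Real.zero_rpow hτ0.ne', add_zero, div_one] at h1
    have hb : powGap d (j + p) j ≤ bracket (((j + p : ℕ+) : ℝ) ^ d - (j : ℝ) ^ d) := le_max_right _ _
    have h2 : γ' * powGap d (j + p) j ≤ γ' * bracket (((j + p : ℕ+) : ℝ) ^ d - (j : ℝ) ^ d) := by
      gcongr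
    simpa using h2.trans h1
  have hnej : ∀ j p : ℕ+, j + p ≠ j := by
    intro j p h
    have := congrArg PNat.val h
    simp at this
  -- The indices are natural numbers so as to run through `Finset.Icc`; `Nat.toPNat'` is only used
  -- at positive values in `Bad`.
  let Rp : (Fin n → ℤ) → ℕ → ℕ → Set (Fin n → ℝ) := fun k p j =>
    resonantSet d τ S lam' γ' (Nat.toPNat' j + Nat.toPNat' p) (Nat.toPNat' j) k
  let J : (Fin n → ℤ) → ℕ → ℕ := fun k p => ⌊(u * (1 + intNorm k ^ τ) / (p : ℝ)) ^ κ⁻¹⌋₊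
  let Bad : (Fin n → ℤ) → Set (Fin n → ℝ) := fun k => if k = 0 then ∅ else
    ⋃ p ∈ Finset.Icc 1 ⌊4 * intNorm k / K₀⌋₊, ⋃ j ∈ Finset.Icc 1 (J k p), Rp k p j
  have hBadm : ∀ k, MeasurableSet (Bad k) := by
    intro k
    by_cases hk : k = 0
    · simp [Bad, hk]
    · simp only [Bad, hk, if_false]
      exact Finset.measurableSet_biUnion _ fun p _ => Finset.measurableSet_biUnion _ fun j _ =>
        measurableSet_resonantSet hS hlip _ _ _ _
  have hBadv : ∀ k, volume (Bad k) ≤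
      ENNReal.ofReal (A * γ' * u ^ κ⁻¹ * (1 + intNorm k) ^ (-((τ - 1) * (1 - κ⁻¹)))) := by
    intro k
    by_cases hk : k = 0
    · simp [Bad, hk]
    · simp only [Bad, hk, if_false]
      refine le_trans ?_ (ENNReal.ofReal_le_ofReal (resonance_count_bound hκ hτ1 hK₀ hu0 hγ' hk))
      have hnn : (0 : ℝ) ≤ 1 + intNorm k ^ τ := by
        have := Real.rpow_nonneg (intNorm_nonneg k) τ
        linarith
      rw [ENNReal.ofReal_sum_of_nonneg (fun p _ => by positivity)]
      refine (measure_biUnion_finset_le _ _).trans (Finset.sum_le_sum fun p _ => ?_)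
      refine (measure_biUnion_finset_le _ _).trans ?_
      calc ∑ j ∈ Finset.Icc 1 (J k p), volume (Rp k p j)
          ≤ ∑ j ∈ Finset.Icc 1 (J k p),
            ENNReal.ofReal (3 ^ n * (16 * γ' / (K₀ * (1 + intNorm k ^ τ)))) :=
            Finset.sum_le_sum fun j _ => (resonantSet_estimate hS hSs hd hτ0 hK₁ hK hK₀' hK₁' hγ'
              hgap hlip (hnej _ _) (hlow _ _) hk).2
        _ = ENNReal.ofReal ((J k p : ℝ) * (3 ^ n * (16 * γ' / (K₀ * (1 + intNorm k ^ τ))))) := by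
            rw [Finset.sum_const, Nat.card_Icc, add_tsub_cancel_right, nsmul_eq_mul,
              ENNReal.ofReal_mul (p := (J k p : ℝ)) (by positivity), ENNReal.ofReal_natCast]
        _ ≤ _ := by
            apply ENNReal.ofReal_le_ofReal
            gcongr
            exact Nat.floor_le (by positivity)
  refine ⟨S \ ⋃ k, Bad k, Set.sdiff_subset, hS.diff (MeasurableSet.iUnion hBadm), ?_, ?_⟩
  · -- the ordered case
    have hord : ∀ ω ∈ S \ ⋃ k, Bad k, ∀ (j p : ℕ+) (k : Fin n → ℤ),
        γ' / (1 + intNorm k ^ τ) * bracket (((j + p : ℕ+) : ℝ) ^ d - (j : ℝ) ^ d) ≤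
          |lam' (j + p) ω - lam' j ω + ∑ m, ω m * (k m : ℝ)| := by
      rintro ω ⟨hωS, hωB⟩ j p k
      by_contra! hcon
      have hX : (p : ℝ) * (j : ℝ) ^ κ < u * (1 + intNorm k ^ τ) := by
        by_contra! hX
        exact absurd (auto ω hωS j p k hX) (not_le.2 hcon)
      have hk : k ≠ 0 := by
        rintro rfl
        have h0 : intNorm (0 : Fin n → ℤ) = 0 := by simp [intNorm]
        rw [h0, Real.zero_rpow hτ0.ne', add_zero, mul_one] at hX
        linarith [hpj p j]
      have hR : ω ∈ resonantSet d τ S lam' γ' (j + p) j k := ⟨hωS, hcon⟩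
      have hg := (resonantSet_estimate hS hSs hd hτ0 hK₁ hK hK₀' hK₁' hγ'
              hgap hlip (hnej j p) (hlow j p) hk).1 ⟨ω, hR⟩
      have hp1 : (p : ℝ) ≤ 4 * intNorm k / K₀ := by
        refine le_trans ?_ hg
        refine le_trans (le_of_eq ?_) (abs_sub_le_powGap hd (j + p) j)
        push_cast
        rw [add_sub_cancel_left, abs_of_nonneg (by positivity)]
      have hp0 : (0 : ℝ) < (p : ℝ) := by exact_mod_cast p.pos
      have hj1 : (j : ℝ) ≤ (u * (1 + intNorm k ^ τ) / (p : ℝ)) ^ κ⁻¹ := by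
        have h1 : (j : ℝ) ^ κ ≤ u * (1 + intNorm k ^ τ) / (p : ℝ) := by
          rw [le_div_iff₀ hp0]; linarith
        have h2 := Real.rpow_le_rpow (by positivity) h1 hκi.le
        rwa [Real.rpow_rpow_inv (by positivity) (by positivity)] at h2
      apply hωB
      rw [Set.mem_iUnion]
      refine ⟨k, ?_⟩
      simp only [Bad, hk, if_false, Set.mem_iUnion]
      refine ⟨p, Finset.mem_Icc.2 ⟨p.pos, Nat.le_floor hp1⟩, j,
        Finset.mem_Icc.2 ⟨j.pos, Nat.le_floor hj1⟩, ?_⟩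
      simpa only [Rp, PNat.coe_toPNat'] using hR
    intro ω hω i j k hijk
    rcases lt_trichotomy i j with h | h | h
    -- Exchanging `i` and `j` together with `k ↦ -k` changes the sign of the divisor.
    · obtain ⟨p, rfl⟩ : ∃ p, j = i + p := ⟨j - i, (PNat.add_sub_of_lt h).symm⟩
      have h1 := hord ω hω i p (-k)
      rw [intNorm_neg] at h1
      have e1 : lam' i ω - lam' (i + p) ω + ∑ m, ω m * (k m : ℝ) =
          -(lam' (i + p) ω - lam' i ω + ∑ m, ω m * (((-k) m : ℤ) : ℝ)) := by
        simp [Finset.sum_neg_distrib]; ring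
      have e2 : bracket ((i : ℝ) ^ d - ((i + p : ℕ+) : ℝ) ^ d) =
          bracket (((i + p : ℕ+) : ℝ) ^ d - (i : ℝ) ^ d) := by
        rw [bracket, bracket, abs_sub_comm]
      rw [e1, e2, abs_neg]
      exact h1
    · subst h
      have h1 := hmel ω hω.1 i i k hijk
      have e : lam' i ω - lam' i ω = lam i ω - lam i ω := by ring
      rw [e]
      refine le_trans ?_ h1
      have hnn : (0 : ℝ) ≤ 1 + intNorm k ^ τ := by
        have := Real.rpow_nonneg (intNorm_nonneg k) τ
        linarith
      have := one_le_bracket ((i : ℝ) ^ d - (i : ℝ) ^ d)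
      gcongr
      linarith
    · obtain ⟨p, rfl⟩ : ∃ p, i = j + p := ⟨i - j, (PNat.add_sub_of_lt h).symm⟩
      exact hord ω hω j p k
  · have e : S \ (S \ ⋃ k, Bad k) ⊆ ⋃ k, Bad k := by
      intro ω hω
      by_contra hcon
      exact hω.2 ⟨hω.1, hcon⟩
    refine (measure_mono e).trans ((measure_iUnion_le _).trans ?_)
    refine (ENNReal.tsum_le_tsum hBadv).trans ?_
    have hnn : ∀ k : Fin n → ℤ, 0 ≤ A * γ' * u ^ κ⁻¹ * (1 + intNorm k) ^ (-((τ - 1) * (1 - κ⁻¹))) := by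
      intro k
      have := intNorm_nonneg k
      positivity
    have hsum : ∀ T : Finset (Fin n → ℤ),
        ∑ k ∈ T, A * γ' * u ^ κ⁻¹ * (1 + intNorm k) ^ (-((τ - 1) * (1 - κ⁻¹))) ≤
          A * γ' * u ^ κ⁻¹ * B := by
      intro T
      rw [← Finset.mul_sum]
      gcongr
      exact hB T
    rw [← ENNReal.ofReal_tsum_of_nonneg hnn (summable_of_sum_le hnn hsum)]
    apply ENNReal.ofReal_le_ofReal
    refine (Real.tsum_le_of_sum_le hnn hsum).trans (le_of_eq ?_)
    rw [hu, mul_div_assoc, Real.mul_rpow (by norm_num) (by positivity)]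
    ring

end Excision

/-! ### Families of maps with quantitative bounds -/

/-- `F` is periodic and analytic on the strip, bounded by `e`, with Lipschitz constant `e * M`. -/
structure Ctl {n : ℕ} {E : Type*} [NormedAddCommGroup E] [NormedSpace ℂ E] (ρ : ℝ)
    (S : Set (Fin n → ℝ)) (F : (Fin n → ℂ) → (Fin n → ℝ) → E) (e M : ℝ) : Prop where
  periodic : ∀ ω ∈ S, StripPeriodic ρ (fun φ => F φ ω)
  analytic : ∀ ω ∈ S, DifferentiableOn ℂ (fun φ => F φ ω) (strip n ρ)
  sup : ∀ ω ∈ S, ∀ φ ∈ strip n ρ, ‖F φ ω‖ ≤ e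
  lip : ∀ ω ∈ S, ∀ ω' ∈ S, ∀ φ ∈ strip n ρ, ‖F φ ω - F φ ω'‖ ≤ e * M * ‖ω - ω'‖

theorem isUnit_one_sub_of_norm_lt {A : Type*} [NormedRing A] [CompleteSpace A] {t : A}
    (h : ‖t‖ < 1) : IsUnit (1 - t) :=
  (Units.oneSub t h).isUnit

theorem norm_inverse_one_sub_le {A : Type*} [NormedRing A] [CompleteSpace A] [NormOneClass A]
    {t : A} (h : ‖t‖ ≤ 1 / 2) : ‖Ring.inverse (1 - t)‖ ≤ 2 := by
  have h1 : ‖t‖ < 1 := by linarith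
  have h2 : ‖∑' i : ℕ, t ^ i‖ ≤ ‖(1 : A)‖ - 1 + (1 - ‖t‖)⁻¹ :=
    tsum_geometric_le_of_norm_lt_one t h1
  rw [norm_one, sub_self, zero_add] at h2
  have h3 : Ring.inverse (1 - t) = ∑' i : ℕ, t ^ i := by
    rw [NormedRing.inverse_one_sub t h1]; rfl
  rw [h3]
  refine h2.trans ?_
  rw [inv_le_comm₀ (by linarith) (by norm_num)]
  linarith

section Ctl

variable {n : ℕ} {E : Type*} [NormedAddCommGroup E] [NormedSpace ℂ E] {ρ e e' M : ℝ}
  {S : Set (Fin n → ℝ)} {F G : (Fin n → ℂ) → (Fin n → ℝ) → E}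

theorem Ctl.mono (h : Ctl ρ S F e M) {ρ' : ℝ} {S' : Set (Fin n → ℝ)} (hρ : ρ' ≤ ρ) (hS : S' ⊆ S)
    (he : e ≤ e') (hM : 0 ≤ M) : Ctl ρ' S' F e' M where
  periodic ω hω φ hφ := h.periodic ω (hS hω) φ (strip_mono hρ hφ)
  analytic ω hω := (h.analytic ω (hS hω)).mono (strip_mono hρ)
  sup ω hω φ hφ := (h.sup ω (hS hω) φ (strip_mono hρ hφ)).trans he
  lip ω hω ω' hω' φ hφ := (h.lip ω (hS hω) ω' (hS hω') φ (strip_mono hρ hφ)).trans (by gcongr)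

theorem Ctl.add (hF : Ctl ρ S F e M) (hG : Ctl ρ S G e' M) :
    Ctl ρ S (fun φ ω => F φ ω + G φ ω) (e + e') M where
  periodic ω hω φ hφ m := by
    have h1 := hF.periodic ω hω φ hφ m
    have h2 := hG.periodic ω hω φ hφ m
    simp only at h1 h2
    simp only [h1, h2]
  analytic ω hω := (hF.analytic ω hω).add (hG.analytic ω hω)
  sup ω hω φ hφ := (norm_add_le _ _).trans (add_le_add (hF.sup ω hω φ hφ) (hG.sup ω hω φ hφ))
  lip ω hω ω' hω' φ hφ := by
    rw [add_sub_add_comm]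
    refine (norm_add_le _ _).trans ?_
    linarith [hF.lip ω hω ω' hω' φ hφ, hG.lip ω hω ω' hω' φ hφ]

theorem Ctl.neg (hF : Ctl ρ S F e M) : Ctl ρ S (fun φ ω => -F φ ω) e M where
  periodic ω hω φ hφ m := by
    have h1 := hF.periodic ω hω φ hφ m
    simp only at h1
    simp only [h1]
  analytic ω hω := (hF.analytic ω hω).neg
  sup ω hω φ hφ := by rw [norm_neg]; exact hF.sup ω hω φ hφ
  lip ω hω ω' hω' φ hφ := by
    rw [← neg_sub_neg, neg_neg, neg_neg, norm_sub_rev]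
    exact hF.lip ω hω ω' hω' φ hφ

theorem Ctl.sub (hF : Ctl ρ S F e M) (hG : Ctl ρ S G e' M) :
    Ctl ρ S (fun φ ω => F φ ω - G φ ω) (e + e') M := by
  simpa only [sub_eq_add_neg] using hF.add hG.neg

theorem Ctl.const {c : E} (hc : ‖c‖ ≤ e) (hM : 0 ≤ M) :
    Ctl ρ S (fun (_ : Fin n → ℂ) (_ : Fin n → ℝ) => c) e M where
  periodic _ _ _ _ _ := rfl
  analytic _ _ := differentiableOn_const c
  sup _ _ _ _ := hc
  lip ω _ ω' _ _ _ := by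
    have : 0 ≤ e := (norm_nonneg _).trans hc
    simp only [sub_self, norm_zero]
    positivity

variable {A : Type*} [NormedRing A] [NormedAlgebra ℂ A] {F G : (Fin n → ℂ) → (Fin n → ℝ) → A}

/-- With one `M` common to all families, the sup bound scales both estimates and the Leibniz rule
costs just a factor `2`. -/
theorem Ctl.mul (hF : Ctl ρ S F e M) (hG : Ctl ρ S G e' M) (he : 0 ≤ e) (he' : 0 ≤ e') :
    Ctl ρ S (fun φ ω => F φ ω * G φ ω) (2 * e * e') M where
  periodic ω hω φ hφ m := by
    have h1 := hF.periodic ω hω φ hφ m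
    have h2 := hG.periodic ω hω φ hφ m
    simp only at h1 h2
    simp only [h1, h2]
  analytic ω hω := (hF.analytic ω hω).mul (hG.analytic ω hω)
  sup ω hω φ hφ := by
    refine (norm_mul_le _ _).trans ?_
    have := mul_le_mul (hF.sup ω hω φ hφ) (hG.sup ω hω φ hφ) (norm_nonneg _) he
    nlinarith
  lip ω hω ω' hω' φ hφ := by
    have e1 : F φ ω * G φ ω - F φ ω' * G φ ω' =
      (F φ ω - F φ ω') * G φ ω + F φ ω' * (G φ ω - G φ ω') := by noncomm_ring
    rw [e1]
    have h1 := hF.lip ω hω ω' hω' φ hφ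
    have h2 := hG.lip ω hω ω' hω' φ hφ
    have h3 : ‖(F φ ω - F φ ω') * G φ ω‖ ≤ (e * M * ‖ω - ω'‖) * e' :=
      (norm_mul_le _ _).trans (mul_le_mul h1 (hG.sup ω hω φ hφ) (norm_nonneg _)
        ((norm_nonneg _).trans h1))
    have h4 : ‖F φ ω' * (G φ ω - G φ ω')‖ ≤ e * (e' * M * ‖ω - ω'‖) :=
      (norm_mul_le _ _).trans (mul_le_mul (hF.sup ω' hω' φ hφ) h2 (norm_nonneg _) he)
    refine (norm_add_le _ _).trans ?_
    linarith

theorem Ctl.mul_const (hF : Ctl ρ S F e M) {c : A} (hc : ‖c‖ ≤ 1) :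
    Ctl ρ S (fun φ ω => F φ ω * c) e M where
  periodic ω hω φ hφ m := by
    have h1 := hF.periodic ω hω φ hφ m
    simp only at h1
    simp only [h1]
  analytic ω hω := (hF.analytic ω hω).mul_const c
  sup ω hω φ hφ := ((norm_mul_le _ _).trans (mul_le_of_le_one_right (norm_nonneg _) hc)).trans
    (hF.sup ω hω φ hφ)
  lip ω hω ω' hω' φ hφ := by
    rw [← sub_mul]
    exact ((norm_mul_le _ _).trans (mul_le_of_le_one_right (norm_nonneg _) hc)).trans
      (hF.lip ω hω ω' hω' φ hφ)

theorem Ctl.const_mul (hF : Ctl ρ S F e M) {c : A} (hc : ‖c‖ ≤ 1) :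
    Ctl ρ S (fun φ ω => c * F φ ω) e M where
  periodic ω hω φ hφ m := by
    have h1 := hF.periodic ω hω φ hφ m
    simp only at h1
    simp only [h1]
  analytic ω hω := (hF.analytic ω hω).const_mul c
  sup ω hω φ hφ := ((norm_mul_le _ _).trans (mul_le_of_le_one_left (norm_nonneg _) hc)).trans
    (hF.sup ω hω φ hφ)
  lip ω hω ω' hω' φ hφ := by
    rw [← mul_sub]
    exact ((norm_mul_le _ _).trans (mul_le_of_le_one_left (norm_nonneg _) hc)).trans
      (hF.lip ω hω ω' hω' φ hφ)

/-- The Lipschitz bound comes from the resolvent identity: two inverses of norm at most `2`, and a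
difference of size `M / 2`. -/
theorem Ctl.inverse_one_sub [CompleteSpace A] [NormOneClass A] (hF : Ctl ρ S F e M)
    (he : e ≤ 1 / 2) (hM : 0 ≤ M) :
    Ctl ρ S (fun φ ω => Ring.inverse (1 - F φ ω)) 2 M where
  periodic ω hω φ hφ m := by
    have h1 := hF.periodic ω hω φ hφ m
    simp only at h1
    simp only [h1]
  analytic ω hω φ hφ := by
    have h1 : ‖F φ ω‖ < 1 := by linarith [hF.sup ω hω φ hφ]
    have h2 : DifferentiableAt ℂ Ring.inverse (1 - F φ ω) :=
      differentiableAt_inverse (isUnit_one_sub_of_norm_lt h1)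
    exact h2.comp_differentiableWithinAt φ ((differentiableWithinAt_const _).sub (hF.analytic ω hω φ hφ))
  sup ω hω φ hφ := norm_inverse_one_sub_le ((hF.sup ω hω φ hφ).trans he)
  lip ω hω ω' hω' φ hφ := by
    have h1 : IsUnit (1 - F φ ω) := isUnit_one_sub_of_norm_lt (by linarith [hF.sup ω hω φ hφ])
    have h2 : IsUnit (1 - F φ ω') := isUnit_one_sub_of_norm_lt (by linarith [hF.sup ω' hω' φ hφ])
    have e1 : Ring.inverse (1 - F φ ω) - Ring.inverse (1 - F φ ω') =
        Ring.inverse (1 - F φ ω) * (F φ ω - F φ ω') * Ring.inverse (1 - F φ ω') := by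
      have : F φ ω - F φ ω' = (1 - F φ ω') - (1 - F φ ω) := by abel
      rw [this, mul_sub, sub_mul, Ring.inverse_mul_cancel _ h1, mul_assoc,
        Ring.mul_inverse_cancel _ h2, mul_one, one_mul]
    rw [e1]
    have h3 := norm_inverse_one_sub_le ((hF.sup ω hω φ hφ).trans he)
    have h4 := norm_inverse_one_sub_le ((hF.sup ω' hω' φ hφ).trans he)
    have h5 := hF.lip ω hω ω' hω' φ hφ
    have h6 : e * M * ‖ω - ω'‖ ≤ 1 / 2 * M * ‖ω - ω'‖ := by gcongr
    calc _ ≤ ‖Ring.inverse (1 - F φ ω)‖ * ‖F φ ω - F φ ω'‖ * ‖Ring.inverse (1 - F φ ω')‖ :=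
          (norm_mul_le _ _).trans (mul_le_mul_of_nonneg_right (norm_mul_le _ _) (norm_nonneg _))
      _ ≤ 2 * (1 / 2 * M * ‖ω - ω'‖) * 2 := by
          gcongr
          exact h5.trans h6
      _ = _ := by ring

end Ctl

/-! ### Sums of exponentials -/

section ExpSeries

variable {n : ℕ}

theorem expk_coef_bound {E : Type*} [NormedAddCommGroup E] {C a ρ δ : ℝ} {c : (Fin n → ℤ) → E}
    (hc : ∀ k, ‖c k‖ ≤ C * ((1 + intNorm k) ^ a * Real.exp (-ρ * intNorm k))) {φ : Fin n → ℂ}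
    (hφ : φ ∈ strip n (ρ - δ)) (k : Fin n → ℤ) :
    ‖expk k φ‖ * ‖c k‖ ≤ C * ((1 + intNorm k) ^ a * Real.exp (-δ * intNorm k)) := by
  calc ‖expk k φ‖ * ‖c k‖ ≤ Real.exp ((ρ - δ) * intNorm k) *
        (C * ((1 + intNorm k) ^ a * Real.exp (-ρ * intNorm k))) :=
        mul_le_mul (norm_expk_le k hφ) (hc k) (norm_nonneg _) (Real.exp_pos _).le
    _ = C * ((1 + intNorm k) ^ a * (Real.exp ((ρ - δ) * intNorm k) * Real.exp (-ρ * intNorm k))) := by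
        ring
    _ = _ := by rw [← Real.exp_add]; congr 3; ring

variable {E : Type*} [NormedAddCommGroup E] [NormedSpace ℂ E]

theorem realAngle_smul (t : ℝ) (ω : Fin n → ℝ) : realAngle (t • ω) = (t : ℂ) • realAngle ω := by
  funext m; simp [realAngle]

/-- The linear form `φ ↦ k·φ`. -/
def dotCLM (k : Fin n → ℤ) : (Fin n → ℂ) →L[ℂ] ℂ :=
  ∑ m, (k m : ℂ) • ContinuousLinearMap.proj (R := ℂ) (φ := fun _ : Fin n => ℂ) m

theorem dotCLM_apply (k : Fin n → ℤ) (φ : Fin n → ℂ) : dotCLM k φ = ∑ m, (k m : ℂ) * φ m := by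
  simp [dotCLM]

theorem norm_dotCLM_le (k : Fin n → ℤ) : ‖dotCLM k‖ ≤ intNorm k := by
  refine ContinuousLinearMap.opNorm_le_bound _ (intNorm_nonneg k) fun φ => ?_
  rw [dotCLM_apply, intNorm, Finset.sum_mul]
  refine (norm_sum_le _ _).trans (Finset.sum_le_sum fun m _ => ?_)
  rw [norm_mul]
  have : ‖(k m : ℂ)‖ = |(k m : ℝ)| := by simp
  rw [this]
  exact mul_le_mul_of_nonneg_left (norm_le_pi_norm φ m) (abs_nonneg _)

theorem hasFDerivAt_expk_smul (k : Fin n → ℤ) (c : E) (φ : Fin n → ℂ) :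
    HasFDerivAt (fun φ => expk k φ • c)
      ((expk k φ • (Complex.I • dotCLM k)).smulRight c) φ := by
  have h1 : HasFDerivAt (fun φ => Complex.I * dotCLM k φ) (Complex.I • dotCLM k) φ :=
    (dotCLM k).hasFDerivAt.const_mul Complex.I
  have h2 := h1.cexp
  have e : expk k = fun φ => Complex.exp (Complex.I * dotCLM k φ) := by
    funext φ; rw [expk, dotCLM_apply]
  have h3 : HasFDerivAt (expk k) (expk k φ • (Complex.I • dotCLM k)) φ := by
    rw [e]; exact h2
  exact h3.smul_const c

theorem summable_rpow_exp (n : ℕ) {a : ℝ} (ha : 0 < a) {δ : ℝ} (h0 : 0 < δ) (h1 : δ ≤ 1) :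
    Summable (fun k : Fin n → ℤ => (1 + intNorm k) ^ a * Real.exp (-δ * intNorm k)) := by
  obtain ⟨C, -, hC⟩ := exists_sum_rpow_exp_le n ha
  refine summable_of_sum_le (fun k => ?_) (hC δ h0 h1)
  have := intNorm_nonneg k
  positivity

theorem summable_expk_smul [CompleteSpace E] {C a ρ δ : ℝ} (ha : 0 < a) (h0 : 0 < δ) (h1 : δ ≤ 1)
    {c : (Fin n → ℤ) → E}
    (hc : ∀ k, ‖c k‖ ≤ C * ((1 + intNorm k) ^ a * Real.exp (-ρ * intNorm k))) {φ : Fin n → ℂ}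
    (hφ : φ ∈ strip n (ρ - δ)) : Summable (fun k => expk k φ • c k) := by
  refine Summable.of_norm_bounded ((summable_rpow_exp n ha h0 h1).mul_left C) fun k => ?_
  rw [norm_smul]
  exact expk_coef_bound hc hφ k

/-- Termwise differentiation costs one more power of `|k|`, which the loss `δ` in the width of the
strip absorbs. -/
theorem hasFDerivAt_expk_series [CompleteSpace E] {C a ρ δ : ℝ} (ha : 0 < a) (h0 : 0 < δ) (h1 : δ ≤ 1)
    {c : (Fin n → ℤ) → E}
    (hc : ∀ k, ‖c k‖ ≤ C * ((1 + intNorm k) ^ a * Real.exp (-ρ * intNorm k))) {φ : Fin n → ℂ}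
    (hφ : φ ∈ strip n (ρ - δ)) :
    Summable (fun k => ((expk k φ • (Complex.I • dotCLM k)).smulRight (c k))) ∧
    HasFDerivAt (fun φ => ∑' k, expk k φ • c k)
      (∑' k, (expk k φ • (Complex.I • dotCLM k)).smulRight (c k)) φ := by
  have hb : ∀ (k : Fin n → ℤ) (ψ : Fin n → ℂ), ψ ∈ strip n (ρ - δ) →
      ‖(expk k ψ • (Complex.I • dotCLM k)).smulRight (c k)‖ ≤
        C * ((1 + intNorm k) ^ (a + 1) * Real.exp (-δ * intNorm k)) := by
    intro k ψ hψ
    have hk := intNorm_nonneg k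
    rw [ContinuousLinearMap.norm_smulRight_apply, norm_smul, norm_smul, Complex.norm_I, one_mul]
    have h2 := expk_coef_bound hc hψ k
    rw [Real.rpow_add_one (by positivity)]
    calc ‖expk k ψ‖ * ‖dotCLM k‖ * ‖c k‖ = (‖expk k ψ‖ * ‖c k‖) * ‖dotCLM k‖ := by ring
      _ ≤ (‖expk k ψ‖ * ‖c k‖) * (1 + intNorm k) := by
        gcongr
        linarith [norm_dotCLM_le k]
      _ ≤ C * ((1 + intNorm k) ^ a * Real.exp (-δ * intNorm k)) * (1 + intNorm k) := by gcongr
      _ = _ := by ring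
  have hs := (summable_rpow_exp n (by linarith : 0 < a + 1) h0 h1).mul_left C
  refine ⟨Summable.of_norm_bounded hs fun k => hb k φ hφ, ?_⟩
  exact hasFDerivAt_tsum_of_isPreconnected hs (isOpen_strip n _) (convex_strip n _).isPreconnected
    (fun k ψ _ => hasFDerivAt_expk_smul k (c k) ψ) hb hφ (summable_expk_smul ha h0 h1 hc hφ) hφ

theorem hasDerivAt_along {f : (Fin n → ℂ) → E} {f' : (Fin n → ℂ) →L[ℂ] E} {φ : Fin n → ℂ}
    (h : HasFDerivAt f f' φ) (ω : Fin n → ℝ) :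
    HasDerivAt (fun t : ℝ => f (φ + realAngle (t • ω))) (f' (realAngle ω)) 0 := by
  simp only [realAngle_smul]
  have h1 : HasDerivAt (fun t : ℝ => φ + (t : ℂ) • realAngle ω) (realAngle ω) (0 : ℝ) := by
    have := ((hasDerivAt_id (0 : ℝ)).ofReal_comp.smul_const (realAngle ω)).const_add φ
    simpa using this
  have h2 : HasFDerivAt f f' (φ + ((0 : ℝ) : ℂ) • realAngle ω) := by simpa using h
  exact (h2.restrictScalars ℝ).comp_hasDerivAt (0 : ℝ) h1

theorem hasDerivAt_expk_series [CompleteSpace E] {C a ρ δ : ℝ} (ha : 0 < a) (h0 : 0 < δ) (h1 : δ ≤ 1)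
    {c : (Fin n → ℤ) → E}
    (hc : ∀ k, ‖c k‖ ≤ C * ((1 + intNorm k) ^ a * Real.exp (-ρ * intNorm k))) {φ : Fin n → ℂ}
    (hφ : φ ∈ strip n (ρ - δ)) (ω : Fin n → ℝ) :
    ∃ D : E, HasDerivAt (fun t : ℝ => ∑' k, expk k (φ + realAngle (t • ω)) • c k) D 0 ∧
      HasSum (fun k => (Complex.I * ((∑ m, ω m * (k m : ℝ) : ℝ) : ℂ)) • expk k φ • c k) D := by
  obtain ⟨hs, hd⟩ := hasFDerivAt_expk_series ha h0 h1 hc hφ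
  refine ⟨_, hasDerivAt_along hd ω, ?_⟩
  have := (ContinuousLinearMap.apply ℂ E (realAngle ω)).hasSum hs.hasSum
  simp only [ContinuousLinearMap.apply_apply] at this
  convert this using 2 with k
  simp only [ContinuousLinearMap.smulRight_apply, dotCLM_apply,
    smul_apply, smul_eq_mul, smul_smul]
  congr 1
  have : (∑ m, (k m : ℂ) * realAngle ω m) = ((∑ m, ω m * (k m : ℝ) : ℝ) : ℂ) := by
    push_cast
    exact Finset.sum_congr rfl fun m _ => by simp [realAngle, mul_comm]
  rw [this]; ring

theorem stripPeriodic_expk_series {r : ℝ} (c : (Fin n → ℤ) → E) :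
    StripPeriodic r (fun φ => ∑' k, expk k φ • c k) := by
  intro φ hφ m
  simp only [stripPeriodic_expk _ r φ hφ m]

theorem norm_expk_series_le {C a B ρ δ : ℝ} (hC0 : 0 ≤ C) {c : (Fin n → ℤ) → E}
    (hB : ∀ T : Finset (Fin n → ℤ), ∑ k ∈ T, (1 + intNorm k) ^ a * Real.exp (-δ * intNorm k) ≤ B)
    (hc : ∀ k, ‖c k‖ ≤ C * ((1 + intNorm k) ^ a * Real.exp (-ρ * intNorm k))) {φ : Fin n → ℂ}
    (hφ : φ ∈ strip n (ρ - δ)) : ‖∑' k, expk k φ • c k‖ ≤ C * B := by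
  have hnn : ∀ k : Fin n → ℤ, 0 ≤ (1 + intNorm k) ^ a * Real.exp (-δ * intNorm k) := by
    intro k
    have := intNorm_nonneg k
    positivity
  have hs := (summable_of_sum_le hnn hB).mul_left C
  refine (tsum_of_norm_bounded (f := fun k => expk k φ • c k) hs.hasSum fun k => ?_).trans ?_
  · rw [norm_smul]
    exact expk_coef_bound hc hφ k
  · rw [tsum_mul_left]
    gcongr
    exact Real.tsum_le_of_sum_le hnn hB

end ExpSeries

/-! ### The homological equation -/

open Classical in
/-- The operator with matrix `m_ij * a_ij`, if there is one. -/
def schurMul (m : ℕ+ → ℕ+ → ℂ) (a : EllOp) : EllOp :=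
  if h : ∃ b : EllOp, ∀ i j, entry b i j = m i j * entry a i j then h.choose else 0

theorem schurMul_spec {m : ℕ+ → ℕ+ → ℂ} {c : ℝ} (hc : 0 ≤ c)
    (hm : ∀ i j : ℕ+, ‖m i j‖ ≤ c / max 1 |(i : ℝ) - (j : ℝ)|) (a : EllOp) :
    (∀ i j, entry (schurMul m a) i j = m i j * entry a i j) ∧
      ‖schurMul m a‖ ≤ schurConst * c * ‖a‖ := by
  obtain ⟨b, hb, hbn⟩ := exists_schur_multiplier m c hc hm a
  have h : ∃ b : EllOp, ∀ i j, entry b i j = m i j * entry a i j := ⟨b, hb⟩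
  have e : schurMul m a = b := by
    rw [schurMul, dif_pos h]
    exact ellOp_ext fun i j => by rw [h.choose_spec, hb]
  rw [e]
  exact ⟨hb, hbn⟩

theorem norm_schurMul_sub_le {m m' : ℕ+ → ℕ+ → ℂ} {c c' : ℝ} (hc : 0 ≤ c) (hc' : 0 ≤ c')
    (hm : ∀ i j : ℕ+, ‖m i j‖ ≤ c / max 1 |(i : ℝ) - (j : ℝ)|)
    (hm' : ∀ i j : ℕ+, ‖m' i j‖ ≤ c / max 1 |(i : ℝ) - (j : ℝ)|)
    (hd : ∀ i j : ℕ+, ‖m i j - m' i j‖ ≤ c' / max 1 |(i : ℝ) - (j : ℝ)|) (a a' : EllOp) :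
    ‖schurMul m a - schurMul m' a'‖ ≤ schurConst * c * ‖a - a'‖ + schurConst * c' * ‖a'‖ := by
  have h1 := schurMul_spec hc hm (a - a')
  have h2 := schurMul_spec hc' hd a'
  have e : schurMul m a - schurMul m' a' =
      schurMul m (a - a') + schurMul (fun i j => m i j - m' i j) a' := by
    refine ellOp_ext fun i j => ?_
    rw [entry_sub, entry_add, h1.1, h2.1, (schurMul_spec hc hm a).1, (schurMul_spec hc hm' a').1,
      entry_sub]
    ring
  rw [e]
  exact (norm_add_le _ _).trans (add_le_add h1.2 h2.2)

section Homological

variable {n : ℕ}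

/-- The small divisor `λ_i - λ_j + ω·k`. -/
def divisor (lam : ℕ+ → (Fin n → ℝ) → ℝ) (ω : Fin n → ℝ) (k : Fin n → ℤ) (i j : ℕ+) : ℝ :=
  lam i ω - lam j ω + ∑ m, ω m * (k m : ℝ)

/-- The multiplier that solves the homological equation. -/
def homMult (lam : ℕ+ → (Fin n → ℝ) → ℝ) (ω : Fin n → ℝ) (k : Fin n → ℤ) (i j : ℕ+) : ℂ :=
  if i = j ∧ k = 0 then 0 else -((1 / (2 * divisor lam ω k i j) : ℝ) : ℂ)

/-- The solution of the homological equation. -/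
def homSol (lam : ℕ+ → (Fin n → ℝ) → ℝ) (P : (Fin n → ℂ) → (Fin n → ℝ) → EllOp)
    (φ : Fin n → ℂ) (ω : Fin n → ℝ) : EllOp :=
  ∑' k, expk k φ • schurMul (homMult lam ω k) (fcoef (fun φ => P φ ω) k)

/-- The diagonal of the average of `P`. -/
def avgDiag (P : (Fin n → ℂ) → (Fin n → ℝ) → EllOp) (ω : Fin n → ℝ) : EllOp :=
  schurMul (fun i j => if i = j then 1 else 0) (fcoef (fun φ => P φ ω) 0)

theorem avgDiag_mult_bound (i j : ℕ+) :
    ‖(if i = j then (1 : ℂ) else 0)‖ ≤ 1 / max 1 |(i : ℝ) - (j : ℝ)| := by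
  split_ifs with h
  · subst h; simp
  · rw [norm_zero]; positivity

theorem entry_avgDiag (P : (Fin n → ℂ) → (Fin n → ℝ) → EllOp) (ω : Fin n → ℝ) (i j : ℕ+) :
    entry (avgDiag P ω) i j = if i = j then entry (fcoef (fun φ => P φ ω) 0) i i else 0 := by
  rw [avgDiag, (schurMul_spec zero_le_one avgDiag_mult_bound _).1]
  split_ifs with h
  · subst h; simp
  · simp

variable {d τ Γ K₁ : ℝ} {S : Set (Fin n → ℝ)} {lam : ℕ+ → (Fin n → ℝ) → ℝ}

theorem one_add_rpow_le {x : ℝ} (hx : 0 ≤ x) (hτ : 0 ≤ τ) : 1 + x ^ τ ≤ 2 * (1 + x) ^ τ := by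
  have h1 : (1 : ℝ) ≤ (1 + x) ^ τ := Real.one_le_rpow (by linarith) hτ
  have h2 : x ^ τ ≤ (1 + x) ^ τ := Real.rpow_le_rpow hx (by linarith) hτ
  linarith

theorem divisor_lower (hτ : 0 < τ) (hΓ : 0 < Γ) (hmel : MelnikovBound d τ S lam Γ)
    {ω : Fin n → ℝ} (hω : ω ∈ S) {k : Fin n → ℤ} {i j : ℕ+} (h : ¬(i = j ∧ k = 0)) :
    Γ * bracket ((i : ℝ) ^ d - (j : ℝ) ^ d) / (2 * (1 + intNorm k) ^ τ) ≤
      |divisor lam ω k i j| := by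
  have h' : i ≠ j ∨ k ≠ 0 := by
    by_contra! hc
    exact h hc
  refine le_trans ?_ (hmel ω hω i j k h')
  have hx := intNorm_nonneg k
  rw [div_mul_eq_mul_div]
  have := one_le_bracket ((i : ℝ) ^ d - (j : ℝ) ^ d)
  have h2 : 0 < 1 + intNorm k ^ τ := by positivity
  exact div_le_div_of_nonneg_left (by positivity) h2 (one_add_rpow_le hx hτ.le)

/-- The Melnikov condition gains `⟨i^d - j^d⟩ ≥ max 1 |i - j|` in the denominator, exactly the decay
required of a Schur multiplier. -/
theorem norm_homMult_le (hd : 1 ≤ d) (hτ : 0 < τ) (hΓ : 0 < Γ) (hmel : MelnikovBound d τ S lam Γ)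
    {ω : Fin n → ℝ} (hω : ω ∈ S) (k : Fin n → ℤ) (i j : ℕ+) :
    ‖homMult lam ω k i j‖ ≤ ((1 + intNorm k) ^ τ / Γ) / max 1 |(i : ℝ) - (j : ℝ)| := by
  have hx := intNorm_nonneg k
  rw [homMult]
  split_ifs with h
  · rw [norm_zero]; positivity
  · have h1 := divisor_lower hτ hΓ hmel hω h
    have h2 := max_abs_sub_le_bracket hd i j
    have h3 : (0 : ℝ) < max 1 |(i : ℝ) - (j : ℝ)| := by positivity
    set b := bracket ((i : ℝ) ^ d - (j : ℝ) ^ d)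
    have hb : 0 < b := h3.trans_le h2
    have hp : 0 < (1 + intNorm k) ^ τ := by positivity
    rw [norm_neg, Complex.norm_real, Real.norm_eq_abs, abs_div, abs_one, abs_mul, abs_two]
    have hL : 0 < Γ * b / (2 * (1 + intNorm k) ^ τ) := by positivity
    calc 1 / (2 * |divisor lam ω k i j|) ≤ 1 / (2 * (Γ * b / (2 * (1 + intNorm k) ^ τ))) := by
          gcongr
      _ = ((1 + intNorm k) ^ τ / Γ) / b := by field_simp
      _ ≤ _ := by gcongr

/-- A difference of reciprocals has two divisors in the denominator. The variation of the divisor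
itself is at most `(K₁ + 1)(1 + |k|) ⟨i^d - j^d⟩ |Δω|`, so one bracket cancels and one survives; the
price is the power `2τ + 1` of `1 + |k|`. -/
theorem norm_homMult_sub_le (hd : 1 ≤ d) (hτ : 0 < τ) (hΓ : 0 < Γ) (hK₁ : 0 < K₁)
    (hmel : MelnikovBound d τ S lam Γ) (hlip : LipGapBound d S lam K₁)
    {ω ω' : Fin n → ℝ} (hω : ω ∈ S) (hω' : ω' ∈ S) (k : Fin n → ℤ) (i j : ℕ+) :
    ‖homMult lam ω k i j - homMult lam ω' k i j‖ ≤
      (2 * (K₁ + 1) * (1 + intNorm k) ^ (2 * τ + 1) / Γ ^ 2 * ‖ω - ω'‖) /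
        max 1 |(i : ℝ) - (j : ℝ)| := by
  have hx := intNorm_nonneg k
  by_cases hωω : ω = ω'
  · subst hωω; simp
  rw [homMult, homMult]
  split_ifs with h
  · rw [sub_zero, norm_zero]; positivity
  · have h1 := divisor_lower hτ hΓ hmel hω h
    have h1' := divisor_lower hτ hΓ hmel hω' h
    have h2 := max_abs_sub_le_bracket hd i j
    have h3 : (0 : ℝ) < max 1 |(i : ℝ) - (j : ℝ)| := by positivity
    have hg : powGap d i j ≤ bracket ((i : ℝ) ^ d - (j : ℝ) ^ d) := le_max_right _ _
    have hb1 := one_le_bracket ((i : ℝ) ^ d - (j : ℝ) ^ d)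
    set b := bracket ((i : ℝ) ^ d - (j : ℝ) ^ d)
    have hb : 0 < b := h3.trans_le h2
    have hp : 0 < (1 + intNorm k) ^ τ := by positivity
    set p := (1 + intNorm k) ^ τ with hpdef
    set D := divisor lam ω k i j with hD
    set D' := divisor lam ω' k i j with hD'
    have hL : 0 < Γ * b / (2 * p) := by positivity
    have hD0 : D ≠ 0 := abs_pos.1 (hL.trans_le h1)
    have hD0' : D' ≠ 0 := abs_pos.1 (hL.trans_le h1')
    have hdiff : |D' - D| ≤ (K₁ + 1) * (1 + intNorm k) * b * ‖ω - ω'‖ := by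
      have e : D' - D = ((lam i ω' - lam j ω') - (lam i ω - lam j ω)) +
          ∑ m, (ω' m - ω m) * (k m : ℝ) := by
        rw [hD, hD', divisor, divisor]
        simp only [sub_mul, Finset.sum_sub_distrib]
        ring
      rw [e]
      have e1 := hlip ω hω ω' hω' hωω i j
      have e2 := abs_sum_mul_le (fun m => ω' m - ω m) k (c := ‖ω - ω'‖) (fun m => by
        rw [← Real.norm_eq_abs, norm_sub_rev]
        exact norm_le_pi_norm (ω - ω') m)
      rw [norm_sub_rev] at e1
      refine (abs_add_le _ _).trans ((add_le_add e1 e2).trans ?_)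
      have e3 : K₁ * powGap d i j * ‖ω - ω'‖ ≤ K₁ * b * ‖ω - ω'‖ := by gcongr
      have hN := norm_nonneg (ω - ω')
      have e4 : ‖ω - ω'‖ * intNorm k ≤ ‖ω - ω'‖ * intNorm k * b :=
        le_mul_of_one_le_right (by positivity) hb1
      have e5 : 0 ≤ (K₁ * intNorm k + 1) * b * ‖ω - ω'‖ := by positivity
      nlinarith
    have e : (-((1 / (2 * D) : ℝ) : ℂ)) - (-((1 / (2 * D') : ℝ) : ℂ)) =
        ((-((D' - D) / (2 * (D * D'))) : ℝ) : ℂ) := by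
      rw [← Complex.ofReal_neg, ← Complex.ofReal_neg, ← Complex.ofReal_sub]
      congr 1
      field_simp
      ring
    rw [e, Complex.norm_real, Real.norm_eq_abs, abs_neg, abs_div, abs_mul, abs_mul, abs_two]
    have hpp : (1 + intNorm k) ^ (2 * τ + 1) = (1 + intNorm k) * p ^ 2 := by
      rw [Real.rpow_add_one (by positivity), two_mul, Real.rpow_add (by positivity), ← hpdef]
      ring
    calc |D' - D| / (2 * (|D| * |D'|))
        ≤ ((K₁ + 1) * (1 + intNorm k) * b * ‖ω - ω'‖) /
          (2 * ((Γ * b / (2 * p)) * (Γ * b / (2 * p)))) := by gcongr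
      _ = (2 * (K₁ + 1) * (1 + intNorm k) ^ (2 * τ + 1) / Γ ^ 2 * ‖ω - ω'‖) / b := by
        rw [hpp]; field_simp
      _ ≤ _ := by gcongr

variable {P : (Fin n → ℂ) → (Fin n → ℝ) → EllOp} {ρ e M : ℝ}

theorem norm_homCoef_le (hρ : 0 < ρ) (hd : 1 ≤ d) (hτ : 0 < τ) (hΓ : 0 < Γ)
    (hmel : MelnikovBound d τ S lam Γ) (hP : Ctl ρ S P e M) {ω : Fin n → ℝ} (hω : ω ∈ S)
    (k : Fin n → ℤ) :
    ‖schurMul (homMult lam ω k) (fcoef (fun φ => P φ ω) k)‖ ≤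
      (schurConst / Γ * e) * ((1 + intNorm k) ^ τ * Real.exp (-ρ * intNorm k)) := by
  have hx := intNorm_nonneg k
  have h0 := schurConst_nonneg
  refine (schurMul_spec (by positivity) (norm_homMult_le hd hτ hΓ hmel hω k) _).2.trans ?_
  have h1 := norm_fcoef_le hρ (hP.periodic ω hω) (hP.analytic ω hω) (hP.sup ω hω) k
  calc _ ≤ schurConst * ((1 + intNorm k) ^ τ / Γ) * (e * Real.exp (-ρ * intNorm k)) := by gcongr
    _ = _ := by ring

theorem norm_homCoef_sub_le (hρ : 0 < ρ) (hd : 1 ≤ d) (hτ : 0 < τ) (hΓ : 0 < Γ) (hK₁ : 0 < K₁)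
    (hmel : MelnikovBound d τ S lam Γ) (hlip : LipGapBound d S lam K₁) (hP : Ctl ρ S P e M)
    {ω ω' : Fin n → ℝ} (hω : ω ∈ S) (hω' : ω' ∈ S) (k : Fin n → ℤ) :
    ‖schurMul (homMult lam ω k) (fcoef (fun φ => P φ ω) k) -
        schurMul (homMult lam ω' k) (fcoef (fun φ => P φ ω') k)‖ ≤
      (schurConst / Γ * e * M * ‖ω - ω'‖) * ((1 + intNorm k) ^ τ * Real.exp (-ρ * intNorm k)) +
      (schurConst * (2 * (K₁ + 1)) / Γ ^ 2 * e * ‖ω - ω'‖) *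
        ((1 + intNorm k) ^ (2 * τ + 1) * Real.exp (-ρ * intNorm k)) := by
  have hx := intNorm_nonneg k
  have h0 := schurConst_nonneg
  have h1 := norm_fcoef_le hρ (hP.periodic ω' hω') (hP.analytic ω' hω') (hP.sup ω' hω') k
  have h2 : ‖fcoef (fun φ => P φ ω) k - fcoef (fun φ => P φ ω') k‖ ≤
      (e * M * ‖ω - ω'‖) * Real.exp (-ρ * intNorm k) := by
    rw [← fcoef_sub hρ (hP.periodic ω hω) (hP.periodic ω' hω') (hP.analytic ω hω).continuousOn
      (hP.analytic ω' hω').continuousOn]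
    refine norm_fcoef_le hρ (fun φ hφ m => ?_) ((hP.analytic ω hω).sub (hP.analytic ω' hω'))
      (hP.lip ω hω ω' hω') k
    have e1 : P (φ + Pi.single m ((2 * Real.pi : ℝ) : ℂ)) ω = P φ ω :=
            hP.periodic ω hω φ hφ m
    have e2 : P (φ + Pi.single m ((2 * Real.pi : ℝ) : ℂ)) ω' = P φ ω' :=
            hP.periodic ω' hω' φ hφ m
    change P (φ + Pi.single m ((2 * Real.pi : ℝ) : ℂ)) ω - P (φ + Pi.single m ((2 * Real.pi : ℝ) : ℂ)) ω' = P φ ω - P φ ω'; rw [e1, e2]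
  refine (norm_schurMul_sub_le (by positivity) (by positivity) (norm_homMult_le hd hτ hΓ hmel hω k)
    (norm_homMult_le hd hτ hΓ hmel hω' k)
    (norm_homMult_sub_le hd hτ hΓ hK₁ hmel hlip hω hω' k) _ _).trans ?_
  calc _ ≤ schurConst * ((1 + intNorm k) ^ τ / Γ) *
        ((e * M * ‖ω - ω'‖) * Real.exp (-ρ * intNorm k)) +
        schurConst * (2 * (K₁ + 1) * (1 + intNorm k) ^ (2 * τ + 1) / Γ ^ 2 * ‖ω - ω'‖) *
          (e * Real.exp (-ρ * intNorm k)) := by gcongr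
    _ = _ := by ring

/-- Bounds on the solution of the homological equation. -/
theorem exists_homSol_bound (n : ℕ) (hd : 1 ≤ d) (hτ : 0 < τ) (hΓ : 0 < Γ) (hK₁ : 0 < K₁) :
    ∃ C : ℝ, 0 < C ∧ ∀ (S : Set (Fin n → ℝ)) (lam : ℕ+ → (Fin n → ℝ) → ℝ)
      (P : (Fin n → ℂ) → (Fin n → ℝ) → EllOp) (ρ δ e M L : ℝ), 0 < δ → δ ≤ 1 → δ < ρ → 0 ≤ e →
      0 ≤ M → 0 ≤ L → 1 / δ ^ (τ + 1) ≤ L * M → MelnikovBound d τ S lam Γ →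
      LipGapBound d S lam K₁ → Ctl ρ S P e M →
      Ctl (ρ - δ) S (homSol lam P) (C * (1 + L) * e / δ ^ ((n : ℝ) + τ)) M := by
  obtain ⟨C₁, hC₁, hB₁⟩ := exists_sum_rpow_exp_le n hτ
  obtain ⟨C₂, hC₂, hB₂⟩ := exists_sum_rpow_exp_le n (a := 2 * τ + 1) (by linarith)
  have h0 := schurConst_nonneg
  set A := schurConst / Γ * C₁ + schurConst * (2 * (K₁ + 1)) / Γ ^ 2 * C₂ + 1 with hA
  have hA1 : schurConst / Γ * C₁ ≤ A := by
    have : 0 ≤ schurConst * (2 * (K₁ + 1)) / Γ ^ 2 * C₂ := by positivity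
    linarith
  have hA2 : schurConst * (2 * (K₁ + 1)) / Γ ^ 2 * C₂ ≤ A := by
    have : 0 ≤ schurConst / Γ * C₁ := by positivity
    linarith
  refine ⟨A, by positivity, ?_⟩
  intro S lam P ρ δ e M L hδ hδ1 hδρ he hM hL hLM hmel hlip hP
  have hρ : 0 < ρ := hδ.trans hδρ
  have hcoef := fun ω (hω : ω ∈ S) => norm_homCoef_le hρ hd hτ hΓ hmel hP hω
  have hA0 : 0 < A := by positivity
  refine ⟨fun ω hω => stripPeriodic_expk_series (r := ρ - δ)
      (fun k => schurMul (homMult lam ω k) (fcoef (fun φ => P φ ω) k)), fun ω hω φ hφ => ?_, fun ω hω φ hφ => ?_,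
    fun ω hω ω' hω' φ hφ => ?_⟩
  · exact (hasFDerivAt_expk_series hτ hδ hδ1 (hcoef ω hω) hφ).2.differentiableAt.differentiableWithinAt
  · refine (norm_expk_series_le (by positivity) (hB₁ δ hδ hδ1) (hcoef ω hω) hφ).trans ?_
    calc schurConst / Γ * e * (C₁ / δ ^ ((n : ℝ) + τ))
        = (schurConst / Γ * C₁) * e / δ ^ ((n : ℝ) + τ) := by ring
      _ ≤ A * e / δ ^ ((n : ℝ) + τ) := by gcongr
      _ ≤ A * (1 + L) * e / δ ^ ((n : ℝ) + τ) := by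
        gcongr
        exact le_mul_of_one_le_right hA0.le (by linarith)
  · have hs := (summable_expk_smul hτ hδ hδ1 (hcoef ω hω) hφ)
    have hs' := (summable_expk_smul hτ hδ hδ1 (hcoef ω' hω') hφ)
    rw [homSol, homSol, ← hs.tsum_sub hs']
    simp only [← smul_sub]
    set c := fun k => schurMul (homMult lam ω k) (fcoef (fun φ => P φ ω) k) -
      schurMul (homMult lam ω' k) (fcoef (fun φ => P φ ω') k) with hc
    have hcb : ∀ k, ‖expk k φ‖ * ‖c k‖ ≤
        (schurConst / Γ * e * M * ‖ω - ω'‖) * ((1 + intNorm k) ^ τ * Real.exp (-δ * intNorm k)) +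
        (schurConst * (2 * (K₁ + 1)) / Γ ^ 2 * e * ‖ω - ω'‖) *
        ((1 + intNorm k) ^ (2 * τ + 1) * Real.exp (-δ * intNorm k)) := by
      intro k
      have h1 := norm_homCoef_sub_le hρ hd hτ hΓ hK₁ hmel hlip hP hω hω' k
      have h2 := norm_expk_le k hφ
      have h3 : Real.exp ((ρ - δ) * intNorm k) * Real.exp (-ρ * intNorm k) =
          Real.exp (-δ * intNorm k) := by rw [← Real.exp_add]; congr 1; ring
      refine (mul_le_mul h2 h1 (norm_nonneg _) (Real.exp_pos _).le).trans (le_of_eq ?_)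
      rw [← h3]; ring
    have hT : ∀ T : Finset (Fin n → ℤ), ∑ k ∈ T, ‖expk k φ • c k‖ ≤
        (schurConst / Γ * e * M * ‖ω - ω'‖) * (C₁ / δ ^ ((n : ℝ) + τ)) +
        (schurConst * (2 * (K₁ + 1)) / Γ ^ 2 * e * ‖ω - ω'‖) *
          (C₂ / δ ^ ((n : ℝ) + (2 * τ + 1))) := by
      intro T
      calc ∑ k ∈ T, ‖expk k φ • c k‖ ≤ ∑ k ∈ T, ((schurConst / Γ * e * M * ‖ω - ω'‖) *
            ((1 + intNorm k) ^ τ * Real.exp (-δ * intNorm k)) +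
            (schurConst * (2 * (K₁ + 1)) / Γ ^ 2 * e * ‖ω - ω'‖) *
            ((1 + intNorm k) ^ (2 * τ + 1) * Real.exp (-δ * intNorm k))) :=
            Finset.sum_le_sum fun k _ => by rw [norm_smul]; exact hcb k
        _ ≤ _ := by
            rw [Finset.sum_add_distrib, ← Finset.mul_sum, ← Finset.mul_sum]
            gcongr
            · exact hB₁ δ hδ hδ1 T
            · exact hB₂ δ hδ hδ1 T
    have hsn : Summable (fun k => ‖expk k φ • c k‖) :=
      summable_of_sum_le (fun _ => norm_nonneg _) hT
    refine (norm_tsum_le_tsum_norm hsn).trans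
      ((Real.tsum_le_of_sum_le (fun _ => norm_nonneg _) hT).trans ?_)
    -- The Lipschitz bound costs `δ ^ (-(τ + 1))` more than the sup bound; the hypothesis `hLM`
    -- absorbs this into `L * M`.
    have hsplit : δ ^ ((n : ℝ) + (2 * τ + 1)) = δ ^ ((n : ℝ) + τ) * δ ^ (τ + 1) := by
      rw [← Real.rpow_add hδ]; congr 1; ring
    have hX : 0 < δ ^ ((n : ℝ) + τ) := by positivity
    set X := δ ^ ((n : ℝ) + τ)
    calc _ = ((schurConst / Γ * C₁) * M + (schurConst * (2 * (K₁ + 1)) / Γ ^ 2 * C₂) *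
          (1 / δ ^ (τ + 1))) * (e * ‖ω - ω'‖ / X) := by
          rw [hsplit]; field_simp
      _ ≤ (A * M + A * (L * M)) * (e * ‖ω - ω'‖ / X) := by gcongr
      _ = _ := by ring

theorem avgDiag_ctl (hρ : 0 < ρ) (hP : Ctl ρ S P e M) :
    Ctl ρ S (fun _ ω => avgDiag P ω) (schurConst * e) M := by
  have h0 := schurConst_nonneg
  have hz : intNorm (0 : Fin n → ℤ) = 0 := by simp [intNorm]
  have hb : ∀ i j : ℕ+, ‖(fun i j : ℕ+ => if i = j then (1 : ℂ) else 0) i j -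
      (fun i j : ℕ+ => if i = j then (1 : ℂ) else 0) i j‖ ≤ 0 / max 1 |(i : ℝ) - (j : ℝ)| := by
    intro i j; simp
  refine ⟨fun _ _ _ _ _ => rfl, fun _ _ => differentiableOn_const _, fun ω hω φ hφ => ?_,
    fun ω hω ω' hω' φ hφ => ?_⟩
  · refine (schurMul_spec zero_le_one avgDiag_mult_bound _).2.trans ?_
    have h1 := norm_fcoef_le hρ (hP.periodic ω hω) (hP.analytic ω hω) (hP.sup ω hω) 0
    rw [hz, mul_zero, Real.exp_zero, mul_one] at h1
    rw [mul_one]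
    gcongr
  · refine (norm_schurMul_sub_le zero_le_one le_rfl avgDiag_mult_bound avgDiag_mult_bound hb _ _).trans ?_
    have h2 : ‖fcoef (fun φ => P φ ω) 0 - fcoef (fun φ => P φ ω') 0‖ ≤ e * M * ‖ω - ω'‖ := by
      rw [← fcoef_sub hρ (hP.periodic ω hω) (hP.periodic ω' hω') (hP.analytic ω hω).continuousOn
        (hP.analytic ω' hω').continuousOn]
      have := norm_fcoef_le hρ (F := fun φ => P φ ω - P φ ω') (fun φ hφ m => by
          have e1 : P (φ + Pi.single m ((2 * Real.pi : ℝ) : ℂ)) ω = P φ ω :=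
            hP.periodic ω hω φ hφ m
          have e2 : P (φ + Pi.single m ((2 * Real.pi : ℝ) : ℂ)) ω' = P φ ω' :=
            hP.periodic ω' hω' φ hφ m
          change P (φ + Pi.single m ((2 * Real.pi : ℝ) : ℂ)) ω - P (φ + Pi.single m ((2 * Real.pi : ℝ) : ℂ)) ω' = P φ ω - P φ ω'; rw [e1, e2]) ((hP.analytic ω hω).sub (hP.analytic ω' hω'))
        (hP.lip ω hω ω' hω') 0
      rwa [hz, mul_zero, Real.exp_zero, mul_one] at this
    calc _ ≤ schurConst * 1 * (e * M * ‖ω - ω'‖) + schurConst * 0 * _ := by gcongr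
      _ = _ := by ring

/-- Single entries are bounded without the factor `schurConst` of `avgDiag_ctl`; these are the
numbers that move the eigenvalues. -/
theorem norm_avgDiag_entry_le (hρ : 0 < ρ) (hP : Ctl ρ S P e M) {ω : Fin n → ℝ} (hω : ω ∈ S)
    (i : ℕ+) : ‖entry (avgDiag P ω) i i‖ ≤ e := by
  have hz : intNorm (0 : Fin n → ℤ) = 0 := by simp [intNorm]
  rw [entry_avgDiag, if_pos rfl]
  have h1 := norm_fcoef_le hρ (hP.periodic ω hω) (hP.analytic ω hω) (hP.sup ω hω) 0
  rw [hz, mul_zero, Real.exp_zero, mul_one] at h1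
  exact (norm_entry_le _ _ _).trans h1

theorem norm_avgDiag_entry_sub_le (hρ : 0 < ρ) (hP : Ctl ρ S P e M) {ω ω' : Fin n → ℝ} (hω : ω ∈ S)
    (hω' : ω' ∈ S) (i : ℕ+) :
    ‖entry (avgDiag P ω) i i - entry (avgDiag P ω') i i‖ ≤ e * M * ‖ω - ω'‖ := by
  have hz : intNorm (0 : Fin n → ℤ) = 0 := by simp [intNorm]
  rw [entry_avgDiag, entry_avgDiag, if_pos rfl, if_pos rfl, ← entry_sub,
    ← fcoef_sub hρ (hP.periodic ω hω) (hP.periodic ω' hω') (hP.analytic ω hω).continuousOn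
    (hP.analytic ω' hω').continuousOn]
  have := norm_fcoef_le hρ (F := fun φ => P φ ω - P φ ω') (fun φ hφ m => by
      have e1 : P (φ + Pi.single m ((2 * Real.pi : ℝ) : ℂ)) ω = P φ ω :=
            hP.periodic ω hω φ hφ m
      have e2 : P (φ + Pi.single m ((2 * Real.pi : ℝ) : ℂ)) ω' = P φ ω' :=
            hP.periodic ω' hω' φ hφ m
      change P (φ + Pi.single m ((2 * Real.pi : ℝ) : ℂ)) ω - P (φ + Pi.single m ((2 * Real.pi : ℝ) : ℂ)) ω' = P φ ω - P φ ω'; rw [e1, e2]) ((hP.analytic ω hω).sub (hP.analytic ω' hω'))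
    (hP.lip ω hω ω' hω') 0
  rw [hz, mul_zero, Real.exp_zero, mul_one] at this
  exact (norm_entry_le _ _ _).trans this

/-- The homological equation. -/
theorem homSol_equation {δ : ℝ} (hδ : 0 < δ) (hδ1 : δ ≤ 1) (hδρ : δ < ρ) (hd : 1 ≤ d) (hτ : 0 < τ)
    (hΓ : 0 < Γ) (hmel : MelnikovBound d τ S lam Γ) (hP : Ctl ρ S P e M) {ω : Fin n → ℝ}
    (hω : ω ∈ S) {φ : Fin n → ℂ} (hφ : φ ∈ strip n (ρ - δ)) :
    ∃ D : EllOp, HasDerivAt (fun t : ℝ => homSol lam P (φ + realAngle (t • ω)) ω) D 0 ∧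
      ∀ i j, ((lam i ω - lam j ω : ℝ) : ℂ) * entry (homSol lam P φ ω) i j - Complex.I * entry D i j =
        (entry (avgDiag P ω) i j - entry (P φ ω) i j) / 2 := by
  have hρ : 0 < ρ := hδ.trans hδρ
  have hcoef := norm_homCoef_le hρ hd hτ hΓ hmel hP hω
  obtain ⟨D, hD, hDs⟩ := hasDerivAt_expk_series hτ hδ hδ1 hcoef hφ ω
  refine ⟨D, hD, fun i j => ?_⟩
  have hY := (entryCLM i j).hasSum (summable_expk_smul hτ hδ hδ1 hcoef hφ).hasSum
  have hD' := (entryCLM i j).hasSum hDs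
  have hent : ∀ k, entry (schurMul (homMult lam ω k) (fcoef (fun φ => P φ ω) k)) i j =
      homMult lam ω k i j * fcoef (fun φ => entry (P φ ω) i j) k := by
    intro k
    have hx := intNorm_nonneg k
    rw [(schurMul_spec (by positivity) (norm_homMult_le hd hτ hΓ hmel hω k) _).1]
    congr 1
    exact fcoef_clm hρ (hP.periodic ω hω) (hP.analytic ω hω).continuousOn (entryCLM i j) k
  simp only [map_smul, smul_eq_mul, entryCLM_apply, hent] at hY hD'
  change HasSum _ (entry (homSol lam P φ ω) i j) at hY
  have hPs := hasSum_fcoef_scalar (F := fun φ => entry (P φ ω) i j) hρ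
    (fun φ hφ m => by
      have e1 : P (φ + Pi.single m ((2 * Real.pi : ℝ) : ℂ)) ω = P φ ω :=
            hP.periodic ω hω φ hφ m
      change entry (P (φ + Pi.single m ((2 * Real.pi : ℝ) : ℂ)) ω) i j = entry (P φ ω) i j; rw [e1])
    ((entryCLM i j).differentiable.comp_differentiableOn (hP.analytic ω hω))
    (fun φ hφ => (norm_entry_le _ i j).trans (hP.sup ω hω φ hφ)) (strip_mono (by linarith) hφ)
  have hlhs := (hY.mul_left ((lam i ω - lam j ω : ℝ) : ℂ)).sub (hD'.mul_left Complex.I)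
  have hz0 : entry (avgDiag P ω) i j = if i = j then fcoef (fun φ => entry (P φ ω) i j) 0 else 0 := by
    rw [entry_avgDiag]
    split_ifs with h
    · subst h
      exact fcoef_clm hρ (hP.periodic ω hω) (hP.analytic ω hω).continuousOn (entryCLM i i) 0
    · rfl
  have hsing : HasSum (fun k : Fin n → ℤ => if k = 0 then entry (avgDiag P ω) i j else 0)
      (entry (avgDiag P ω) i j) := by
    have := hasSum_single (f := fun k : Fin n → ℤ => if k = 0 then entry (avgDiag P ω) i j else 0) 0
      (fun k hk => by simp [hk])
    simpa using this
  have hrhs := (hsing.sub hPs).div_const 2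
  refine hlhs.unique (hrhs.congr_fun fun k => ?_)
  -- For `i = j`, `k = 0` both sides vanish, because `avgDiag` removes that coefficient. Otherwise
  -- the left side is the divisor times the coefficient of the solution, that is, minus half the
  -- coefficient of `P`.
  rw [hz0, homMult]
  by_cases hk : k = 0
  · subst hk
    by_cases hij : i = j
    · subst hij
      simp [expk]
    · simp only [hij, false_and, if_false, if_true]
      have hdv : divisor lam ω 0 i j ≠ 0 := by
        have h1 := divisor_lower hτ hΓ hmel hω (k := 0) (i := i) (j := j) (by tauto)
        have h2 := one_le_bracket ((i : ℝ) ^ d - (j : ℝ) ^ d)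
        have hx := intNorm_nonneg (0 : Fin n → ℤ)
        exact abs_pos.1 (lt_of_lt_of_le (by positivity) h1)
      have e1 : divisor lam ω 0 i j = lam i ω - lam j ω := by simp [divisor]
      have hc : ((lam i ω - lam j ω : ℝ) : ℂ) ≠ 0 := Complex.ofReal_ne_zero.2 (e1 ▸ hdv)
      simp only [e1]
      push_cast at hc ⊢
      simp only [Pi.zero_apply, Int.cast_zero, mul_zero, Finset.sum_const_zero, zero_mul]
      field_simp
      ring
  · simp only [hk, and_false, if_false]
    have hdv : divisor lam ω k i j ≠ 0 := by
      have h1 := divisor_lower hτ hΓ hmel hω (k := k) (i := i) (j := j) (by tauto)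
      have h2 := one_le_bracket ((i : ℝ) ^ d - (j : ℝ) ^ d)
      have hx := intNorm_nonneg k
      exact abs_pos.1 (lt_of_lt_of_le (by positivity) h1)
    have hc : ((divisor lam ω k i j : ℝ) : ℂ) ≠ 0 := by exact_mod_cast hdv
    have e1 : ((∑ m, ω m * (k m : ℝ) : ℝ) : ℂ) =
        ((divisor lam ω k i j : ℝ) : ℂ) - ((lam i ω - lam j ω : ℝ) : ℂ) := by
      rw [← Complex.ofReal_sub]; congr 1; simp [divisor]
    rw [e1]
    generalize ((lam i ω - lam j ω : ℝ) : ℂ) = z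
    push_cast
    field_simp
    linear_combination (expk k φ * fcoef (fun φ => entry (P φ ω) i j) k * ((divisor lam ω k i j : ℝ) : ℂ) -
      expk k φ * fcoef (fun φ => entry (P φ ω) i j) k * z) * Complex.I_sq

/-! ### Hermitian symmetry and the homological equation. -/

theorem conj_fcoef (f : (Fin n → ℂ) → ℂ) (k : Fin n → ℤ) :
    (starRingEnd ℂ) (fcoef f k) = fcoef (fun φ => (starRingEnd ℂ) (f φ)) (-k) := by
  rw [fcoef, fcoef, ← integral_conj]
  congr 1
  funext q
  simp only [smul_eq_mul, map_mul, neg_neg]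
  congr 1
  rw [expk, expk, ← Complex.exp_conj]
  congr 1
  simp [realAngle]

theorem conj_expk_real (k : Fin n → ℤ) (x : Fin n → ℝ) :
    (starRingEnd ℂ) (expk k (realAngle x)) = expk (-k) (realAngle x) := by
  rw [expk, expk, ← Complex.exp_conj]
  congr 1
  simp [realAngle]

theorem fcoef_congr_real {f g : (Fin n → ℂ) → ℂ} (h : ∀ x : Fin n → ℝ, f (realAngle x) = g (realAngle x))
    (k : Fin n → ℤ) : fcoef f k = fcoef g k := by
  simp only [fcoef, h]

/-- The factors `u` and `v` allow for the weights: it is the unweighted matrix that is Hermitian.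
Conjugation exchanges the modes `k` and `-k`. -/
theorem fcoef_hermitian (hρ : 0 < ρ) (hP : Ctl ρ S P e M) {ω : Fin n → ℝ} (hω : ω ∈ S)
    {u v : ℕ+ → ℝ}
    (hH : ∀ (x : Fin n → ℝ) (i j : ℕ+), (u i : ℂ) * entry (P (realAngle x) ω) i j * (v j : ℂ) =
      (starRingEnd ℂ) ((u j : ℂ) * entry (P (realAngle x) ω) j i * (v i : ℂ))) (k : Fin n → ℤ)
    (i j : ℕ+) :
    (u i : ℂ) * entry (fcoef (fun φ => P φ ω) k) i j * (v j : ℂ) =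
      (starRingEnd ℂ) ((u j : ℂ) * entry (fcoef (fun φ => P φ ω) (-k)) j i * (v i : ℂ)) := by
  have key : ∀ (k : Fin n → ℤ) (i j : ℕ+),
      (u i : ℂ) * entry (fcoef (fun φ => P φ ω) k) i j * (v j : ℂ) =
      fcoef (fun φ => (u i : ℂ) * entry (P φ ω) i j * (v j : ℂ)) k := by
    intro k i j
    have := fcoef_clm hρ (hP.periodic ω hω) (hP.analytic ω hω).continuousOn
      (((u i : ℂ) * (v j : ℂ)) • entryCLM i j) k
    simp only [smul_apply, entryCLM_apply, smul_eq_mul] at this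
    rw [mul_right_comm, this]
    congr 1
    funext φ
    ring
  rw [key, key, conj_fcoef, neg_neg]
  exact fcoef_congr_real (fun x => hH x i j) k

theorem avgDiag_hermitian (hρ : 0 < ρ) (hP : Ctl ρ S P e M) {ω : Fin n → ℝ} (hω : ω ∈ S)
    {u v : ℕ+ → ℝ}
    (hH : ∀ (x : Fin n → ℝ) (i j : ℕ+), (u i : ℂ) * entry (P (realAngle x) ω) i j * (v j : ℂ) =
      (starRingEnd ℂ) ((u j : ℂ) * entry (P (realAngle x) ω) j i * (v i : ℂ))) (i j : ℕ+) :
    (u i : ℂ) * entry (avgDiag P ω) i j * (v j : ℂ) =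
      (starRingEnd ℂ) ((u j : ℂ) * entry (avgDiag P ω) j i * (v i : ℂ)) := by
  rw [entry_avgDiag, entry_avgDiag]
  by_cases h : i = j
  · subst h
    simpa using fcoef_hermitian hρ hP hω hH 0 i i
  · simp [h, Ne.symm h]

/-- Passing to the adjoint exchanges `i` with `j` and `k` with `-k`, under which the real divisor
changes sign; so Hermitian data give a skew solution. -/
theorem homSol_skew {δ : ℝ} (hδ : 0 < δ) (hδ1 : δ ≤ 1) (hδρ : δ < ρ) (hd : 1 ≤ d) (hτ : 0 < τ)
    (hΓ : 0 < Γ) (hmel : MelnikovBound d τ S lam Γ) (hP : Ctl ρ S P e M) {ω : Fin n → ℝ}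
    (hω : ω ∈ S) {u v : ℕ+ → ℝ}
    (hH : ∀ (x : Fin n → ℝ) (i j : ℕ+), (u i : ℂ) * entry (P (realAngle x) ω) i j * (v j : ℂ) =
      (starRingEnd ℂ) ((u j : ℂ) * entry (P (realAngle x) ω) j i * (v i : ℂ)))
    (x : Fin n → ℝ) (i j : ℕ+) :
    (u i : ℂ) * entry (homSol lam P (realAngle x) ω) i j * (v j : ℂ) =
      -(starRingEnd ℂ) ((u j : ℂ) * entry (homSol lam P (realAngle x) ω) j i * (v i : ℂ)) := by
  have hρ : 0 < ρ := hδ.trans hδρ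
  have hcoef := norm_homCoef_le hρ hd hτ hΓ hmel hP hω
  have hφ : realAngle x ∈ strip n (ρ - δ) := realAngle_mem_strip (by linarith) x
  have hent : ∀ k i j, entry (schurMul (homMult lam ω k) (fcoef (fun φ => P φ ω) k)) i j =
      homMult lam ω k i j * entry (fcoef (fun φ => P φ ω) k) i j := by
    intro k i j
    have hx := intNorm_nonneg k
    rw [(schurMul_spec (by positivity) (norm_homMult_le hd hτ hΓ hmel hω k) _).1]
  have hY : ∀ i j, HasSum (fun k => expk k (realAngle x) *
      (homMult lam ω k i j * entry (fcoef (fun φ => P φ ω) k) i j))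
      (entry (homSol lam P (realAngle x) ω) i j) := by
    intro i j
    have := (entryCLM i j).hasSum (summable_expk_smul hτ hδ hδ1 hcoef hφ).hasSum
    simpa only [map_smul, smul_eq_mul, entryCLM_apply, hent] using! this
  have h1 := ((hY i j).mul_left (u i : ℂ)).mul_right (v j : ℂ)
  have h2 := ((((hY j i).mul_left (u j : ℂ)).mul_right (v i : ℂ)).map (starRingEnd ℂ)
    Complex.continuous_conj).neg
  rw [← (Equiv.neg (Fin n → ℤ)).hasSum_iff] at h2
  refine h1.unique (h2.congr_fun fun k => ?_)
  simp only [Function.comp_apply, Equiv.neg_apply, map_mul, Complex.conj_ofReal, conj_expk_real,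
    neg_neg]
  have h3 := fcoef_hermitian hρ hP hω hH k i j
  simp only [map_mul, Complex.conj_ofReal] at h3
  have h4 : (starRingEnd ℂ) (homMult lam ω (-k) j i) = -homMult lam ω k i j := by
    rw [homMult, homMult]
    by_cases h : i = j ∧ k = 0
    · rw [if_pos h, if_pos ⟨h.1.symm, by rw [h.2, neg_zero]⟩]; simp
    · rw [if_neg h, if_neg (fun h' => h ⟨h'.1.symm, neg_eq_zero.1 h'.2⟩)]
      have e : divisor lam ω (-k) j i = -divisor lam ω k i j := by
        simp [divisor, Finset.sum_neg_distrib]; ring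
      rw [e, map_neg, Complex.conj_ofReal, neg_neg, ← Complex.ofReal_neg]
      congr 1
      rw [mul_neg, div_neg, neg_neg]
  rw [h4]
  linear_combination (expk k (realAngle x) * homMult lam ω k i j) * h3

end Homological

/-! ### Commutators with a diagonal operator -/

/-- `c` is the commutator of `diag(lam)` with `a`. -/
def IsComm (lam : ℕ+ → ℝ) (a c : EllOp) : Prop :=
  ∀ i j, entry c i j = ((lam i - lam j : ℝ) : ℂ) * entry a i j

section IsComm

variable {lam : ℕ+ → ℝ} {a a' c c' : EllOp}

theorem IsComm.add (h : IsComm lam a c) (h' : IsComm lam a' c') : IsComm lam (a + a') (c + c') :=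
  fun i j => by rw [entry_add, entry_add, h, h']; ring

theorem IsComm.neg (h : IsComm lam a c) : IsComm lam (-a) (-c) :=
  fun i j => by rw [entry_neg, entry_neg, h]; ring

theorem IsComm.mul (h : IsComm lam a c) (h' : IsComm lam a' c') :
    IsComm lam (a * a') (c * a' + a * c') := by
  intro i j
  have h1 := (hasSum_entry_mul_entry c a' i j).add (hasSum_entry_mul_entry a c' i j)
  have h2 := (hasSum_entry_mul_entry a a' i j).mul_left ((lam i - lam j : ℝ) : ℂ)
  rw [entry_add]
  refine h1.unique (h2.congr_fun fun l => ?_)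
  rw [h, h']
  push_cast
  ring

theorem IsComm.of_diagonal (h : ∀ i j, i ≠ j → entry a i j = 0) : IsComm lam a 0 := by
  intro i j
  rw [entry_zero]
  by_cases hij : i = j
  · subst hij; simp
  · rw [h i j hij, mul_zero]

theorem IsComm.of_tendsto {A C : ℕ → EllOp} (h : ∀ N, IsComm lam (A N) (C N))
    (hA : Filter.Tendsto A Filter.atTop (nhds a)) (hC : Filter.Tendsto C Filter.atTop (nhds c)) :
    IsComm lam a c := by
  intro i j
  have h1 := ((continuous_entry i j).tendsto c).comp hC
  have h2 := (((continuous_entry i j).tendsto a).comp hA).const_mul ((lam i - lam j : ℝ) : ℂ)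
  exact tendsto_nhds_unique h1 (h2.congr fun N => (h N i j).symm)

end IsComm

theorem tendsto_zero_of_contraction {e : ℕ → ℝ} {q : ℝ} (h0 : ∀ N, 0 ≤ e N) (hq : 0 ≤ q) (hq1 : q < 1)
    (h : ∀ N, e (N + 1) ≤ q * e N) : Filter.Tendsto e Filter.atTop (nhds 0) := by
  have hb : ∀ N, e N ≤ q ^ N * e 0 := by
    intro N
    induction N with
    | zero => simp
    | succ N ih =>
      calc e (N + 1) ≤ q * e N := h N
        _ ≤ q * (q ^ N * e 0) := by gcongr
        _ = _ := by ring
  refine squeeze_zero h0 hb ?_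
  simpa using (tendsto_pow_atTop_nhds_zero_of_lt_one hq hq1).mul_const (e 0)

theorem tendsto_of_contraction {E : Type*} [NormedAddCommGroup E] {f : ℕ → E} {a : E} {q : ℝ}
    (hq : 0 ≤ q) (hq1 : q < 1) (h : ∀ N, ‖f (N + 1) - a‖ ≤ q * ‖f N - a‖) :
    Filter.Tendsto f Filter.atTop (nhds a) :=
  tendsto_iff_norm_sub_tendsto_zero.2
    (tendsto_zero_of_contraction (fun _ => norm_nonneg _) hq hq1 h)

/-- Fixed points of corresponding contractions correspond to each other. -/
theorem OpRel.of_fixedPoint {s κ : ℝ} {T t : EllOp → EllOp} {a b : EllOp} {q : ℝ} (hq : 0 ≤ q)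
    (hq1 : q < 1) (h : ∀ x y, OpRel s κ x y → OpRel s κ (T x) (t y))
    (hT : ∀ x, ‖T x - a‖ ≤ q * ‖x - a‖) (ht : ∀ y, ‖t y - b‖ ≤ q * ‖y - b‖) : OpRel s κ a b := by
  have hr : ∀ N, OpRel s κ (T^[N] 0) (t^[N] 0) := by
    intro N
    induction N with
    | zero => exact OpRel.zero
    | succ N ih =>
      rw [Function.iterate_succ_apply', Function.iterate_succ_apply']
      exact h _ _ ih
  refine OpRel.of_tendsto hr (tendsto_of_contraction hq hq1 fun N => ?_)
    (tendsto_of_contraction hq hq1 fun N => ?_)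
  · rw [Function.iterate_succ_apply']; exact hT _
  · rw [Function.iterate_succ_apply']; exact ht _

/-- A commutator with an unbounded diagonal is only given entrywise, so the inverse is handled
through its geometric series. The iteration `A ↦ A d y + y` carries its commutator along, both
converge, and `IsComm` is closed under limits. -/
theorem IsComm.mul_inverse_one_sub {lam : ℕ+ → ℝ} {y c d : EllOp} (hy : IsComm lam y c)
    (hd : IsComm lam d 0) (hd1 : ‖d‖ ≤ 1) (hy1 : ‖y‖ ≤ 1 / 4) :
    IsComm lam (y * Ring.inverse (1 - d * y))
      (c * Ring.inverse (1 - d * y) +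
        y * Ring.inverse (1 - d * y) * d * c * Ring.inverse (1 - d * y)) := by
  have hdy : ‖d * y‖ ≤ 1 / 4 := (norm_mul_le _ _).trans (by nlinarith [norm_nonneg y, norm_nonneg d])
  have hu : IsUnit (1 - d * y) := isUnit_one_sub_of_norm_lt (by linarith)
  set G := Ring.inverse (1 - d * y) with hG
  have hGb : G * (1 - d * y) = 1 := Ring.inverse_mul_cancel _ hu
  have hG1 : G = G * d * y + 1 := by rw [← hGb]; noncomm_ring
  set A := y * G with hA
  set C := c * G + A * d * c * G with hC
  have hAf : A = A * d * y + y := by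
    rw [hA]; nth_rewrite 1 [hG1]; noncomm_ring
  have hCf : C = C * d * y + A * d * c + c := by
    rw [hC]; nth_rewrite 1 [hG1]; nth_rewrite 2 [hG1]; noncomm_ring
  clear_value C A G
  obtain ⟨f, hf0, hf⟩ : ∃ f : ℕ → EllOp × EllOp, f 0 = (0, 0) ∧
      ∀ N, f (N + 1) = ((f N).1 * d * y + y, (f N).2 * d * y + (f N).1 * d * c + c) :=
    ⟨fun N => Nat.rec (0, 0) (fun _ p => (p.1 * d * y + y, p.2 * d * y + p.1 * d * c + c)) N,
      rfl, fun _ => rfl⟩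
  have hr : ∀ N, IsComm lam (f N).1 (f N).2 := by
    intro N
    induction N with
    | zero => intro i j; simp [hf0, entry_zero]
    | succ N ih =>
      rw [hf]
      have := ((ih.mul hd).mul hy).add hy
      simpa only [mul_zero, add_zero] using this
  have e1 : ∀ N, (f (N + 1)).1 - A = ((f N).1 - A) * d * y := by
    intro N
    rw [hf]; nth_rewrite 1 [hAf]; noncomm_ring
  have e2 : ∀ N, (f (N + 1)).2 - C = ((f N).2 - C) * d * y + ((f N).1 - A) * d * c := by
    intro N
    rw [hf]; nth_rewrite 1 [hCf]; noncomm_ring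
  have n1 : ∀ x z : EllOp, ‖x * d * z‖ ≤ ‖x‖ * ‖z‖ := fun x z =>
    (norm_mul_le _ _).trans (mul_le_mul_of_nonneg_right
      ((norm_mul_le _ _).trans (mul_le_of_le_one_right (norm_nonneg _) hd1)) (norm_nonneg _))
  have b1 : ∀ N, ‖(f (N + 1)).1 - A‖ ≤ 1 / 4 * ‖(f N).1 - A‖ := by
    intro N
    rw [e1]
    nlinarith [n1 ((f N).1 - A) y, norm_nonneg ((f N).1 - A)]
  -- The error of the commutators is fed by that of the operators; the weight `4 ‖c‖` makes the sum
  -- of both contract by `1 / 2`.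
  have b2 : ∀ N, ‖(f (N + 1)).2 - C‖ + 4 * ‖c‖ * ‖(f (N + 1)).1 - A‖ ≤
      1 / 2 * (‖(f N).2 - C‖ + 4 * ‖c‖ * ‖(f N).1 - A‖) := by
    intro N
    have h1 : ‖(f (N + 1)).2 - C‖ ≤ ‖(f N).2 - C‖ * ‖y‖ + ‖(f N).1 - A‖ * ‖c‖ := by
      rw [e2]
      exact (norm_add_le _ _).trans (add_le_add (n1 _ _) (n1 _ _))
    have h2 : ‖(f N).2 - C‖ * ‖y‖ ≤ ‖(f N).2 - C‖ * (1 / 4) := by gcongr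
    have h3 : ‖c‖ * ‖(f (N + 1)).1 - A‖ ≤ ‖c‖ * (1 / 4 * ‖(f N).1 - A‖) := by
      gcongr; exact b1 N
    nlinarith [norm_nonneg ((f N).2 - C)]
  have t1 := tendsto_of_contraction (E := EllOp) (f := fun N => (f N).1) (a := A)
    (q := 1 / 4) (by norm_num) (by norm_num) b1
  have t2 := tendsto_zero_of_contraction
    (e := fun N => ‖(f N).2 - C‖ + 4 * ‖c‖ * ‖(f N).1 - A‖) (q := 1 / 2) (fun N => by positivity) (by norm_num)
    (by norm_num) b2
  refine IsComm.of_tendsto hr t1 (tendsto_iff_norm_sub_tendsto_zero.2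
    (squeeze_zero (fun _ => norm_nonneg _) (fun N => ?_) t2))
  have : 0 ≤ 4 * ‖c‖ * ‖(f N).1 - A‖ := by positivity
  linarith

/-! ### The derivation `[diag(lam), ·] - i d/dt` -/

/-- At time `0` the derivation `[diag(lam), ·] - i d/dt` takes the curve `T` to `R`. -/
def Gen (lam : ℕ+ → ℝ) (T : ℝ → EllOp) (R : EllOp) : Prop :=
  ∃ T' : EllOp, HasDerivAt T T' 0 ∧ IsComm lam (T 0) (R + Complex.I • T')

section Gen

variable {lam : ℕ+ → ℝ} {T T₁ : ℝ → EllOp} {R R₁ : EllOp}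

theorem Gen.add (h : Gen lam T R) (h₁ : Gen lam T₁ R₁) :
    Gen lam (fun t => T t + T₁ t) (R + R₁) := by
  obtain ⟨T', hT, hC⟩ := h
  obtain ⟨T₁', hT₁, hC₁⟩ := h₁
  refine ⟨T' + T₁', hT.add hT₁, ?_⟩
  have := hC.add hC₁
  rw [smul_add, add_add_add_comm]
  exact this

theorem Gen.neg (h : Gen lam T R) : Gen lam (fun t => -T t) (-R) := by
  obtain ⟨T', hT, hC⟩ := h
  refine ⟨-T', hT.neg, ?_⟩
  have := hC.neg
  rw [smul_neg, ← neg_add]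
  exact this

theorem Gen.sub (h : Gen lam T R) (h₁ : Gen lam T₁ R₁) :
    Gen lam (fun t => T t - T₁ t) (R - R₁) := by
  simpa only [sub_eq_add_neg] using h.add h₁.neg

theorem Gen.mul (h : Gen lam T R) (h₁ : Gen lam T₁ R₁) :
    Gen lam (fun t => T t * T₁ t) (R * T₁ 0 + T 0 * R₁) := by
  obtain ⟨T', hT, hC⟩ := h
  obtain ⟨T₁', hT₁, hC₁⟩ := h₁
  refine ⟨T' * T₁ 0 + T 0 * T₁', hT.mul hT₁, ?_⟩
  have := hC.mul hC₁
  have e : R * T₁ 0 + T 0 * R₁ + Complex.I • (T' * T₁ 0 + T 0 * T₁') =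
      (R + Complex.I • T') * T₁ 0 + T 0 * (R₁ + Complex.I • T₁') := by
    rw [add_mul, mul_add, smul_add, smul_mul_assoc, mul_smul_comm]; abel
  rw [e]
  exact this

theorem Gen.const {d : EllOp} (hd : IsComm lam d 0) : Gen lam (fun _ => d) 0 :=
  ⟨0, hasDerivAt_const _ _, by simpa using hd⟩

theorem Gen.mul_inverse_one_sub {d : EllOp} (h : Gen lam T R) (hd : IsComm lam d 0) (hd1 : ‖d‖ ≤ 1)
    (hT1 : ‖T 0‖ ≤ 1 / 4) :
    Gen lam (fun t => T t * Ring.inverse (1 - d * T t))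
      (R * Ring.inverse (1 - d * T 0) +
        T 0 * Ring.inverse (1 - d * T 0) * d * R * Ring.inverse (1 - d * T 0)) := by
  obtain ⟨T', hT, hC⟩ := h
  have hdy : ‖d * T 0‖ < 1 :=
    ((norm_mul_le _ _).trans (by nlinarith [norm_nonneg (T 0), norm_nonneg d])).trans_lt
      (by norm_num : (1 / 4 : ℝ) < 1)
  obtain ⟨w, hw⟩ := isUnit_one_sub_of_norm_lt hdy
  have h1 : HasDerivAt (fun t => 1 - d * T t) (-(d * T')) 0 := by
    simpa using (hT.const_mul d).const_sub 1
  have h2 : HasFDerivAt Ring.inverse (-ContinuousLinearMap.mulLeftRight ℝ EllOp ↑w⁻¹ ↑w⁻¹)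
      (1 - d * T 0) := hw ▸ hasFDerivAt_ringInverse w
  have h3 := h2.comp_hasDerivAt (0 : ℝ) h1
  set G := Ring.inverse (1 - d * T 0) with hG
  have hwG : (↑w⁻¹ : EllOp) = G := by rw [hG, ← hw, Ring.inverse_unit]
  have h4 := hT.mul h3
  refine ⟨_, h4, ?_⟩
  have := hC.mul_inverse_one_sub hd hd1 hT1
  convert this using 1
  simp only [neg_apply, ContinuousLinearMap.mulLeftRight_apply, hwG, Function.comp_apply,
    mul_neg, neg_mul, neg_neg, ← hG]
  simp only [smul_add, mul_add, add_mul, smul_mul_assoc, mul_smul_comm, mul_assoc]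
  abel

/-- Change of the diagonal operator. -/
theorem Gen.shift {lam' q : ℕ+ → ℝ} {m : EllOp} (h : Gen lam T R)
    (hm : ∀ i j, entry m i j = if i = j then (q i : ℂ) else 0) (hl : ∀ i, lam i = lam' i + q i) :
    Gen lam' T (R - m * T 0 + T 0 * m) := by
  obtain ⟨T', hT, hC⟩ := h
  refine ⟨T', hT, fun i j => ?_⟩
  have h1 : entry (m * T 0) i j = (q i : ℂ) * entry (T 0) i j := by
    refine (hasSum_entry_mul_entry m (T 0) i j).unique ?_
    have := hasSum_single (f := fun l => entry m i l * entry (T 0) l j) i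
      (fun l hl => by simp [hm, Ne.symm hl])
    simpa [hm] using this
  have h2 : entry (T 0 * m) i j = entry (T 0) i j * (q j : ℂ) := by
    refine (hasSum_entry_mul_entry (T 0) m i j).unique ?_
    have := hasSum_single (f := fun l => entry (T 0) i l * entry m l j) j
      (fun l hl => by simp [hm, hl])
    simpa [hm] using this
  have h3 := hC i j
  simp only [entry_add, entry_sub, h1, h2, entry_smul, hl] at h3 ⊢
  push_cast at h3 ⊢
  linear_combination h3

end Gen

/-! ### The Cayley transformation -/

section Cayley

/-- `-2 Y (1 - D Y)⁻¹`. -/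
def cayleyDefect (D Y : EllOp) : EllOp :=
  -(Y * Ring.inverse (1 - D * Y) + Y * Ring.inverse (1 - D * Y))

/-- The new perturbation after a Cayley transformation. -/
def cayleyRemainder (D Y P Q : EllOp) : EllOp :=
  Ring.inverse (1 - -(Y * D)) *
    (P * D * Y - Y * D * P - Y * D * P * D * Y + (Q * D * Y - Y * D * Q + Y * D * Q * D * Y)) *
    Ring.inverse (1 - D * Y)

variable {D Y P Q : EllOp}

/-- Suppress `D`. Multiplied by `1 - Y` on both sides, the conjugation equation for `U = (1 + Y)(1 -
Y)⁻¹` reads `2 ([A, Y] - i Y') + (1 - Y) P (1 + Y) = (1 + Y)(Q + P')(1 - Y)`. The homological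
equation replaces the first term by `Q - P`, which explains its factor `1 / 2`; solving for `P'`
gives `cayleyRemainder`. -/
theorem cayley_identity (hD : ‖D‖ ≤ 1) (hY : ‖Y‖ ≤ 1 / 4) :
    -((Q - P) * Ring.inverse (1 - D * Y) +
        Y * Ring.inverse (1 - D * Y) * D * (Q - P) * Ring.inverse (1 - D * Y)) =
      P - P * D * cayleyDefect D Y - (cayleyRemainder D Y P Q + Q) +
        cayleyDefect D Y * D * (cayleyRemainder D Y P Q + Q) := by
  have hDY : ‖D * Y‖ < 1 :=
    ((norm_mul_le _ _).trans (by nlinarith [norm_nonneg Y, norm_nonneg D])).trans_lt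
      (by norm_num : (1 / 4 : ℝ) < 1)
  have hYD : ‖Y * D‖ < 1 :=
    ((norm_mul_le _ _).trans (by nlinarith [norm_nonneg Y, norm_nonneg D])).trans_lt
      (by norm_num : (1 / 4 : ℝ) < 1)
  have ub : IsUnit (1 - D * Y) := isUnit_one_sub_of_norm_lt hDY
  have ua : IsUnit (1 - Y * D) := isUnit_one_sub_of_norm_lt hYD
  have uh : IsUnit (1 - -(Y * D)) := isUnit_one_sub_of_norm_lt (by rwa [norm_neg])
  have hG1 := Ring.inverse_mul_cancel _ ub
  have hG2 := Ring.mul_inverse_cancel _ ub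
  have hH := Ring.mul_inverse_cancel _ uh
  unfold cayleyDefect cayleyRemainder
  set G := Ring.inverse (1 - D * Y)
  set H := Ring.inverse (1 - -(Y * D))
  set N := P * D * Y - Y * D * P - Y * D * P * D * Y + (Q * D * Y - Y * D * Q + Y * D * Q * D * Y) with hN
  have hA1 : Y * G * (1 - D * Y) = Y := by rw [mul_assoc, hG1, mul_one]
  have hA2 : (1 - Y * D) * (Y * G) = Y := by
    have : (1 - Y * D) * (Y * G) = Y * ((1 - D * Y) * G) := by noncomm_ring
    rw [this, hG2, mul_one]
  set A := Y * G
  -- Multiplication by `1 - Y D` on the left and `1 - D Y` on the right clears the inverses, except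
  -- `H`, which meets its own inverse in `r2`.
  refine ua.mul_left_cancel (ub.mul_right_cancel ?_)
  have l1 : (1 - Y * D) * -((Q - P) * G + A * D * (Q - P) * G) * (1 - D * Y) =
      -((1 - Y * D) * (Q - P) * (G * (1 - D * Y)) +
        ((1 - Y * D) * A) * D * (Q - P) * (G * (1 - D * Y))) := by noncomm_ring
  have r1 : (1 - Y * D) * (P - P * D * -(A + A) - (H * N * G + Q) + -(A + A) * D * (H * N * G + Q)) *
      (1 - D * Y) =
      (1 - Y * D) * P * (1 - D * Y) + (1 - Y * D) * P * D * (2 * (A * (1 - D * Y))) -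
      (1 - Y * D) * (H * N * (G * (1 - D * Y)) + Q * (1 - D * Y)) -
      2 * ((1 - Y * D) * A) * D * (H * N * (G * (1 - D * Y)) + Q * (1 - D * Y)) := by noncomm_ring
  rw [l1, r1, hG1, hA1, hA2]
  have r2 : (1 - Y * D) * P * (1 - D * Y) + (1 - Y * D) * P * D * (2 * Y) -
      (1 - Y * D) * (H * N * 1 + Q * (1 - D * Y)) - 2 * Y * D * (H * N * 1 + Q * (1 - D * Y)) =
      (1 - Y * D) * P * (1 + D * Y) - (((1 - -(Y * D)) * H) * N + (1 + Y * D) * Q * (1 - D * Y)) := by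
    noncomm_ring
  rw [r2, hH, hN]
  noncomm_ring

theorem Gen.cayley {lam : ℕ+ → ℝ} {Y : ℝ → EllOp} {R : EllOp} (h : Gen lam Y R) (hDc : IsComm lam D 0)
    (hD : ‖D‖ ≤ 1) (hY : ‖Y 0‖ ≤ 1 / 4) (hR : R + R = Q - P) :
    Gen lam (fun t => cayleyDefect D (Y t))
      (P - P * D * cayleyDefect D (Y 0) - (cayleyRemainder D (Y 0) P Q + Q) +
        cayleyDefect D (Y 0) * D * (cayleyRemainder D (Y 0) P Q + Q)) := by
  have h1 := h.mul_inverse_one_sub hDc hD hY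
  have h2 := (h1.add h1).neg
  have e : ∀ G Z : EllOp, -((Q - P) * G + Z * (Q - P) * G) = -(R * G + Z * R * G + (R * G + Z * R * G)) := by
    intro G Z
    rw [← hR]
    noncomm_ring
  rw [← cayley_identity hD hY, e]
  exact h2

/-- Composition of two transformations. -/
theorem Gen.compose {lam : ℕ+ → ℝ} {V W : ℝ → EllOp} {P₀ F F' : EllOp}
    (hV : Gen lam V (P₀ - P₀ * D * V 0 - F + V 0 * D * F))
    (hW : Gen lam W (F - F * D * W 0 - F' + W 0 * D * F')) (hDc : IsComm lam D 0) :
    Gen lam (fun t => V t + W t - V t * D * W t)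
      (P₀ - P₀ * D * (V 0 + W 0 - V 0 * D * W 0) - F' + (V 0 + W 0 - V 0 * D * W 0) * D * F') := by
  have h := (hV.add hW).sub ((hV.mul (Gen.const hDc)).mul hW)
  convert h using 1
  noncomm_ring

end Cayley

/-! ### Symmetry of the transformed operators -/

section Symmetry

variable {s κ : ℝ} {Y y P Q p q : EllOp}

theorem contraction_bound {D Y x : EllOp} (hD : ‖D‖ ≤ 1) (hY : ‖Y‖ ≤ 1 / 4) :
    ‖x * D * Y‖ ≤ 1 / 4 * ‖x‖ ∧ ‖Y * D * x‖ ≤ 1 / 4 * ‖x‖ ∧ ‖Y * D * x * D * Y‖ ≤ 1 / 16 * ‖x‖ := by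
  have h1 : ∀ x : EllOp, ‖x * D * Y‖ ≤ 1 / 4 * ‖x‖ := fun x =>
    calc ‖x * D * Y‖ ≤ ‖x‖ * ‖D‖ * ‖Y‖ :=
          (norm_mul_le _ _).trans (mul_le_mul_of_nonneg_right (norm_mul_le _ _) (norm_nonneg _))
      _ ≤ ‖x‖ * 1 * (1 / 4) := by gcongr
      _ = _ := by ring
  have h2 : ∀ x : EllOp, ‖Y * D * x‖ ≤ 1 / 4 * ‖x‖ := fun x =>
    calc ‖Y * D * x‖ ≤ ‖Y‖ * ‖D‖ * ‖x‖ :=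
          (norm_mul_le _ _).trans (mul_le_mul_of_nonneg_right (norm_mul_le _ _) (norm_nonneg _))
      _ ≤ (1 / 4) * 1 * ‖x‖ := by gcongr
      _ = _ := by ring
  refine ⟨h1 x, h2 x, (h1 _).trans ?_⟩
  linarith [h2 x]

/-- The defect is the fixed point of `x ↦ x D Y - 2 Y`, a contraction in both pictures. The inverse
cannot be carried over directly: the identity is not a bounded operator from `ℋ^(s-κ)` to `ℋ^s` for
`κ > 0`. -/
theorem OpRel.cayleyDefect (hκ : 0 ≤ κ) (h : OpRel s κ Y y) (hY : ‖Y‖ ≤ 1 / 4) (hy : ‖y‖ ≤ 1 / 4) :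
    OpRel s κ (cayleyDefect (powOp κ) Y) (cayleyDefect 1 y) := by
  have key : ∀ D Y : EllOp, ‖D‖ ≤ 1 → ‖Y‖ ≤ 1 / 4 → ∀ x : EllOp,
      ‖(x * D * Y - (Y + Y)) - _root_.cayleyDefect D Y‖ ≤ 1 / 4 * ‖x - _root_.cayleyDefect D Y‖ := by
    intro D Y hD hY x
    have hDY : ‖D * Y‖ < 1 :=
      ((norm_mul_le _ _).trans (by nlinarith [norm_nonneg Y, norm_nonneg D])).trans_lt
        (by norm_num : (1 / 4 : ℝ) < 1)
    have hG := Ring.inverse_mul_cancel _ (isUnit_one_sub_of_norm_lt hDY)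
    have hf : _root_.cayleyDefect D Y = _root_.cayleyDefect D Y * D * Y - (Y + Y) := by
      unfold _root_.cayleyDefect
      set G := Ring.inverse (1 - D * Y)
      have hG1 : G = G * D * Y + 1 := by rw [← hG]; noncomm_ring
      nth_rewrite 1 [hG1]; nth_rewrite 2 [hG1]; noncomm_ring
    have e : (x * D * Y - (Y + Y)) - _root_.cayleyDefect D Y =
        (x - _root_.cayleyDefect D Y) * D * Y := by
      nth_rewrite 1 [hf]; noncomm_ring
    rw [e]
    exact (contraction_bound hD hY).1
  refine OpRel.of_fixedPoint (T := fun x => x * powOp κ * Y - (Y + Y))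
    (t := fun x => x * 1 * y - (y + y)) (by norm_num : (0 : ℝ) ≤ 1 / 4) (by norm_num)
    (fun x x' hx => ?_) (key _ _ (norm_powOp_le κ) hY) (key _ _ (by simp) hy)
  rw [mul_one]
  exact (hx.mul hκ h).sub (h.add h)

/-- The equation `(1 + Y D) X (1 - D Y) = N`, solved for the `X` that stands alone, is a fixed point
equation with contraction factor `1/4 + 1/4 + 1/16`. -/
theorem OpRel.cayleyRemainder (hκ : 0 ≤ κ) (h : OpRel s κ Y y) (hP : OpRel s κ P p)
    (hQ : OpRel s κ Q q) (hY : ‖Y‖ ≤ 1 / 4) (hy : ‖y‖ ≤ 1 / 4) :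
    OpRel s κ (cayleyRemainder (powOp κ) Y P Q) (cayleyRemainder 1 y p q) := by
  have key : ∀ D Y P Q : EllOp, ‖D‖ ≤ 1 → ‖Y‖ ≤ 1 / 4 → ∀ x : EllOp,
      ‖((P * D * Y - Y * D * P - Y * D * P * D * Y + (Q * D * Y - Y * D * Q + Y * D * Q * D * Y)) +
        x * D * Y - Y * D * x + Y * D * x * D * Y) - _root_.cayleyRemainder D Y P Q‖ ≤
        9 / 16 * ‖x - _root_.cayleyRemainder D Y P Q‖ := by
    intro D Y P Q hD hY x
    have hDY : ‖D * Y‖ < 1 :=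
      ((norm_mul_le _ _).trans (by nlinarith [norm_nonneg Y, norm_nonneg D])).trans_lt
        (by norm_num : (1 / 4 : ℝ) < 1)
    have hYD : ‖-(Y * D)‖ < 1 := by
      rw [norm_neg]
      exact ((norm_mul_le _ _).trans (by nlinarith [norm_nonneg Y, norm_nonneg D])).trans_lt
        (by norm_num : (1 / 4 : ℝ) < 1)
    have hG := Ring.inverse_mul_cancel _ (isUnit_one_sub_of_norm_lt hDY)
    have hH := Ring.mul_inverse_cancel _ (isUnit_one_sub_of_norm_lt hYD)
    set N := P * D * Y - Y * D * P - Y * D * P * D * Y +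
      (Q * D * Y - Y * D * Q + Y * D * Q * D * Y) with hN
    have hf : N = (1 - -(Y * D)) * _root_.cayleyRemainder D Y P Q * (1 - D * Y) := by
      unfold _root_.cayleyRemainder
      rw [← hN]
      rw [← mul_assoc, ← mul_assoc, hH, one_mul, mul_assoc, hG, mul_one]
    have e : (N + x * D * Y - Y * D * x + Y * D * x * D * Y) - _root_.cayleyRemainder D Y P Q =
        (x - _root_.cayleyRemainder D Y P Q) * D * Y - Y * D * (x - _root_.cayleyRemainder D Y P Q) +
          Y * D * (x - _root_.cayleyRemainder D Y P Q) * D * Y := by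
      rw [hf]; noncomm_ring
    rw [e]
    obtain ⟨h1, h2, h3⟩ := contraction_bound (x := x - _root_.cayleyRemainder D Y P Q) hD hY
    refine (norm_add_le _ _).trans ((add_le_add (norm_sub_le _ _) le_rfl).trans ?_)
    linarith
  refine OpRel.of_fixedPoint (by norm_num : (0 : ℝ) ≤ 9 / 16) (by norm_num)
    (fun x x' hx => ?_) (key _ _ P Q (norm_powOp_le κ) hY) (key _ _ p q (by simp) hy)
  simp only [mul_one]
  have m := fun {a b a' b' : EllOp} (h1 : OpRel s κ a b) (h2 : OpRel s κ a' b') => h1.mul hκ h2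
  exact ((((((m hP h).sub (m h hP)).sub (m (m h hP) h)).add
    (((m hQ h).sub (m h hQ)).add (m (m h hQ) h))).add (m hx h)).sub (m h hx)).add (m (m h hx) h)

theorem star_inverse_one_sub {y : EllOp} : star (Ring.inverse (1 - y)) = Ring.inverse (1 - star y) := by
  rw [← Ring.inverse_star]; simp

/-- As `y` is skew, taking adjoints exchanges the two outer inverses; it fixes the middle factor. -/
theorem isSelfAdjoint_cayleyRemainder (hy : star y = -y) (hp : IsSelfAdjoint p)
    (hq : IsSelfAdjoint q) : IsSelfAdjoint (cayleyRemainder 1 y p q) := by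
  have h1 : star (Ring.inverse (1 + y)) = Ring.inverse (1 - y) := by
    rw [← sub_neg_eq_add, star_inverse_one_sub, star_neg, hy, neg_neg]
  rw [IsSelfAdjoint, cayleyRemainder]
  simp only [mul_one, one_mul, star_mul, star_inverse_one_sub, star_sub, star_add, hy,
    hp.star_eq, hq.star_eq, sub_neg_eq_add, h1]
  rw [← mul_assoc]
  congr 2
  noncomm_ring

/-- The Cayley transform of a skew-adjoint operator is unitary. -/
theorem one_sub_cayleyDefect_mem_unitary (hy : star y = -y) (hy1 : ‖y‖ ≤ 1 / 4) :
    1 - cayleyDefect 1 y ∈ unitary EllOp := by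
  have u1 : IsUnit (1 - y) := isUnit_one_sub_of_norm_lt (by linarith)
  have u2 : IsUnit (1 + y) := by
    have := isUnit_one_sub_of_norm_lt (t := -y) (by rw [norm_neg]; linarith)
    simpa using this
  have hG := Ring.inverse_mul_cancel _ u1
  have hG' := Ring.mul_inverse_cancel _ u1
  have hH := Ring.inverse_mul_cancel _ u2
  have hH' := Ring.mul_inverse_cancel _ u2
  have hs : star (Ring.inverse (1 - y)) = Ring.inverse (1 + y) := by
    rw [star_inverse_one_sub, hy, sub_neg_eq_add]
  have e1 : 1 - cayleyDefect 1 y = (1 + y) * Ring.inverse (1 - y) := by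
    rw [cayleyDefect, one_mul]
    nth_rewrite 1 [← hG']
    noncomm_ring
  have hsw : star ((1 + y) * Ring.inverse (1 - y)) = Ring.inverse (1 + y) * (1 - y) := by
    rw [star_mul, hs, star_add, star_one, hy, sub_eq_add_neg]
  have hc : (1 - y) * (1 + y) = (1 + y) * (1 - y) := by noncomm_ring
  rw [Unitary.mem_iff, e1, hsw]
  constructor
  · calc _ = Ring.inverse (1 + y) * ((1 - y) * (1 + y)) * Ring.inverse (1 - y) := by noncomm_ring
      _ = (Ring.inverse (1 + y) * (1 + y)) * ((1 - y) * Ring.inverse (1 - y)) := by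
        rw [hc]; noncomm_ring
      _ = 1 := by rw [hH, hG', one_mul]
  · have hc2 : Ring.inverse (1 - y) * Ring.inverse (1 + y) =
        Ring.inverse (1 + y) * Ring.inverse (1 - y) := by
      rw [← Ring.mul_inverse_rev' (Commute.symm hc), ← Ring.mul_inverse_rev' hc, hc]
    calc _ = (1 + y) * (Ring.inverse (1 - y) * Ring.inverse (1 + y)) * (1 - y) := by noncomm_ring
      _ = ((1 + y) * Ring.inverse (1 + y)) * (Ring.inverse (1 - y) * (1 - y)) := by
        rw [hc2]; noncomm_ring
      _ = 1 := by rw [hH', hG, one_mul]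

theorem norm_cayleyDefect_le {D : EllOp} (hD : ‖D‖ ≤ 1) (hY : ‖Y‖ ≤ 1 / 4) :
    ‖cayleyDefect D Y‖ ≤ 4 * ‖Y‖ := by
  have hDY : ‖D * Y‖ ≤ 1 / 2 :=
    (norm_mul_le _ _).trans (by nlinarith [norm_nonneg Y, norm_nonneg D])
  have h1 := norm_inverse_one_sub_le hDY
  have h2 : ‖Y * Ring.inverse (1 - D * Y)‖ ≤ ‖Y‖ * 2 := (norm_mul_le _ _).trans (by gcongr)
  rw [cayleyDefect, norm_neg]
  exact (norm_add_le _ _).trans (by linarith)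

end Symmetry

/-! ### One step of the iteration -/

open Classical in
/-- The operator corresponding to `a`, if there is one. -/
def relOp (s κ : ℝ) (a : EllOp) : EllOp := if h : ∃ b, OpRel s κ a b then h.choose else 0

theorem OpRel.relOp_eq {s κ : ℝ} {a b : EllOp} (h : OpRel s κ a b) : relOp s κ a = b := by
  have h' : ∃ b, OpRel s κ a b := ⟨b, h⟩
  rw [relOp, dif_pos h']
  exact h'.choose_spec.unique_right h

/-! ### Stability of the spectral bounds, and the data of the iteration. -/

section Perturb

variable {n : ℕ} {d K g M : ℝ} {S S₀ : Set (Fin n → ℝ)} {lam lam₀ : ℕ+ → (Fin n → ℝ) → ℝ}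

theorem powGap_self (d : ℝ) (i : ℕ+) : powGap d i i = 0 := by simp [powGap]

/-- Off the diagonal `powGap ≥ 1`, so a uniform change of the eigenvalues is absorbed by the
constant. -/
theorem GapBound.perturb (h : GapBound d S₀ lam₀ K) (hd : 1 ≤ d) (hS : S ⊆ S₀) (hg : 0 ≤ g)
    (hl : ∀ ω ∈ S, ∀ i, |lam i ω - lam₀ i ω| ≤ g) : GapBound d S lam (K - 2 * g) := by
  intro ω hω i j
  by_cases hij : i = j
  · subst hij; simp [powGap_self]
  have h1 := h ω (hS hω) i j
  have h2 := one_le_powGap hd hij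
  have h3 := abs_le.1 (hl ω hω i)
  have h4 := abs_le.1 (hl ω hω j)
  have h5 : |lam₀ i ω - lam₀ j ω| ≤ |lam i ω - lam j ω| + 2 * g := by
    have e : lam₀ i ω - lam₀ j ω = (lam i ω - lam j ω) +
      (-(lam i ω - lam₀ i ω) + (lam j ω - lam₀ j ω)) := by ring
    rw [e]
    refine (abs_add_le _ _).trans (add_le_add le_rfl ?_)
    rw [abs_le]; constructor <;> linarith
  nlinarith

theorem LipGapBound.perturb (h : LipGapBound d S₀ lam₀ K) (hd : 1 ≤ d) (hS : S ⊆ S₀) (hg : 0 ≤ g)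
    (hM : 0 ≤ M) (hl : ∀ ω ∈ S, ∀ ω' ∈ S, ∀ i,
      |(lam i ω - lam₀ i ω) - (lam i ω' - lam₀ i ω')| ≤ g * M * ‖ω - ω'‖) :
    LipGapBound d S lam (K + 2 * g * M) := by
  intro ω hω ω' hω' hne i j
  by_cases hij : i = j
  · subst hij; simp [powGap_self]
  have h1 := h ω (hS hω) ω' (hS hω') hne i j
  have h2 := one_le_powGap hd hij
  have h3 := hl ω' hω' ω hω i
  have h4 := hl ω' hω' ω hω j
  have e : (lam i ω' - lam j ω') - (lam i ω - lam j ω) =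
      ((lam₀ i ω' - lam₀ j ω') - (lam₀ i ω - lam₀ j ω)) +
      (((lam i ω' - lam₀ i ω') - (lam i ω - lam₀ i ω)) -
        ((lam j ω' - lam₀ j ω') - (lam j ω - lam₀ j ω))) := by ring
  rw [e]
  refine (abs_add_le _ _).trans ((add_le_add h1 ((abs_sub _ _).trans (add_le_add h3 h4))).trans ?_)
  have h5 : g * M * ‖ω' - ω‖ ≤ g * M * ‖ω' - ω‖ * powGap d i j :=
    le_mul_of_one_le_right (by positivity) h2
  linarith

end Perturb

/-- The data after finitely many steps. -/
structure StepData (n : ℕ) where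
  S : Set (Fin n → ℝ)
  lam : ℕ+ → (Fin n → ℝ) → ℝ
  P : (Fin n → ℂ) → (Fin n → ℝ) → EllOp
  -- `V` is the weighted form of `1 - U` at complex angles, `Q` the weighted form of the accumulated
  -- change of the diagonal, and `u` the unitary `U` on `ℓ²` at real angles.
  V : (Fin n → ℂ) → (Fin n → ℝ) → EllOp
  Q : (Fin n → ℝ) → EllOp
  u : (Fin n → ℝ) → (Fin n → ℝ) → EllOp

/-- What is required of the data after finitely many steps. -/
structure StepData.Good {n : ℕ} (s κ d τ : ℝ) (lam₀ : ℕ+ → (Fin n → ℝ) → ℝ)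
    (P₀ : (Fin n → ℂ) → (Fin n → ℝ) → EllOp) (ρ e M v γ g : ℝ) (σ : StepData n) : Prop where
  meas : MeasurableSet σ.S
  ctlP : Ctl ρ σ.S σ.P e M
  selfAdj : ∀ ω ∈ σ.S, ∀ x, ∃ p, OpRel s κ (σ.P (realAngle x) ω) p ∧ IsSelfAdjoint p
  dev : ∀ ω ∈ σ.S, ∀ i, |σ.lam i ω - lam₀ i ω| ≤ g
  devLip : ∀ ω ∈ σ.S, ∀ ω' ∈ σ.S, ∀ i,
    |(σ.lam i ω - lam₀ i ω) - (σ.lam i ω' - lam₀ i ω')| ≤ g * M * ‖ω - ω'‖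
  mel : MelnikovBound d τ σ.S σ.lam γ
  ctlV : Ctl ρ σ.S σ.V v M
  unit : ∀ ω ∈ σ.S, ∀ x, σ.u x ω ∈ unitary EllOp
  rel : ∀ ω ∈ σ.S, ∀ x, OpRel s κ (σ.V (realAngle x) ω) (1 - σ.u x ω)
  cont : ∀ ω ∈ σ.S, Continuous (fun x => σ.u x ω)
  diag : ∀ ω ∈ σ.S, ∀ i j, entry (σ.Q ω) i j =
    if i = j then (((i : ℝ) ^ κ * (σ.lam i ω - lam₀ i ω) : ℝ) : ℂ) else 0
  -- This is `i dU/dt = (A + P₀) U - U (A + P + Q)` with the original diagonal `A`, rewritten for `V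
  -- = 1 - U` in weighted coordinates.
  gen : ∀ ω ∈ σ.S, ∀ x, Gen (fun j => lam₀ j ω) (fun t => σ.V (realAngle x + realAngle (t • ω)) ω)
    (P₀ (realAngle x) ω - P₀ (realAngle x) ω * powOp κ * σ.V (realAngle x) ω -
      (σ.P (realAngle x) ω + σ.Q ω) + σ.V (realAngle x) ω * powOp κ * (σ.P (realAngle x) ω + σ.Q ω))

section Ctl

variable {n : ℕ} {ρ M y p q : ℝ} {S : Set (Fin n → ℝ)} {Y P Q : (Fin n → ℂ) → (Fin n → ℝ) → EllOp}
  {D : EllOp}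

theorem Ctl.cayleyDefect (hY : Ctl ρ S Y y M) (hD : ‖D‖ ≤ 1) (hy : 0 ≤ y) (hy1 : y ≤ 1 / 4)
    (hM : 0 ≤ M) : Ctl ρ S (fun φ ω => cayleyDefect D (Y φ ω)) (8 * y) M := by
  have hG := (hY.const_mul hD).inverse_one_sub (by linarith) hM
  have hA := hY.mul hG hy (by norm_num)
  have := (hA.add hA).neg
  have e : 2 * y * 2 + 2 * y * 2 = 8 * y := by ring
  rw [e] at this
  exact this

theorem Ctl.cayleyRemainder (hY : Ctl ρ S Y y M) (hP : Ctl ρ S P p M) (hQ : Ctl ρ S Q q M)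
    (hD : ‖D‖ ≤ 1) (hy : 0 ≤ y) (hy1 : y ≤ 1 / 4) (hp : 0 ≤ p) (hq : 0 ≤ q) (hM : 0 ≤ M) :
    Ctl ρ S (fun φ ω => cayleyRemainder D (Y φ ω) (P φ ω) (Q φ ω)) (96 * (p + q) * y) M := by
  have hG := (hY.const_mul hD).inverse_one_sub (by linarith) hM
  have hH := (hY.mul_const hD).neg.inverse_one_sub (by linarith) hM
  have m := fun {F : (Fin n → ℂ) → (Fin n → ℝ) → EllOp} {f : ℝ} (hF : Ctl ρ S F f M) (hf : 0 ≤ f) =>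
    (hF.mul_const hD).mul hY hf hy
  have m' := fun {F : (Fin n → ℂ) → (Fin n → ℝ) → EllOp} {f : ℝ} (hF : Ctl ρ S F f M) (hf : 0 ≤ f) =>
    (hY.mul_const hD).mul hF hy hf
  have hN := (((m hP hp).sub (m' hP hp)).sub (m (m' hP hp) (by positivity))).add
    (((m hQ hq).sub (m' hQ hq)).add (m (m' hQ hq) (by positivity)))
  have h := (hH.mul hN (by norm_num) (by positivity)).mul hG (by positivity) (by norm_num)
  -- The middle factor is at most `5 (p + q) y`, since `y ≤ 1 / 4`. The two inverses and the two
  -- products multiply it by `16`, so `80` would do.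
  refine h.mono le_rfl subset_rfl ?_ hM
  have h1 : p * y * y ≤ p * y * (1 / 4) := by gcongr
  have h2 : q * y * y ≤ q * y * (1 / 4) := by gcongr
  have h3 : 0 ≤ p * y := by positivity
  have h4 : 0 ≤ q * y := by positivity
  nlinarith

end Ctl

section OneStep

variable {n : ℕ} {s κ d τ : ℝ} {lam₀ : ℕ+ → (Fin n → ℝ) → ℝ}
  {P₀ : (Fin n → ℂ) → (Fin n → ℝ) → EllOp}

/-- The data after one more step. -/
def StepData.next (s κ : ℝ) (σ : StepData n) (S' : Set (Fin n → ℝ)) : StepData n where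
  S := S'
  lam i ω := σ.lam i ω + (i : ℝ) ^ (-κ) * (entry (avgDiag σ.P ω) i i).re
  P φ ω := cayleyRemainder (powOp κ) (homSol σ.lam σ.P φ ω) (σ.P φ ω) (avgDiag σ.P ω)
  V φ ω := σ.V φ ω + cayleyDefect (powOp κ) (homSol σ.lam σ.P φ ω) -
    σ.V φ ω * powOp κ * cayleyDefect (powOp κ) (homSol σ.lam σ.P φ ω)
  Q ω := σ.Q ω + avgDiag σ.P ω
  u x ω := σ.u x ω * (1 - cayleyDefect 1 (relOp s κ (homSol σ.lam σ.P (realAngle x) ω)))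

variable {σ : StepData n} {ρ e M v γ g : ℝ}

theorem OpRel.weighted_of_selfAdjoint {a p : EllOp} (h : OpRel s κ a p) (hp : IsSelfAdjoint p)
    (i j : ℕ+) :
    (((i : ℝ) ^ (-s) : ℝ) : ℂ) * entry a i j * (((j : ℝ) ^ (s - κ) : ℝ) : ℂ) =
      (starRingEnd ℂ) ((((j : ℝ) ^ (-s) : ℝ) : ℂ) * entry a j i * (((i : ℝ) ^ (s - κ) : ℝ) : ℂ)) := by
  rw [← h, ← h, ← entry_star, hp.star_eq]

theorem StepData.Good.avgDiag_real (hσ : σ.Good s κ d τ lam₀ P₀ ρ e M v γ g) (hρ : 0 < ρ)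
    {ω : Fin n → ℝ} (hω : ω ∈ σ.S) (i : ℕ+) :
    (((entry (avgDiag σ.P ω) i i).re : ℝ) : ℂ) = entry (avgDiag σ.P ω) i i := by
  have h := avgDiag_hermitian hρ hσ.ctlP hω (u := fun i => (i : ℝ) ^ (-s))
    (v := fun i => (i : ℝ) ^ (s - κ)) (fun x i j => by
      obtain ⟨p, hp, hps⟩ := hσ.selfAdj ω hω x
      exact hp.weighted_of_selfAdjoint hps i j) i i
  simp only [map_mul, Complex.conj_ofReal] at h
  have h2 : (starRingEnd ℂ) (entry (avgDiag σ.P ω) i i) = entry (avgDiag σ.P ω) i i :=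
    (mul_left_cancel₀ (cast_rpow_ne_zero i (-s)) (mul_right_cancel₀ (cast_rpow_ne_zero i _) h)).symm
  exact Complex.conj_eq_iff_re.1 h2

end OneStep

section OneStep

variable {n : ℕ} {s κ d τ : ℝ} {lam₀ : ℕ+ → (Fin n → ℝ) → ℝ}
  {P₀ : (Fin n → ℂ) → (Fin n → ℝ) → EllOp} {σ : StepData n} {ρ e M v γ g δ y Γ : ℝ}

/-- A diagonal shift `q` has the weighted form `i^κ q_i`; composing with `powOp κ` recovers `q`. -/
theorem entry_powOp_comm_diag {κ : ℝ} (hκ : 0 ≤ κ) {Q : EllOp} {q : ℕ+ → ℝ}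
    (hQ : ∀ i j, entry Q i j = if i = j then (((i : ℝ) ^ κ * q i : ℝ) : ℂ) else 0) :
    (∀ i j, entry (powOp κ * Q) i j = if i = j then (q i : ℂ) else 0) ∧
      Q * powOp κ = powOp κ * Q := by
  have key : ∀ i : ℕ+, (i : ℝ) ^ (-κ) * ((i : ℝ) ^ κ * q i) = q i := by
    intro i
    have hi : (0 : ℝ) < i := by exact_mod_cast i.pos
    rw [← mul_assoc, ← Real.rpow_add hi, neg_add_cancel, Real.rpow_zero, one_mul]
  have h1 : ∀ i j, entry (powOp κ * Q) i j = if i = j then (q i : ℂ) else 0 := by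
    intro i j
    rw [entry_powOp_mul hκ, hQ]
    split_ifs with h
    · rw [← Complex.ofReal_mul, key]
    · rw [mul_zero]
  refine ⟨h1, ellOp_ext fun i j => ?_⟩
  rw [h1, entry_mul_powOp hκ, hQ]
  split_ifs with h
  · subst h
    rw [← Complex.ofReal_mul, mul_comm, key]
  · rw [zero_mul]

/-- Bounds which hold for the solution of the homological equation. -/
structure StepData.Small (s κ : ℝ) (σ : StepData n) (ρ δ M y Γ d τ : ℝ) : Prop where
  ctl : Ctl (ρ - δ) σ.S (homSol σ.lam σ.P) y M
  pos : 0 ≤ y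
  le : y ≤ 1 / 4
  mel : MelnikovBound d τ σ.S σ.lam Γ
  hΓ : 0 < Γ
  hδ : 0 < δ
  hδ1 : δ ≤ 1
  hδρ : δ < ρ

theorem StepData.Good.skew (hσ : σ.Good s κ d τ lam₀ P₀ ρ e M v γ g) (hs : 0 ≤ s) (hκ : 0 ≤ κ)
    (hd : 1 ≤ d) (hτ : 0 < τ) (hy : σ.Small s κ ρ δ M y Γ d τ) {ω : Fin n → ℝ} (hω : ω ∈ σ.S)
    (x : Fin n → ℝ) :
    OpRel s κ (homSol σ.lam σ.P (realAngle x) ω) (relOp s κ (homSol σ.lam σ.P (realAngle x) ω)) ∧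
      star (relOp s κ (homSol σ.lam σ.P (realAngle x) ω)) =
        -relOp s κ (homSol σ.lam σ.P (realAngle x) ω) ∧
      ‖homSol σ.lam σ.P (realAngle x) ω‖ ≤ 1 / 4 ∧
      ‖relOp s κ (homSol σ.lam σ.P (realAngle x) ω)‖ ≤ y := by
  have h := homSol_skew hy.hδ hy.hδ1 hy.hδρ hd hτ hy.hΓ hy.mel hσ.ctlP hω
    (u := fun i => (i : ℝ) ^ (-s)) (v := fun i => (i : ℝ) ^ (s - κ)) (fun x i j => by
      obtain ⟨p, hp, hps⟩ := hσ.selfAdj ω hω x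
      exact hp.weighted_of_selfAdjoint hps i j) x
  obtain ⟨b, h1, h2, h3⟩ := exists_rel_skewAdjoint hs hκ h
  have hYn := hy.ctl.sup ω hω _ (realAngle_mem_strip (by linarith [hy.hδρ]) x)
  rw [h1.relOp_eq]
  exact ⟨h1, h2, hYn.trans hy.le, h3.trans hYn⟩

/-- The solution is continuous in the weighted norm, and Krein's bound for differences of skew
operators transfers this to the plain norm. -/
theorem StepData.Good.continuous_relOp (hσ : σ.Good s κ d τ lam₀ P₀ ρ e M v γ g) (hs : 0 ≤ s)
    (hκ : 0 ≤ κ) (hd : 1 ≤ d) (hτ : 0 < τ) (hy : σ.Small s κ ρ δ M y Γ d τ) {ω : Fin n → ℝ}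
    (hω : ω ∈ σ.S) : Continuous (fun x => relOp s κ (homSol σ.lam σ.P (realAngle x) ω)) := by
  have hρ : 0 < ρ - δ := by linarith [hy.hδρ]
  have hYc : Continuous (fun x : Fin n → ℝ => homSol σ.lam σ.P (realAngle x) ω) := by
    refine (hy.ctl.analytic ω hω).continuousOn.comp_continuous ?_ fun x => realAngle_mem_strip hρ x
    exact continuous_pi fun m => Complex.continuous_ofReal.comp (continuous_apply m)
  rw [continuous_iff_continuousAt]
  intro x
  have h0 := tendsto_iff_norm_sub_tendsto_zero.1 (hYc.tendsto x)
  refine tendsto_iff_norm_sub_tendsto_zero.2 (squeeze_zero (fun _ => norm_nonneg _) (fun x' => ?_) h0)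
  obtain ⟨r1, s1, -, -⟩ := hσ.skew hs hκ hd hτ hy hω x
  obtain ⟨r2, s2, -, -⟩ := hσ.skew hs hκ hd hτ hy hω x'
  refine (r2.sub r1).norm_le_of_skewAdjoint hs hκ ?_
  rw [star_sub, s1, s2]
  abel

theorem continuous_cayleyDefect {X : Type*} [TopologicalSpace X] {f : X → EllOp} (hf : Continuous f)
    (h1 : ∀ x, ‖f x‖ ≤ 1 / 4) : Continuous (fun x => cayleyDefect 1 (f x)) := by
  have hG : Continuous (fun x => Ring.inverse (1 - 1 * f x)) := by
    rw [continuous_iff_continuousAt]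
    intro x
    have hu : IsUnit (1 - 1 * f x) :=
      isUnit_one_sub_of_norm_lt (by rw [one_mul]; linarith [h1 x])
    obtain ⟨w, hw⟩ := hu
    have h2 : ContinuousAt Ring.inverse (1 - 1 * f x) := hw ▸ NormedRing.inverse_continuousAt w
    have h3 : Continuous (fun x => 1 - 1 * f x) := by fun_prop
    exact ContinuousAt.comp (f := fun x => 1 - 1 * f x) h2 h3.continuousAt
  exact ((hf.mul hG).add (hf.mul hG)).neg

/-- The Cayley step is an equation relative to the current eigenvalues. `Gen.shift` restates it for
the original ones, the accumulated shift `Q` moving to the right side, and `Gen.compose` then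
multiplies the transformations. -/
theorem StepData.Good.gen_next (hσ : σ.Good s κ d τ lam₀ P₀ ρ e M v γ g) (hκ : 0 ≤ κ)
    (hd : 1 ≤ d) (hτ : 0 < τ) (hy : σ.Small s κ ρ δ M y Γ d τ) {S' : Set (Fin n → ℝ)}
    {ω : Fin n → ℝ} (hω : ω ∈ σ.S) (x : Fin n → ℝ) :
    Gen (fun j => lam₀ j ω) (fun t => (σ.next s κ S').V (realAngle x + realAngle (t • ω)) ω)
    (P₀ (realAngle x) ω - P₀ (realAngle x) ω * powOp κ * (σ.next s κ S').V (realAngle x) ω -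
      ((σ.next s κ S').P (realAngle x) ω + (σ.next s κ S').Q ω) +
      (σ.next s κ S').V (realAngle x) ω * powOp κ *
        ((σ.next s κ S').P (realAngle x) ω + (σ.next s κ S').Q ω)) := by
  have hρ : 0 < ρ - δ := by linarith [hy.hδρ]
  have hx := realAngle_mem_strip hρ x
  obtain ⟨T', hT, hC⟩ := homSol_equation hy.hδ hy.hδ1 hy.hδρ hd hτ hy.hΓ hy.mel hσ.ctlP hω hx
  have hDc : ∀ lam : ℕ+ → ℝ, IsComm lam (powOp κ) 0 := fun lam =>
    IsComm.of_diagonal fun i j hij => by rw [entry_powOp hκ, if_neg hij]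
  have h00 : realAngle x + realAngle ((0 : ℝ) • ω) = realAngle x := by
    funext m; simp [realAngle]
  have h1 : Gen (fun j => σ.lam j ω) (fun t => homSol σ.lam σ.P (realAngle x + realAngle (t • ω)) ω)
      ((1 / 2 : ℂ) • (avgDiag σ.P ω - σ.P (realAngle x) ω)) := by
    refine ⟨T', hT, fun i j => ?_⟩
    have := hC i j
    simp only [h00, entry_add, entry_smul, entry_sub]
    linear_combination -this
  have hYn : ‖homSol σ.lam σ.P (realAngle x + realAngle ((0 : ℝ) • ω)) ω‖ ≤ 1 / 4 := by
    rw [h00]; exact (hy.ctl.sup ω hω _ hx).trans hy.le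
  have h2 := h1.cayley (P := σ.P (realAngle x) ω) (Q := avgDiag σ.P ω) (hDc _) (norm_powOp_le κ) hYn
    (by rw [← add_smul]; norm_num)
  obtain ⟨hm, hcm⟩ := entry_powOp_comm_diag hκ (hσ.diag ω hω)
  have h3 := h2.shift (lam' := fun j => lam₀ j ω) hm (fun i => by ring)
  have h4 := hσ.gen ω hω x
  simp only [h00] at h3
  have h5 : Gen (fun j => lam₀ j ω)
      (fun t => cayleyDefect (powOp κ) (homSol σ.lam σ.P (realAngle x + realAngle (t • ω)) ω))
      ((σ.P (realAngle x) ω + σ.Q ω) - (σ.P (realAngle x) ω + σ.Q ω) * powOp κ *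
        cayleyDefect (powOp κ) (homSol σ.lam σ.P (realAngle x + realAngle ((0 : ℝ) • ω)) ω) -
        ((σ.next s κ S').P (realAngle x) ω + (σ.next s κ S').Q ω) +
        cayleyDefect (powOp κ) (homSol σ.lam σ.P (realAngle x + realAngle ((0 : ℝ) • ω)) ω) * powOp κ *
        ((σ.next s κ S').P (realAngle x) ω + (σ.next s κ S').Q ω)) := by
    rw [h00]
    convert h3 using 1
    simp only [StepData.next, ← hcm]
    set W := cayleyDefect (powOp κ) (homSol σ.lam σ.P (realAngle x) ω)
    set P' := cayleyRemainder (powOp κ) (homSol σ.lam σ.P (realAngle x) ω) (σ.P (realAngle x) ω)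
      (avgDiag σ.P ω)
    have hcm2 : W * (σ.Q ω * powOp κ) = W * powOp κ * σ.Q ω := by rw [hcm, mul_assoc]
    rw [hcm2]
    noncomm_ring
  have h6 : Gen (fun j => lam₀ j ω) (fun t => σ.V (realAngle x + realAngle (t • ω)) ω)
      (P₀ (realAngle x) ω - P₀ (realAngle x) ω * powOp κ *
        σ.V (realAngle x + realAngle ((0 : ℝ) • ω)) ω -
      (σ.P (realAngle x) ω + σ.Q ω) + σ.V (realAngle x + realAngle ((0 : ℝ) • ω)) ω * powOp κ *
        (σ.P (realAngle x) ω + σ.Q ω)) := by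
    rw [h00]; exact h4
  have h7 := Gen.compose h6 h5 (hDc _)
  rw [h00] at h7
  exact h7

theorem StepData.Good.next (hσ : σ.Good s κ d τ lam₀ P₀ ρ e M v γ g) (hs : 0 ≤ s) (hκ : 0 ≤ κ)
    (hd : 1 ≤ d) (hτ : 0 < τ) (hy : σ.Small s κ ρ δ M y Γ d τ) (he : 0 ≤ e) (hM : 0 ≤ M)
    (hv : 0 ≤ v) (hv1 : v ≤ 1 / 2) {S' : Set (Fin n → ℝ)} {γ' : ℝ} (hS' : S' ⊆ σ.S)
    (hS'm : MeasurableSet S')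
    (hmel : MelnikovBound d τ S' (σ.next s κ S').lam γ') :
    (σ.next s κ S').Good s κ d τ lam₀ P₀ (ρ - δ) (96 * (1 + schurConst) * e * y) M (v + 16 * y) γ'
      (g + e) := by
  have hρ : 0 < ρ := hy.hδ.trans hy.hδρ
  have hρδ : ρ - δ ≤ ρ := by linarith [hy.hδ]
  have hc := schurConst_nonneg
  have hP := hσ.ctlP.mono hρδ subset_rfl le_rfl hM
  have hQ : Ctl (ρ - δ) σ.S (fun _ ω => avgDiag σ.P ω) (schurConst * e) M :=
    (avgDiag_ctl hρ hσ.ctlP).mono hρδ subset_rfl le_rfl hM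
  have hW := hy.ctl.cayleyDefect (norm_powOp_le κ) hy.pos hy.le hM
  have hV := hσ.ctlV.mono hρδ subset_rfl le_rfl hM
  have hi : ∀ i : ℕ+, 0 ≤ (i : ℝ) ^ (-κ) ∧ (i : ℝ) ^ (-κ) ≤ 1 := fun i =>
    ⟨by positivity, Real.rpow_le_one_of_one_le_of_nonpos (by exact_mod_cast i.pos) (by linarith)⟩
  have hwr : ∀ ω ∈ σ.S, ∀ x : Fin n → ℝ,
      OpRel s κ (cayleyDefect (powOp κ) (homSol σ.lam σ.P (realAngle x) ω))
        (cayleyDefect 1 (relOp s κ (homSol σ.lam σ.P (realAngle x) ω))) := by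
    intro ω hω x
    obtain ⟨r1, s1, n1, n2⟩ := hσ.skew hs hκ hd hτ hy hω x
    exact r1.cayleyDefect hκ n1 (n2.trans hy.le)
  refine ⟨hS'm, ?_, fun ω hω x => ?_, fun ω hω i => ?_, fun ω hω ω' hω' i => ?_, hmel, ?_,
    fun ω hω x => ?_, fun ω hω x => ?_, fun ω hω => ?_, fun ω hω i j => ?_, fun ω hω x => ?_⟩
  · refine (hy.ctl.cayleyRemainder hP hQ (norm_powOp_le κ) hy.pos hy.le he (by positivity) hM).mono
      le_rfl hS' (le_of_eq ?_) hM
    ring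
  · have hω' := hS' hω
    obtain ⟨r1, s1, n1, n2⟩ := hσ.skew hs hκ hd hτ hy hω' x
    obtain ⟨p, hp, hps⟩ := hσ.selfAdj ω hω' x
    obtain ⟨q, hq, hqs, -⟩ := exists_rel_selfAdjoint (a := avgDiag σ.P ω) hs hκ
      (avgDiag_hermitian hρ hσ.ctlP hω' (u := fun i => (i : ℝ) ^ (-s))
        (v := fun i => (i : ℝ) ^ (s - κ)) (fun x i j => by
          obtain ⟨p, hp, hps⟩ := hσ.selfAdj ω hω' x
          exact hp.weighted_of_selfAdjoint hps i j))
    exact ⟨_, r1.cayleyRemainder hκ hp hq n1 (n2.trans hy.le), isSelfAdjoint_cayleyRemainder s1 hps hqs⟩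
  · have h1 := hσ.dev ω (hS' hω) i
    have h2 := norm_avgDiag_entry_le hρ hσ.ctlP (hS' hω) i
    have h3 := (Complex.abs_re_le_norm (entry (avgDiag σ.P ω) i i)).trans h2
    have h4 : |(i : ℝ) ^ (-κ) * (entry (avgDiag σ.P ω) i i).re| ≤ e := by
      rw [abs_mul, abs_of_nonneg (hi i).1]
      exact (mul_le_mul (hi i).2 h3 (abs_nonneg _) zero_le_one).trans (by rw [one_mul])
    change |σ.lam i ω + (i : ℝ) ^ (-κ) * (entry (avgDiag σ.P ω) i i).re - lam₀ i ω| ≤ g + e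
    rw [add_sub_right_comm]
    exact (abs_add_le _ _).trans (add_le_add h1 h4)
  · have h1 := hσ.devLip ω (hS' hω) ω' (hS' hω') i
    have h2 := norm_avgDiag_entry_sub_le hρ hσ.ctlP (hS' hω) (hS' hω') i
    have h3 := (Complex.abs_re_le_norm _).trans h2
    rw [Complex.sub_re] at h3
    have h4 : |(i : ℝ) ^ (-κ) * ((entry (avgDiag σ.P ω) i i).re - (entry (avgDiag σ.P ω') i i).re)| ≤
        e * M * ‖ω - ω'‖ := by
      rw [abs_mul, abs_of_nonneg (hi i).1]
      exact (mul_le_mul (hi i).2 h3 (abs_nonneg _) zero_le_one).trans (by rw [one_mul])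
    have e1 : (σ.next s κ S').lam i ω - lam₀ i ω - ((σ.next s κ S').lam i ω' - lam₀ i ω') =
        ((σ.lam i ω - lam₀ i ω) - (σ.lam i ω' - lam₀ i ω')) + (i : ℝ) ^ (-κ) *
          ((entry (avgDiag σ.P ω) i i).re - (entry (avgDiag σ.P ω') i i).re) := by
      simp only [StepData.next]; ring
    rw [e1]
    refine (abs_add_le _ _).trans ((add_le_add h1 h4).trans (le_of_eq ?_))
    ring
  -- The bound is `v + 8 y + 2 v (8 y) ≤ v + 16 y`, as `v ≤ 1 / 2`.
  · have h1 := (hV.add hW).sub ((hV.mul_const (norm_powOp_le κ)).mul hW hv (by linarith [hy.pos]))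
    refine h1.mono le_rfl hS' ?_ hM
    nlinarith [hy.pos]
  · have hω' := hS' hω
    obtain ⟨r1, s1, n1, n2⟩ := hσ.skew hs hκ hd hτ hy hω' x
    exact mul_mem (hσ.unit ω hω' x) (one_sub_cayleyDefect_mem_unitary s1 (n2.trans hy.le))
  · have h1 := hwr ω (hS' hω) x
    have h2 := hσ.rel ω (hS' hω) x
    have h3 := (h2.add h1).sub (h2.mul hκ h1)
    have e1 : 1 - (σ.next s κ S').u x ω = 1 - σ.u x ω +
        cayleyDefect 1 (relOp s κ (homSol σ.lam σ.P (realAngle x) ω)) -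
        (1 - σ.u x ω) * cayleyDefect 1 (relOp s κ (homSol σ.lam σ.P (realAngle x) ω)) := by
      simp only [StepData.next]; noncomm_ring
    rw [e1]
    exact h3
  · refine (hσ.cont ω (hS' hω)).mul (continuous_const.sub (continuous_cayleyDefect
      (hσ.continuous_relOp hs hκ hd hτ hy (hS' hω)) fun x => ?_))
    exact ((hσ.skew hs hκ hd hτ hy (hS' hω) x).2.2.2).trans hy.le
  · have h1 := hσ.diag ω (hS' hω) i j
    have hi0 : (0 : ℝ) < i := by exact_mod_cast i.pos
    change entry (σ.Q ω) i j + entry (avgDiag σ.P ω) i j = _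
    rw [h1]
    split_ifs with hij
    · subst hij
      rw [← hσ.avgDiag_real hρ (hS' hω), ← Complex.ofReal_add]
      congr 1
      simp only [StepData.next]
      have : (i : ℝ) ^ κ * (i : ℝ) ^ (-κ) = 1 := by
        rw [← Real.rpow_add hi0, add_neg_cancel, Real.rpow_zero]
      linear_combination (-(entry (avgDiag σ.P ω) i i).re) * this
    · rw [entry_avgDiag, if_neg hij, add_zero]
  · exact hσ.gen_next hκ hd hτ hy (hS' hω) x

/-- The size of the increments. -/
theorem StepData.Good.next_diff (hσ : σ.Good s κ d τ lam₀ P₀ ρ e M v γ g) (hs : 0 ≤ s) (hκ : 0 ≤ κ)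
    (hd : 1 ≤ d) (hτ : 0 < τ) (hy : σ.Small s κ ρ δ M y Γ d τ)
    (hM : 0 ≤ M) (hv1 : v ≤ 1 / 2) {S' : Set (Fin n → ℝ)} {ω : Fin n → ℝ} (hω : ω ∈ σ.S) :
    (∀ i, |(σ.next s κ S').lam i ω - σ.lam i ω| ≤ e * (i : ℝ) ^ (-κ)) ∧
    (∀ φ ∈ strip n (ρ - δ), ‖(σ.next s κ S').V φ ω - σ.V φ ω‖ ≤ 16 * y) ∧
    (∀ x, ‖(σ.next s κ S').u x ω - σ.u x ω‖ ≤ 16 * y) ∧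
    ‖(σ.next s κ S').Q ω - σ.Q ω‖ ≤ schurConst * e := by
  have hρ : 0 < ρ := hy.hδ.trans hy.hδρ
  have hρδ : ρ - δ ≤ ρ := by linarith [hy.hδ]
  have hy0 := hy.pos
  refine ⟨fun i => ?_, fun φ hφ => ?_, fun x => ?_, ?_⟩
  · have h2 := norm_avgDiag_entry_le hρ hσ.ctlP hω i
    have h3 := (Complex.abs_re_le_norm (entry (avgDiag σ.P ω) i i)).trans h2
    have e1 : (σ.next s κ S').lam i ω - σ.lam i ω = (entry (avgDiag σ.P ω) i i).re * (i : ℝ) ^ (-κ) := by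
      simp only [StepData.next]; ring
    have h0 : 0 ≤ (i : ℝ) ^ (-κ) := by positivity
    rw [e1, abs_mul, abs_of_nonneg h0]
    gcongr
  · have hW := (hy.ctl.cayleyDefect (norm_powOp_le κ) hy.pos hy.le hM).sup ω hω φ hφ
    have hV := hσ.ctlV.sup ω hω φ (strip_mono hρδ hφ)
    have e1 : (σ.next s κ S').V φ ω - σ.V φ ω =
        cayleyDefect (powOp κ) (homSol σ.lam σ.P φ ω) -
          σ.V φ ω * powOp κ * cayleyDefect (powOp κ) (homSol σ.lam σ.P φ ω) := by
      simp only [StepData.next]; abel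
    rw [e1]
    have h1 : ‖σ.V φ ω * powOp κ * cayleyDefect (powOp κ) (homSol σ.lam σ.P φ ω)‖ ≤
        (1 / 2 * 1) * (8 * y) := by
      refine (norm_mul_le _ _).trans (mul_le_mul ((norm_mul_le _ _).trans ?_) hW (norm_nonneg _)
        (by norm_num))
      exact mul_le_mul (hV.trans hv1) (norm_powOp_le κ) (norm_nonneg _) (by norm_num)
    refine (norm_sub_le _ _).trans ?_
    linarith
  · obtain ⟨r1, s1, n1, n2⟩ := hσ.skew hs hκ hd hτ hy hω x
    have h1 := norm_cayleyDefect_le (D := 1) (Y := relOp s κ (homSol σ.lam σ.P (realAngle x) ω))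
      (by simp) (n2.trans hy.le)
    have e1 : (σ.next s κ S').u x ω - σ.u x ω =
        -(σ.u x ω * cayleyDefect 1 (relOp s κ (homSol σ.lam σ.P (realAngle x) ω))) := by
      simp only [StepData.next]; noncomm_ring
    have h2 : ‖σ.u x ω‖ ≤ 1 := (CStarRing.norm_of_mem_unitary (hσ.unit ω hω x)).le
    rw [e1, norm_neg]
    refine (norm_mul_le _ _).trans ((mul_le_of_le_one_left (norm_nonneg _) h2).trans ?_)
    linarith
  · have e1 : (σ.next s κ S').Q ω - σ.Q ω = avgDiag σ.P ω := by
      simp only [StepData.next]; abel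
    rw [e1]
    exact (avgDiag_ctl hρ hσ.ctlP).sup ω hω _ (realAngle_mem_strip hρ 0)

end OneStep

/-! ### The iteration -/

theorem exists_seq_of_step {α : Type*} {p : ℕ → α → Prop} {r : ℕ → α → α → Prop} {a₀ : α}
    (h0 : p 0 a₀) (hs : ∀ m a, p m a → ∃ a', p (m + 1) a' ∧ r m a a') :
    ∃ f : ℕ → α, f 0 = a₀ ∧ ∀ m, p m (f m) ∧ r m (f m) (f (m + 1)) := by
  choose! F hF using hs
  let f : ℕ → α := fun m => Nat.rec a₀ (fun m a => F m a) m
  have hf : ∀ m, f (m + 1) = F m (f m) := fun _ => rfl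
  have hp : ∀ m, p m (f m) := by
    intro m
    induction m with
    | zero => exact h0
    | succ m ih => rw [hf]; exact (hF m _ ih).1
  exact ⟨f, rfl, fun m => ⟨hp m, by rw [hf]; exact (hF m _ (hp m)).2⟩⟩

/-- The numbers behind the iteration: the perturbation has size `ε`, the solution of the
homological equation has size `Y`. -/
structure IterNumbers (n : ℕ) (τ θ r ε Y q A C : ℝ) : Prop where
  hr : 0 < r
  hr1 : r ≤ 1
  hε : 0 < ε
  hε1 : ε ≤ 1 / 4
  hθ₀ : 0 < θ
  hθ₁ : θ < 1
  hC : 0 < C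
  hq : q = 2 ^ ((n : ℝ) + 2 * τ + 1)
  hY : Y = 2 * C * ((1 - θ) / 2) ^ (-((n : ℝ) + 2 * τ + 1)) * (ε / r ^ ((n : ℝ) + τ))
  hY1 : 32 * Y ≤ 1 / 2
  hA : 0 ≤ A
  hAY : A * Y ≤ (q ^ 2)⁻¹
  hτ : 0 < τ

namespace IterNumbers

variable {n : ℕ} {τ θ r ε Y q A C : ℝ}

theorem Y_nonneg (h : IterNumbers n τ θ r ε Y q A C) : 0 ≤ Y := by
  have := h.hr; have := h.hε; have := h.hC; have := h.hθ₁
  have : 0 < (1 - θ) / 2 := by linarith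
  rw [h.hY]; positivity

theorem two_le_q (h : IterNumbers n τ θ r ε Y q A C) : 2 ≤ q := by
  rw [h.hq]
  have hτ := h.hτ
  have := Real.rpow_le_rpow_of_exponent_le (x := 2) (by norm_num)
    (show (1 : ℝ) ≤ (n : ℝ) + 2 * τ + 1 by have : (0 : ℝ) ≤ n := Nat.cast_nonneg n; linarith)
  rwa [Real.rpow_one] at this

theorem half_pow_pos (m : ℕ) : 0 < (1 / 2 : ℝ) ^ m := by positivity

theorem half_pow_le (m : ℕ) : (1 / 2 : ℝ) ^ m ≤ 1 := pow_le_one₀ (by norm_num) (by norm_num)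

theorem e_le (h : IterNumbers n τ θ r ε Y q A C) (m : ℕ) :
    ε * (q ^ 2)⁻¹ ^ m ≤ ε * (1 / 2) ^ m := by
  have h1 := h.two_le_q
  have h2 := h.hε
  gcongr
  rw [inv_le_comm₀ (by positivity) (by norm_num)]
  nlinarith

/-- The width lost at step `m` is `r X`, `X = (1 - θ) / 2 · 2^(-m)`, and the small divisors cost
`X^(-(n+2τ+1))`, a constant times `q^m`. The size `q^(-2m)` of the perturbation pays for this and
leaves `q^(-m) ≤ 2^(-m)`. -/
theorem homSol_bound (h : IterNumbers n τ θ r ε Y q A C) (m : ℕ) :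
    C * (1 + ((1 - θ) / 2 * (1 / 2) ^ m) ^ (-(τ + 1))) * (ε * (q ^ 2)⁻¹ ^ m) /
      (r * ((1 - θ) / 2 * (1 / 2) ^ m)) ^ ((n : ℝ) + τ) ≤ Y * (1 / 2) ^ m := by
  have hr := h.hr; have hε := h.hε; have hC := h.hC; have hθ := h.hθ₁; have hτ := h.hτ
  have hθ0 := h.hθ₀
  have h2q := h.two_le_q
  have hn : (0 : ℝ) ≤ n := Nat.cast_nonneg n
  have ha : 0 < (1 - θ) / 2 := by linarith
  have ha1 : (1 - θ) / 2 ≤ 1 := by linarith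
  rw [h.hY]
  set a := (1 - θ) / 2
  set p := (n : ℝ) + 2 * τ + 1 with hp
  have hh := half_pow_pos m
  have hh1 := half_pow_le m
  set X := a * (1 / 2) ^ m with hX
  have hX0 : 0 < X := by positivity
  have hX1 : X ≤ 1 := mul_le_one₀ ha1 hh.le hh1
  have hL : 1 ≤ X ^ (-(τ + 1)) := Real.one_le_rpow_of_pos_of_le_one_of_nonpos hX0 hX1 (by linarith)
  have e1 : X ^ (-(τ + 1)) / X ^ ((n : ℝ) + τ) = a ^ (-p) * q ^ m := by
    rw [← Real.rpow_sub hX0]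
    have : -(τ + 1) - ((n : ℝ) + τ) = -p := by rw [hp]; ring
    rw [this, hX, Real.mul_rpow ha.le hh.le, h.hq]
    congr 1
    rw [one_div, inv_pow, Real.rpow_neg (by positivity), Real.inv_rpow (by positivity), inv_inv,
      ← Real.rpow_natCast, ← Real.rpow_natCast, ← Real.rpow_mul (by norm_num),
      ← Real.rpow_mul (by norm_num), mul_comm]
  have e2 : q ^ m * (q ^ 2)⁻¹ ^ m ≤ (1 / 2) ^ m := by
    rw [← mul_pow]
    have hq0 : 0 < q := by linarith
    have : q * (q ^ 2)⁻¹ = q⁻¹ := by field_simp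
    rw [this]
    gcongr
    rw [inv_le_comm₀ hq0 (by norm_num)]
    simpa using h2q
  have hq0 : 0 < q := by linarith
  calc C * (1 + X ^ (-(τ + 1))) * (ε * (q ^ 2)⁻¹ ^ m) / (r * X) ^ ((n : ℝ) + τ)
      ≤ C * (2 * X ^ (-(τ + 1))) * (ε * (q ^ 2)⁻¹ ^ m) / (r * X) ^ ((n : ℝ) + τ) := by
        gcongr; linarith
    _ = 2 * C * (X ^ (-(τ + 1)) / X ^ ((n : ℝ) + τ)) * (ε / r ^ ((n : ℝ) + τ)) * (q ^ 2)⁻¹ ^ m := by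
        rw [Real.mul_rpow hr.le hX0.le]; field_simp
    _ = 2 * C * a ^ (-p) * (ε / r ^ ((n : ℝ) + τ)) * (q ^ m * (q ^ 2)⁻¹ ^ m) := by rw [e1]; ring
    _ ≤ _ := by gcongr

/-- The new perturbation is at most `A e_m Y_m`. A geometric rate is all that is asked for, so the
fixed smallness `A Y ≤ q⁻²` suffices. -/
theorem gain (h : IterNumbers n τ θ r ε Y q A C) (m : ℕ) :
    A * (ε * (q ^ 2)⁻¹ ^ m) * (Y * (1 / 2) ^ m) ≤ ε * (q ^ 2)⁻¹ ^ (m + 1) := by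
  have hε := h.hε; have hY := h.Y_nonneg; have hA := h.hA; have h2q := h.two_le_q
  calc A * (ε * (q ^ 2)⁻¹ ^ m) * (Y * (1 / 2) ^ m) = ε * (q ^ 2)⁻¹ ^ m * ((A * Y) * (1 / 2) ^ m) := by ring
    _ ≤ ε * (q ^ 2)⁻¹ ^ m * ((q ^ 2)⁻¹ * 1) := by
      gcongr
      · exact h.hAY
      · exact half_pow_le m
    _ = _ := by ring

end IterNumbers

theorem StepData.Good.mono {n : ℕ} {s κ d τ : ℝ} {lam₀ : ℕ+ → (Fin n → ℝ) → ℝ}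
    {P₀ : (Fin n → ℂ) → (Fin n → ℝ) → EllOp} {σ : StepData n} {ρ e M v γ g e' g' : ℝ}
    (hσ : σ.Good s κ d τ lam₀ P₀ ρ e M v γ g) (he : e ≤ e') (hg : g ≤ g') (hM : 0 ≤ M) :
    σ.Good s κ d τ lam₀ P₀ ρ e' M v γ g' where
  meas := hσ.meas
  ctlP := hσ.ctlP.mono le_rfl subset_rfl he hM
  selfAdj := hσ.selfAdj
  dev ω hω i := (hσ.dev ω hω i).trans hg
  devLip ω hω ω' hω' i := (hσ.devLip ω hω ω' hω' i).trans (by gcongr)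
  mel := hσ.mel
  ctlV := hσ.ctlV
  unit := hσ.unit
  rel := hσ.rel
  cont := hσ.cont
  diag := hσ.diag
  gen := hσ.gen

/-- The initial data. -/
def StepData.init {n : ℕ} (S : Set (Fin n → ℝ)) (lam : ℕ+ → (Fin n → ℝ) → ℝ)
    (P : (Fin n → ℂ) → (Fin n → ℝ) → EllOp) : StepData n where
  S := S
  lam := lam
  P := P
  V _ _ := 0
  Q _ := 0
  u _ _ := 1

theorem StepData.good_init {n : ℕ} {s κ d τ : ℝ} {S : Set (Fin n → ℝ)}
    {lam : ℕ+ → (Fin n → ℝ) → ℝ} {P : (Fin n → ℂ) → (Fin n → ℝ) → EllOp} {ρ e M γ : ℝ}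
    (hS : MeasurableSet S) (hP : Ctl ρ S P e M) (hM : 0 ≤ M)
    (hsa : ∀ ω ∈ S, ∀ x, ∃ p, OpRel s κ (P (realAngle x) ω) p ∧ IsSelfAdjoint p)
    (hmel : MelnikovBound d τ S lam γ) :
    (StepData.init S lam P).Good s κ d τ lam P ρ e M 0 γ 0 where
  meas := hS
  ctlP := hP
  selfAdj := hsa
  dev ω _ i := by simp [StepData.init]
  devLip ω _ ω' _ i := by simp [StepData.init]
  mel := hmel
  ctlV := Ctl.const (norm_zero (E := EllOp)).le hM
  unit ω _ x := one_mem _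
  rel ω _ x := by
    have : (1 : EllOp) - (StepData.init S lam P).u x ω = 0 := sub_self 1
    rw [this]; exact OpRel.zero
  cont ω _ := continuous_const
  diag ω _ i j := by
    change entry 0 i j = _
    simp [StepData.init, entry_zero]
  gen ω _ x := by
    have h : Gen (fun j => lam j ω) (fun _ => (0 : EllOp)) 0 :=
      Gen.const fun i j => by simp [entry_zero]
    have e0 : P (realAngle x) ω - P (realAngle x) ω * powOp κ * 0 - (P (realAngle x) ω + 0) +
        0 * powOp κ * (P (realAngle x) ω + 0) = 0 := by noncomm_ring
    exact e0.symm ▸ h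

/-- `C` is a constant for the bound on the solutions of the homological equation. -/
def HomSolBound (n : ℕ) (d τ Γ K₁ C : ℝ) : Prop :=
  ∀ (S : Set (Fin n → ℝ)) (lam : ℕ+ → (Fin n → ℝ) → ℝ)
    (P : (Fin n → ℂ) → (Fin n → ℝ) → EllOp) (ρ δ e M L : ℝ), 0 < δ → δ ≤ 1 → δ < ρ → 0 ≤ e →
    0 ≤ M → 0 ≤ L → 1 / δ ^ (τ + 1) ≤ L * M → MelnikovBound d τ S lam Γ →
    LipGapBound d S lam K₁ → Ctl ρ S P e M →
    Ctl (ρ - δ) S (homSol lam P) (C * (1 + L) * e / δ ^ ((n : ℝ) + τ)) M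

/-- `C` is a constant for the measure of the resonant frequencies. -/
def ExcisionBound (n : ℕ) (κ d τ K₀ K₁ C : ℝ) : Prop :=
  ∀ (S : Set (Fin n → ℝ)) (lam lam' : ℕ+ → (Fin n → ℝ) → ℝ)
    (γ δγ e K₀' K₁' : ℝ), MeasurableSet S → S ⊆ frequencySet n → 0 < e → 2 * e ≤ δγ →
    0 < γ - δγ → MelnikovBound d τ S lam γ → GapBound d S lam' K₀' → LipGapBound d S lam' K₁' →
    K₀ ≤ K₀' → K₁' ≤ K₁ → (∀ ω ∈ S, ∀ i, |lam' i ω - lam i ω| ≤ e * (i : ℝ) ^ (-κ)) →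
    ∃ S' : Set (Fin n → ℝ), S' ⊆ S ∧ MeasurableSet S' ∧ MelnikovBound d τ S' lam' (γ - δγ) ∧
      volume (S \ S') ≤ ENNReal.ofReal (C * (γ - δγ) * (e / δγ) ^ κ⁻¹)

/-- What is required of the data after `m` steps. -/
def IterGood {n : ℕ} (s κ d τ θ r ε Y q γ₀ : ℝ) (S : Set (Fin n → ℝ))
    (lam : ℕ+ → (Fin n → ℝ) → ℝ) (P : (Fin n → ℂ) → (Fin n → ℝ) → EllOp) (m : ℕ)
    (σ : StepData n) : Prop :=
  σ.S ⊆ S ∧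
    σ.Good s κ d τ lam P (r * (θ + (1 - θ) * (1 / 2) ^ m)) (ε * (q ^ 2)⁻¹ ^ m)
      (1 / r ^ (τ + 1)) (32 * Y * (1 - (1 / 2) ^ m)) (γ₀ - 2 * √ε * (1 - (1 / 2) ^ m))
      (2 * ε * (1 - (1 / 2) ^ m))

/-- The relation between the data after `m` and after `m + 1` steps. -/
structure IterStep {n : ℕ} (κ θ r ε Y γ₀ Ce : ℝ) (m : ℕ) (σ σ' : StepData n) : Prop where
  subset : σ'.S ⊆ σ.S
  vol : volume (σ.S \ σ'.S) ≤ ENNReal.ofReal (Ce * γ₀ * (√ε ^ κ⁻¹ * ((1 / 2) ^ κ⁻¹) ^ m))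
  lam : ∀ ω ∈ σ'.S, ∀ i, |σ'.lam i ω - σ.lam i ω| ≤ ε * (1 / 2) ^ m
  V : ∀ ω ∈ σ'.S, ∀ φ ∈ strip n (θ * r), ‖σ'.V φ ω - σ.V φ ω‖ ≤ 16 * Y * (1 / 2) ^ m
  u : ∀ ω ∈ σ'.S, ∀ x, ‖σ'.u x ω - σ.u x ω‖ ≤ 16 * Y * (1 / 2) ^ m
  Q : ∀ ω ∈ σ'.S, ‖σ'.Q ω - σ.Q ω‖ ≤ schurConst * ε * (1 / 2) ^ m

-- The homological equation is solved with the current eigenvalues, and the resonances of the new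
-- ones are then cut out with `δγ = √ε 2^(-m)`. Since the perturbation is at most `ε 4^(-m)`, the
-- quotient `e / δγ` is at most `√ε 2^(-m)` as well: this choice balances the loss in the Melnikov
-- constant against the loss of measure.
set_option maxHeartbeats 1000000 in
theorem exists_iterStep {n : ℕ} {s κ K₀ K₁ Γ τ θ d C Ce r ε Y q K₀₀ K₁₀ γ₀ : ℝ} (hs : 0 ≤ s)
    (hκ : 1 < κ) (hΓ : 0 < Γ) (hd : 1 ≤ d)
    (hCe : 0 < Ce) (hB : HomSolBound n d τ Γ K₁ C) (hE : ExcisionBound n κ d τ K₀ K₁ Ce)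
    (hN : IterNumbers n τ θ r ε Y q (96 * (1 + schurConst)) C)
    {S : Set (Fin n → ℝ)} {lam : ℕ+ → (Fin n → ℝ) → ℝ} {P : (Fin n → ℂ) → (Fin n → ℝ) → EllOp}
    (hSf : S ⊆ frequencySet n) (hgap : GapBound d S lam K₀₀) (hlip : LipGapBound d S lam K₁₀)
    (hK₀' : K₀ ≤ K₀₀ - 4 * ε) (hK₁' : K₁₀ + 4 * ε * (1 / r ^ (τ + 1)) ≤ K₁)
    (hΓ' : Γ ≤ γ₀ - 2 * √ε) {m : ℕ} {σ : StepData n}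
    (h : IterGood s κ d τ θ r ε Y q γ₀ S lam P m σ) :
    ∃ σ', IterGood s κ d τ θ r ε Y q γ₀ S lam P (m + 1) σ' ∧ IterStep κ θ r ε Y γ₀ Ce m σ σ' := by
  obtain ⟨hσS, hσ⟩ := h
  unfold IterGood
  have hκi : 0 < κ⁻¹ := by positivity
  have hτ0 := hN.hτ
  have hκ0 : 0 ≤ κ := by linarith
  have hr := hN.hr; have hr1 := hN.hr1; have hε := hN.hε; have hε1 := hN.hε1
  have hθ₀ := hN.hθ₀; have hθ₁ := hN.hθ₁; have hY := hN.Y_nonneg; have hY1 := hN.hY1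
  have h2q := hN.two_le_q
  have hsq : 0 < √ε := Real.sqrt_pos.2 hε
  have hsq2 : √ε * √ε = ε := Real.mul_self_sqrt hε.le
  have hsq1 : √ε ≤ 1 / 2 := by nlinarith
  have hM0 : 0 ≤ 1 / r ^ (τ + 1) := by positivity
  have hMeq : 1 / r ^ (τ + 1) = (r ^ (τ + 1))⁻¹ := one_div _
  generalize 1 / r ^ (τ + 1) = M at *
  have hc := schurConst_nonneg
  have hγ0 : 0 < γ₀ := by linarith
  have hh : 0 < (1 / 2 : ℝ) ^ m := by positivity
  have hh1 := IterNumbers.half_pow_le m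
  have hhs : (1 / 2 : ℝ) ^ (m + 1) = (1 / 2) ^ m / 2 := by rw [pow_succ]; ring
  have hem := hN.e_le m
  have hem0 : 0 < ε * (q ^ 2)⁻¹ ^ m := by positivity
  have hgain := hN.gain m
  have hbd := hN.homSol_bound m
  set e := ε * (q ^ 2)⁻¹ ^ m with he
  set X := (1 - θ) / 2 * (1 / 2) ^ m with hX
  have hX0 : 0 < X := mul_pos (by linarith) hh
  have hX1 : X ≤ 1 := mul_le_one₀ (by linarith) hh.le hh1
  have hδ1 : r * X ≤ 1 := mul_le_one₀ hr1 hX0.le hX1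
  have hρX : θ + (1 - θ) * (1 / 2) ^ m = θ + 2 * X := by rw [hX]; ring
  have hδρ : r * X < r * (θ + (1 - θ) * (1 / 2) ^ m) := by
    rw [hρX]; exact mul_lt_mul_of_pos_left (by linarith) hr
  -- `M = r^(-(τ+1))` is the same at all steps; the width of the present step enters only through `L
  -- = X^(-(τ+1))`.
  have hLM : 1 / (r * X) ^ (τ + 1) ≤ X ^ (-(τ + 1)) * M := by
    rw [Real.mul_rpow hr.le hX0.le, Real.rpow_neg hX0.le, hMeq]
    apply le_of_eq; field_simp
  have hg0 : 0 ≤ 2 * ε * (1 - (1 / 2) ^ m) := mul_nonneg (by linarith) (by linarith)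
  have hgε : 2 * ε * (1 - (1 / 2) ^ m) ≤ 2 * ε := mul_le_of_le_one_right (by linarith) (by linarith)
  have hΓm : Γ ≤ γ₀ - 2 * √ε * (1 - (1 / 2) ^ m) := by
    have : 2 * √ε * (1 - (1 / 2) ^ m) ≤ 2 * √ε :=
      mul_le_of_le_one_right (by linarith) (by linarith)
    linarith
  have hmelΓ : MelnikovBound d τ σ.S σ.lam Γ := by
    intro ω hω i j k hijk
    refine le_trans ?_ (hσ.mel ω hω i j k hijk)
    have h1 := intNorm_nonneg k
    have h2 := one_le_bracket ((i : ℝ) ^ d - (j : ℝ) ^ d)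
    gcongr
  have hlipσ : LipGapBound d σ.S σ.lam K₁ := by
    have h1 := hlip.perturb hd hσS hg0 hM0 hσ.devLip
    intro ω hω ω' hω' hne i j
    refine (h1 ω hω ω' hω' hne i j).trans ?_
    have h2 := powGap_nonneg d i j
    have h3 : 2 * (2 * ε * (1 - (1 / 2) ^ m)) * M ≤ 4 * ε * M := by
      have := mul_le_mul_of_nonneg_right hgε hM0
      linarith
    have h4 : K₁₀ + 2 * (2 * ε * (1 - (1 / 2) ^ m)) * M ≤ K₁ := by linarith
    gcongr
  have hctlY : Ctl (r * (θ + (1 - θ) * (1 / 2) ^ m) - r * X) σ.S (homSol σ.lam σ.P)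
      (Y * (1 / 2) ^ m) M :=
    (hB σ.S σ.lam σ.P _ (r * X) e M (X ^ (-(τ + 1))) (mul_pos hr hX0) hδ1 hδρ hem0.le hM0
      (by positivity) hLM hmelΓ hlipσ hσ.ctlP).mono le_rfl subset_rfl hbd hM0
  have hYm : Y * (1 / 2) ^ m ≤ Y := mul_le_of_le_one_right hY hh1
  have hsm : σ.Small s κ (r * (θ + (1 - θ) * (1 / 2) ^ m)) (r * X) M (Y * (1 / 2) ^ m) Γ d τ :=
    ⟨hctlY, by positivity, by linarith, hmelΓ, hΓ, mul_pos hr hX0, hδ1, hδρ⟩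
  have hv0 : 0 ≤ 32 * Y * (1 - (1 / 2) ^ m) := mul_nonneg (by linarith) (by linarith)
  have hv1 : 32 * Y * (1 - (1 / 2) ^ m) ≤ 1 / 2 :=
    (mul_le_of_le_one_right (by linarith) (by linarith)).trans hY1
  have hdiff := fun (S' : Set (Fin n → ℝ)) ω (hω : ω ∈ σ.S) =>
    hσ.next_diff hs hκ0 hd hτ0 hsm hM0 hv1 (S' := S') hω
  -- The new eigenvalues do not depend on the set given to `next`, so they are known before the
  -- excision that determines it.
  set lam' := (σ.next s κ σ.S).lam with hlam'
  have hdm : ∀ S', S' ⊆ σ.S → MeasurableSet S' → ∀ γ', MelnikovBound d τ S' lam' γ' →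
      (σ.next s κ S').Good s κ d τ lam P (r * (θ + (1 - θ) * (1 / 2) ^ (m + 1)))
        (ε * (q ^ 2)⁻¹ ^ (m + 1)) M (32 * Y * (1 - (1 / 2) ^ (m + 1))) γ'
        (2 * ε * (1 - (1 / 2) ^ (m + 1))) := by
    intro S' hS' hS'm γ' hmel'
    have h1 := hσ.next hs hκ0 hd hτ0 hsm hem0.le hM0 hv0 hv1 hS' hS'm hmel'
    have h2 := h1.mono hgain (g' := 2 * ε * (1 - (1 / 2) ^ (m + 1))) (by rw [hhs]; linarith) hM0
    have e1 : r * (θ + (1 - θ) * (1 / 2) ^ m) - r * X = r * (θ + (1 - θ) * (1 / 2) ^ (m + 1)) := by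
      rw [hhs, hX]; ring
    have e2 : 32 * Y * (1 - (1 / 2) ^ m) + 16 * (Y * (1 / 2) ^ m) =
        32 * Y * (1 - (1 / 2) ^ (m + 1)) := by
      rw [hhs]; ring
    rw [e1, e2] at h2
    exact h2
  have hδγ : γ₀ - 2 * √ε * (1 - (1 / 2) ^ m) - √ε * (1 / 2) ^ m =
      γ₀ - 2 * √ε * (1 - (1 / 2) ^ (m + 1)) := by rw [hhs]; ring
  have hΓm' : Γ ≤ γ₀ - 2 * √ε * (1 - (1 / 2) ^ (m + 1)) := by
    have h1 : (0 : ℝ) < (1 / 2) ^ (m + 1) := by positivity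
    have : 2 * √ε * (1 - (1 / 2) ^ (m + 1)) ≤ 2 * √ε :=
      mul_le_of_le_one_right (by linarith) (by linarith)
    linarith
  have hgap' : GapBound d σ.S lam' K₀ ∧ LipGapBound d σ.S lam' K₁ := by
    -- The Melnikov bound with constant `0` is trivial; it gives the deviation bounds on the whole
    -- of `σ.S`, before any excision.
    have hG := hdm σ.S subset_rfl hσ.meas 0 (fun ω _ i j k _ => by simp)
    have h1 : 0 ≤ 2 * ε * (1 - (1 / 2) ^ (m + 1)) :=
      mul_nonneg (by linarith) (by linarith [IterNumbers.half_pow_le (m + 1)])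
    have h2 : 2 * ε * (1 - (1 / 2) ^ (m + 1)) ≤ 2 * ε :=
      mul_le_of_le_one_right (by linarith) (by linarith [IterNumbers.half_pow_pos (m + 1)])
    have h3 := hgap.perturb hd hσS h1 hG.dev
    have h4 := hlip.perturb hd hσS h1 hM0 hG.devLip
    refine ⟨fun ω hω i j => le_trans ?_ (h3 ω hω i j), fun ω hω ω' hω' hne i j =>
      (h4 ω hω ω' hω' hne i j).trans ?_⟩
    · have h5 := powGap_nonneg d i j
      gcongr
      linarith
    · have h5 := powGap_nonneg d i j
      have h6 : 2 * (2 * ε * (1 - (1 / 2) ^ (m + 1))) * M ≤ 4 * ε * M := by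
        have := mul_le_mul_of_nonneg_right h2 hM0
        linarith
      gcongr
      linarith
  obtain ⟨S', hS'S, hS'm, hS'mel, hS'v⟩ := hE σ.S σ.lam lam' (γ₀ - 2 * √ε * (1 - (1 / 2) ^ m))
    (√ε * (1 / 2) ^ m) e K₀ K₁ hσ.meas (hσS.trans hSf) hem0
    (by nlinarith) (by rw [hδγ]; linarith) hσ.mel hgap'.1 hgap'.2 le_rfl le_rfl
    (fun ω hω => (hdiff σ.S ω hω).1)
  rw [hδγ] at hS'mel hS'v
  refine ⟨σ.next s κ S', ⟨hS'S.trans hσS, ?_⟩, hS'S, hS'v.trans ?_, ?_, ?_, ?_, ?_⟩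
  · exact hdm S' hS'S hS'm _ hS'mel
  · apply ENNReal.ofReal_le_ofReal
    have h1 : γ₀ - 2 * √ε * (1 - (1 / 2) ^ (m + 1)) ≤ γ₀ := by
      have : (1 / 2 : ℝ) ^ (m + 1) ≤ 1 := IterNumbers.half_pow_le _
      have : 0 ≤ 2 * √ε * (1 - (1 / 2) ^ (m + 1)) := mul_nonneg (by linarith) (by linarith)
      linarith
    have h2 : e / (√ε * (1 / 2) ^ m) ≤ √ε * (1 / 2) ^ m := by
      have h3 : e ≤ ε * ((1 / 2) ^ m * (1 / 2) ^ m) := by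
        rw [he, ← mul_pow]
        gcongr
        rw [inv_le_comm₀ (by positivity) (by norm_num)]
        nlinarith
      rw [div_le_iff₀ (by positivity)]
      calc e ≤ ε * ((1 / 2) ^ m * (1 / 2) ^ m) := h3
        _ = (√ε * √ε) * ((1 / 2) ^ m * (1 / 2) ^ m) := by rw [hsq2]
        _ = _ := by ring
    have h3 : (e / (√ε * (1 / 2) ^ m)) ^ κ⁻¹ ≤ √ε ^ κ⁻¹ * ((1 / 2) ^ κ⁻¹) ^ m := by
      refine (Real.rpow_le_rpow (by positivity) h2 hκi.le).trans (le_of_eq ?_)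
      rw [Real.mul_rpow hsq.le hh.le, ← Real.rpow_natCast, ← Real.rpow_mul (by norm_num),
        ← Real.rpow_natCast, ← Real.rpow_mul (by norm_num), mul_comm (m : ℝ)]
    gcongr
  · intro ω hω i
    have : (i : ℝ) ^ (-κ) ≤ 1 :=
      Real.rpow_le_one_of_one_le_of_nonpos (by exact_mod_cast i.pos) (by linarith)
    exact ((hdiff S' ω (hS'S hω)).1 i).trans ((mul_le_of_le_one_right hem0.le this).trans hem)
  · intro ω hω φ hφ
    refine ((hdiff S' ω (hS'S hω)).2.1 φ (strip_mono ?_ hφ)).trans (le_of_eq (by ring))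
    rw [hρX]; nlinarith
  · intro ω hω x
    exact ((hdiff S' ω (hS'S hω)).2.2.1 x).trans (le_of_eq (by ring))
  · intro ω hω
    refine (hdiff S' ω (hS'S hω)).2.2.2.trans ?_
    rw [mul_assoc]; gcongr

/-- The infinite sequence of steps. -/
theorem exists_iteration {n : ℕ} {s κ K₀ K₁ Γ τ θ d C Ce r ε Y q K₀₀ K₁₀ γ₀ : ℝ} (hs : 0 ≤ s)
    (hκ : 1 < κ) (hΓ : 0 < Γ) (hd : 1 ≤ d)
    (hCe : 0 < Ce) (hB : HomSolBound n d τ Γ K₁ C) (hE : ExcisionBound n κ d τ K₀ K₁ Ce)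
    (hN : IterNumbers n τ θ r ε Y q (96 * (1 + schurConst)) C)
    {S : Set (Fin n → ℝ)} {lam : ℕ+ → (Fin n → ℝ) → ℝ} {P : (Fin n → ℂ) → (Fin n → ℝ) → EllOp}
    (hSm : MeasurableSet S) (hSf : S ⊆ frequencySet n) (hP : Ctl r S P ε (1 / r ^ (τ + 1)))
    (hsa : ∀ ω ∈ S, ∀ x, ∃ p, OpRel s κ (P (realAngle x) ω) p ∧ IsSelfAdjoint p)
    (hgap : GapBound d S lam K₀₀) (hlip : LipGapBound d S lam K₁₀)
    (hmel : MelnikovBound d τ S lam γ₀)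
    (hK₀' : K₀ ≤ K₀₀ - 4 * ε) (hK₁' : K₁₀ + 4 * ε * (1 / r ^ (τ + 1)) ≤ K₁)
    (hΓ' : Γ ≤ γ₀ - 2 * √ε) :
    ∃ σ : ℕ → StepData n, (σ 0).S = S ∧ ∀ m,
      IterGood s κ d τ θ r ε Y q γ₀ S lam P m (σ m) ∧
      IterStep κ θ r ε Y γ₀ Ce m (σ m) (σ (m + 1)) := by
  have hM0 : 0 ≤ 1 / r ^ (τ + 1) := by have := hN.hr; positivity
  obtain ⟨σ, h0, h⟩ := exists_seq_of_step (p := IterGood s κ d τ θ r ε Y q γ₀ S lam P)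
    (r := IterStep κ θ r ε Y γ₀ Ce) (a₀ := StepData.init S lam P)
    ⟨subset_rfl, by simpa using StepData.good_init hSm hP hM0 hsa hmel⟩
    (fun m σ hσ => exists_iterStep hs hκ hΓ hd hCe hB hE hN hSf hgap hlip hK₀' hK₁' hΓ' hσ)
  exact ⟨σ, by rw [h0]; rfl, h⟩

/-! ### Limits -/

section Limits

open Filter Topology

theorem tendsto_limUnder_of_half {E : Type*} [NormedAddCommGroup E] [CompleteSpace E] {f : ℕ → E}
    {C : ℝ} (h : ∀ m, ‖f (m + 1) - f m‖ ≤ C * (1 / 2) ^ m) :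
    Tendsto f atTop (𝓝 (limUnder atTop f)) ∧
      ∀ m, ‖f m - limUnder atTop f‖ ≤ 2 * C * (1 / 2) ^ m := by
  have hd : ∀ m, dist (f m) (f (m + 1)) ≤ C * (1 / 2) ^ m := fun m => by
    rw [dist_comm, dist_eq_norm]; exact h m
  have ht := (cauchySeq_of_le_geometric (1 / 2) C (by norm_num) hd).tendsto_limUnder
  refine ⟨ht, fun m => ?_⟩
  have := dist_le_of_le_geometric_of_tendsto (1 / 2) C (by norm_num) hd ht m
  rw [dist_eq_norm] at this
  refine this.trans (le_of_eq ?_)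
  ring

/-- Cauchy's estimate on the complex lines through `z`: in the direction `w` on the disc of radius
`R / (2 ‖w‖)`. -/
theorem norm_fderiv_le_of_bound {E F : Type*} [NormedAddCommGroup E] [NormedSpace ℂ E]
    [NormedAddCommGroup F] [NormedSpace ℂ F] [CompleteSpace F] {f : E → F} {z : E} {R C : ℝ} (hR : 0 < R)
    (hf : DifferentiableOn ℂ f (Metric.ball z R)) (hC : ∀ w ∈ Metric.ball z R, ‖f w‖ ≤ C) :
    ‖fderiv ℂ f z‖ ≤ 2 * C / R := by
  have hC0 : 0 ≤ C := (norm_nonneg _).trans (hC z (Metric.mem_ball_self hR))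
  refine ContinuousLinearMap.opNorm_le_bound _ (by positivity) fun w => ?_
  by_cases hw : w = 0
  · subst hw; simp
  have hw' : 0 < ‖w‖ := norm_pos_iff.2 hw
  set ρ := R / (2 * ‖w‖) with hρ
  have hρ0 : 0 < ρ := by positivity
  have hmem : ∀ t ∈ Metric.closedBall (0 : ℂ) ρ, z + t • w ∈ Metric.ball z R := by
    intro t ht
    rw [mem_closedBall_zero_iff] at ht
    rw [mem_ball_iff_norm, add_sub_cancel_left, norm_smul]
    calc ‖t‖ * ‖w‖ ≤ ρ * ‖w‖ := by gcongr
      _ = R / 2 := by rw [hρ]; field_simp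
      _ < R := by linarith
  have hg : ∀ t ∈ Metric.closedBall (0 : ℂ) ρ, DifferentiableAt ℂ (fun t : ℂ => f (z + t • w)) t := by
    intro t ht
    have h1 : DifferentiableAt ℂ f (z + t • w) :=
      hf.differentiableAt (Metric.isOpen_ball.mem_nhds (hmem t ht))
    have h2 : DifferentiableAt ℂ (fun t : ℂ => z + t • w) t := by fun_prop
    exact DifferentiableAt.comp t h1 h2
  have h1 := Complex.norm_deriv_le_of_forall_mem_sphere_norm_le (f := fun t : ℂ => f (z + t • w))
    (c := 0) hρ0 (C := C) ⟨fun t ht => (hg t (Metric.ball_subset_closedBall ht)).differentiableWithinAt,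
      by
        rw [closure_ball (0 : ℂ) hρ0.ne']
        exact fun t ht => (hg t ht).continuousAt.continuousWithinAt⟩
    (fun t ht => hC _ (hmem t (Metric.sphere_subset_closedBall ht)))
  have h2 : HasDerivAt (fun t : ℂ => f (z + t • w)) (fderiv ℂ f z w) 0 := by
    have h3 : HasFDerivAt f (fderiv ℂ f z) (z + (0 : ℂ) • w) := by
      rw [zero_smul, add_zero]
      exact (hf.differentiableAt (Metric.ball_mem_nhds z hR)).hasFDerivAt
    have h4 : HasDerivAt (fun t : ℂ => z + t • w) w 0 := by
      simpa using ((hasDerivAt_id (0 : ℂ)).smul_const w).const_add z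
    exact h3.comp_hasDerivAt (0 : ℂ) h4
  rw [h2.deriv] at h1
  refine h1.trans (le_of_eq ?_)
  rw [hρ]; field_simp

/-- Limits of analytic maps with geometrically decreasing increments are analytic. -/
theorem differentiableOn_of_half {E F : Type*} [NormedAddCommGroup E] [NormedSpace ℂ E]
    [NormedAddCommGroup F] [NormedSpace ℂ F] [CompleteSpace F] {U : Set E} (hU : IsOpen U)
    {f : ℕ → E → F} {g : E → F} {C : ℝ} (hf : ∀ m, DifferentiableOn ℂ (f m) U)
    (hb : ∀ m, ∀ z ∈ U, ‖f (m + 1) z - f m z‖ ≤ C * (1 / 2) ^ m)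
    (hg : ∀ z ∈ U, Tendsto (fun m => f m z) atTop (𝓝 (g z))) : DifferentiableOn ℂ g U := by
  intro z hz
  obtain ⟨R, hR, hRU⟩ := Metric.isOpen_iff.1 hU z hz
  have hsum : Summable (fun m : ℕ => 2 * (C * (1 / 2) ^ m) / (R / 2)) :=
    (((summable_geometric_of_lt_one (by norm_num : (0 : ℝ) ≤ 1 / 2) (by norm_num)).mul_left C).mul_left
      2).div_const _
  have hR2 : 0 < R / 2 := by linarith
  have hsub : Metric.ball z (R / 2) ⊆ U := (Metric.ball_subset_ball (by linarith)).trans hRU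
  have hdi : ∀ m, DifferentiableOn ℂ (fun w => f (m + 1) w - f m w) U := fun m =>
    (hf (m + 1)).sub (hf m)
  have hsm : ∀ w ∈ U, Summable (fun m => f (m + 1) w - f m w) := fun w hw =>
    Summable.of_norm_bounded
      ((summable_geometric_of_lt_one (by norm_num : (0 : ℝ) ≤ 1 / 2) (by norm_num)).mul_left C)
      (fun m => hb m w hw)
  -- The telescoping series of increments is differentiated term by term; Cauchy's estimate makes
  -- the derivatives decrease geometrically too.
  have key := hasFDerivAt_tsum_of_isPreconnected hsum (s := Metric.ball z (R / 2)) Metric.isOpen_ball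
    (convex_ball z (R / 2)).isPreconnected (f := fun m w => f (m + 1) w - f m w)
    (f' := fun m w => fderiv ℂ (fun w => f (m + 1) w - f m w) w)
    (fun m w hw => ((hdi m).differentiableAt (hU.mem_nhds (hsub hw))).hasFDerivAt)
    (fun m w hw => by
      have hbw : Metric.ball w (R / 2) ⊆ U := by
        refine (Metric.ball_subset_ball' ?_).trans hRU
        rw [Metric.mem_ball] at hw
        linarith
      exact norm_fderiv_le_of_bound hR2 ((hdi m).mono hbw) (fun x hx => hb m x (hbw hx)))
    (Metric.mem_ball_self hR2) (hsm z hz) (Metric.mem_ball_self hR2)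
  have h2 := key.differentiableAt.add ((hf 0).differentiableAt (hU.mem_nhds hz))
  refine (h2.congr_of_eventuallyEq ?_).differentiableWithinAt
  filter_upwards [hU.mem_nhds hz] with w hw
  have h3 : Tendsto (fun N => ∑ m ∈ Finset.range N, (f (m + 1) w - f m w)) atTop (𝓝 (g w - f 0 w)) := by
    simp only [Finset.sum_range_sub (fun m => f m w)]
    exact (hg w hw).sub_const _
  have h4 := tendsto_nhds_unique (hsm w hw).hasSum.tendsto_sum_nat h3
  change g w = (∑' m, (f (m + 1) w - f m w)) + f 0 w
  rw [h4, sub_add_cancel]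

theorem tendstoUniformly_of_norm_le {X E : Type*} [NormedAddCommGroup E] {f : ℕ → X → E} {g : X → E}
    {c : ℕ → ℝ} (hc : Tendsto c atTop (𝓝 0)) (h : ∀ m x, ‖f m x - g x‖ ≤ c m) :
    TendstoUniformly f g atTop := by
  rw [Metric.tendstoUniformly_iff]
  intro ε hε
  filter_upwards [hc.eventually_lt_const hε] with m hm x
  rw [dist_comm, dist_eq_norm]
  exact (h m x).trans_lt hm

end Limits

/-! ### The operator equation for the matrix elements, and its limit. -/

section Stage

variable {n : ℕ} {s κ d τ : ℝ} {lam₀ : ℕ+ → (Fin n → ℝ) → ℝ}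
  {P₀ : (Fin n → ℂ) → (Fin n → ℝ) → EllOp} {σ : StepData n} {ρ e M v γ g : ℝ}

theorem StepData.Good.rel_Q (hσ : σ.Good s κ d τ lam₀ P₀ ρ e M v γ g) (hκ : 0 ≤ κ) {ω : Fin n → ℝ}
    (hω : ω ∈ σ.S) : OpRel s κ (σ.Q ω) (powOp κ * σ.Q ω) := by
  intro i j
  rw [entry_powOp_mul hκ, hσ.diag ω hω]
  split_ifs with h
  · subst h
    have h1 := cast_rpow_mul i (-s) (s - κ)
    have h2 : -s + (s - κ) = -κ := by ring
    rw [h2] at h1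
    rw [← h1]; ring
  · simp

/-- The differential equation for the matrix elements of the transformation. -/
theorem StepData.Good.hasDerivAt_entry (hσ : σ.Good s κ d τ lam₀ P₀ ρ e M v γ g) (hκ : 0 ≤ κ)
    {ω : Fin n → ℝ} (hω : ω ∈ σ.S) (t : ℝ) {p₀ p : EllOp}
    (hp₀ : OpRel s κ (P₀ (realAngle (t • ω)) ω) p₀) (hp : OpRel s κ (σ.P (realAngle (t • ω)) ω) p)
    (i j : ℕ+) :
    HasDerivAt (fun t => entry (σ.u (t • ω) ω) i j)
      (-(Complex.I * (((lam₀ i ω - lam₀ j ω : ℝ) : ℂ) * entry (σ.u (t • ω) ω) i j +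
        entry (p₀ * σ.u (t • ω) ω - σ.u (t • ω) ω * (p + powOp κ * σ.Q ω)) i j))) t := by
  obtain ⟨T', hT, hC⟩ := hσ.gen ω hω (t • ω)
  have h00 : realAngle (t • ω) + realAngle ((0 : ℝ) • ω) = realAngle (t • ω) := by
    funext m; simp [realAngle]
  have hC' := hC i j
  simp only at hC'
  rw [h00, entry_add, entry_smul] at hC'
  have h1 := (hσ.rel ω hω (t • ω))
  have hF := hp.add (hσ.rel_Q hκ hω)
  have h2 := ((hp₀.sub (hp₀.mul hκ h1)).sub hF).add (h1.mul hκ hF) i j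
  set R := P₀ (realAngle (t • ω)) ω - P₀ (realAngle (t • ω)) ω * powOp κ * σ.V (realAngle (t • ω)) ω -
      (σ.P (realAngle (t • ω)) ω + σ.Q ω) + σ.V (realAngle (t • ω)) ω * powOp κ *
        (σ.P (realAngle (t • ω)) ω + σ.Q ω)
  have e1 : p₀ - p₀ * (1 - σ.u (t • ω) ω) - (p + powOp κ * σ.Q ω) +
      (1 - σ.u (t • ω) ω) * (p + powOp κ * σ.Q ω) =
      p₀ * σ.u (t • ω) ω - σ.u (t • ω) ω * (p + powOp κ * σ.Q ω) := by noncomm_ring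
  rw [e1] at h2
  rw [h2]
  have h3 := h1 i j
  rw [entry_sub, entry_one] at h3
  -- `gen` speaks of time `0` from an arbitrary angle; started from the angle `t • ω` it gives the
  -- derivative at time `t`.
  have h4 : HasDerivAt (fun t' : ℝ => entry (σ.V (realAngle (t' • ω)) ω) i j) (entry T' i j) t := by
    have h5 := ((entryCLM i j).restrictScalars ℝ).hasFDerivAt.comp_hasDerivAt (0 : ℝ) hT
    have h6 : HasDerivAt (fun t' : ℝ => t' - t) 1 t := (hasDerivAt_id t).sub_const t
    have h7 := HasDerivAt.scomp_of_eq (x := t) h5 h6 (by simp)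
    rw [one_smul] at h7
    refine h7.congr_of_eventuallyEq (Filter.Eventually.of_forall fun t' => ?_)
    simp only [Function.comp_apply]
    rw [← realAngle_add, ← add_smul, add_sub_cancel]
    rfl
  have h8 : ∀ t' : ℝ, entry (σ.u (t' • ω) ω) i j = (if i = j then 1 else 0) -
      (((i : ℝ) ^ (-s) : ℝ) : ℂ) * entry (σ.V (realAngle (t' • ω)) ω) i j *
        (((j : ℝ) ^ (s - κ) : ℝ) : ℂ) := by
    intro t'
    rw [← hσ.rel ω hω (t' • ω) i j, entry_sub, entry_one]; ring
  simp only [h8]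
  have h9 := ((h4.const_mul (((i : ℝ) ^ (-s) : ℝ) : ℂ)).mul_const
    (((j : ℝ) ^ (s - κ) : ℝ) : ℂ)).const_sub (if i = j then (1 : ℂ) else 0)
  refine h9.congr_deriv (Eq.symm ?_)
  have h10 : ((lam₀ i ω - lam₀ j ω : ℝ) : ℂ) * (if i = j then (1 : ℂ) else 0) = 0 := by
    split_ifs with h
    · subst h; simp
    · simp
  linear_combination (-Complex.I) * h10 - (Complex.I * (((i : ℝ) ^ (-s) : ℝ) : ℂ) * (((j : ℝ) ^ (s - κ) : ℝ) : ℂ)) * hC' +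
    (((i : ℝ) ^ (-s) : ℝ) : ℂ) * (((j : ℝ) ^ (s - κ) : ℝ) : ℂ) * entry T' i j * Complex.I_mul_I

end Stage

/-- The matrix elements of the product with a diagonal operator. -/
theorem entry_mul_diag {m : EllOp} {c : ℕ+ → ℂ} (hm : ∀ i j, entry m i j = if i = j then c j else 0)
    (a : EllOp) (i j : ℕ+) : entry (a * m) i j = entry a i j * c j := by
  refine (hasSum_entry_mul_entry a m i j).unique ?_
  have := hasSum_single (f := fun l => entry a i l * entry m l j) j (fun l hl => by simp [hm, hl])
  simpa [hm] using this

/-- The transformation to a diagonal system. -/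
structure NormalForm {n : ℕ} (s κ d τ ρ v M K K' γ : ℝ) (lam : ℕ+ → (Fin n → ℝ) → ℝ)
    (P : (Fin n → ℂ) → (Fin n → ℝ) → EllOp) (S : Set (Fin n → ℝ)) (lam₁ : ℕ+ → (Fin n → ℝ) → ℝ)
    (V : (Fin n → ℂ) → (Fin n → ℝ) → EllOp) (u : (Fin n → ℝ) → (Fin n → ℝ) → EllOp) : Prop where
  meas : MeasurableSet S
  ctl : Ctl ρ S V v M
  unit : ∀ ω ∈ S, ∀ x, u x ω ∈ unitary EllOp
  rel : ∀ ω ∈ S, ∀ x, OpRel s κ (V (realAngle x) ω) (1 - u x ω)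
  cont : ∀ ω ∈ S, Continuous (fun x => u x ω)
  gap : GapBound d S lam₁ K
  lip : LipGapBound d S lam₁ K'
  mel : MelnikovBound d τ S lam₁ γ
  deriv : ∀ ω ∈ S, ∀ (t : ℝ) (p : EllOp), OpRel s κ (P (realAngle (t • ω)) ω) p → ∀ i j,
    HasDerivAt (fun t => entry (u (t • ω) ω) i j)
      (-(Complex.I * (((lam i ω - lam₁ j ω : ℝ) : ℂ) * entry (u (t • ω) ω) i j +
        entry (p * u (t • ω) ω) i j))) t

section Deriv

open Filter Topology

variable {n : ℕ} {s κ d τ : ℝ} {lam lam₁ : ℕ+ → (Fin n → ℝ) → ℝ}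
  {P : (Fin n → ℂ) → (Fin n → ℝ) → EllOp} {σ : ℕ → StepData n} {ρ e v γ g : ℕ → ℝ} {M ε Y C : ℝ}

/-- On matrix elements the unbounded diagonal acts as the mere factor `λ_i - λ_j`. Their derivatives
converge uniformly in time, because the remaining perturbation tends to `0` in the plain norm by
Krein's lemma; so limit and derivative may be exchanged. -/
theorem hasDerivAt_limit_entry (hs : 0 ≤ s) (hκ : 0 ≤ κ) {ω : Fin n → ℝ}
    (hρ : ∀ m, 0 < ρ m) (he : ∀ m, e m ≤ ε * (1 / 2) ^ m)
    (hσ : ∀ m, (σ m).Good s κ d τ lam P (ρ m) (e m) M (v m) (γ m) (g m))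
    (hω : ∀ m, ω ∈ (σ m).S) {u : (Fin n → ℝ) → EllOp} {Q : EllOp}
    (hsa : ∀ x, ∃ p, OpRel s κ (P (realAngle x) ω) p ∧ IsSelfAdjoint p)
    (hPε : ∀ x, ‖P (realAngle x) ω‖ ≤ ε)
    (hu1 : ∀ x, u x ∈ unitary EllOp)
    (hu : ∀ m x, ‖(σ m).u x ω - u x‖ ≤ Y * (1 / 2) ^ m)
    (hQ : ∀ m, ‖(σ m).Q ω - Q‖ ≤ C * (1 / 2) ^ m)
    (hl : ∀ i, Tendsto (fun m => (σ m).lam i ω) atTop (𝓝 (lam₁ i ω)))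
    (t : ℝ) {p : EllOp} (hp : OpRel s κ (P (realAngle (t • ω)) ω) p) (i j : ℕ+) :
    HasDerivAt (fun t : ℝ => entry (u (t • ω)) i j)
      (-(Complex.I * (((lam i ω - lam₁ j ω : ℝ) : ℂ) * entry (u (t • ω)) i j +
        entry (p * u (t • ω)) i j))) t := by
  choose p₀ hp₀ hp₀s using hsa
  choose q hq hqs using fun m x => (hσ m).selfAdj ω (hω m) x
  have hp₀n : ∀ x, ‖p₀ x‖ ≤ ε := fun x =>
    ((hp₀ x).norm_le_of_selfAdjoint hs hκ (hp₀s x)).trans (hPε x)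
  have hqn : ∀ m x, ‖q m x‖ ≤ ε * (1 / 2) ^ m := fun m x =>
    ((hq m x).norm_le_of_selfAdjoint hs hκ (hqs m x)).trans
      (((hσ m).ctlP.sup ω (hω m) _ (realAngle_mem_strip (hρ m) x)).trans (he m))
  have hε : 0 ≤ ε := (norm_nonneg _).trans (hp₀n 0)
  have hY : 0 ≤ Y := by have := (norm_nonneg _).trans (hu 0 0); simpa using this
  have hC : 0 ≤ C := by have := (norm_nonneg _).trans (hQ 0); simpa using this
  have h0 : Tendsto (fun m : ℕ => (1 / 2 : ℝ) ^ m) atTop (𝓝 0) :=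
    tendsto_pow_atTop_nhds_zero_of_lt_one (by norm_num) (by norm_num)
  have hQt : Tendsto (fun m => (σ m).Q ω) atTop (𝓝 Q) :=
    tendsto_iff_norm_sub_tendsto_zero.2 (squeeze_zero (fun _ => norm_nonneg _) hQ
      (by simpa using h0.const_mul C))
  have hut : ∀ x, Tendsto (fun m => (σ m).u x ω) atTop (𝓝 (u x)) := fun x =>
    tendsto_iff_norm_sub_tendsto_zero.2 (squeeze_zero (fun _ => norm_nonneg _) (fun m => hu m x)
      (by simpa using h0.const_mul Y))
  have hun : ∀ x, ‖u x‖ ≤ 1 := fun x => (CStarRing.norm_of_mem_unitary (hu1 x)).le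
  have humn : ∀ m x, ‖(σ m).u x ω‖ ≤ 1 := fun m x =>
    (CStarRing.norm_of_mem_unitary ((hσ m).unit ω (hω m) x)).le
  -- In the limit the accumulated diagonal is `lam₁ - lam`, which changes the factor `lam j` on the
  -- right of `u` into `lam₁ j`.
  have hDQ : ∀ i j, entry (powOp κ * Q) i j = if i = j then ((lam₁ j ω - lam j ω : ℝ) : ℂ) else 0 := by
    intro i j
    have h1 : Tendsto (fun m => entry (powOp κ * (σ m).Q ω) i j) atTop (𝓝 (entry (powOp κ * Q) i j)) :=
      ((continuous_entry i j).tendsto _).comp (hQt.const_mul _)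
    have h2 := fun m => (entry_powOp_comm_diag hκ ((hσ m).diag ω (hω m))).1 i j
    simp only [h2] at h1
    refine tendsto_nhds_unique h1 ?_
    split_ifs with h
    · subst h
      exact (Complex.continuous_ofReal.tendsto _).comp ((hl i).sub_const _)
    · exact tendsto_const_nhds
  have hpeq : p = p₀ (t • ω) := hp.unique_right (hp₀ _)
  subst hpeq
  set Λ : ℂ := ((lam i ω - lam j ω : ℝ) : ℂ)
  let g' : ℝ → ℂ := fun t => -(Complex.I * (Λ * entry (u (t • ω)) i j +
    entry (p₀ (t • ω) * u (t • ω) - u (t • ω) * (powOp κ * Q)) i j))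
  let f' : ℕ → ℝ → ℂ := fun m t => -(Complex.I * (Λ * entry ((σ m).u (t • ω) ω) i j +
    entry (p₀ (t • ω) * (σ m).u (t • ω) ω -
      (σ m).u (t • ω) ω * (q m (t • ω) + powOp κ * (σ m).Q ω)) i j))
  have hbound : ∀ m t, ‖f' m t - g' t‖ ≤
      (‖Λ‖ * Y + ε * Y + ε + Y * ‖Q‖ + C) * (1 / 2) ^ m := by
    intro m t
    have e1 : f' m t - g' t = -(Complex.I * (Λ * entry ((σ m).u (t • ω) ω - u (t • ω)) i j +
        entry (p₀ (t • ω) * ((σ m).u (t • ω) ω - u (t • ω)) - (σ m).u (t • ω) ω * q m (t • ω) -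
          ((σ m).u (t • ω) ω - u (t • ω)) * (powOp κ * Q) -
          (σ m).u (t • ω) ω * (powOp κ * ((σ m).Q ω - Q))) i j)) := by
      have e2 : p₀ (t • ω) * ((σ m).u (t • ω) ω - u (t • ω)) - (σ m).u (t • ω) ω * q m (t • ω) -
          ((σ m).u (t • ω) ω - u (t • ω)) * (powOp κ * Q) -
          (σ m).u (t • ω) ω * (powOp κ * ((σ m).Q ω - Q)) =
          (p₀ (t • ω) * (σ m).u (t • ω) ω -
            (σ m).u (t • ω) ω * (q m (t • ω) + powOp κ * (σ m).Q ω)) -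
          (p₀ (t • ω) * u (t • ω) - u (t • ω) * (powOp κ * Q)) := by noncomm_ring
      rw [e2, entry_sub, entry_sub]
      ring
    rw [e1, norm_neg, norm_mul, Complex.norm_I, one_mul]
    have hD := norm_powOp_le κ
    have b0 := hu m (t • ω)
    have b1 : ‖Λ * entry ((σ m).u (t • ω) ω - u (t • ω)) i j‖ ≤ ‖Λ‖ * (Y * (1 / 2) ^ m) := by
      rw [norm_mul]
      gcongr
      exact (norm_entry_le _ _ _).trans b0
    have b2 : ‖p₀ (t • ω) * ((σ m).u (t • ω) ω - u (t • ω))‖ ≤ ε * (Y * (1 / 2) ^ m) :=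
      (norm_mul_le _ _).trans (mul_le_mul (hp₀n _) b0 (norm_nonneg _) hε)
    have b3 : ‖(σ m).u (t • ω) ω * q m (t • ω)‖ ≤ 1 * (ε * (1 / 2) ^ m) :=
      (norm_mul_le _ _).trans (mul_le_mul (humn _ _) (hqn _ _) (norm_nonneg _) zero_le_one)
    have b4 : ‖((σ m).u (t • ω) ω - u (t • ω)) * (powOp κ * Q)‖ ≤ (Y * (1 / 2) ^ m) * (1 * ‖Q‖) :=
      (norm_mul_le _ _).trans (mul_le_mul b0 ((norm_mul_le _ _).trans (by gcongr)) (norm_nonneg _)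
        (by positivity))
    have b5 : ‖(σ m).u (t • ω) ω * (powOp κ * ((σ m).Q ω - Q))‖ ≤ 1 * (1 * (C * (1 / 2) ^ m)) :=
      (norm_mul_le _ _).trans (mul_le_mul (humn _ _) ((norm_mul_le _ _).trans
        (mul_le_mul hD (hQ m) (norm_nonneg _) zero_le_one)) (norm_nonneg _) zero_le_one)
    refine (norm_add_le _ _).trans ((add_le_add b1 ((norm_entry_le _ _ _).trans
      ((norm_sub_le _ _).trans (add_le_add ((norm_sub_le _ _).trans
        (add_le_add ((norm_sub_le _ _).trans (add_le_add b2 b3)) b4)) b5)))).trans (le_of_eq ?_))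
    ring
  have hunif : TendstoUniformly f' g' atTop :=
    tendstoUniformly_of_norm_le (by simpa using h0.const_mul _) hbound
  have key := hasDerivAt_of_tendstoUniformly (𝕜 := ℝ) hunif
    (f := fun m t => entry ((σ m).u (t • ω) ω) i j) (g := fun t => entry (u (t • ω)) i j)
    (Eventually.of_forall fun m t => (hσ m).hasDerivAt_entry hκ (hω m) t (hp₀ _) (hq m _) i j)
    (fun t => ((continuous_entry i j).tendsto _).comp (hut _)) t
  refine key.congr_deriv ?_
  simp only [g']
  rw [entry_sub, entry_mul_diag hDQ]
  simp only [Λ]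
  push_cast
  ring

end Deriv

section Limit

open Filter Topology

theorem volume_diff_iInter_le {n : ℕ} {T : ℕ → Set (Fin n → ℝ)} {a q : ℝ} (ha : 0 ≤ a) (hq : 0 ≤ q)
    (hq1 : q < 1) (h : ∀ m, volume (T m \ T (m + 1)) ≤ ENNReal.ofReal (a * q ^ m)) :
    volume (T 0 \ ⋂ m, T m) ≤ ENNReal.ofReal (a / (1 - q)) := by
  have hsub : T 0 \ ⋂ m, T m ⊆ ⋃ m, (T m \ T (m + 1)) := by
    rintro ω ⟨h0, h1⟩
    rw [Set.mem_iInter, not_forall] at h1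
    classical
    have hm := Nat.find_spec h1
    set m := Nat.find h1 with hmdef
    have hm0 : m ≠ 0 := fun hz => hm (hz ▸ h0)
    obtain ⟨k, hk⟩ := Nat.exists_eq_succ_of_ne_zero hm0
    have hk' : ω ∈ T k := not_not.1 (Nat.find_min h1 (m := k) (by omega))
    exact Set.mem_iUnion.2 ⟨k, hk', by rw [hk] at hm; exact hm⟩
  have hs := (summable_geometric_of_lt_one hq hq1).mul_left a
  calc volume (T 0 \ ⋂ m, T m) ≤ ∑' m, volume (T m \ T (m + 1)) :=
        (measure_mono hsub).trans (measure_iUnion_le _)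
    _ ≤ ∑' m, ENNReal.ofReal (a * q ^ m) := ENNReal.tsum_le_tsum h
    _ = ENNReal.ofReal (a / (1 - q)) := by
      rw [← ENNReal.ofReal_tsum_of_nonneg (fun m => by positivity) hs, tsum_mul_left,
        tsum_geometric_of_lt_one hq hq1, div_eq_mul_inv]

theorem Ctl.of_tendsto {n : ℕ} {E : Type*} [NormedAddCommGroup E] [NormedSpace ℂ E] [CompleteSpace E]
    {S : Set (Fin n → ℝ)} {F : ℕ → (Fin n → ℂ) → (Fin n → ℝ) → E}
    {G : (Fin n → ℂ) → (Fin n → ℝ) → E} {ρ e M C : ℝ} (hF : ∀ m, Ctl ρ S (F m) e M)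
    (hC : ∀ ω ∈ S, ∀ φ ∈ strip n ρ, ∀ m, ‖F (m + 1) φ ω - F m φ ω‖ ≤ C * (1 / 2) ^ m)
    (hG : ∀ ω ∈ S, ∀ φ ∈ strip n ρ, Tendsto (fun m => F m φ ω) atTop (𝓝 (G φ ω))) :
    Ctl ρ S G e M where
  periodic ω hω φ hφ m := by
    have hφ' : φ + Pi.single m ((2 * Real.pi : ℝ) : ℂ) ∈ strip n ρ := by
      intro m'
      have := hφ m'
      by_cases h : m' = m
      · subst h; simpa using this
      · simpa [h] using this
    refine tendsto_nhds_unique (hG ω hω _ hφ') ((hG ω hω φ hφ).congr fun N => ?_)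
    exact ((hF N).periodic ω hω φ hφ m).symm
  analytic ω hω := differentiableOn_of_half (isOpen_strip n ρ) (fun m => (hF m).analytic ω hω)
    (fun m φ hφ => hC ω hω φ hφ m) (hG ω hω)
  sup ω hω φ hφ := le_of_tendsto (hG ω hω φ hφ).norm
    (Eventually.of_forall fun m => (hF m).sup ω hω φ hφ)
  lip ω hω ω' hω' φ hφ := le_of_tendsto ((hG ω hω φ hφ).sub (hG ω' hω' φ hφ)).norm
    (Eventually.of_forall fun m => (hF m).lip ω hω ω' hω' φ hφ)

/-- The KAM theorem for operators of `ℓ²`. -/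
theorem exists_normalForm {n : ℕ} {s κ K₀ K₁ Γ τ θ d C Ce r ε Y q K₀₀ K₁₀ γ₀ : ℝ} (hs : 0 ≤ s)
    (hκ : 1 < κ) (hΓ : 0 < Γ) (hd : 1 ≤ d)
    (hCe : 0 < Ce) (hB : HomSolBound n d τ Γ K₁ C) (hE : ExcisionBound n κ d τ K₀ K₁ Ce)
    (hN : IterNumbers n τ θ r ε Y q (96 * (1 + schurConst)) C)
    {S : Set (Fin n → ℝ)} {lam : ℕ+ → (Fin n → ℝ) → ℝ} {P : (Fin n → ℂ) → (Fin n → ℝ) → EllOp}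
    (hSm : MeasurableSet S) (hSf : S ⊆ frequencySet n) (hP : Ctl r S P ε (1 / r ^ (τ + 1)))
    (hsa : ∀ ω ∈ S, ∀ x, ∃ p, OpRel s κ (P (realAngle x) ω) p ∧ IsSelfAdjoint p)
    (hgap : GapBound d S lam K₀₀) (hlip : LipGapBound d S lam K₁₀)
    (hmel : MelnikovBound d τ S lam γ₀)
    (hK₀' : K₀ ≤ K₀₀ - 4 * ε) (hK₁' : K₁₀ + 4 * ε * (1 / r ^ (τ + 1)) ≤ K₁)
    (hΓ' : Γ ≤ γ₀ - 2 * √ε) :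
    ∃ S₁ lam₁ V u, S₁ ⊆ S ∧
      volume (S \ S₁) ≤ ENNReal.ofReal (Ce * γ₀ * √ε ^ κ⁻¹ / (1 - (1 / 2) ^ κ⁻¹)) ∧
      NormalForm s κ d τ (θ * r) (32 * Y) (1 / r ^ (τ + 1)) (K₀₀ - 4 * ε)
        (K₁₀ + 4 * ε * (1 / r ^ (τ + 1))) (γ₀ - 2 * √ε) lam P S₁ lam₁ V u := by
  obtain ⟨σ, hσ0, hσ⟩ := exists_iteration hs hκ hΓ hd hCe hB hE hN hSm hSf hP hsa hgap hlip hmel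
    hK₀' hK₁' hΓ'
  have hκ0 : 0 ≤ κ := by linarith
  have hκi : 0 < κ⁻¹ := by positivity
  have hr := hN.hr; have hε := hN.hε; have hθ₀ := hN.hθ₀; have hθ₁ := hN.hθ₁; have hY := hN.Y_nonneg
  have hsq : 0 < √ε := Real.sqrt_pos.2 hε
  have hM0 : 0 ≤ 1 / r ^ (τ + 1) := by positivity
  have hγ0 : 0 < γ₀ := by linarith
  have hh0 : ∀ m : ℕ, (0 : ℝ) < (1 / 2) ^ m := fun m => by positivity
  have hgood := fun m => (hσ m).1.2
  have hstep := fun m => (hσ m).2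
  set S₁ := ⋂ m, (σ m).S with hS₁
  have hmem : ∀ {ω}, ω ∈ S₁ → ∀ m, ω ∈ (σ m).S := fun h m => Set.mem_iInter.1 h m
  have hS₁S : S₁ ⊆ S := fun ω hω => (hσ 0).1.1 (hmem hω 0)
  have tl := fun ω (hω : ω ∈ S₁) i => tendsto_limUnder_of_half (f := fun m => (σ m).lam i ω)
    (fun m => (hstep m).lam ω (hmem hω _) i)
  have tV := fun ω (hω : ω ∈ S₁) φ (hφ : φ ∈ strip n (θ * r)) =>
    tendsto_limUnder_of_half (f := fun m => (σ m).V φ ω) (fun m => (hstep m).V ω (hmem hω _) φ hφ)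
  have tu := fun ω (hω : ω ∈ S₁) x => tendsto_limUnder_of_half (f := fun m => (σ m).u x ω)
    (fun m => (hstep m).u ω (hmem hω _) x)
  have tQ := fun ω (hω : ω ∈ S₁) => tendsto_limUnder_of_half (f := fun m => (σ m).Q ω)
    (fun m => (hstep m).Q ω (hmem hω _))
  set lam₁ : ℕ+ → (Fin n → ℝ) → ℝ := fun i ω => limUnder atTop (fun m => (σ m).lam i ω)
  set V : (Fin n → ℂ) → (Fin n → ℝ) → EllOp := fun φ ω => limUnder atTop (fun m => (σ m).V φ ω)
  set u : (Fin n → ℝ) → (Fin n → ℝ) → EllOp := fun x ω => limUnder atTop (fun m => (σ m).u x ω)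
  have hh := tendsto_pow_atTop_nhds_zero_of_lt_one (r := (1 / 2 : ℝ)) (by norm_num) (by norm_num)
  have hgm : ∀ m : ℕ, 2 * ε * (1 - (1 / 2) ^ m) ≤ 2 * ε := fun m =>
    mul_le_of_le_one_right (by linarith) (by linarith [hh0 m])
  have hdev : ∀ ω ∈ S₁, ∀ i, |lam₁ i ω - lam i ω| ≤ 2 * ε := fun ω hω i =>
    le_of_tendsto ((tl ω hω i).1.sub_const _).abs
      (Eventually.of_forall fun m => ((hgood m).dev ω (hmem hω m) i).trans (hgm m))
  have hdevLip : ∀ ω ∈ S₁, ∀ ω' ∈ S₁, ∀ i, |(lam₁ i ω - lam i ω) - (lam₁ i ω' - lam i ω')| ≤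
      2 * ε * (1 / r ^ (τ + 1)) * ‖ω - ω'‖ := fun ω hω ω' hω' i =>
    le_of_tendsto (((tl ω hω i).1.sub_const _).sub ((tl ω' hω' i).1.sub_const _)).abs
      (Eventually.of_forall fun m => ((hgood m).devLip ω (hmem hω m) ω' (hmem hω' m) i).trans
        (by have := hgm m; gcongr))
  have hρm : ∀ m : ℕ, θ * r ≤ r * (θ + (1 - θ) * (1 / 2) ^ m) := fun m => by
    have : 0 ≤ r * ((1 - θ) * (1 / 2) ^ m) := mul_nonneg hr.le (mul_nonneg (by linarith) (hh0 m).le)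
    linarith
  have hun : ∀ ω ∈ S₁, ∀ x, u x ω ∈ unitary EllOp := by
    intro ω hω x
    have h1 := (tu ω hω x).1
    rw [Unitary.mem_iff]
    constructor
    · refine tendsto_nhds_unique (h1.star.mul h1) (tendsto_const_nhds.congr fun m => ?_)
      exact ((Unitary.mem_iff.1 ((hgood m).unit ω (hmem hω m) x)).1).symm
    · refine tendsto_nhds_unique (h1.mul h1.star) (tendsto_const_nhds.congr fun m => ?_)
      exact ((Unitary.mem_iff.1 ((hgood m).unit ω (hmem hω m) x)).2).symm
  refine ⟨S₁, lam₁, V, u, hS₁S, ?_, ?_, ?_, hun, ?_, ?_, ?_, ?_, ?_, ?_⟩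
  · rw [← hσ0]
    refine volume_diff_iInter_le (T := fun m => (σ m).S) (by positivity) (by positivity)
      (Real.rpow_lt_one (by norm_num) (by norm_num) hκi) (fun m => (hstep m).vol.trans (le_of_eq ?_))
    rw [mul_assoc]
    congr 1
    ring
  · exact MeasurableSet.iInter fun m => (hgood m).meas
  · refine Ctl.of_tendsto (F := fun m => (σ m).V) (C := 16 * Y) (fun m => ?_)
      (fun ω hω φ hφ m => (hstep m).V ω (hmem hω _) φ hφ) (fun ω hω φ hφ => (tV ω hω φ hφ).1)
    refine (hgood m).ctlV.mono (hρm m) (fun ω hω => hmem hω m) ?_ hM0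
    exact mul_le_of_le_one_right (by linarith) (by linarith [hh0 m])
  · exact fun ω hω x => OpRel.of_tendsto (fun m => (hgood m).rel ω (hmem hω m) x)
      (tV ω hω _ (realAngle_mem_strip (by positivity) x)).1 (tendsto_const_nhds.sub (tu ω hω x).1)
  · intro ω hω
    have h1 : TendstoUniformly (fun m x => (σ m).u x ω) (fun x => u x ω) atTop :=
      tendstoUniformly_of_norm_le (c := fun m => 2 * (16 * Y) * (1 / 2) ^ m)
        (by simpa using hh.const_mul (2 * (16 * Y))) (fun m x => (tu ω hω x).2 m)
    exact h1.continuous (Frequently.of_forall fun m => (hgood m).cont ω (hmem hω m))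
  · have := hgap.perturb hd hS₁S (by positivity) hdev
    have e : K₀₀ - 2 * (2 * ε) = K₀₀ - 4 * ε := by ring
    rwa [e] at this
  · have := hlip.perturb hd hS₁S (by positivity) hM0 hdevLip
    have e : 2 * (2 * ε) = 4 * ε := by ring
    rwa [e] at this
  · intro ω hω i j k hijk
    refine ge_of_tendsto (((tl ω hω i).1.sub (tl ω hω j).1).add_const _).abs
      (Eventually.of_forall fun m => le_trans ?_ ((hgood m).mel ω (hmem hω m) i j k hijk))
    have h1 := intNorm_nonneg k
    have h2 := one_le_bracket ((i : ℝ) ^ d - (j : ℝ) ^ d)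
    have h3 : 2 * √ε * (1 - (1 / 2) ^ m) ≤ 2 * √ε :=
      mul_le_of_le_one_right (by linarith) (by linarith [hh0 m])
    gcongr
  · intro ω hω t p hp i j
    exact hasDerivAt_limit_entry (σ := σ) (u := fun x => u x ω) hs hκ0
      (fun m => (mul_pos hθ₀ hr).trans_le (hρm m)) (fun m => hN.e_le m) hgood (hmem hω)
      (fun x => hsa ω (hS₁S hω) x)
      (fun x => hP.sup ω (hS₁S hω) _ (realAngle_mem_strip hr x)) (hun ω hω)
      (fun m x => (tu ω hω x).2 m) (tQ ω hω).2 (fun i => (tl ω hω i).1) t hp i j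

end Limit

/-! ### The linear flows -/

section Flow

open Filter Topology

theorem hasSum_inner_coord (y x : EllTwo) :
    HasSum (fun i => (starRingEnd ℂ) (y i) * x i) (inner ℂ y x) := by
  have := lp.hasSum_inner (𝕜 := ℂ) y x
  simpa [mul_comm] using this

theorem norm_sum_conj_mul_le (y x : EllTwo) (s : Finset ℕ+) :
    ‖∑ i ∈ s, (starRingEnd ℂ) (y i) * x i‖ ≤ ‖y‖ ^ 2 + ‖x‖ ^ 2 := by
  have h1 : ∀ z : EllTwo, ∑ i ∈ s, ‖z i‖ ^ 2 ≤ ‖z‖ ^ 2 := fun z => by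
    have h := ellTwo_hasSum_sq z
    exact sum_le_hasSum s (fun _ _ => by positivity) h
  refine (norm_sum_le _ _).trans ?_
  calc ∑ i ∈ s, ‖(starRingEnd ℂ) (y i) * x i‖ ≤ ∑ i ∈ s, (‖y i‖ ^ 2 + ‖x i‖ ^ 2) := by
        refine Finset.sum_le_sum fun i _ => ?_
        rw [norm_mul, RCLike.norm_conj]
        nlinarith [sq_nonneg (‖y i‖ - ‖x i‖), sq_nonneg (‖y i‖ + ‖x i‖)]
    _ ≤ _ := by rw [Finset.sum_add_distrib]; exact add_le_add (h1 y) (h1 x)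

theorem continuous_coord {x : ℝ → EllTwo} (hx : Continuous x) (i : ℕ+) : Continuous (fun t => x t i) :=
  (coordCLM i).continuous.comp hx

/-- The scalar product of two solutions of inhomogeneous equations with the same diagonal part. -/
theorem hasDerivAt_inner_of_diag {lam : ℕ+ → ℝ} {x y f g : ℝ → EllTwo} (hx : Continuous x)
    (hy : Continuous y) (hf : Continuous f) (hg : Continuous g)
    (hx' : ∀ t i, HasDerivAt (fun t => x t i) (-(Complex.I * lam i * x t i) + f t i) t)
    (hy' : ∀ t i, HasDerivAt (fun t => y t i) (-(Complex.I * lam i * y t i) + g t i) t) (t : ℝ) :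
    HasDerivAt (fun t => inner ℂ (y t) (x t)) (inner ℂ (y t) (f t) + inner ℂ (g t) (x t)) t := by
  -- In the derivative of a partial sum the diagonal terms cancel, `lam` being real, so `F'`
  -- involves only `f` and `g`. The identity passes to the limit in integrated form, by dominated
  -- convergence.
  let F : Finset ℕ+ → ℝ → ℂ := fun s t => ∑ i ∈ s, (starRingEnd ℂ) (y t i) * x t i
  let F' : Finset ℕ+ → ℝ → ℂ := fun s t =>
    ∑ i ∈ s, (starRingEnd ℂ) (y t i) * f t i + ∑ i ∈ s, (starRingEnd ℂ) (g t i) * x t i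
  let G : ℝ → ℂ := fun t => inner ℂ (y t) (f t) + inner ℂ (g t) (x t)
  have hG : Continuous G := (hy.inner hf).add (hg.inner hx)
  have hFd : ∀ s t, HasDerivAt (F s) (F' s t) t := by
    intro s t
    have h1 : ∀ i ∈ s, HasDerivAt (fun t => (starRingEnd ℂ) (y t i) * x t i)
        ((starRingEnd ℂ) (y t i) * f t i + (starRingEnd ℂ) (g t i) * x t i) t := by
      intro i _
      have h2 := ((hy' t i).star).mul (hx' t i)
      refine h2.congr_deriv ?_
      simp only [← starRingEnd_apply, map_add, map_neg, map_mul, Complex.conj_I, Complex.conj_ofReal]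
      ring
    have h3 := HasDerivAt.fun_sum h1
    refine h3.congr_deriv ?_
    rw [Finset.sum_add_distrib]
  have hF'c : ∀ s, Continuous (F' s) := by
    intro s
    refine (continuous_finsetSum _ fun i _ => ?_).add (continuous_finsetSum _ fun i _ => ?_)
    · exact (Complex.continuous_conj.comp (continuous_coord hy i)).mul (continuous_coord hf i)
    · exact (Complex.continuous_conj.comp (continuous_coord hg i)).mul (continuous_coord hx i)
  have hFTC : ∀ s t, ∫ r in (0 : ℝ)..t, F' s r = F s t - F s 0 := fun s t =>
    intervalIntegral.integral_eq_sub_of_hasDerivAt (fun r _ => hFd s r)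
      ((hF'c s).intervalIntegrable _ _)
  have hlim : ∀ t, Tendsto (fun s => F s t) atTop (𝓝 (inner ℂ (y t) (x t))) := fun t =>
    hasSum_inner_coord (y t) (x t)
  have hlim' : ∀ t, Tendsto (fun s => F' s t) atTop (𝓝 (G t)) := by
    intro t
    have h1 : Tendsto (fun s : Finset ℕ+ => ∑ i ∈ s, (starRingEnd ℂ) (y t i) * f t i) atTop
        (𝓝 (inner ℂ (y t) (f t))) := hasSum_inner_coord _ _
    have h2 : Tendsto (fun s : Finset ℕ+ => ∑ i ∈ s, (starRingEnd ℂ) (g t i) * x t i) atTop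
        (𝓝 (inner ℂ (g t) (x t))) := hasSum_inner_coord _ _
    exact h1.add h2
  have hint : ∀ t, Tendsto (fun s => ∫ r in (0 : ℝ)..t, F' s r) atTop (𝓝 (∫ r in (0 : ℝ)..t, G r)) := by
    intro t
    refine intervalIntegral.tendsto_integral_filter_of_dominated_convergence
      (fun r => ‖y r‖ ^ 2 + ‖f r‖ ^ 2 + (‖g r‖ ^ 2 + ‖x r‖ ^ 2))
      (Eventually.of_forall fun s => (hF'c s).aestronglyMeasurable)
      (Eventually.of_forall fun s => Eventually.of_forall fun r _ => ?_) ?_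
      (Eventually.of_forall fun r _ => hlim' r)
    · exact (norm_add_le _ _).trans (add_le_add (norm_sum_conj_mul_le _ _ s)
        (norm_sum_conj_mul_le _ _ s))
    · exact Continuous.intervalIntegrable (by fun_prop) _ _
  have hid : ∀ t, inner ℂ (y t) (x t) = inner ℂ (y 0) (x 0) + ∫ r in (0 : ℝ)..t, G r := by
    intro t
    have h1 : Tendsto (fun s => ∫ r in (0 : ℝ)..t, F' s r) atTop
        (𝓝 (inner ℂ (y t) (x t) - inner ℂ (y 0) (x 0))) := by
      simp only [hFTC]
      exact (hlim t).sub (hlim 0)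
    rw [tendsto_nhds_unique (hint t) h1]
    ring
  have h2 : HasDerivAt (fun t => inner ℂ (y 0) (x 0) + ∫ r in (0 : ℝ)..t, G r) (G t) t :=
    (intervalIntegral.integral_hasDerivAt_right (hG.intervalIntegrable _ _)
      hG.aestronglyMeasurable.stronglyMeasurableAtFilter hG.continuousAt).const_add _
  exact h2.congr_of_eventuallyEq (Eventually.of_forall hid)

/-- For a diagonal plus a bounded operator the series over `j` converges at every vector of `ℓ²`, so
only the differential equation remains. -/
theorem isSolution_iff {lam : ℕ+ → ℝ} {p : ℝ → EllOp} {H : ℝ → ℕ+ → ℕ+ → ℂ}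
    (hH : ∀ t i j, H t i j = diagMatrix lam i j + entry (p t) i j) (ψ : ℝ → EllTwo) :
    IsSolution H ψ ↔ Continuous ψ ∧ ∀ t i, HasDerivAt (fun t => ψ t i)
      (-(Complex.I * lam i * ψ t i) + (-Complex.I • p t (ψ t)) i) t := by
  have hs : ∀ t i, HasSum (fun j => H t i j * ψ t j) (lam i * ψ t i + p t (ψ t) i) := by
    intro t i
    have h1 := hasSum_single (f := fun j => diagMatrix lam i j * ψ t j) i
      (fun j hj => by simp [diagMatrix, Ne.symm hj])
    have h2 := h1.add (hasSum_entry_mul (p t) (ψ t) i)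
    simp only [diagMatrix, if_true] at h2
    refine h2.congr_fun fun j => ?_
    rw [hH, add_mul]; rfl
  have hv : ∀ t i, (-(Complex.I * lam i * ψ t i) + (-Complex.I • p t (ψ t)) i) =
      -Complex.I * (lam i * ψ t i + p t (ψ t) i) := by
    intro t i
    rw [lp.coeFn_smul, Pi.smul_apply, smul_eq_mul]; ring
  refine and_congr_right fun _ => forall_congr' fun t => forall_congr' fun i => ?_
  rw [hv]
  constructor
  · rintro ⟨v, h1, h2⟩
    have h3 := h1.unique (hs t i)
    refine h2.congr_deriv ?_
    rw [← h3]
    linear_combination v * Complex.I_mul_I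
  · intro h
    refine ⟨_, ?_, h⟩
    have e : Complex.I * (-Complex.I * (lam i * ψ t i + p t (ψ t) i)) = lam i * ψ t i + p t (ψ t) i := by
      linear_combination -(lam i * ψ t i + p t (ψ t) i) * Complex.I_mul_I
    rw [e]
    exact hs t i

/-- A unitary transformation which satisfies the operator equation maps the solutions of the
diagonal equation onto the solutions of the perturbed one. -/
theorem solution_iff_of_intertwining {lam lam₁ : ℕ+ → ℝ} {p u : ℝ → EllOp} (hp : Continuous p)
    (hps : ∀ t, IsSelfAdjoint (p t)) (hu : Continuous u) (hu1 : ∀ t, u t ∈ unitary EllOp)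
    (hd : ∀ t i j, HasDerivAt (fun t => entry (u t) i j)
      (-(Complex.I * (((lam i - lam₁ j : ℝ) : ℂ) * entry (u t) i j + entry (p t * u t) i j))) t)
    (ψ : ℝ → EllTwo) :
    (Continuous ψ ∧ ∀ t i, HasDerivAt (fun t => ψ t i) (-(Complex.I * lam₁ i * ψ t i)) t) ↔
    (Continuous (fun t => u t (ψ t)) ∧ ∀ t i, HasDerivAt (fun t => u t (ψ t) i)
      (-(Complex.I * lam i * u t (ψ t) i) + (-Complex.I • p t (u t (ψ t))) i) t) := by
  have hsu : ∀ t, star (u t) * u t = 1 := fun t => (Unitary.mem_iff.1 (hu1 t)).1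
  have hsu' : ∀ t x, star (u t) (u t x) = x := fun t x => by
    have := congrArg (fun T : EllOp => T x) (hsu t)
    exact this
  have hadj : ∀ (T : EllOp) (x y : EllTwo), inner ℂ (star T x) y = inner ℂ x (T y) := fun T x y => by
    rw [ContinuousLinearMap.star_eq_adjoint]
    exact ContinuousLinearMap.adjoint_inner_left T y x
  constructor
  · rintro ⟨hψ, hψ'⟩
    have hc : Continuous (fun t => u t (ψ t)) := hu.clm_apply hψ
    refine ⟨hc, fun t i => ?_⟩
    have hpu : Continuous (fun t => p t * u t) := hp.mul hu
    have hc1 : Continuous (fun t => (Complex.I * lam i) • star (u t) (ellBasis i)) :=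
      (hu.star.clm_apply continuous_const).const_smul (Complex.I * (lam i : ℂ))
    have hc2 : Continuous (fun t => Complex.I • star (p t * u t) (ellBasis i)) :=
      (hpu.star.clm_apply continuous_const).const_smul Complex.I
    -- The `i`-th component of `u ψ` is `⟨u* e_i, ψ⟩`, and by `hd` the vector `u* e_i` solves an
    -- inhomogeneous equation with the diagonal `lam₁`.
    have key := hasDerivAt_inner_of_diag (lam := lam₁) (x := ψ) (y := fun t => star (u t) (ellBasis i))
      (f := fun _ => 0)
      (g := fun t => (Complex.I * lam i) • star (u t) (ellBasis i) +
        Complex.I • star (p t * u t) (ellBasis i)) hψ (hu.star.clm_apply continuous_const)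
      continuous_const
      (hc1.add hc2)
      (fun t j => by
        have := hψ' t j
        simpa using this)
      (fun t j => by
        have h1 := (hd t i j).star
        have e1 : ∀ (T : EllOp), star T (ellBasis i) j = (starRingEnd ℂ) (entry T i j) := fun T =>
          entry_star T j i
        simp only [e1, ← starRingEnd_apply] at h1 ⊢
        refine h1.congr_deriv ?_
        simp only [lp.coeFn_add, lp.coeFn_smul, Pi.add_apply, Pi.smul_apply, smul_eq_mul, e1, map_neg,
          map_mul, map_add, Complex.conj_I, Complex.conj_ofReal]
        push_cast
        ring) t
    simp only [hadj, inner_ellBasis_left, map_zero, lp.coeFn_zero, Pi.zero_apply, zero_add,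
      inner_add_left, inner_smul_left,
      map_mul, Complex.conj_I, Complex.conj_ofReal] at key
    refine key.congr_deriv ?_
    rw [lp.coeFn_smul, Pi.smul_apply, smul_eq_mul]
    have : (p t * u t) (ψ t) = p t (u t (ψ t)) := rfl
    rw [this]
    ring
  · rintro ⟨hψ, hψ'⟩
    have hc : Continuous ψ := by
      have h1 : Continuous (fun t => star (u t) (u t (ψ t))) := hu.star.clm_apply hψ
      simpa only [hsu'] using h1
    refine ⟨hc, fun t j => ?_⟩
    have hpc : Continuous (fun t => p t (u t (ψ t))) := hp.clm_apply hψ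
    have huc : Continuous (fun t => u t (ellBasis j)) := hu.clm_apply continuous_const
    have hc1 : Continuous (fun t => (Complex.I * lam₁ j) • u t (ellBasis j)) :=
      huc.const_smul (Complex.I * (lam₁ j : ℂ))
    have hc2 : Continuous (fun t => Complex.I • p t (u t (ellBasis j))) :=
      (hp.clm_apply huc).const_smul Complex.I
    -- By unitarity `ψ_j = ⟨u e_j, u ψ⟩`. The columns of `u` solve an equation with the diagonal
    -- `lam`, and the two contributions of `p` cancel by selfadjointness.
    have key := hasDerivAt_inner_of_diag (lam := lam) (x := fun t => u t (ψ t))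
      (y := fun t => u t (ellBasis j)) (f := fun t => -Complex.I • p t (u t (ψ t)))
      (g := fun t => (Complex.I * lam₁ j) • u t (ellBasis j) - Complex.I • p t (u t (ellBasis j)))
      hψ huc (hpc.const_smul (-Complex.I)) (hc1.sub hc2) hψ'
      (fun t i => by
        have h1 := hd t i j
        refine h1.congr_deriv ?_
        simp only [lp.coeFn_sub, lp.coeFn_smul, Pi.sub_apply, Pi.smul_apply, smul_eq_mul]
        have e1 : entry (p t * u t) i j = p t (u t (ellBasis j)) i := rfl
        have e2 : entry (u t) i j = u t (ellBasis j) i := rfl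
        rw [e1, e2]
        push_cast
        ring) t
    have hin : ∀ t, inner ℂ (u t (ellBasis j)) (u t (ψ t)) = ψ t j := by
      intro t
      rw [← hadj, hsu' t, inner_ellBasis_left]
    have hsym : inner ℂ (p t (u t (ellBasis j))) (u t (ψ t)) =
        inner ℂ (u t (ellBasis j)) (p t (u t (ψ t))) := by
      have := hadj (p t) (u t (ellBasis j)) (u t (ψ t))
      rwa [(hps t).star_eq] at this
    simp only [hin, inner_smul_right, inner_sub_left, inner_smul_left, hsym, map_mul, Complex.conj_I,
      Complex.conj_ofReal] at key
    refine key.congr_deriv ?_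
    ring

end Flow

/-! ### Operators between the spaces `ℋ^σ` -/

section Transfer

theorem Sobolev.toEllTwo_surjective (σ : ℝ) : Function.Surjective (Sobolev.toEllTwo σ) := by
  intro x
  have hj : ∀ j : ℕ+, (((j : ℝ) ^ σ : ℝ) : ℂ) * ((((j : ℝ) ^ (-σ) : ℝ) : ℂ) * x j) = x j := by
    intro j
    rw [← mul_assoc, cast_rpow_mul, add_neg_cancel, Real.rpow_zero]; simp
  refine ⟨⟨fun j => (((j : ℝ) ^ (-σ) : ℝ) : ℂ) * x j, ?_⟩, ?_⟩
  · change Memℓp _ 2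
    simp only [hj]
    exact x.2
  · apply Subtype.ext
    funext j
    exact hj j

/-- `ℋ^σ` is isometric to `ℓ²`. -/
def sobolevEquiv (σ : ℝ) : Sobolev σ ≃ₗᵢ[ℂ] EllTwo where
  toLinearEquiv := LinearEquiv.ofBijective (Sobolev.toEllTwo σ)
    ⟨Sobolev.toEllTwo_injective σ, Sobolev.toEllTwo_surjective σ⟩
  norm_map' _ := rfl

theorem sobolevEquiv_apply (σ : ℝ) (ψ : Sobolev σ) (j : ℕ+) :
    sobolevEquiv σ ψ j = (((j : ℝ) ^ σ : ℝ) : ℂ) * ψ.coord j := rfl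

theorem sobolevEquiv_basisVec (σ : ℝ) (j : ℕ+) :
    sobolevEquiv σ (Sobolev.basisVec σ j) = (((j : ℝ) ^ σ : ℝ) : ℂ) • ellBasis j := by
  ext i
  rw [sobolevEquiv_apply, lp.coeFn_smul, Pi.smul_apply, smul_eq_mul, ellBasis_apply]
  change _ * (Pi.single j (1 : ℂ) : ℕ+ → ℂ) i = _
  by_cases h : i = j
  · subst h; simp
  · simp [h]

/-- Operators from `ℋ^a` to `ℋ^b` as operators of `ℓ²`. -/
def transfer (a b : ℝ) : (Sobolev a →L[ℂ] Sobolev b) ≃ₗᵢ[ℂ] EllOp where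
  toFun T := ((sobolevEquiv b).toContinuousLinearEquiv : Sobolev b →L[ℂ] EllTwo) ∘L T ∘L
    ((sobolevEquiv a).symm.toContinuousLinearEquiv : EllTwo →L[ℂ] Sobolev a)
  invFun T := ((sobolevEquiv b).symm.toContinuousLinearEquiv : EllTwo →L[ℂ] Sobolev b) ∘L T ∘L
    ((sobolevEquiv a).toContinuousLinearEquiv : Sobolev a →L[ℂ] EllTwo)
  map_add' T T' := by ext1 x; simp
  map_smul' c T := by ext1 x; simp
  left_inv T := by ext1 x; simp
  right_inv T := by ext1 x; simp
  norm_map' T := by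
    refine le_antisymm ?_ ?_
    · refine ContinuousLinearMap.opNorm_le_bound _ (norm_nonneg _) fun x => ?_
      have h1 := T.le_opNorm ((sobolevEquiv a).symm x)
      rw [LinearIsometryEquiv.norm_map] at h1
      change ‖sobolevEquiv b (T ((sobolevEquiv a).symm x))‖ ≤ _
      rwa [LinearIsometryEquiv.norm_map]
    · refine ContinuousLinearMap.opNorm_le_bound _ (norm_nonneg _) fun x => ?_
      set T' : EllOp := ((sobolevEquiv b).toContinuousLinearEquiv : Sobolev b →L[ℂ] EllTwo) ∘L T ∘L
        ((sobolevEquiv a).symm.toContinuousLinearEquiv : EllTwo →L[ℂ] Sobolev a) with hT'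
      have h1 := T'.le_opNorm (sobolevEquiv a x)
      rw [LinearIsometryEquiv.norm_map] at h1
      have h2 : T' (sobolevEquiv a x) = sobolevEquiv b (T x) := by simp [hT']
      rw [h2, LinearIsometryEquiv.norm_map] at h1
      exact h1

theorem entry_transfer {a b : ℝ} (T : Sobolev a →L[ℂ] Sobolev b) (i j : ℕ+) :
    entry (transfer a b T) i j =
      (((i : ℝ) ^ b : ℝ) : ℂ) * matrixElem T i j * (((j : ℝ) ^ (-a) : ℝ) : ℂ) := by
  have h1 : (sobolevEquiv a).symm (ellBasis j) =
      (((j : ℝ) ^ (-a) : ℝ) : ℂ) • Sobolev.basisVec a j := by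
    apply (sobolevEquiv a).injective
    rw [LinearIsometryEquiv.apply_symm_apply, map_smul, sobolevEquiv_basisVec, smul_smul,
      cast_rpow_mul, neg_add_cancel, Real.rpow_zero]
    simp
  change sobolevEquiv b (T ((sobolevEquiv a).symm (ellBasis j))) i = _
  rw [h1, map_smul, map_smul, lp.coeFn_smul, Pi.smul_apply, smul_eq_mul, sobolevEquiv_apply]
  rw [mul_comm]; rfl

theorem matrixElem_eq {s κ : ℝ} (T : Sobolev (s - κ) →L[ℂ] Sobolev s) (i j : ℕ+) :
    matrixElem T i j = (((i : ℝ) ^ (-s) : ℝ) : ℂ) * entry (transfer (s - κ) s T) i j *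
      (((j : ℝ) ^ (s - κ) : ℝ) : ℂ) := by
  rw [entry_transfer]
  have h1 := cast_rpow_mul i (-s) s
  have h2 := cast_rpow_mul j (-(s - κ)) (s - κ)
  rw [neg_add_cancel, Real.rpow_zero, Complex.ofReal_one] at h1 h2
  linear_combination (-matrixElem T i j) * h1 - ((((i : ℝ) ^ (-s) : ℝ) : ℂ) * (((i : ℝ) ^ s : ℝ) : ℂ) * matrixElem T i j) * h2

end Transfer

theorem OpRel.entry_eq_matrixElem {s κ : ℝ} {T : Sobolev (s - κ) →L[ℂ] Sobolev s} {b : EllOp}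
    (h : OpRel s κ (transfer (s - κ) s T) b) (i j : ℕ+) : entry b i j = matrixElem T i j := by
  rw [h, matrixElem_eq]

theorem continuous_realAngle {n : ℕ} : Continuous (realAngle (n := n)) :=
  continuous_pi fun m => Complex.continuous_ofReal.comp (continuous_apply m)

theorem continuous_of_opRel_selfAdjoint {X : Type*} [TopologicalSpace X] {s κ : ℝ} (hs : 0 ≤ s)
    (hκ : 0 ≤ κ) {a b : X → EllOp} (ha : Continuous a) (h : ∀ x, OpRel s κ (a x) (b x))
    (hb : ∀ x, IsSelfAdjoint (b x)) : Continuous b := by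
  rw [continuous_iff_continuousAt]
  intro x
  have h0 := tendsto_iff_norm_sub_tendsto_zero.1 (ha.tendsto x)
  exact tendsto_iff_norm_sub_tendsto_zero.2 (squeeze_zero (fun _ => norm_nonneg _)
    (fun x' => ((h x').sub (h x)).norm_le_of_selfAdjoint hs hκ ((hb x').sub (hb x))) h0)

/-! ### Return to the spaces `ℋ^σ` and conjugation of the flows. -/

section Pull

variable {n : ℕ} {s κ r e M : ℝ} {S : Set (Fin n → ℝ)}

theorem IsLipschitzAnalytic.ctl_transfer
    {P : (Fin n → ℂ) → (Fin n → ℝ) → (Sobolev (s - κ) →L[ℂ] Sobolev s)}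
    (hP : IsLipschitzAnalytic r S P) (h1 : SupNormLE r S P e) (h2 : LipNormLE r S P (e * M)) :
    Ctl r S (fun φ ω => transfer (s - κ) s (P φ ω)) e M where
  periodic ω hω φ hφ m := congrArg _ (hP.periodic ω hω φ hφ m)
  analytic ω hω :=
    (transfer (s - κ) s).toContinuousLinearEquiv.differentiable.comp_differentiableOn
      (hP.analytic ω hω)
  sup ω hω φ hφ := by rw [LinearIsometryEquiv.norm_map]; exact h1 ω hω φ hφ
  lip ω hω ω' hω' φ hφ := by
    rw [← map_sub, LinearIsometryEquiv.norm_map]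
    by_cases h : ω = ω'
    · subst h; simp
    · exact h2 ω hω ω' hω' h φ hφ

theorem Ctl.supNormLE_symm {V : (Fin n → ℂ) → (Fin n → ℝ) → EllOp} (hV : Ctl r S V e M) :
    SupNormLE r S (fun φ ω => (transfer (s - κ) s).symm (V φ ω)) e := fun ω hω φ hφ => by
  rw [LinearIsometryEquiv.norm_map]; exact hV.sup ω hω φ hφ

theorem Ctl.lipNormLE_symm {V : (Fin n → ℂ) → (Fin n → ℝ) → EllOp} (hV : Ctl r S V e M) :
    LipNormLE r S (fun φ ω => (transfer (s - κ) s).symm (V φ ω)) (e * M) :=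
  fun ω hω ω' hω' _ φ hφ => by
    rw [← map_sub, LinearIsometryEquiv.norm_map]; exact hV.lip ω hω ω' hω' φ hφ

theorem Ctl.isLipschitzAnalytic_symm {V : (Fin n → ℂ) → (Fin n → ℝ) → EllOp} (hV : Ctl r S V e M) :
    IsLipschitzAnalytic r S (fun φ ω => (transfer (s - κ) s).symm (V φ ω)) where
  periodic ω hω φ hφ m := congrArg _ (hV.periodic ω hω φ hφ m)
  analytic ω hω :=
    (transfer (s - κ) s).symm.toContinuousLinearEquiv.differentiable.comp_differentiableOn
      (hV.analytic ω hω)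
  bounded := ⟨e, hV.supNormLE_symm⟩
  lipschitz := ⟨e * M, hV.lipNormLE_symm⟩

open Classical in
/-- A unitary operator as an isometry, the identity for other operators. -/
def toIsometry (u : EllOp) : EllTwo ≃ₗᵢ[ℂ] EllTwo :=
  if h : u ∈ unitary EllOp then Unitary.linearIsometryEquiv ⟨u, h⟩ else LinearIsometryEquiv.refl ℂ _

theorem toIsometry_apply {u : EllOp} (h : u ∈ unitary EllOp) (x : EllTwo) : toIsometry u x = u x := by
  rw [toIsometry, dif_pos h]; rfl

theorem unitaryElem_toIsometry {u : EllOp} (h : u ∈ unitary EllOp) (i j : ℕ+) :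
    unitaryElem (toIsometry u) i j = entry u i j := by
  rw [unitaryElem, toIsometry_apply h]; rfl

/-- The unitary transformation of the normal form conjugates the flows. -/
theorem NormalForm.conjugates {d τ ρ v K K' γ e : ℝ} {lam lam₁ : ℕ+ → (Fin n → ℝ) → ℝ}
    {P : (Fin n → ℂ) → (Fin n → ℝ) → (Sobolev (s - κ) →L[ℂ] Sobolev s)} {S₀ : Set (Fin n → ℝ)}
    {V : (Fin n → ℂ) → (Fin n → ℝ) → EllOp} {u : (Fin n → ℝ) → (Fin n → ℝ) → EllOp}
    {M' : ℝ} (hN : NormalForm s κ d τ ρ v M K K' γ lam (fun φ ω => transfer (s - κ) s (P φ ω)) S lam₁ V u)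
    (hr : 0 < r) (hs : 0 ≤ s) (hκ : 0 ≤ κ) (hP : Ctl r S₀ (fun φ ω => transfer (s - κ) s (P φ ω)) e M')
    (hsa : ∀ ω ∈ S₀, ∀ x, ∃ p, OpRel s κ (transfer (s - κ) s (P (realAngle x) ω)) p ∧ IsSelfAdjoint p)
    {ω : Fin n → ℝ} (hω : ω ∈ S) (hω₀ : ω ∈ S₀) (ψ : ℝ → EllTwo) :
    IsSolution (fun _ => diagMatrix (fun j => lam₁ j ω)) ψ ↔
      IsSolution (fun t i j => diagMatrix (fun j => lam j ω) i j +
        matrixElem (P (realAngle (t • ω)) ω) i j) (fun t => toIsometry (u (t • ω) ω) (ψ t)) := by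
  choose p hp hps using hsa ω hω₀
  have hsm : Continuous (fun t : ℝ => t • ω) := continuous_id.smul continuous_const
  have hpc : Continuous (fun t : ℝ => p (t • ω)) := by
    have h1 : Continuous (fun x : Fin n → ℝ => transfer (s - κ) s (P (realAngle x) ω)) :=
      (hP.analytic ω hω₀).continuousOn.comp_continuous continuous_realAngle
        fun x => realAngle_mem_strip hr x
    exact (continuous_of_opRel_selfAdjoint hs hκ h1 hp hps).comp hsm
  have h1 := isSolution_iff (lam := fun j => lam₁ j ω) (p := fun _ => 0)
    (H := fun _ => diagMatrix (fun j => lam₁ j ω)) (fun t i j => by rw [entry_zero, add_zero]) ψ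
  have h2 := isSolution_iff (lam := fun j => lam j ω) (p := fun t => p (t • ω))
    (H := fun t i j => diagMatrix (fun j => lam j ω) i j + matrixElem (P (realAngle (t • ω)) ω) i j)
    (fun t i j => by rw [(hp _).entry_eq_matrixElem]) (fun t => u (t • ω) ω (ψ t))
  have h3 := solution_iff_of_intertwining (lam := fun j => lam j ω) (lam₁ := fun j => lam₁ j ω)
    (p := fun t => p (t • ω)) (u := fun t => u (t • ω) ω) hpc (fun t => hps _)
    ((hN.cont ω hω).comp hsm) (fun t => hN.unit ω hω _) (fun t => hN.deriv ω hω t _ (hp _)) ψ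
  have e1 : (fun t => toIsometry (u (t • ω) ω) (ψ t)) = fun t => u (t • ω) ω (ψ t) :=
    funext fun t => toIsometry_apply (hN.unit ω hω _) _
  rw [e1, h1, h2, ← h3]
  simp

end Pull

/-! ### The theorem: choice of the constants. -/

theorem theorem6p4
    (n l : ℕ) (hn : 1 ≤ n) (hl : 1 ≤ l)
    (s κ K₀ K₁ Γ τ θ : ℝ) (hs : 0 < s) (hκ : 1 < κ)
    (hK₀ : 0 < K₀) (hK₁ : 0 < K₁) (hΓ : 0 < Γ)
    (hτ : ((n : ℝ) + 1 - κ⁻¹) / (1 - κ⁻¹) < τ)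
    (hθ₀ : 0 < θ) (hθ₁ : θ < 1) (hK : 8 * K₁ < K₀)
    (d b : ℝ) (hd : d = growthExp l) (hb : b = 2 * (n : ℝ) + 2 * τ + 1) :
    ∃ ςs CΓ C₀ CΩ CU d₂ d₃ : ℝ,
      0 < ςs ∧ 0 < CΓ ∧ 0 < C₀ ∧ 0 < CΩ ∧ 0 < CU ∧ 0 < d₂ ∧ 0 < d₃ ∧
      ∀ (r ς : ℝ), 0 < r → r ≤ 1 → 0 < ς → ς < ςs →
      ∀ (Ω₀ : Set (Fin n → ℝ)) (Υ : ℝ), MeasurableSet Ω₀ → Ω₀ ⊆ frequencySet n → 0 < Υ →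
        volume (frequencySet n \ Ω₀) ≤ ENNReal.ofReal Υ →
      ∀ (lam : ℕ+ → (Fin n → ℝ) → ℝ)
        (P : (Fin n → ℂ) → (Fin n → ℝ) → (Sobolev (s - κ) →L[ℂ] Sobolev s)),
        IsLipschitzAnalytic r Ω₀ P →
        -- `P` is selfadjoint at real angles
        (∀ ω ∈ Ω₀, ∀ (φ : Fin n → ℝ) (i j : ℕ+),
          matrixElem (P (realAngle φ) ω) i j =
            (starRingEnd ℂ) (matrixElem (P (realAngle φ) ω) j i)) →
        SupNormLE r Ω₀ P (ς * r ^ b) →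
        LipNormLE r Ω₀ P (ς * r ^ b / r ^ (τ + 1)) →
      ∀ (K₀₀ K₁₀ γ₀ : ℝ),
        GapBound d Ω₀ lam K₀₀ →
        LipGapBound d Ω₀ lam K₁₀ →
        MelnikovBound d τ Ω₀ lam γ₀ →
        K₀ < K₀₀ - C₀ * r ^ b * ς →
        K₁₀ + C₀ * r ^ (b - τ - 1) * ς < K₁ →
        Γ ≤ γ₀ - CΓ * (r ^ b * ς) ^ d₂ →
      ∃ (Ω₁ : Set (Fin n → ℝ)) (lam₁ : ℕ+ → (Fin n → ℝ) → ℝ)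
        (U : (Fin n → ℝ) → (Fin n → ℝ) → (EllTwo ≃ₗᵢ[ℂ] EllTwo))
        (V : (Fin n → ℂ) → (Fin n → ℝ) → (Sobolev (s - κ) →L[ℂ] Sobolev s)),
        MeasurableSet Ω₁ ∧ Ω₁ ⊆ Ω₀ ∧
        -- `V` is the Lipschitz analytic map `1 - U`
        IsLipschitzAnalytic (θ * r) Ω₁ V ∧
        (∀ ω ∈ Ω₁, ∀ (φ : Fin n → ℝ) (i j : ℕ+),
          matrixElem (V (realAngle φ) ω) i j =
            (if i = j then 1 else 0) - unitaryElem (U φ ω) i j) ∧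
        -- `ψ = U(ωt,ω) ψ'` transforms the system into the diagonal one
        (∀ ω ∈ Ω₁, ∀ ψ' : ℝ → EllTwo,
          IsSolution (fun _ => diagMatrix (fun j => lam₁ j ω)) ψ' ↔
            IsSolution
              (fun t i j => diagMatrix (fun j => lam j ω) i j +
                matrixElem (P (realAngle (t • ω)) ω) i j)
              (fun t => U (t • ω) ω (ψ' t))) ∧
        GapBound d Ω₁ lam₁ (K₀₀ - C₀ * r ^ b * ς) ∧
        LipGapBound d Ω₁ lam₁ (K₁₀ + C₀ * r ^ (b - τ - 1) * ς) ∧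
        MelnikovBound d τ Ω₁ lam₁ (γ₀ - CΓ * (r ^ b * ς) ^ d₂) ∧
        volume (Ω₀ \ Ω₁) ≤ ENNReal.ofReal (CΩ * γ₀ * (ς * r ^ b) ^ d₃) ∧
        volume (frequencySet n \ Ω₁) ≤ ENNReal.ofReal (Υ + CΩ * γ₀ * (ς * r ^ b) ^ d₃) ∧
        SupNormLE (θ * r) Ω₁ V (CU * ς * r ^ (b - (n + τ))) ∧
        LipNormLE (θ * r) Ω₁ V (CU * ς * r ^ (b - (n + τ)) / r ^ (τ + 1)) := by
  have hn0 : (1 : ℝ) ≤ n := by exact_mod_cast hn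
  have hκ0 : 0 < κ := by linarith
  have hκi : 0 < κ⁻¹ := by positivity
  have hκi1 : κ⁻¹ < 1 := inv_lt_one_of_one_lt₀ hκ
  have hτ0 : 0 < τ := lt_trans (div_pos (by linarith) (by linarith)) hτ
  have hd1 : 1 ≤ d := hd ▸ one_le_growthExp hl
  obtain ⟨C, hC, hB⟩ := exists_homSol_bound (d := d) (τ := τ) (Γ := Γ) (K₁ := K₁) n hd1 hτ0 hΓ hK₁
  obtain ⟨Ce, hCe, hE⟩ := exists_excision (d := d) hn hκ hτ hK₁ hK hd1
  have hθ : 0 < (1 - θ) / 2 := by linarith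
  set c := 2 * C * ((1 - θ) / 2) ^ (-((n : ℝ) + 2 * τ + 1)) with hc
  have hc0 : 0 < c := by positivity
  set q : ℝ := 2 ^ ((n : ℝ) + 2 * τ + 1) with hq
  have hq0 : 0 < q := by positivity
  set A := 96 * (1 + schurConst) with hA
  have hA0 : 0 ≤ A := by have := schurConst_nonneg; positivity
  have hhalf : (1 / 2 : ℝ) ^ κ⁻¹ < 1 := Real.rpow_lt_one (by norm_num) (by norm_num) hκi
  have hhalf' : 0 < 1 - (1 / 2 : ℝ) ^ κ⁻¹ := by linarith
  -- With `Y = c ε / r^(n+τ) ≤ c ς`, the three bounds on `ς` ensure `ε ≤ 1/4`, `32 Y ≤ 1/2` and `A Y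
  -- ≤ q⁻²`. The Melnikov constant loses `2 √ε` in all, whence `2` and `1/2`; each eigenvalue moves
  -- by at most `2 ε`, so a difference of two by `4 ε`. The removed measure sums to a geometric
  -- series of ratio `2^(-1/κ)` whose first term carries `(√ε)^(1/κ)`, whence `κ⁻¹ / 2`.
  refine ⟨min (1 / 4) (min (1 / (64 * c)) (1 / (q ^ 2 * (A * c + 1)))), 2, 4,
    Ce / (1 - (1 / 2) ^ κ⁻¹), 32 * c, 1 / 2, κ⁻¹ / 2, by positivity, by norm_num, by norm_num,
    by positivity, by positivity, by norm_num, by positivity, ?_⟩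
  intro r ς hr hr1 hς hςs Ω₀ Υ hm hsub hΥ hvol lam P hP hherm hsup hlipP K₀₀ K₁₀ γ₀ hgap hlip hmel
    hK₀' hK₁' hΓ'
  rw [lt_min_iff, lt_min_iff] at hςs
  obtain ⟨hς1, hς2, hς3⟩ := hςs
  rw [lt_div_iff₀ (by positivity)] at hς2 hς3
  have hb0 : 0 ≤ b := by rw [hb]; positivity
  set ε := ς * r ^ b with hε
  have hε0 : 0 < ε := by positivity
  have hrb : r ^ b ≤ 1 := Real.rpow_le_one hr.le hr1 hb0
  have hε1 : ε ≤ ς := mul_le_of_le_one_right hς.le hrb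
  have hdiv : ε / r ^ ((n : ℝ) + τ) = ς * r ^ (b - ((n : ℝ) + τ)) := by
    rw [Real.rpow_sub hr, hε, mul_div_assoc]
  have hdiv1 : ε / r ^ ((n : ℝ) + τ) ≤ ς := by
    rw [hdiv]
    refine mul_le_of_le_one_right hς.le (Real.rpow_le_one hr.le hr1 ?_)
    rw [hb]; linarith
  have hN : IterNumbers n τ θ r ε (c * (ε / r ^ ((n : ℝ) + τ))) q A C := by
    have h1 : c * (ε / r ^ ((n : ℝ) + τ)) ≤ c * ς := by gcongr
    refine ⟨hr, hr1, hε0, by linarith, hθ₀, hθ₁, hC, hq, rfl, by linarith, hA0, ?_, hτ0⟩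
    rw [← one_div, le_div_iff₀ (by positivity)]
    have h2 : A * (c * (ε / r ^ ((n : ℝ) + τ))) ≤ A * (c * ς) := by gcongr
    have h3 := mul_le_mul_of_nonneg_right h2 (sq_nonneg q)
    nlinarith [mul_pos hς (pow_pos hq0 2)]
  have hsq : √ε = (r ^ b * ς) ^ (1 / 2 : ℝ) := by rw [Real.sqrt_eq_rpow, hε, mul_comm]
  have hsqκ : √ε ^ κ⁻¹ = ε ^ (κ⁻¹ / 2) := by
    rw [Real.sqrt_eq_rpow, ← Real.rpow_mul hε0.le]; congr 1; ring
  have e₀ : K₀₀ - 4 * r ^ b * ς = K₀₀ - 4 * ε := by rw [hε]; ring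
  have e₁ : K₁₀ + 4 * r ^ (b - τ - 1) * ς = K₁₀ + 4 * ε * (1 / r ^ (τ + 1)) := by
    rw [show b - τ - 1 = b - (τ + 1) by ring, Real.rpow_sub hr, hε]; ring
  have e₂ : 32 * c * ς * r ^ (b - ((n : ℝ) + τ)) = 32 * (c * (ε / r ^ ((n : ℝ) + τ))) := by
    rw [hdiv]; ring
  rw [← hsq] at hΓ' ⊢
  rw [e₀] at hK₀' ⊢
  rw [e₁] at hK₁' ⊢
  rw [e₂, ← hsqκ, div_eq_mul_one_div (32 * (c * (ε / r ^ ((n : ℝ) + τ)))) (r ^ (τ + 1))]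
  have hctl := hP.ctl_transfer hsup (M := 1 / r ^ (τ + 1)) (by rwa [mul_one_div])
  have hsa : ∀ ω ∈ Ω₀, ∀ x : Fin n → ℝ, ∃ p,
      OpRel s κ (transfer (s - κ) s (P (realAngle x) ω)) p ∧ IsSelfAdjoint p := by
    intro ω hω x
    obtain ⟨p, h1, h2, -⟩ := exists_rel_selfAdjoint (a := transfer (s - κ) s (P (realAngle x) ω))
      hs.le hκ0.le (fun i j => by rw [← matrixElem_eq, ← matrixElem_eq]; exact hherm ω hω x i j)
    exact ⟨p, h1, h2⟩
  obtain ⟨S₁, lam₁, V, u, hS₁, hv, hNF⟩ := exists_normalForm hs.le hκ hΓ hd1 hCe hB hE hN hm hsub hctl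
    hsa hgap hlip hmel hK₀'.le hK₁'.le hΓ'
  have hγ0 : 0 < γ₀ := by have := Real.sqrt_nonneg ε; linarith
  have e₃ : Ce * γ₀ * √ε ^ κ⁻¹ / (1 - (1 / 2) ^ κ⁻¹) =
      Ce / (1 - (1 / 2) ^ κ⁻¹) * γ₀ * √ε ^ κ⁻¹ := by ring
  rw [e₃] at hv
  refine ⟨S₁, lam₁, fun x ω => toIsometry (u x ω), fun φ ω => (transfer (s - κ) s).symm (V φ ω),
    hNF.meas, hS₁, hNF.ctl.isLipschitzAnalytic_symm, fun ω hω x i j => ?_,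
    fun ω hω ψ => hNF.conjugates hr hs.le hκ0.le hctl hsa hω (hS₁ hω) ψ,
    hNF.gap, hNF.lip, hNF.mel, hv, ?_, hNF.ctl.supNormLE_symm, hNF.ctl.lipNormLE_symm⟩
  · have h1 := hNF.rel ω hω x
    rw [← (transfer (s - κ) s).apply_symm_apply (V (realAngle x) ω)] at h1
    rw [unitaryElem_toIsometry (hNF.unit ω hω x), ← h1.entry_eq_matrixElem, entry_sub, entry_one]
  · rw [ENNReal.ofReal_add hΥ.le (by positivity)]
    refine (measure_mono ?_).trans ((measure_union_le _ _).trans (add_le_add hvol hv))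
    intro ω hω
    by_cases h : ω ∈ Ω₀
    · exact Or.inr ⟨h, hω.2⟩
    · exact Or.inl ⟨hω.1, h⟩

end
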